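/- Let $(N_1,g_1)$ and $(N_2,g_2)$ be compact smooth Riemannian manifolds without boundary, of dimensions $n_1,n_2\ge 0$, with $N_1\neq\emptyset$ (orientability is not needed), let $\alpha_1,\alpha_2\ge 1$ be real numbers, and let $$M=\mathbb R_+\times N_1\times N_2,\qquad g=dr^2+r^{2\alpha_1}g_1+r^{2\alpha_2}g_2,$$ where $\mathbb R_+=(0,\infty)$ and $r$ is the first variable. Write $(\cdot,\cdot)$ for the $L^2$ inner product of differential forms on $(M,g)$ with respect to the Riemannian volume, $d^t$ for the formal adjoint of the exterior derivative $d$, and let $d_{\max}=(d^t)^*$ and $d^t_{\max}=d^*$ be the Hilbert space adjoints of $d^t$ and $d$ acting on smooth compactly supported forms. Suppose that $$k=\frac{\alpha_1n_1+\alpha_2n_2}{2\alpha_2}$$ is an integer and that the real de Rham cohomology $H^k(N_2)$ is non-zero. Then the $L^2$-Stokes theorem fails for $k$-forms supported near $r=0$: for every $\varepsilon>0$ there are a $k$-form $\omega\in\operatorname{dom}(d_{\max})$ and a $(k+1)$-form $\eta\in\operatorname{dom}(d^t_{\max})$, both vanishing outside $\{r<\varepsilon\}$, such that $$(d_{\max}\omega,\eta)\neq(\omega,d^t_{\max}\eta).$$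 -/

import Mathlib

open scoped Manifold ContDiff
open MeasureTheory

noncomputable section

namespace L2Forms

/-! ## Differential forms on a manifold -/

section Forms

variable {E H : Type*} [NormedAddCommGroup E] [NormedSpace ℝ E] [TopologicalSpace H]
  (I : ModelWithCorners ℝ E H)
  {X : Type*} [TopologicalSpace X] [ChartedSpace H X]

/-- Arbitrary (not necessarily continuous) real differential forms of degree `k` on `X`. -/
abbrev DForm (X : Type*) [TopologicalSpace X] [ChartedSpace H X] (k : ℕ) : Type _ :=
  ∀ x : X, (TangentSpace I x) [⋀^Fin k]→L[ℝ] ℝ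

/-- The pullback of `u` under the inverse of the preferred chart around `x₀`: the expression of
`u` in the coordinates of that chart. It is meaningful on the target of the chart. -/
def inChart {k : ℕ} (u : DForm I X k) (x₀ : X) (y : E) : E [⋀^Fin k]→L[ℝ] ℝ :=
  (u ((extChartAt I x₀).symm y)).compContinuousLinearMap
    (mfderiv 𝓘(ℝ, E) I (extChartAt I x₀).symm y)

/-- Smooth forms: all coordinate expressions are smooth. -/
def IsSmooth {k : ℕ} (u : DForm I X k) : Prop :=
  ∀ x₀ : X, ContDiffOn ℝ ∞ (inChart I u x₀) (extChartAt I x₀).target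

/-- The form vanishes outside a compact set. -/
def HasCompactSupp {k : ℕ} (u : DForm I X k) : Prop :=
  ∃ K : Set X, IsCompact K ∧ ∀ x ∉ K, u x = 0

/-- The space `Ω₀ᵏ(X)` of test forms: smooth forms with compact support. -/
def IsTest {k : ℕ} (u : DForm I X k) : Prop :=
  IsSmooth I u ∧ HasCompactSupp I u

/-- The exterior derivative, computed at `x` in the preferred chart around `x`. -/
def extD {k : ℕ} (u : DForm I X k) : DForm I X (k + 1) := fun x =>
  (extDeriv (inChart I u x) (extChartAt I x x)).compContinuousLinearMap
    (mfderiv I 𝓘(ℝ, E) (extChartAt I x) x)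

/-! ## De Rham cohomology -/

theorem inChart_add {k : ℕ} (u η : DForm I X k) (x₀ : X) :
    inChart I (u + η) x₀ = inChart I u x₀ + inChart I η x₀ := rfl

theorem inChart_smul {k : ℕ} (c : ℝ) (u : DForm I X k) (x₀ : X) :
    inChart I (c • u) x₀ = c • inChart I u x₀ := rfl

theorem inChart_zero {k : ℕ} (x₀ : X) :
    inChart I (0 : DForm I X k) x₀ = 0 := rfl

theorem IsSmooth.add {k : ℕ} {u η : DForm I X k} (hu : IsSmooth I u) (hη : IsSmooth I η) :
    IsSmooth I (u + η) := fun x₀ => by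
  rw [inChart_add]; exact (hu x₀).add (hη x₀)

theorem IsSmooth.smul {k : ℕ} (c : ℝ) {u : DForm I X k} (hu : IsSmooth I u) :
    IsSmooth I (c • u) := fun x₀ => by
  rw [inChart_smul]; exact (hu x₀).const_smul c

theorem isSmooth_zero {k : ℕ} : IsSmooth I (0 : DForm I X k) := fun x₀ => by
  rw [inChart_zero]; exact contDiffOn_const

theorem extD_smul {k : ℕ} (c : ℝ) (u : DForm I X k) : extD I (c • u) = c • extD I u := by
  funext x
  simp only [extD, inChart_smul, Pi.smul_apply]
  rw [extDeriv_smul]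
  rfl

theorem extD_zero {k : ℕ} : extD I (0 : DForm I X k) = 0 := by
  have h := extD_smul I (X := X) (0 : ℝ) (0 : DForm I X k)
  rwa [zero_smul, zero_smul] at h

theorem extD_add [I.Boundaryless] {k : ℕ} {u η : DForm I X k}
    (hu : IsSmooth I u) (hη : IsSmooth I η) : extD I (u + η) = extD I u + extD I η := by
  funext x
  have key : ∀ {θ : DForm I X k}, IsSmooth I θ →
      DifferentiableAt ℝ (inChart I θ x) (extChartAt I x x) := fun hθ =>
    ((hθ x).contDiffAt (extChartAt_target_mem_nhds x)).differentiableAt (by simp)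
  simp only [extD, inChart_add, Pi.add_apply]
  rw [extDeriv_add (key hu) (key hη)]
  rfl

/-- The space of smooth closed forms. -/
def closedForms [I.Boundaryless] (X : Type*) [TopologicalSpace X] [ChartedSpace H X] (k : ℕ) :
    Submodule ℝ (DForm I X k) where
  carrier := {u | IsSmooth I u ∧ extD I u = 0}
  add_mem' := fun ha hb =>
    ⟨ha.1.add I hb.1, by rw [extD_add I ha.1 hb.1, ha.2, hb.2, add_zero]⟩
  zero_mem' := ⟨isSmooth_zero I, extD_zero I⟩
  smul_mem' := fun c _ ha => ⟨ha.1.smul I c, by rw [extD_smul, ha.2, smul_zero]⟩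

/-- The space of exact forms: `dσ` with `σ` smooth of one degree less; zero in degree `0`. -/
def exactForms [I.Boundaryless] (X : Type*) [TopologicalSpace X] [ChartedSpace H X] :
    ∀ k : ℕ, Submodule ℝ (DForm I X k)
  | 0 => ⊥
  | k + 1 =>
    { carrier := {u | ∃ σ : DForm I X k, IsSmooth I σ ∧ extD I σ = u}
      add_mem' := by
        rintro _ _ ⟨σ, hσ, rfl⟩ ⟨τ, hτ, rfl⟩
        exact ⟨σ + τ, hσ.add I hτ, extD_add I hσ hτ⟩
      zero_mem' := ⟨0, isSmooth_zero I, extD_zero I⟩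
      smul_mem' := by
        rintro c _ ⟨σ, hσ, rfl⟩
        exact ⟨c • σ, hσ.smul I c, extD_smul I c σ⟩ }

/-- The de Rham cohomology `Hᵏ(X)`: closed forms modulo exact forms, realised as the image of the
space of closed forms in the quotient of the space of all forms by the exact forms. -/
abbrev DeRham [I.Boundaryless] (X : Type*) [TopologicalSpace X] [ChartedSpace H X] (k : ℕ) :
    Type _ :=
  (closedForms I X k).map (exactForms I X k).mkQ

/-! ## Riemannian volume and the Hilbert space of square integrable forms

In this section `b` is an auxiliary basis of the model vector space, in which coordinate
expressions are written. The volume and the inner products do not depend on it. -/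

variable {ι : Type*} [Fintype ι] [DecidableEq ι] (b : Module.Basis ι ℝ E)

/-- A field of bilinear forms on the tangent spaces of `X`. -/
abbrev MetricField (X : Type*) [TopologicalSpace X] [ChartedSpace H X] : Type _ :=
  ∀ x : X, TangentSpace I x →L[ℝ] TangentSpace I x →L[ℝ] ℝ

variable (g : MetricField I X)

/-- The Gram matrix `(g_x(b_i, b_j))` of the metric at `x`. -/
def gram (x : X) : Matrix ι ι ℝ :=
  Matrix.of fun i j => g x (b i : E) (b j : E)

/-- The inner product induced by `g_x` on the `k`-th exterior power of the cotangent space at `x`,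
`(1 / k!) ∑ g^{i₁ j₁} ⋯ g^{i_k j_k} α_{i₁ … i_k} β_{j₁ … j_k}`
(for which the wedge products `e^{i₁} ∧ ⋯ ∧ e^{i_k}`, `i₁ < ⋯ < i_k`, of the covectors of an
orthonormal coframe are orthonormal). -/
def formInner {k : ℕ} (x : X) (α β : (TangentSpace I x) [⋀^Fin k]→L[ℝ] ℝ) : ℝ :=
  (1 / (k.factorial : ℝ)) * ∑ i : Fin k → ι, ∑ j : Fin k → ι,
    (∏ a, (gram I b g x)⁻¹ (i a) (j a)) *
      (α (fun a => (b (i a) : E)) * β (fun a => (b (j a) : E)))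

/-- The matrix `(g_ij(y))` of the metric in the coordinates of the preferred chart
around `x₀`. -/
def chartGram (x₀ : X) (y : E) : Matrix ι ι ℝ :=
  Matrix.of fun i j => g ((extChartAt I x₀).symm y)
    (mfderiv 𝓘(ℝ, E) I (extChartAt I x₀).symm y (b i))
    (mfderiv 𝓘(ℝ, E) I (extChartAt I x₀).symm y (b j))

variable [MeasurableSpace E] [BorelSpace E] [MeasurableSpace X]

/-- The Riemannian volume of the source of the preferred chart around `x₀`, as a measure on `X`:
the image under the inverse of the chart of `√det(g_ij(y)) dy`, where `dy` is Lebesgue measure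
for which the parallelepiped spanned by `b` has measure one. -/
def chartVolume (x₀ : X) : Measure X :=
  (((b.addHaar).restrict (extChartAt I x₀).target).withDensity
    (fun y => ENNReal.ofReal (Real.sqrt (chartGram I b g x₀ y).det))).map (extChartAt I x₀).symm

/-- The Riemannian volume measure: the smallest measure which dominates the volume of
every chart domain. (For a second countable manifold this is the measure whose
restriction to every chart domain is the volume of that domain.) -/
def vol : Measure X := ⨆ x₀ : X, chartVolume I b g x₀

/-- A form is measurable if its coordinate expressions are (up to null sets). -/
def FormMeasurable {k : ℕ} (u : DForm I X k) : Prop :=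
  ∀ x₀ : X, AEStronglyMeasurable (inChart I u x₀) ((b.addHaar).restrict (extChartAt I x₀).target)

/-- Square integrable forms. -/
def MemL2 {k : ℕ} (u : DForm I X k) : Prop :=
  FormMeasurable I b u ∧
    ∫⁻ x, ENNReal.ofReal (formInner I b g x (u x) (u x)) ∂(vol I b g) < ⊤

/-- The `L²` inner product `(u, η)`. -/
def l2Inner {k : ℕ} (u η : DForm I X k) : ℝ :=
  ∫ x, formInner I b g x (u x) (η x) ∂(vol I b g)

/-! ## The maximal extensions and the `L²`-Stokes theorem -/

/-- `σ = dᵗ η` for a test form `η`, where `dᵗ` is the formal adjoint of `d`: the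
test form `σ` satisfies `(dθ, η) = (θ, σ)` for all test forms `θ`. -/
def IsFormalAdjoint {k : ℕ} (η : DForm I X (k + 1)) (σ : DForm I X k) : Prop :=
  IsTest I η ∧ IsTest I σ ∧
    ∀ θ : DForm I X k, IsTest I θ → l2Inner I b g (extD I θ) η = l2Inner I b g θ σ

/-- `u` is in the domain of `d_max` and `d_max u = τ`, where `d_max = (dᵗ)^*` is the Hilbert
space adjoint of `dᵗ` acting on test forms. -/
def IsDMax {k : ℕ} (u : DForm I X k) (τ : DForm I X (k + 1)) : Prop :=
  MemL2 I b g u ∧ MemL2 I b g τ ∧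
    ∀ (η : DForm I X (k + 1)) (σ : DForm I X k), IsFormalAdjoint I b g η σ →
      l2Inner I b g τ η = l2Inner I b g u σ

/-- `η` is in the domain of `dᵗ_max` and `dᵗ_max η = σ`, where `dᵗ_max = d^*` is the Hilbert
space adjoint of `d` acting on test forms. -/
def IsDtMax {k : ℕ} (η : DForm I X (k + 1)) (σ : DForm I X k) : Prop :=
  MemL2 I b g η ∧ MemL2 I b g σ ∧
    ∀ θ : DForm I X k, IsTest I θ → l2Inner I b g θ σ = l2Inner I b g (extD I θ) η

/-- The `L²`-Stokes theorem for `k`-forms supported in `S`: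
`(d_max u, η) = (u, dᵗ_max η)` for all `k`-forms `u` in the domain of `d_max` and all
`(k + 1)`-forms `η` in the domain of `dᵗ_max` which vanish outside `S`. -/
def L2StokesOn (k : ℕ) (S : Set X) : Prop :=
  ∀ (u : DForm I X k) (τ : DForm I X (k + 1)) (η : DForm I X (k + 1)) (σ : DForm I X k),
    IsDMax I b g u τ → IsDtMax I b g η σ →
    (∀ x ∉ S, u x = 0) → (∀ x ∉ S, η x = 0) →
    l2Inner I b g τ η = l2Inner I b g u σ

end Forms

/-! ## The manifold `ℝ₊ × N₁ × N₂` -/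

/-- The open half line `ℝ₊ = (0, ∞)`, as an open submanifold of `ℝ`. -/
abbrev RPlus : TopologicalSpace.Opens ℝ := ⟨Set.Ioi 0, isOpen_Ioi⟩

/-- The model space of an `n`-dimensional manifold. -/
abbrev Euc (n : ℕ) : Type := EuclideanSpace ℝ (Fin n)

/-- Smooth Riemannian metrics on an `n`-dimensional manifold. -/
abbrev SmoothMetric (n : ℕ) (N : Type*) [TopologicalSpace N] [ChartedSpace (Euc n) N]
    [IsManifold (𝓡 n) ∞ N] : Type _ :=
  Bundle.ContMDiffRiemannianMetric (𝓡 n) ∞ (Euc n) (fun x : N => TangentSpace (𝓡 n) x)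

/-- The model of `ℝ₊ × N₁ × N₂`. -/
abbrev modelM (n₁ n₂ : ℕ) :
    ModelWithCorners ℝ (ℝ × Euc n₁ × Euc n₂) (ModelProd ℝ (ModelProd (Euc n₁) (Euc n₂))) :=
  𝓘(ℝ, ℝ).prod ((𝓡 n₁).prod (𝓡 n₂))

/-- The standard basis of `ℝ × ℝ^{n₁} × ℝ^{n₂}`. -/
def basisM (n₁ n₂ : ℕ) :
    Module.Basis (Unit ⊕ (Fin n₁ ⊕ Fin n₂)) ℝ (ℝ × Euc n₁ × Euc n₂) :=
  (Module.Basis.singleton Unit ℝ).prod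
    ((EuclideanSpace.basisFun (Fin n₁) ℝ).toBasis.prod
      (EuclideanSpace.basisFun (Fin n₂) ℝ).toBasis)

section Warped

variable {n₁ n₂ : ℕ}
  {N₁ : Type*} [TopologicalSpace N₁] [ChartedSpace (Euc n₁) N₁] [IsManifold (𝓡 n₁) ∞ N₁]
  {N₂ : Type*} [TopologicalSpace N₂] [ChartedSpace (Euc n₂) N₂] [IsManifold (𝓡 n₂) ∞ N₂]

/-- The metric `dr² + r^{2α₁} g₁ + r^{2α₂} g₂` on `ℝ₊ × N₁ × N₂`. -/
def warpedMetric (α₁ α₂ : ℝ) (g₁ : SmoothMetric n₁ N₁) (g₂ : SmoothMetric n₂ N₂) :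
    MetricField (modelM n₁ n₂) (RPlus × N₁ × N₂) := fun p =>
  let B₁ : Euc n₁ →L[ℝ] Euc n₁ →L[ℝ] ℝ := g₁.inner p.2.1
  let B₂ : Euc n₂ →L[ℝ] Euc n₂ →L[ℝ] ℝ := g₂.inner p.2.2
  let P₀ : ℝ × Euc n₁ × Euc n₂ →L[ℝ] ℝ := ContinuousLinearMap.fst ℝ ℝ (Euc n₁ × Euc n₂)
  let Q : ℝ × Euc n₁ × Euc n₂ →L[ℝ] Euc n₁ × Euc n₂ :=
    ContinuousLinearMap.snd ℝ ℝ (Euc n₁ × Euc n₂)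
  let P₁ := (ContinuousLinearMap.fst ℝ (Euc n₁) (Euc n₂)).comp Q
  let P₂ := (ContinuousLinearMap.snd ℝ (Euc n₁) (Euc n₂)).comp Q
  ((ContinuousLinearMap.mul ℝ ℝ).bilinearComp P₀ P₀
    + ((p.1 : ℝ) ^ (2 * α₁)) • B₁.bilinearComp P₁ P₁
    + ((p.1 : ℝ) ^ (2 * α₂)) • B₂.bilinearComp P₂ P₂ :
      (ℝ × Euc n₁ × Euc n₂) →L[ℝ] (ℝ × Euc n₁ × Euc n₂) →L[ℝ] ℝ)

/-- The value of the metric on tangent vectors `(s, v, w)` and `(s', v', w')`. -/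
theorem warpedMetric_apply (α₁ α₂ : ℝ) (g₁ : SmoothMetric n₁ N₁) (g₂ : SmoothMetric n₂ N₂)
    (r : RPlus) (x : N₁) (y : N₂) (s s' : ℝ) (v v' : Euc n₁) (w w' : Euc n₂) :
    warpedMetric α₁ α₂ g₁ g₂ (r, x, y) (s, v, w) (s', v', w') =
      s * s' + (r : ℝ) ^ (2 * α₁) * g₁.inner x v v' + (r : ℝ) ^ (2 * α₂) * g₂.inner y w w' :=
  rfl

end Warped

end L2Forms

end

set_option linter.unusedSectionVars false

noncomputable section

namespace L2Forms


/-! ### Coordinates of alternating forms and smoothness of pullbacks. -/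

section LinearAlgebra

variable {E : Type*} [NormedAddCommGroup E] [NormedSpace ℝ E] {ι : Type*} [Fintype ι]
  (b : Module.Basis ι ℝ E) {k : ℕ}

/-! The failure is a boundary term at `r = 0`. Let `h` be a closed, non-exact `k`-form on `N₂` and
let `ω = φ(r) h`, with `φ = 1` near `r = 0`. The pointwise square norm of `h` carries the weight
`r^(-2α₂k)` and the volume carries `r^(α₁n₁+α₂n₂)`. In the critical degree these cancel, so `ω` is
square integrable up to `r = 0` although it does not decay there (`density_mul_cInner_pullback`,
`memL2_pullForm`).

The partner is `η = f(r) dr ∧ (dual of W)`, with `f = 1` near `r = 0`. Here `W` is a square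
integrable current on `N₂` that kills exact forms but not `h`; along `N₁` it is multiplied by the
indicator of a compact set `C` in one chart. The same cancellation makes `η` square integrable
(`memL2_currentForm`). For a test form `θ`, the `dr ∧ N₂` part of `dθ` on a slice `{r} × {x} × N₂`
is the radial derivative of `θ` minus an exact form on `N₂` (`exists_exact_slice`). The exact form
is invisible to `W`, so integration by parts in `r` gives `dᵗη = -f'(r) (dual of W)`
(`sum_integral_coef_extD`, `isDtMax_currentForm`). No derivative along `N₁` enters, so the
discontinuous indicator is harmless. If `φ = 1` on the support of `f` and somewhat beyond, then
`(dω, η) = 0` because the supports are disjoint, whereas `(ω, dᵗη) = (∫ -f') vol(C) ⟨W, h⟩ = vol(C)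
⟨W, h⟩ ≠ 0` (`l2Inner_pullForm_currentForm`).

The analytic work lies in the existence of `W` (`exists_current`). By projection in a Hilbert space
it suffices that a smooth form which is an `L²` limit of exact forms is exact
(`mem_exactForms_of_mem_closure`). This is proved without Hodge theory, by a local homotopy
operator. The vector field `homKernel` has divergence `δ₀ - ρ` with `ρ` a mollifier. Contraction
with it followed by convolution gives an operator `B` with `v - ρ*v = dBv + Bdv` (`homotopy_succ`),
whose norm is of the order of the radius of `ρ`.

Two consequences are drawn from it. Patched over charts, it shows that modulo closed forms `σ` is
bounded by `dσ`, finitely many linear functionals and a small multiple of `σ` (`global_correction`).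
An abstract argument then turns convergence of `dσₙ` into convergence of modified `σₙ`
(`exists_tendsto_of_mem_closure`). Secondly, subtracting closed forms chart by chart makes the limit
smooth without changing its weak derivative (`IsWeakLimit.regularise`), which yields a smooth
primitive (`IsWeakLimit.exists_primitive`). -/

/-- The coordinates of an alternating form with respect to a basis. -/
def coords : (E [⋀^Fin k]→L[ℝ] ℝ) →L[ℝ] ((Fin k → ι) → ℝ) :=
  ContinuousLinearMap.pi fun J => ContinuousAlternatingMap.apply ℝ E ℝ (fun a => b (J a))

theorem coords_apply (α : E [⋀^Fin k]→L[ℝ] ℝ) (J : Fin k → ι) :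
    coords b α J = α (fun a => b (J a)) := rfl

/-- Plain multilinear expansion over all tuples of indices, repeated and unordered ones included, so
that no signs or factorials appear. -/
theorem apply_eq_sum_coords (α : E [⋀^Fin k]→L[ℝ] ℝ) (v : Fin k → E) :
    α v = ∑ J : Fin k → ι, (∏ a, b.repr (v a) (J a)) * coords b α J := by
  classical
  have hv : v = fun a => ∑ i, b.repr (v a) i • b i := by
    funext a; exact (b.sum_repr (v a)).symm
  conv_lhs => rw [hv]
  rw [ContinuousAlternatingMap.map_sum]
  refine Finset.sum_congr rfl fun J _ => ?_
  rw [ContinuousAlternatingMap.map_smul_univ]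
  rfl

theorem coords_injective : Function.Injective (coords b (k := k)) := by
  intro α β h
  ext v
  rw [apply_eq_sum_coords b α, apply_eq_sum_coords b β, h]

/-- Coordinates of alternating forms fill only a subspace of the functions on tuples. An injective
linear map nevertheless has a left inverse, and it is continuous because the function space is
finite dimensional. Smoothness and measurability can thus be tested on coordinates. -/
theorem exists_recon : ∃ R : ((Fin k → ι) → ℝ) →L[ℝ] (E [⋀^Fin k]→L[ℝ] ℝ),
    ∀ α, R (coords b α) = α := by
  obtain ⟨g, hg⟩ := LinearMap.exists_leftInverse_of_injective
    (coords b (k := k)).toLinearMap (LinearMap.ker_eq_bot.2 (coords_injective b))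
  exact ⟨LinearMap.toContinuousLinearMap g, fun α => LinearMap.congr_fun hg α⟩

/-- The alternating form with given coordinates. -/
def recon : ((Fin k → ι) → ℝ) →L[ℝ] (E [⋀^Fin k]→L[ℝ] ℝ) := (exists_recon b).choose

theorem recon_coords (α : E [⋀^Fin k]→L[ℝ] ℝ) : recon b (coords b α) = α :=
  (exists_recon b).choose_spec α

variable {G : Type*} [NormedAddCommGroup G] [NormedSpace ℝ G]

theorem contDiffAt_iff_coords {f : G → E [⋀^Fin k]→L[ℝ] ℝ} {x : G} {n : WithTop ℕ∞} :
    ContDiffAt ℝ n f x ↔ ∀ J : Fin k → ι, ContDiffAt ℝ n (fun z => f z (fun a => b (J a))) x := by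
  constructor
  · intro h J
    exact (ContinuousAlternatingMap.apply ℝ E ℝ (fun a => b (J a))).contDiff.contDiffAt.comp x h
  · intro h
    have h1 : ContDiffAt ℝ n (fun z => coords b (f z)) x := contDiffAt_pi.2 h
    have h2 := (recon b (k := k)).contDiff.contDiffAt.comp x h1
    refine h2.congr_of_eventuallyEq (Filter.Eventually.of_forall fun z => ?_)
    exact (recon_coords b (f z)).symm

variable {E' : Type*} [NormedAddCommGroup E'] [NormedSpace ℝ E']

/-- In coordinates, evaluation on moving vectors is a polynomial in the coordinates of the form and
of the vectors. -/
theorem contDiffAt_form_apply [FiniteDimensional ℝ E] {f : G → E [⋀^Fin k]→L[ℝ] ℝ}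
    {v : Fin k → G → E} {x : G} {n : WithTop ℕ∞} (hf : ContDiffAt ℝ n f x)
    (hv : ∀ a, ContDiffAt ℝ n (v a) x) : ContDiffAt ℝ n (fun z => f z (fun a => v a z)) x := by
  have b := Module.finBasis ℝ E
  simp_rw [apply_eq_sum_coords b]
  refine ContDiffAt.sum fun J _ => ContDiffAt.mul (contDiffAt_prod fun a _ => ?_)
    ((contDiffAt_iff_coords b).1 hf J)
  have : ContDiff ℝ n (fun w : E => b.repr w (J a)) :=
    (LinearMap.toContinuousLinearMap (b.coord (J a))).contDiff
  exact this.contDiffAt.comp x (hv a)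

theorem contDiffAt_pullback [FiniteDimensional ℝ E] [FiniteDimensional ℝ E']
    {f : G → E [⋀^Fin k]→L[ℝ] ℝ} {g : G → E' →L[ℝ] E} {x : G} {n : WithTop ℕ∞}
    (hf : ContDiffAt ℝ n f x) (hg : ContDiffAt ℝ n g x) :
    ContDiffAt ℝ n (fun z => (f z).compContinuousLinearMap (g z)) x := by
  rw [contDiffAt_iff_coords (Module.finBasis ℝ E')]
  intro J
  exact contDiffAt_form_apply (v := fun a z => g z (Module.finBasis ℝ E' (J a))) hf
    fun a => hg.clm_apply contDiffAt_const

theorem norm_pullback_le (α : E [⋀^Fin k]→L[ℝ] ℝ) (g : E' →L[ℝ] E) :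
    ‖α.compContinuousLinearMap g‖ ≤ ‖α‖ * ‖g‖ ^ k := by
  have := ContinuousAlternatingMap.norm_compContinuousLinearMap_le α g
  simpa using this

end LinearAlgebra

/-! ### Forms in preferred charts: change of charts, smoothness, and extension by zero. -/

section ChartCalculus

variable {E H : Type*} [NormedAddCommGroup E] [NormedSpace ℝ E] [TopologicalSpace H]
  (I : ModelWithCorners ℝ E H) [I.Boundaryless]
  {X : Type*} [TopologicalSpace X] [ChartedSpace H X]

/-- The derivative of the inverse of the preferred chart, as an endomorphism of the model space. -/
def dSymm (x₀ : X) (y : E) : E →L[ℝ] E := mfderiv 𝓘(ℝ, E) I (extChartAt I x₀).symm y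

/-- The derivative of the preferred chart, as an endomorphism of the model space. -/
def dChart (x₀ : X) (x : X) : E →L[ℝ] E := mfderiv I 𝓘(ℝ, E) (extChartAt I x₀) x

/-- The value of a form at a point, as a form on the model space. -/
def formAt {k : ℕ} (u : DForm I X k) (x : X) : E [⋀^Fin k]→L[ℝ] ℝ := u x

theorem inChart_eq {k : ℕ} (u : DForm I X k) (x₀ : X) (y : E) :
    inChart I u x₀ y =
      (formAt I u ((extChartAt I x₀).symm y)).compContinuousLinearMap (dSymm I x₀ y) := rfl

/-- The transition map between the preferred charts around `x₀` and `x₁`. -/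
def trans (x₀ x₁ : X) (y : E) : E := extChartAt I x₁ ((extChartAt I x₀).symm y)

/-- The domain of the transition map. -/
def transDom (x₀ x₁ : X) : Set E :=
  (extChartAt I x₀).target ∩ (extChartAt I x₀).symm ⁻¹' (extChartAt I x₁).source

theorem isOpen_transDom (x₀ x₁ : X) : IsOpen (transDom I x₀ x₁) :=
  (continuousOn_extChartAt_symm x₀).isOpen_inter_preimage (isOpen_extChartAt_target x₀)
    (isOpen_extChartAt_source x₁)

theorem trans_mem {x₀ x₁ : X} {y : E} (hy : y ∈ transDom I x₀ x₁) :
    trans I x₀ x₁ y ∈ transDom I x₁ x₀ := by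
  refine ⟨(extChartAt I x₁).map_source hy.2, ?_⟩
  rw [Set.mem_preimage, trans, (extChartAt I x₁).left_inv hy.2]
  exact (extChartAt I x₀).map_target hy.1

theorem symm_trans {x₀ x₁ : X} {y : E} (hy : y ∈ transDom I x₀ x₁) :
    (extChartAt I x₁).symm (trans I x₀ x₁ y) = (extChartAt I x₀).symm y :=
  (extChartAt I x₁).left_inv hy.2

theorem trans_trans {x₀ x₁ : X} {y : E} (hy : y ∈ transDom I x₀ x₁) :
    trans I x₁ x₀ (trans I x₀ x₁ y) = y := by
  rw [trans, symm_trans I hy, (extChartAt I x₀).right_inv hy.1]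

variable [IsManifold I ∞ X] [FiniteDimensional ℝ E]

theorem dChart_comp_dSymm {x₀ : X} {y : E} (hy : y ∈ (extChartAt I x₀).target) :
    (dChart I x₀ ((extChartAt I x₀).symm y)).comp (dSymm I x₀ y) = ContinuousLinearMap.id ℝ E := by
  have : IsManifold I 1 X := IsManifold.of_le (n := ∞) (by norm_num)
  have h := mfderiv_extChartAt_comp_mfderivWithin_extChartAt_symm (I := I) hy
  rw [I.range_eq_univ, mfderivWithin_univ] at h
  exact h

theorem dSymm_comp_dChart {x₀ : X} {y : E} (hy : y ∈ (extChartAt I x₀).target) :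
    (dSymm I x₀ y).comp (dChart I x₀ ((extChartAt I x₀).symm y)) = ContinuousLinearMap.id ℝ E := by
  have : IsManifold I 1 X := IsManifold.of_le (n := ∞) (by norm_num)
  have h := mfderivWithin_extChartAt_symm_comp_mfderiv_extChartAt (I := I) hy
  rw [I.range_eq_univ, mfderivWithin_univ] at h
  exact h

theorem dSymm_comp_dChart' {x₀ x : X} (hx : x ∈ (extChartAt I x₀).source) :
    (dSymm I x₀ (extChartAt I x₀ x)).comp (dChart I x₀ x) = ContinuousLinearMap.id ℝ E := by
  have h := dSymm_comp_dChart I ((extChartAt I x₀).map_source hx)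
  rwa [(extChartAt I x₀).left_inv hx] at h

/-- The tangent space at `x` is the model space, identified through the preferred chart around `x`;
in this identification that chart has the identity as its derivative at `x`. This links the
chartwise definition of `extD` to the ordinary exterior derivative. -/
theorem dChart_self (x : X) : dChart I x x = ContinuousLinearMap.id ℝ E := by
  have : IsManifold I 1 X := IsManifold.of_le (n := ∞) (by norm_num)
  exact mfderiv_extChartAt_self (I := I) (x := x)

theorem contDiffOn_trans (x₀ x₁ : X) : ContDiffOn ℝ ∞ (trans I x₀ x₁) (transDom I x₀ x₁) := by
  have h := contDiffOn_ext_coord_change (I := I) (n := ∞) x₁ x₀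
  refine h.mono ?_
  intro y hy
  simp only [PartialEquiv.trans_source, PartialEquiv.symm_source]
  exact hy

theorem fderiv_trans {x₀ x₁ : X} {y : E} (hy : y ∈ transDom I x₀ x₁) :
    fderiv ℝ (trans I x₀ x₁) y =
      (dChart I x₁ ((extChartAt I x₀).symm y)).comp (dSymm I x₀ y) := by
  have : IsManifold I 1 X := IsManifold.of_le (n := ∞) (by norm_num)
  have h1 : MDifferentiableAt 𝓘(ℝ, E) I (extChartAt I x₀).symm y := by
    have := mdifferentiableWithinAt_extChartAt_symm (I := I) hy.1
    rwa [I.range_eq_univ, mdifferentiableWithinAt_univ] at this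
  have h2 : MDifferentiableAt I 𝓘(ℝ, E) (extChartAt I x₁) ((extChartAt I x₀).symm y) :=
    mdifferentiableAt_extChartAt (by rw [← extChartAt_source (I := I)]; exact hy.2)
  have := mfderiv_comp y h2 h1
  rw [mfderiv_eq_fderiv] at this
  exact this

theorem formAt_eq {k : ℕ} (u : DForm I X k) {x₀ x : X} (hx : x ∈ (extChartAt I x₀).source) :
    formAt I u x =
      (inChart I u x₀ (extChartAt I x₀ x)).compContinuousLinearMap (dChart I x₀ x) := by
  rw [inChart_eq, (extChartAt I x₀).left_inv hx]
  have h := dSymm_comp_dChart' I hx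
  ext v
  simp only [ContinuousAlternatingMap.compContinuousLinearMap_apply]
  congr 1
  funext i
  exact (DFunLike.congr_fun h (v i)).symm

/-- The usual transformation law of differential forms; smoothness, measurability and norm bounds
are carried between charts by it. -/
theorem inChart_trans {k : ℕ} (u : DForm I X k) {x₀ x₁ : X} {y : E}
    (hy : y ∈ transDom I x₀ x₁) :
    inChart I u x₀ y = (inChart I u x₁ (trans I x₀ x₁ y)).compContinuousLinearMap
      (fderiv ℝ (trans I x₀ x₁) y) := by
  rw [inChart_eq, formAt_eq I u hy.2, fderiv_trans I hy]
  rfl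

/-- What is needed later is that the Jacobian determinant of a transition map does not vanish. -/
theorem fderiv_trans_comp {x₀ x₁ : X} {y : E} (hy : y ∈ transDom I x₀ x₁) :
    (fderiv ℝ (trans I x₁ x₀) (trans I x₀ x₁ y)).comp (fderiv ℝ (trans I x₀ x₁) y) =
      ContinuousLinearMap.id ℝ E := by
  rw [fderiv_trans I hy, fderiv_trans I (trans_mem I hy), symm_trans I hy]
  have h1 := dSymm_comp_dChart' I hy.2
  have h2 := dChart_comp_dSymm I hy.1
  ext v
  have h1' := DFunLike.congr_fun h1 (dSymm I x₀ y v)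
  have h2' := DFunLike.congr_fun h2 v
  simp only [ContinuousLinearMap.comp_apply, ContinuousLinearMap.id_apply] at h1' h2' ⊢
  rw [trans, h1', h2']

/-! ### Smoothness of forms at a point -/

/-- A form is smooth near a point. -/
def SmoothAt {k : ℕ} (u : DForm I X k) (x : X) : Prop :=
  ContDiffAt ℝ ∞ (inChart I u x) (extChartAt I x x)

/-- Near `y` the expression in one chart is the pullback of the other under the smooth transition
map, so smoothness may be tested in any chart that contains the point. -/
theorem contDiffAt_inChart_trans {k : ℕ} {u : DForm I X k} {x₀ x₁ : X} {y : E}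
    (hy : y ∈ transDom I x₀ x₁) (h : ContDiffAt ℝ ∞ (inChart I u x₁) (trans I x₀ x₁ y)) :
    ContDiffAt ℝ ∞ (inChart I u x₀) y := by
  have hτ : ContDiffAt ℝ ∞ (trans I x₀ x₁) y :=
    (contDiffOn_trans I x₀ x₁).contDiffAt ((isOpen_transDom I x₀ x₁).mem_nhds hy)
  have hd : ContDiffAt ℝ ∞ (fderiv ℝ (trans I x₀ x₁)) y := hτ.fderiv_right (by simp)
  have : ContDiffAt ℝ ∞ (fun z => (inChart I u x₁ (trans I x₀ x₁ z)).compContinuousLinearMap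
      (fderiv ℝ (trans I x₀ x₁) z)) y :=
    contDiffAt_pullback (h.comp y hτ) hd
  refine this.congr_of_eventuallyEq ?_
  filter_upwards [(isOpen_transDom I x₀ x₁).mem_nhds hy] with z hz
  exact inChart_trans I u hz

theorem mem_transDom {x₀ x₁ x : X} (h₀ : x ∈ (extChartAt I x₀).source)
    (h₁ : x ∈ (extChartAt I x₁).source) : extChartAt I x₀ x ∈ transDom I x₀ x₁ := by
  refine ⟨(extChartAt I x₀).map_source h₀, ?_⟩
  rwa [Set.mem_preimage, (extChartAt I x₀).left_inv h₀]

theorem smoothAt_iff {k : ℕ} {u : DForm I X k} {x₀ x : X} (hx : x ∈ (extChartAt I x₀).source) :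
    SmoothAt I u x ↔ ContDiffAt ℝ ∞ (inChart I u x₀) (extChartAt I x₀ x) := by
  have hx' := mem_extChartAt_source (I := I) x
  constructor
  · intro h
    refine contDiffAt_inChart_trans I (mem_transDom I hx hx') ?_
    rwa [trans, (extChartAt I x₀).left_inv hx]
  · intro h
    refine contDiffAt_inChart_trans I (mem_transDom I hx' hx) ?_
    rwa [trans, (extChartAt I x).left_inv hx']

theorem SmoothAt.contDiffAt {k : ℕ} {u : DForm I X k} {x₀ : X} {y : E}
    (hy : y ∈ (extChartAt I x₀).target) (h : SmoothAt I u ((extChartAt I x₀).symm y)) :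
    ContDiffAt ℝ ∞ (inChart I u x₀) y := by
  have := (smoothAt_iff I ((extChartAt I x₀).map_target hy)).1 h
  rwa [(extChartAt I x₀).right_inv hy] at this

theorem isSmooth_iff {k : ℕ} {u : DForm I X k} : IsSmooth I u ↔ ∀ x, SmoothAt I u x := by
  constructor
  · intro h x
    exact (h x).contDiffAt (extChartAt_target_mem_nhds x)
  · intro h x₀ y hy
    exact (SmoothAt.contDiffAt I hy (h _)).contDiffWithinAt

theorem eventually_inChart {P : X → Prop} {x : X} (h : ∀ᶠ z in nhds x, P z) :
    ∀ᶠ y in nhds (extChartAt I x x), P ((extChartAt I x).symm y) := by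
  have : Filter.Tendsto (extChartAt I x).symm (nhds (extChartAt I x x)) (nhds x) := by
    have := continuousAt_extChartAt_symm (I := I) x
    rw [ContinuousAt, extChartAt_to_inv] at this
    exact this
  exact this.eventually h

theorem SmoothAt.congr {k : ℕ} {u v : DForm I X k} {x : X} (hu : SmoothAt I u x)
    (h : ∀ᶠ z in nhds x, v z = u z) : SmoothAt I v x := by
  refine ContDiffAt.congr_of_eventuallyEq hu ?_
  filter_upwards [eventually_inChart I h] with y hy
  simp only [inChart_eq, formAt, hy]

theorem smoothAt_zero {k : ℕ} (x : X) : SmoothAt I (0 : DForm I X k) x :=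
  (isSmooth_iff I).1 (isSmooth_zero I) x

theorem SmoothAt.sub {k : ℕ} {u v : DForm I X k} {x : X} (hu : SmoothAt I u x)
    (hv : SmoothAt I v x) : SmoothAt I (u - v) x := ContDiffAt.sub hu hv

/-- In the coordinates of any preferred chart, `extD` is the exterior derivative. -/
theorem inChart_extD {k : ℕ} {u : DForm I X k} {x₀ : X} {y : E}
    (hy : y ∈ (extChartAt I x₀).target) (h : SmoothAt I u ((extChartAt I x₀).symm y)) :
    inChart I (extD I u) x₀ y = extDeriv (inChart I u x₀) y := by
  set x := (extChartAt I x₀).symm y with hx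
  have hyd : y ∈ transDom I x₀ x := ⟨hy, mem_extChartAt_source x⟩
  have h1 : formAt I (extD I u) x = extDeriv (inChart I u x) (extChartAt I x x) := by
    have : formAt I (extD I u) x =
      (extDeriv (inChart I u x) (extChartAt I x x)).compContinuousLinearMap (dChart I x x) := rfl
    rw [this, dChart_self]; rfl
  have hτ : ContDiffAt ℝ ∞ (trans I x₀ x) y :=
    (contDiffOn_trans I x₀ x).contDiffAt ((isOpen_transDom I x₀ x).mem_nhds hyd)
  have h2 : dSymm I x₀ y = fderiv ℝ (trans I x₀ x) y := by
    rw [fderiv_trans I hyd, ← hx, dChart_self]; rfl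
  rw [inChart_eq, ← hx, h1, h2]
  have hdiff : DifferentiableAt ℝ (inChart I u x) (trans I x₀ x y) :=
    ContDiffAt.differentiableAt h (by simp)
  -- At `x` the form `extD u` is computed in the chart around `x`, whose derivative there is the
  -- identity. Naturality of the exterior derivative under the transition map carries the formula to
  -- the chart around `x₀`.
  have h3 := extDeriv_pullback (r := ∞) hdiff hτ
    (by rw [minSmoothness_of_isRCLikeNormedField]; exact ENat.LEInfty.out)
  have h4 : trans I x₀ x y = extChartAt I x x := rfl
  rw [h4] at h3
  rw [← h3]
  refine Filter.EventuallyEq.extDeriv_eq ?_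
  filter_upwards [(isOpen_transDom I x₀ x).mem_nhds hyd] with z hz
  exact (inChart_trans I u hz).symm

theorem contDiffAt_extDeriv {G : Type*} [NormedAddCommGroup G] [NormedSpace ℝ G] {k : ℕ}
    {f : G → G [⋀^Fin k]→L[ℝ] ℝ} {x : G} (hf : ContDiffAt ℝ ∞ f x) :
    ContDiffAt ℝ ∞ (extDeriv f) x := by
  change ContDiffAt ℝ ∞ (ContinuousAlternatingMap.alternatizeUncurryFinCLM ℝ G ℝ ∘ fderiv ℝ f) x
  exact (ContinuousAlternatingMap.alternatizeUncurryFinCLM ℝ G ℝ).contDiff.contDiffAt.comp x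
    (hf.fderiv_right (m := ∞) (by simp))

theorem IsSmooth.extD {k : ℕ} {u : DForm I X k} (hu : IsSmooth I u) :
    IsSmooth I (extD I u) := by
  intro x₀ y hy
  have hd : ∀ z ∈ (extChartAt I x₀).target, ContDiffAt ℝ ∞ (inChart I u x₀) z := fun z hz =>
    (hu x₀).contDiffAt ((isOpen_extChartAt_target x₀).mem_nhds hz)
  refine ((contDiffAt_extDeriv (hd y hy)).congr_of_eventuallyEq ?_).contDiffWithinAt
  filter_upwards [(isOpen_extChartAt_target x₀).mem_nhds hy] with z hz
  exact inChart_extD I hz ((isSmooth_iff I).1 hu _)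

/-! ### Forms supported in a chart -/

open Classical in
/-- The form on `X` with coordinate expression `f` in the preferred chart around `x₁`, extended
by zero. -/
def fromChart {k : ℕ} (x₁ : X) (f : E → E [⋀^Fin k]→L[ℝ] ℝ) : DForm I X k :=
  let F : X → E [⋀^Fin k]→L[ℝ] ℝ := fun x => if x ∈ (extChartAt I x₁).source then
    (f (extChartAt I x₁ x)).compContinuousLinearMap (dChart I x₁ x) else 0
  F

theorem fromChart_of_mem {k : ℕ} {x₁ x : X} (f : E → E [⋀^Fin k]→L[ℝ] ℝ)
    (hx : x ∈ (extChartAt I x₁).source) : formAt I (fromChart I x₁ f) x =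
      (f (extChartAt I x₁ x)).compContinuousLinearMap (dChart I x₁ x) := if_pos hx

theorem fromChart_of_notMem {k : ℕ} {x₁ x : X} (f : E → E [⋀^Fin k]→L[ℝ] ℝ)
    (hx : x ∉ (extChartAt I x₁).source) : formAt I (fromChart I x₁ f) x = 0 := if_neg hx

theorem inChart_fromChart {k : ℕ} {x₀ x₁ : X} (f : E → E [⋀^Fin k]→L[ℝ] ℝ) {y : E}
    (hy : y ∈ transDom I x₀ x₁) : inChart I (fromChart I x₁ f) x₀ y =
      (f (trans I x₀ x₁ y)).compContinuousLinearMap (fderiv ℝ (trans I x₀ x₁) y) := by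
  rw [inChart_eq, fromChart_of_mem I f hy.2, fderiv_trans I hy]
  rfl

theorem inChart_fromChart_self {k : ℕ} {x₁ : X} (f : E → E [⋀^Fin k]→L[ℝ] ℝ) {y : E}
    (hy : y ∈ (extChartAt I x₁).target) : inChart I (fromChart I x₁ f) x₁ y = f y := by
  rw [inChart_eq, fromChart_of_mem I f ((extChartAt I x₁).map_target hy),
    (extChartAt I x₁).right_inv hy]
  have h := dChart_comp_dSymm I hy
  ext v
  simp only [ContinuousAlternatingMap.compContinuousLinearMap_apply]
  congr 1
  funext i
  exact DFunLike.congr_fun h (v i)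

theorem inChart_fromChart_of_notMem {k : ℕ} {x₀ x₁ : X} (f : E → E [⋀^Fin k]→L[ℝ] ℝ) {y : E}
    (hy : (extChartAt I x₀).symm y ∉ (extChartAt I x₁).source) :
    inChart I (fromChart I x₁ f) x₀ y = 0 := by
  rw [inChart_eq, fromChart_of_notMem I f hy]
  rfl

theorem smoothAt_fromChart {k : ℕ} {x₁ x : X} {f : E → E [⋀^Fin k]→L[ℝ] ℝ}
    (hx : x ∈ (extChartAt I x₁).source) (hf : ContDiffAt ℝ ∞ f (extChartAt I x₁ x)) :
    SmoothAt I (fromChart I x₁ f) x := by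
  rw [smoothAt_iff I hx]
  refine hf.congr_of_eventuallyEq ?_
  filter_upwards [(isOpen_extChartAt_target x₁).mem_nhds ((extChartAt I x₁).map_source hx)]
    with z hz
  exact inChart_fromChart_self I f hz

/-- The image of `K` is compact, hence closed in a Hausdorff space. This rules out a singularity of
the extension by zero at the edge of the chart domain. -/
theorem eventually_fromChart_eq_zero [T2Space X] {k : ℕ} {x₁ x : X}
    {f : E → E [⋀^Fin k]→L[ℝ] ℝ} {K : Set E} (hK : IsCompact K)
    (hKt : K ⊆ (extChartAt I x₁).target) (hf : ∀ y ∉ K, f y = 0)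
    (hx : x ∉ (extChartAt I x₁).symm '' K) :
    ∀ᶠ z in nhds x, formAt I (fromChart I x₁ f) z = 0 := by
  have hc : IsClosed ((extChartAt I x₁).symm '' K) :=
    (hK.image_of_continuousOn ((continuousOn_extChartAt_symm x₁).mono hKt)).isClosed
  filter_upwards [hc.isOpen_compl.mem_nhds hx] with z hz
  by_cases hzs : z ∈ (extChartAt I x₁).source
  · rw [fromChart_of_mem I f hzs, hf]
    · rfl
    · intro h
      exact hz ⟨_, h, (extChartAt I x₁).left_inv hzs⟩
  · exact fromChart_of_notMem I f hzs

theorem isSmooth_fromChart [T2Space X] {k : ℕ} {x₁ : X}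
    {f : E → E [⋀^Fin k]→L[ℝ] ℝ} {K : Set E} (hK : IsCompact K)
    (hKt : K ⊆ (extChartAt I x₁).target) (hf : ∀ y ∉ K, f y = 0) (hs : ContDiff ℝ ∞ f) :
    IsSmooth I (fromChart I x₁ f) := by
  rw [isSmooth_iff]
  intro x
  by_cases hx : x ∈ (extChartAt I x₁).symm '' K
  · obtain ⟨y, hy, rfl⟩ := hx
    exact smoothAt_fromChart I ((extChartAt I x₁).map_target (hKt hy)) hs.contDiffAt
  · exact (smoothAt_zero I x).congr I (eventually_fromChart_eq_zero I hK hKt hf hx)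

theorem fromChart_sub {k : ℕ} (x₁ : X) (f g : E → E [⋀^Fin k]→L[ℝ] ℝ) :
    fromChart I x₁ (f - g) = fromChart I x₁ f - fromChart I x₁ g := by
  suffices h : ∀ x, formAt I (fromChart I x₁ (f - g)) x =
      formAt I (fromChart I x₁ f) x - formAt I (fromChart I x₁ g) x from funext h
  intro x
  by_cases hx : x ∈ (extChartAt I x₁).source
  · rw [fromChart_of_mem I _ hx, fromChart_of_mem I _ hx, fromChart_of_mem I _ hx]; rfl
  · rw [fromChart_of_notMem I _ hx, fromChart_of_notMem I _ hx, fromChart_of_notMem I _ hx]; simp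

/-- The exterior derivative of a form supported in a chart vanishes if its coordinate expression
is closed. -/
theorem extD_fromChart_eq_zero [T2Space X] {k : ℕ} {x₁ : X}
    {f : E → E [⋀^Fin k]→L[ℝ] ℝ} {K : Set E} (hK : IsCompact K)
    (hKt : K ⊆ (extChartAt I x₁).target) (hf : ∀ y ∉ K, f y = 0) (hs : ContDiff ℝ ∞ f)
    (hd : extDeriv f = 0) : extD I (fromChart I x₁ f) = 0 := by
  have hsm := isSmooth_fromChart I hK hKt hf hs
  have key : ∀ x, formAt I (extD I (fromChart I x₁ f)) x = 0 := by
    intro x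
    by_cases hx : x ∈ (extChartAt I x₁).source
    · rw [formAt_eq I _ hx, inChart_extD I ((extChartAt I x₁).map_source hx)
        ((isSmooth_iff I).1 hsm _)]
      have : inChart I (fromChart I x₁ f) x₁ =ᶠ[nhds (extChartAt I x₁ x)] f := by
        filter_upwards [(isOpen_extChartAt_target x₁).mem_nhds
          ((extChartAt I x₁).map_source hx)] with z hz
        exact inChart_fromChart_self I f hz
      rw [this.extDeriv_eq, hd]
      rfl
    · have hx' : x ∉ (extChartAt I x₁).symm '' K := by
        rintro ⟨y, hy, rfl⟩
        exact hx ((extChartAt I x₁).map_target (hKt hy))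
      have h0 := eventually_inChart I (eventually_fromChart_eq_zero I hK hKt hf hx')
      rw [formAt_eq I _ (mem_extChartAt_source x), inChart_extD I (mem_extChartAt_target x)
        ((isSmooth_iff I).1 hsm _)]
      have : inChart I (fromChart I x₁ f) x =ᶠ[nhds (extChartAt I x x)] (fun _ => 0) := by
        filter_upwards [h0] with z hz
        rw [inChart_eq, hz]; rfl
      rw [this.extDeriv_eq]
      have : extDeriv (fun _ : E => (0 : E [⋀^Fin k]→L[ℝ] ℝ)) (extChartAt I x x) = 0 := by
        ext v
        rw [extDeriv_apply (differentiableAt_const _)]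
        simp
      rw [this]; rfl
  funext x
  exact key x

end ChartCalculus
end L2Forms
end

noncomputable section

namespace L2Forms

/-! ### A vector field with divergence `δ₀ - ρ`. -/

section Kernel

variable {E : Type*} [NormedAddCommGroup E] [NormedSpace ℝ E] [FiniteDimensional ℝ E]
  [MeasurableSpace E] [BorelSpace E] (μ : Measure E) [μ.IsAddHaarMeasure]

/-- A bump function supported in the ball of radius `δ` (or `1` if `δ ≤ 0`) around the origin. -/
def bumpAt (δ : ℝ) : ContDiffBump (0 : E) :=
  if h : 0 < δ then ⟨δ / 2, δ, by positivity, by linarith⟩ else ⟨1 / 2, 1, by norm_num, by norm_num⟩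

/-- A smooth mollifier supported in the ball of radius `δ`. -/
def moll (δ : ℝ) (z : E) : ℝ := (bumpAt (E := E) δ).normed μ z

theorem moll_nonneg (δ : ℝ) (z : E) : 0 ≤ moll μ δ z := ContDiffBump.nonneg_normed _ _

theorem integral_moll (δ : ℝ) : ∫ z, moll μ δ z ∂μ = 1 := ContDiffBump.integral_normed _

theorem contDiff_moll (δ : ℝ) : ContDiff ℝ ∞ (moll (E := E) μ δ) := ContDiffBump.contDiff_normed _

theorem moll_eq_zero {δ : ℝ} (hδ : 0 < δ) {z : E} (hz : δ ≤ ‖z‖) : moll μ δ z = 0 := by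
  have h : z ∉ Function.support ((bumpAt (E := E) δ).normed μ) := by
    rw [ContDiffBump.support_normed_eq]
    simp only [bumpAt, dif_pos hδ, Metric.mem_ball, dist_zero_right, not_lt]
    exact hz
  simpa [moll] using h

theorem hasCompactSupport_moll (δ : ℝ) : HasCompactSupport (moll (E := E) μ δ) :=
  ContDiffBump.hasCompactSupport_normed _

theorem integrable_moll (δ : ℝ) : Integrable (moll (E := E) μ δ) μ :=
  (contDiff_moll μ δ).continuous.integrable_of_hasCompactSupport (hasCompactSupport_moll μ δ)

/-- The integrand of the density of `homKernel`. -/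
def homIntegrand (δ : ℝ) (z : E) (t : ℝ) : ℝ :=
  (t ^ (Module.finrank ℝ E + 1))⁻¹ * moll μ δ (t⁻¹ • z)

/-- The vector field `b` with `div b = δ₀ - ρ` for the mollifier `ρ`. -/
def homKernel (δ : ℝ) (z : E) : E :=
  (∫ t in Set.Ioc (0 : ℝ) 1, homIntegrand μ δ z t) • z

theorem homIntegrand_nonneg (δ : ℝ) (z : E) {t : ℝ} (ht : 0 < t) : 0 ≤ homIntegrand μ δ z t :=
  mul_nonneg (by positivity) (moll_nonneg _ _ _)

theorem measurable_homIntegrand (δ : ℝ) :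
    Measurable (fun p : E × ℝ => homIntegrand μ δ p.1 p.2) := by
  unfold homIntegrand
  have := (contDiff_moll (E := E) μ δ).continuous.measurable
  fun_prop

variable {F : Type*} [NormedAddCommGroup F] [NormedSpace ℝ F]

/-- Substitution `z = t y`. Of the power `t^(-(n+1))`, the Jacobian uses up `t^n`; the remaining
`t⁻¹` will cancel the factor `t` of a `Φ` that vanishes linearly at the origin. -/
theorem integral_homIntegrand_smul (δ : ℝ) (Φ : E → F) {t : ℝ} (ht : 0 < t) :
    ∫ z, homIntegrand μ δ z t • Φ z ∂μ = ∫ y, moll μ δ y • t⁻¹ • Φ (t • y) ∂μ := by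
  have h := Measure.integral_comp_smul μ (fun y => moll μ δ y • t⁻¹ • Φ (t • y)) t⁻¹
  have ht' : t ≠ 0 := ht.ne'
  rw [abs_of_pos (by positivity), inv_pow, inv_inv] at h
  have h2 : ∫ y, moll μ δ y • t⁻¹ • Φ (t • y) ∂μ =
      (t ^ Module.finrank ℝ E)⁻¹ • ∫ x, moll μ δ (t⁻¹ • x) • t⁻¹ • Φ (t • t⁻¹ • x) ∂μ := by
    rw [h, smul_smul, inv_mul_cancel₀ (by positivity), one_smul]
  rw [h2, ← integral_smul]
  congr 1
  funext z
  rw [smul_smul t t⁻¹, mul_inv_cancel₀ ht', one_smul, smul_smul, smul_smul, homIntegrand, pow_succ,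
    mul_inv]
  congr 1
  ring

theorem integrable_homIntegrand_smul {δ : ℝ} (Φ : E → F) (hΦ : Continuous Φ) {t : ℝ}
    (ht : 0 < t) : Integrable (fun z => homIntegrand μ δ z t • Φ z) μ := by
  refine Continuous.integrable_of_hasCompactSupport ?_ ?_
  · unfold homIntegrand
    have := (contDiff_moll (E := E) μ δ).continuous
    fun_prop
  · apply HasCompactSupport.smul_right
    apply HasCompactSupport.mul_left
    exact (hasCompactSupport_moll (E := E) μ δ).comp_smul (inv_ne_zero ht.ne')

/-- The only danger is `t → 0`. After rescaling, `t⁻¹ ‖Φ(t y)‖ ≤ C ‖y‖ ≤ C δ` on the support of the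
mollifier, uniformly in `t`, which licenses Fubini. -/
theorem integrable_prod_homIntegrand {δ : ℝ} (hδ : 0 < δ) (Φ : E → F) (hΦ : Continuous Φ) {C : ℝ}
    (hC0 : 0 ≤ C) (hC : ∀ z, ‖Φ z‖ ≤ C * ‖z‖) :
    Integrable (fun p : E × ℝ => homIntegrand μ δ p.1 p.2 • Φ p.1)
      (μ.prod (volume.restrict (Set.Ioc (0 : ℝ) 1))) := by
  rw [integrable_prod_iff']
  · constructor
    · filter_upwards [ae_restrict_mem measurableSet_Ioc] with t ht
      exact integrable_homIntegrand_smul μ Φ hΦ ht.1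
    · have hmeas : AEStronglyMeasurable
          (fun t => ∫ z, ‖homIntegrand μ δ z t • Φ z‖ ∂μ)
          (volume.restrict (Set.Ioc (0 : ℝ) 1)) := by
        have : StronglyMeasurable (fun p : ℝ × E => ‖homIntegrand μ δ p.2 p.1 • Φ p.2‖) := by
          refine Measurable.stronglyMeasurable ?_
          simp_rw [norm_smul]
          have h1 := (measurable_homIntegrand (E := E) μ δ).comp measurable_swap (α := ℝ × E)
          exact h1.norm.mul ((hΦ.norm.measurable).comp measurable_snd)
        exact this.integral_prod_right.aestronglyMeasurable
      refine Integrable.of_bound hmeas (C * δ) ?_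
      filter_upwards [ae_restrict_mem measurableSet_Ioc] with t ht
      have ht0 := ht.1
      have h1 : ∀ z, ‖homIntegrand μ δ z t • Φ z‖ = homIntegrand μ δ z t • ‖Φ z‖ := by
        intro z
        rw [norm_smul, Real.norm_of_nonneg (homIntegrand_nonneg μ δ z ht0), smul_eq_mul]
      simp_rw [h1]
      have h0 : 0 ≤ ∫ y, moll μ δ y • t⁻¹ • ‖Φ (t • y)‖ ∂μ :=
        integral_nonneg fun y => mul_nonneg (moll_nonneg _ _ _) (by positivity)
      rw [integral_homIntegrand_smul μ δ (fun z => ‖Φ z‖) ht0, Real.norm_of_nonneg h0]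
      calc ∫ y, moll μ δ y • t⁻¹ • ‖Φ (t • y)‖ ∂μ ≤ ∫ y, moll μ δ y * (C * δ) ∂μ := by
            refine integral_mono ?_ ((integrable_moll μ δ).mul_const _) ?_
            · refine Continuous.integrable_of_hasCompactSupport ?_ ?_
              · have := (contDiff_moll (E := E) μ δ).continuous
                fun_prop
              · exact (hasCompactSupport_moll μ δ).smul_right
            · intro y
              simp only [smul_eq_mul]
              by_cases hy : δ ≤ ‖y‖
              · simp [moll_eq_zero μ hδ hy]
              · push Not at hy
                refine mul_le_mul_of_nonneg_left ?_ (moll_nonneg _ _ _)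
                have h3 : t⁻¹ * ‖Φ (t • y)‖ ≤ C * ‖y‖ := by
                  rw [inv_mul_le_iff₀ ht0]
                  refine (hC _).trans (le_of_eq ?_)
                  rw [norm_smul, Real.norm_of_nonneg ht0.le]; ring
                refine h3.trans ?_
                exact mul_le_mul_of_nonneg_left hy.le hC0
        _ = C * δ := by rw [integral_mul_const, integral_moll, one_mul]
  · refine AEStronglyMeasurable.smul ?_ ?_
    · exact (measurable_homIntegrand (E := E) μ δ).aestronglyMeasurable
    · exact (hΦ.stronglyMeasurable.comp_measurable measurable_fst).aestronglyMeasurable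

theorem integral_density_smul {δ : ℝ} (hδ : 0 < δ) [CompleteSpace F] (Φ : E → F)
    (hΦ : Continuous Φ)
    {C : ℝ} (hC0 : 0 ≤ C) (hC : ∀ z, ‖Φ z‖ ≤ C * ‖z‖) :
    ∫ z, (∫ t in Set.Ioc (0 : ℝ) 1, homIntegrand μ δ z t) • Φ z ∂μ =
      ∫ t in Set.Ioc (0 : ℝ) 1, ∫ y, moll μ δ y • t⁻¹ • Φ (t • y) ∂μ := by
  have h := integral_integral_swap (f := fun z t => homIntegrand μ δ z t • Φ z)
    (integrable_prod_homIntegrand μ hδ Φ hΦ hC0 hC)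
  simp_rw [integral_smul_const] at h
  rw [h]
  refine setIntegral_congr_fun measurableSet_Ioc fun t ht => ?_
  exact integral_homIntegrand_smul μ δ Φ ht.1

theorem density_nonneg (δ : ℝ) (z : E) : 0 ≤ ∫ t in Set.Ioc (0 : ℝ) 1, homIntegrand μ δ z t :=
  setIntegral_nonneg measurableSet_Ioc fun _ ht => homIntegrand_nonneg μ δ z ht.1

theorem norm_homKernel (δ : ℝ) (z : E) :
    ‖homKernel μ δ z‖ = (∫ t in Set.Ioc (0 : ℝ) 1, homIntegrand μ δ z t) • ‖z‖ := by
  rw [homKernel, norm_smul, Real.norm_of_nonneg (density_nonneg μ δ z), smul_eq_mul]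

theorem integrable_homKernel {δ : ℝ} (hδ : 0 < δ) : Integrable (homKernel (E := E) μ δ) μ := by
  have h := (integrable_prod_homIntegrand μ hδ (fun z : E => z) continuous_id zero_le_one
    (fun z => by simp)).integral_prod_left
  simp_rw [integral_smul_const] at h
  exact h

/-- After Fubini and rescaling, each `t ∈ (0, 1]` contributes the integral of `ρ(y) ‖y‖`, at most
`δ`. This smallness of the kernel in `L¹` is what later makes the commutator terms absorbable. -/
theorem integral_norm_homKernel_le {δ : ℝ} (hδ : 0 < δ) :
    ∫ z, ‖homKernel (E := E) μ δ z‖ ∂μ ≤ δ := by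
  simp_rw [norm_homKernel]
  rw [integral_density_smul μ hδ (fun z : E => ‖z‖) continuous_norm zero_le_one (fun z => by simp)]
  have hle : ∀ t ∈ Set.Ioc (0 : ℝ) 1, ∫ y, moll (E := E) μ δ y • t⁻¹ • ‖t • y‖ ∂μ ≤ δ := by
    intro t ht
    have ht0 := ht.1
    have h1 : ∀ y : E, moll μ δ y • t⁻¹ • ‖t • y‖ = moll μ δ y * ‖y‖ := by
      intro y
      rw [norm_smul, Real.norm_of_nonneg ht0.le, smul_eq_mul, smul_eq_mul, ← mul_assoc t⁻¹,
        inv_mul_cancel₀ ht0.ne', one_mul]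
    simp_rw [h1]
    calc ∫ y, moll (E := E) μ δ y * ‖y‖ ∂μ ≤ ∫ y, moll (E := E) μ δ y * δ ∂μ := by
          refine integral_mono ?_ ((integrable_moll μ δ).mul_const _) ?_
          · refine Continuous.integrable_of_hasCompactSupport ?_ ?_
            · have := (contDiff_moll (E := E) μ δ).continuous
              fun_prop
            · exact (hasCompactSupport_moll μ δ).mul_right
          · intro y
            by_cases hy : δ ≤ ‖y‖
            · simp [moll_eq_zero μ hδ hy]
            · push Not at hy
              exact mul_le_mul_of_nonneg_left hy.le (moll_nonneg _ _ _)
      _ = δ := by rw [integral_mul_const, integral_moll, one_mul]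
  have hn : ∀ t ∈ Set.Ioc (0 : ℝ) 1, ‖∫ y, moll (E := E) μ δ y • t⁻¹ • ‖t • y‖ ∂μ‖ ≤ δ := by
    intro t ht
    have ht0 := ht.1
    rw [Real.norm_of_nonneg]
    · exact hle t ht
    · exact integral_nonneg fun y => mul_nonneg (moll_nonneg _ _ _) (by positivity)
  have := norm_setIntegral_le_of_norm_le_const (μ := volume) (s := Set.Ioc (0 : ℝ) 1)
    (by simp) hn
  simp at this
  exact (le_abs_self _).trans this

/-- For `t ≤ 1` the point `z / t` is at least as far from the origin as `z`, hence outside the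
support of the mollifier. -/
theorem homKernel_eq_zero {δ : ℝ} (hδ : 0 < δ) {z : E} (hz : δ ≤ ‖z‖) :
    homKernel μ δ z = 0 := by
  have : ∫ t in Set.Ioc (0 : ℝ) 1, homIntegrand μ δ z t = 0 := by
    rw [setIntegral_congr_fun (g := fun _ => 0) measurableSet_Ioc, integral_zero]
    intro t ht
    have ht0 := ht.1
    simp only [homIntegrand]
    rw [moll_eq_zero μ hδ, mul_zero]
    rw [norm_smul, norm_inv, Real.norm_of_nonneg ht0.le, ← div_eq_inv_mul, le_div_iff₀ ht0]
    nlinarith [ht.2]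
  rw [homKernel, this, zero_smul]

/-- The fundamental property of `homKernel`: its divergence is `δ₀ - ρ`. -/
theorem integral_fderiv_homKernel {δ : ℝ} (hδ : 0 < δ) [CompleteSpace F] {f : E → F}
    (hf : ContDiff ℝ 1 f) (hc : HasCompactSupport f) (x : E) :
    ∫ z, fderiv ℝ f (x - z) (homKernel μ δ z) ∂μ = f x - ∫ z, moll μ δ z • f (x - z) ∂μ := by
  have hfc : Continuous (fderiv ℝ f) := hf.continuous_fderiv (by simp)
  obtain ⟨C, hC⟩ := (hc.fderiv (𝕜 := ℝ)).exists_bound_of_continuous hfc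
  have hC0 : 0 ≤ C := (norm_nonneg _).trans (hC x)
  have hΦ : Continuous (fun z => fderiv ℝ f (x - z) z) := by fun_prop
  have h := integral_density_smul μ hδ (fun z => fderiv ℝ f (x - z) z) hΦ hC0
    (fun z => ((fderiv ℝ f (x - z)).le_opNorm z).trans (by gcongr; exact hC _))
  have h1 : ∀ z, fderiv ℝ f (x - z) (homKernel μ δ z) =
      (∫ t in Set.Ioc (0 : ℝ) 1, homIntegrand μ δ z t) • fderiv ℝ f (x - z) z := by
    intro z
    rw [homKernel, map_smul]
  simp_rw [h1]
  rw [h]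
  -- The `t⁻¹` left over by the substitution cancels the `t` in the argument of the derivative.
  have h2 : ∫ t in Set.Ioc (0 : ℝ) 1, ∫ y, moll μ δ y • t⁻¹ •
      fderiv ℝ f (x - t • y) (t • y) ∂μ =
      ∫ t in Set.Ioc (0 : ℝ) 1, ∫ y, moll μ δ y • fderiv ℝ f (x - t • y) y ∂μ := by
    refine setIntegral_congr_fun measurableSet_Ioc fun t ht => ?_
    have ht0 := ht.1
    simp only [map_smul, smul_smul t⁻¹ t, inv_mul_cancel₀ ht0.ne', one_smul]
  rw [h2, integral_integral_swap]
  · have h3 : ∀ y, ∫ t in Set.Ioc (0 : ℝ) 1, moll μ δ y • fderiv ℝ f (x - t • y) y =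
        moll μ δ y • (f x - f (x - y)) := by
      intro y
      rw [integral_smul, ← intervalIntegral.integral_of_le zero_le_one]
      congr 1
      have hd : ∀ t ∈ Set.uIcc (0 : ℝ) 1, HasDerivAt (fun t : ℝ => - f (x - t • y))
          (fderiv ℝ f (x - t • y) y) t := by
        intro t _
        have hg : HasDerivAt (fun t : ℝ => x - t • y) (-y) t := by
          have := (hasDerivAt_id t).smul_const y
          simpa using this.const_sub x
        have := ((hf.differentiable (by simp)).differentiableAt.hasFDerivAt
          (x := x - t • y)).comp_hasDerivAt t hg
        simpa using! this.neg
      rw [intervalIntegral.integral_eq_sub_of_hasDerivAt hd]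
      · simp; abel
      · exact Continuous.intervalIntegrable (by fun_prop) _ _
    simp_rw [h3, smul_sub]
    rw [integral_sub, integral_smul_const, integral_moll, one_smul]
    · exact (integrable_moll μ δ).smul_const _
    · refine Continuous.integrable_of_hasCompactSupport ?_ ?_
      · have := (contDiff_moll (E := E) μ δ).continuous
        have := hf.continuous
        fun_prop
      · exact (hasCompactSupport_moll μ δ).smul_right
  · have hm := (contDiff_moll (E := E) μ δ).continuous
    have hi : Integrable (fun p : ℝ × E => C * (moll μ δ p.2 * ‖p.2‖))
        ((volume.restrict (Set.Ioc (0 : ℝ) 1)).prod μ) := by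
      have hi1 : Integrable (fun y : E => C * (moll μ δ y * ‖y‖)) μ := by
        refine (Continuous.integrable_of_hasCompactSupport (by fun_prop) ?_).const_mul C
        exact (hasCompactSupport_moll μ δ).mul_right
      exact hi1.comp_snd _
    refine hi.mono' ?_ (Filter.Eventually.of_forall fun p => ?_)
    · refine Continuous.aestronglyMeasurable ?_
      simp only [Function.uncurry_def]
      fun_prop
    · simp only [Function.uncurry_def]
      rw [norm_smul, Real.norm_of_nonneg (moll_nonneg _ _ _)]
      have h5 : ‖fderiv ℝ f (x - p.1 • p.2) p.2‖ ≤ C * ‖p.2‖ :=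
        ((fderiv ℝ f (x - p.1 • p.2)).le_opNorm _).trans (by gcongr; exact hC _)
      calc moll μ δ p.2 * ‖fderiv ℝ f (x - p.1 • p.2) p.2‖ ≤ moll μ δ p.2 * (C * ‖p.2‖) :=
            mul_le_mul_of_nonneg_left h5 (moll_nonneg _ _ _)
        _ = _ := by ring

end Kernel
end L2Forms
end

noncomputable section

namespace L2Forms

set_option maxSynthPendingDepth 5

/-! ### Contraction, wedge with a covector, and the pointwise Cartan formula. -/

section Algebra

variable {E : Type*} [NormedAddCommGroup E] [NormedSpace ℝ E]

/-- Contraction of a form with a vector. -/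
def contract (E : Type*) [NormedAddCommGroup E] [NormedSpace ℝ E] (k : ℕ) :
    E →L[ℝ] (E [⋀^Fin (k + 1)]→L[ℝ] ℝ) →L[ℝ] (E [⋀^Fin k]→L[ℝ] ℝ) :=
  (ContinuousAlternatingMap.curryLeftLI (𝕜 := ℝ) (E := E) (F := ℝ)
    (n := k)).toContinuousLinearMap.flip

theorem contract_apply {k : ℕ} (z : E) (α : E [⋀^Fin (k + 1)]→L[ℝ] ℝ) (v : Fin k → E) :
    contract E k z α v = α (Matrix.vecCons z v) := rfl

/-- The wedge product of a covector and a form. -/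
def wedge (E : Type*) [NormedAddCommGroup E] [NormedSpace ℝ E] (k : ℕ) :
    (E →L[ℝ] ℝ) →L[ℝ] (E [⋀^Fin k]→L[ℝ] ℝ) →L[ℝ] (E [⋀^Fin (k + 1)]→L[ℝ] ℝ) :=
  (ContinuousLinearMap.compL ℝ _ _ _
    (ContinuousAlternatingMap.alternatizeUncurryFinCLM ℝ E ℝ (n := k))).comp
    (ContinuousLinearMap.smulRightL ℝ E (E [⋀^Fin k]→L[ℝ] ℝ))

theorem wedge_apply {k : ℕ} (l : E →L[ℝ] ℝ) (α : E [⋀^Fin k]→L[ℝ] ℝ) :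
    wedge E k l α = ContinuousAlternatingMap.alternatizeUncurryFin (l.smulRight α) := rfl

/-- In the alternating sum evaluated at `(z, v₁, v₂, …)`, the term of index zero is `D z`, and the
others are the alternation of the contracted map with all signs shifted. For `D = dv` and constant
`z` this is Cartan's formula. -/
theorem contract_alternatize_succ {k : ℕ} (D : E →L[ℝ] E [⋀^Fin (k + 1)]→L[ℝ] ℝ) (z : E) :
    contract E (k + 1) z (ContinuousAlternatingMap.alternatizeUncurryFin D) +
      ContinuousAlternatingMap.alternatizeUncurryFin ((contract E k z).comp D) = D z := by
  ext v
  rw [ContinuousAlternatingMap.add_apply, contract_apply,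
    ContinuousAlternatingMap.alternatizeUncurryFin_apply, Fin.sum_univ_succ,
    ContinuousAlternatingMap.alternatizeUncurryFin_apply]
  have h0 : (0 : Fin (k + 2)).removeNth (Matrix.vecCons z v) = v := by
    funext i; simp [Fin.removeNth]
  have hs : ∀ i : Fin (k + 1), (i.succ).removeNth (Matrix.vecCons z v) =
      Matrix.vecCons z (i.removeNth v) := by
    intro i
    funext j
    refine Fin.cases ?_ (fun j => ?_) j
    · simp [Fin.removeNth]
    · simp [Fin.removeNth]
  simp only [h0, hs, ContinuousLinearMap.comp_apply, contract_apply]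
  simp [pow_succ]

/-- Degree zero is separate because a function has no contraction; the corresponding term of
Cartan's formula is absent. -/
theorem contract_alternatize_zero (D : E →L[ℝ] E [⋀^Fin 0]→L[ℝ] ℝ) (z : E) :
    contract E 0 z (ContinuousAlternatingMap.alternatizeUncurryFin D) = D z := by
  ext v
  rw [contract_apply, ContinuousAlternatingMap.alternatizeUncurryFin_apply]
  simp

/-- The bilinear map `(z, α) ↦ (l ↦ l(z) α - ι_z (l ∧ α))`, which is `l ∧ ι_z α`. -/
def leibniz (E : Type*) [NormedAddCommGroup E] [NormedSpace ℝ E] (k : ℕ) :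
    E →L[ℝ] (E [⋀^Fin k]→L[ℝ] ℝ) →L[ℝ] (E →L[ℝ] ℝ) →L[ℝ] (E [⋀^Fin k]→L[ℝ] ℝ) :=
  (ContinuousLinearMap.smulRightL ℝ (E →L[ℝ] ℝ) (E [⋀^Fin k]→L[ℝ] ℝ)).comp
      (ContinuousLinearMap.apply ℝ ℝ) -
    ((ContinuousLinearMap.compL ℝ (E →L[ℝ] ℝ) (E [⋀^Fin (k + 1)]→L[ℝ] ℝ)
      (E [⋀^Fin k]→L[ℝ] ℝ)).comp (contract E k)).bilinearComp
      (ContinuousLinearMap.id ℝ E) (wedge E k).flip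

theorem leibniz_apply {k : ℕ} (z : E) (α : E [⋀^Fin k]→L[ℝ] ℝ) (l : E →L[ℝ] ℝ) :
    leibniz E k z α l = l z • α - contract E k z (wedge E k l α) := rfl

/-- `leibniz` is defined by the difference, not by `l ∧ ι_z α`, so that it makes sense in every
degree; on functions it is zero, as it must be. -/
theorem leibniz_zero (z : E) (α : E [⋀^Fin 0]→L[ℝ] ℝ) (l : E →L[ℝ] ℝ) :
    leibniz E 0 z α l = 0 := by
  rw [leibniz_apply, wedge_apply, contract_alternatize_zero]
  simp

/-- The Cartan formula for the rank one map `l ⊗ α`. -/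
theorem leibniz_succ {k : ℕ} (z : E) (α : E [⋀^Fin (k + 1)]→L[ℝ] ℝ) (l : E →L[ℝ] ℝ) :
    leibniz E (k + 1) z α l = wedge E k l (contract E k z α) := by
  have h := contract_alternatize_succ (l.smulRight α) z
  rw [leibniz_apply, wedge_apply, wedge_apply]
  have h2 : (contract E k z).comp (l.smulRight α) = l.smulRight (contract E k z α) := by
    ext; simp
  rw [h2] at h
  simp only [ContinuousLinearMap.smulRight_apply] at h
  rw [← h]
  abel

theorem extDeriv_smul_fun {k : ℕ} {φ : E → ℝ} {w : E → E [⋀^Fin k]→L[ℝ] ℝ} {x : E}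
    (hφ : DifferentiableAt ℝ φ x) (hw : DifferentiableAt ℝ w x) :
    extDeriv (fun y => φ y • w y) x = wedge E k (fderiv ℝ φ x) (w x) + φ x • extDeriv w x := by
  rw [extDeriv, fderiv_fun_smul hφ hw, ContinuousAlternatingMap.alternatizeUncurryFin_add,
    ContinuousAlternatingMap.alternatizeUncurryFin_smul, wedge_apply, extDeriv]
  exact add_comm _ _

end Algebra

/-! ### Convolutions: `L²` bounds, locality and smoothness. -/

section Young

variable {E : Type*} [NormedAddCommGroup E] [NormedSpace ℝ E] [FiniteDimensional ℝ E]
  [MeasurableSpace E] [BorelSpace E] (μ : Measure E) [μ.IsAddHaarMeasure]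
  {E₁ E₂ F : Type*} [NormedAddCommGroup E₁] [NormedSpace ℝ E₁] [NormedAddCommGroup E₂]
  [NormedSpace ℝ E₂] [NormedAddCommGroup F] [NormedSpace ℝ F]

/-- Cauchy–Schwarz after splitting `a c` as `a^(1/2) · (a^(1/2) c)`. -/
theorem sq_lintegral_mul_le {α : Type*} [MeasurableSpace α] {ν : Measure α} {a c : α → ENNReal}
    (ha : AEMeasurable a ν) (hc : AEMeasurable c ν) :
    (∫⁻ x, a x * c x ∂ν) ^ 2 ≤ (∫⁻ x, a x ∂ν) * ∫⁻ x, a x * c x ^ 2 ∂ν := by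
  have hhalf : (0 : ℝ) ≤ 1 / 2 := by norm_num
  have h := ENNReal.lintegral_mul_le_Lp_mul_Lq ν (p := 2) (q := 2)
    (f := fun x => a x ^ (1 / 2 : ℝ)) (g := fun x => a x ^ (1 / 2 : ℝ) * c x)
    (by constructor <;> norm_num) (ha.pow_const (1 / 2)) ((ha.pow_const (1 / 2)).mul hc)
  have h1 : ∀ x, a x ^ (1 / 2 : ℝ) * (a x ^ (1 / 2 : ℝ) * c x) = a x * c x := by
    intro x
    rw [← mul_assoc, ← ENNReal.rpow_add_of_nonneg _ _ hhalf hhalf]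
    norm_num
  have h2 : ∀ x, (a x ^ (1 / 2 : ℝ)) ^ (2 : ℝ) = a x := by
    intro x
    rw [← ENNReal.rpow_mul]; norm_num
  have h3 : ∀ x, (a x ^ (1 / 2 : ℝ) * c x) ^ (2 : ℝ) = a x * c x ^ 2 := by
    intro x
    rw [ENNReal.mul_rpow_of_nonneg _ _ (by norm_num), h2]
    norm_num
  simp only [Pi.mul_apply, h1, h2, h3] at h
  calc (∫⁻ x, a x * c x ∂ν) ^ 2
      ≤ ((∫⁻ x, a x ∂ν) ^ (1 / 2 : ℝ) * (∫⁻ x, a x * c x ^ 2 ∂ν) ^ (1 / 2 : ℝ)) ^ 2 := by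
        gcongr
    _ = _ := by
        rw [mul_pow, ← ENNReal.rpow_natCast, ← ENNReal.rpow_natCast, ← ENNReal.rpow_mul,
          ← ENNReal.rpow_mul]
        norm_num

theorem aestronglyMeasurable_convolution (L : E₁ →L[ℝ] E₂ →L[ℝ] F) {f : E → E₁} {g : E → E₂}
    (hf : AEStronglyMeasurable f μ) (hg : AEStronglyMeasurable g μ) :
    AEStronglyMeasurable (convolution f g L μ) μ :=
  (hf.convolution_integrand L hg).integral_prod_right'

/-- Young's inequality for the convolution of an integrable and a square integrable function. -/
theorem lintegral_convolution_sq_le (L : E₁ →L[ℝ] E₂ →L[ℝ] F) {f : E → E₁} {g : E → E₂}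
    (hf : AEStronglyMeasurable f μ) (hg : AEStronglyMeasurable g μ) :
    ∫⁻ x, ‖convolution f g L μ x‖ₑ ^ 2 ∂μ ≤
      (‖L‖ₑ * ∫⁻ z, ‖f z‖ₑ ∂μ) ^ 2 * ∫⁻ x, ‖g x‖ₑ ^ 2 ∂μ := by
  have hgx : ∀ x, AEMeasurable (fun z => ‖g (x - z)‖ₑ) μ := fun x =>
    (hg.comp_quasiMeasurePreserving
      (quasiMeasurePreserving_sub_left_of_right_invariant μ x)).enorm
  -- Cauchy–Schwarz with weight `‖f‖` at fixed `x`; one factor of the `L¹` norm of `f` appears here,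
  -- the other after integration in `x`.
  have hpt : ∀ x, ‖convolution f g L μ x‖ₑ ^ 2 ≤
      ‖L‖ₑ ^ 2 * ((∫⁻ z, ‖f z‖ₑ ∂μ) * ∫⁻ z, ‖f z‖ₑ * ‖g (x - z)‖ₑ ^ 2 ∂μ) := by
    intro x
    have h1 : ‖convolution f g L μ x‖ₑ ≤ ‖L‖ₑ * ∫⁻ z, ‖f z‖ₑ * ‖g (x - z)‖ₑ ∂μ := by
      rw [convolution_def, ← lintegral_const_mul' _ _ enorm_ne_top]
      refine (enorm_integral_le_lintegral_enorm _).trans (lintegral_mono fun z => ?_)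
      rw [← mul_assoc]
      exact (ContinuousLinearMap.le_opENorm _ _).trans
        (by gcongr; exact ContinuousLinearMap.le_opENorm _ _)
    calc ‖convolution f g L μ x‖ₑ ^ 2 ≤ (‖L‖ₑ * ∫⁻ z, ‖f z‖ₑ * ‖g (x - z)‖ₑ ∂μ) ^ 2 := by gcongr
      _ = ‖L‖ₑ ^ 2 * (∫⁻ z, ‖f z‖ₑ * ‖g (x - z)‖ₑ ∂μ) ^ 2 := mul_pow _ _ _
      _ ≤ _ := by gcongr; exact sq_lintegral_mul_le hf.enorm (hgx x)
  have hprod : AEMeasurable (Function.uncurry fun x z => ‖f z‖ₑ * ‖g (x - z)‖ₑ ^ 2)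
      (μ.prod μ) := by
    refine AEMeasurable.mul (hf.enorm.comp_snd) ?_
    exact ((hg.comp_quasiMeasurePreserving (quasiMeasurePreserving_sub μ μ)).enorm).pow_const 2
  calc ∫⁻ x, ‖convolution f g L μ x‖ₑ ^ 2 ∂μ
      ≤ ∫⁻ x, ‖L‖ₑ ^ 2 * ((∫⁻ z, ‖f z‖ₑ ∂μ) * ∫⁻ z, ‖f z‖ₑ * ‖g (x - z)‖ₑ ^ 2 ∂μ) ∂μ :=
        lintegral_mono hpt
    _ = ‖L‖ₑ ^ 2 * ((∫⁻ z, ‖f z‖ₑ ∂μ) * ∫⁻ x, ∫⁻ z, ‖f z‖ₑ * ‖g (x - z)‖ₑ ^ 2 ∂μ ∂μ) := by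
        rw [lintegral_const_mul' _ _ (by simp), lintegral_const_mul'']
        exact hprod.lintegral_prod_right'
    _ = ‖L‖ₑ ^ 2 * ((∫⁻ z, ‖f z‖ₑ ∂μ) * ((∫⁻ z, ‖f z‖ₑ ∂μ) * ∫⁻ x, ‖g x‖ₑ ^ 2 ∂μ)) := by
        -- Tonelli, after which translation invariance removes `z` from the inner integral.
        rw [lintegral_lintegral_swap hprod]
        congr 2
        rw [← lintegral_mul_const'' _ hf.enorm]
        refine lintegral_congr fun z => ?_
        rw [lintegral_const_mul' _ _ enorm_ne_top,
          lintegral_sub_right_eq_self (fun x => ‖g x‖ₑ ^ 2) z]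
    _ = _ := by rw [mul_pow]; ring

/-- Locality: a kernel supported in the ball of radius `δ` sees only values at distance less than
`δ`. This makes the cutoffs invisible to the operators below. -/
theorem convolution_congr (L : E₁ →L[ℝ] E₂ →L[ℝ] F) {f : E → E₁} {g g' : E → E₂} {δ : ℝ} {x : E}
    (hf : ∀ z, δ ≤ ‖z‖ → f z = 0) (hg : ∀ z, ‖z - x‖ < δ → g z = g' z) :
    convolution f g L μ x = convolution f g' L μ x := by
  rw [convolution_def, convolution_def]
  congr 1
  funext z
  by_cases hz : δ ≤ ‖z‖
  · simp [hf z hz]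
  · rw [hg]
    simpa using hz

variable {G : Type*} [NormedAddCommGroup G] [NormedSpace ℝ G]

theorem contDiff_smul_of_tsupport {ζ : G → ℝ} {f : G → F} {O : Set G} (hζ : ContDiff ℝ ∞ ζ)
    (hO : IsOpen O) (hs : tsupport ζ ⊆ O) (hf : ContDiffOn ℝ ∞ f O) :
    ContDiff ℝ ∞ (fun x => ζ x • f x) := by
  rw [contDiff_iff_contDiffAt]
  intro x
  by_cases hx : x ∈ tsupport ζ
  · exact hζ.contDiffAt.smul (hf.contDiffAt (hO.mem_nhds (hs hx)))
  · refine contDiffAt_const (c := 0) |>.congr_of_eventuallyEq ?_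
    filter_upwards [(isClosed_tsupport ζ).isOpen_compl.mem_nhds hx] with z hz
    rw [image_eq_zero_of_notMem_tsupport hz, zero_smul]

/-- The convolution with a kernel supported in the ball of radius `δ` is smooth at `y` if the
other factor is smooth near `closedBall y (3 * δ)`. -/
theorem contDiffAt_convolution (L : E₁ →L[ℝ] E₂ →L[ℝ] F) {f : E → E₁} {g : E → E₂} {δ : ℝ}
    (hδ : 0 < δ) {y : E} {O : Set E} (hf : ∀ z, δ ≤ ‖z‖ → f z = 0) (hfi : LocallyIntegrable f μ)
    (hO : IsOpen O) (hyO : Metric.closedBall y (3 * δ) ⊆ O) (hg : ContDiffOn ℝ ∞ g O) :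
    ContDiffAt ℝ ∞ (convolution f g L μ) y := by
  -- For `x` within `δ` of `y` the convolution uses `g` only within `2δ` of `y`, where `ζ = 1`; the
  -- support of `ζ` stays in the ball of radius `3δ`, where `g` is smooth.
  let ζ : ContDiffBump y := ⟨2 * δ, 3 * δ, by positivity, by linarith⟩
  have hsm : ContDiff ℝ ∞ (fun x => ζ x • g x) :=
    contDiff_smul_of_tsupport ζ.contDiff hO (by rw [ζ.tsupport_eq]; exact hyO) hg
  have hc : HasCompactSupport (fun x => ζ x • g x) := ζ.hasCompactSupport.smul_right
  have := hc.contDiff_convolution_right (n := ⊤) L hfi hsm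
  refine this.contDiffAt.congr_of_eventuallyEq ?_
  filter_upwards [Metric.ball_mem_nhds y hδ] with x hx
  refine convolution_congr μ L hf fun z hz => ?_
  have : ζ z = 1 := by
    refine ζ.one_of_mem_closedBall ?_
    rw [Metric.mem_closedBall]
    have h1 : dist z x < δ := by rwa [dist_eq_norm]
    have h2 : dist x y < δ := hx
    have := dist_triangle z x y
    change dist z y ≤ 2 * δ
    linarith
  rw [this, one_smul]

end Young
-- The homotopy formula and the closed correction of a form.
section Homotopy

variable {E : Type*} [NormedAddCommGroup E] [NormedSpace ℝ E] [FiniteDimensional ℝ E]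
  [MeasurableSpace E] [BorelSpace E] (μ : Measure E) [μ.IsAddHaarMeasure] {k : ℕ}

/-- Mollification of forms. -/
def mollify (δ : ℝ) (v : E → E [⋀^Fin k]→L[ℝ] ℝ) : E → E [⋀^Fin k]→L[ℝ] ℝ :=
  convolution (moll μ δ) v (ContinuousLinearMap.lsmul ℝ ℝ) μ

/-- The homotopy operator between mollification and the identity. -/
def homOp (δ : ℝ) (v : E → E [⋀^Fin (k + 1)]→L[ℝ] ℝ) : E → E [⋀^Fin k]→L[ℝ] ℝ :=
  convolution (homKernel μ δ) v (contract E k) μ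

/-- The operator `v ↦ (l ↦ l ∧ homOp v)`, defined in all degrees. -/
def comOp (δ : ℝ) (v : E → E [⋀^Fin k]→L[ℝ] ℝ) : E → (E →L[ℝ] ℝ) →L[ℝ] E [⋀^Fin k]→L[ℝ] ℝ :=
  convolution (homKernel μ δ) v (leibniz E k) μ

/-- The local regularisation operator. -/
def regOp (δ : ℝ) (φ : E → ℝ) (v : E → E [⋀^Fin k]→L[ℝ] ℝ) (x : E) : E [⋀^Fin k]→L[ℝ] ℝ :=
  φ x • mollify μ δ v x - comOp μ δ v x (fderiv ℝ φ x)

theorem locallyIntegrable_homKernel {δ : ℝ} (hδ : 0 < δ) :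
    LocallyIntegrable (homKernel (E := E) μ δ) μ := (integrable_homKernel μ hδ).locallyIntegrable

theorem hasFDerivAt_homOp {δ : ℝ} (hδ : 0 < δ) {v : E → E [⋀^Fin (k + 1)]→L[ℝ] ℝ}
    (hv : ContDiff ℝ ∞ v) (hc : HasCompactSupport v) (x : E) :
    HasFDerivAt (homOp μ δ v) (∫ z, (contract E k (homKernel μ δ z)).comp
      (fderiv ℝ v (x - z)) ∂μ) x :=
  hc.hasFDerivAt_convolution_right (contract E k) (locallyIntegrable_homKernel μ hδ)
    (hv.of_le (by simp)) x

theorem contDiff_homOp {δ : ℝ} (hδ : 0 < δ) {v : E → E [⋀^Fin (k + 1)]→L[ℝ] ℝ}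
    (hv : ContDiff ℝ ∞ v) (hc : HasCompactSupport v) : ContDiff ℝ ∞ (homOp μ δ v) :=
  hc.contDiff_convolution_right (n := ⊤) (contract E k) (locallyIntegrable_homKernel μ hδ) hv

theorem integrable_homKernel_bilin {δ : ℝ} (hδ : 0 < δ) {E₂ F : Type*} [NormedAddCommGroup E₂]
    [NormedSpace ℝ E₂] [NormedAddCommGroup F] [NormedSpace ℝ F] (L : E →L[ℝ] E₂ →L[ℝ] F)
    {w : E → E₂} (hw : Continuous w) (hc : HasCompactSupport w) (x : E) :
    Integrable (fun z => L (homKernel μ δ z) (w (x - z))) μ :=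
  hc.convolutionExists_right L (locallyIntegrable_homKernel μ hδ) hw x

theorem mollify_eq {δ : ℝ} (v : E → E [⋀^Fin k]→L[ℝ] ℝ) (x : E) :
    mollify μ δ v x = ∫ z, moll μ δ z • v (x - z) ∂μ := rfl

theorem extDeriv_hasCompactSupport {v : E → E [⋀^Fin k]→L[ℝ] ℝ} (hc : HasCompactSupport v) :
    HasCompactSupport (extDeriv v) :=
  (hc.fderiv (𝕜 := ℝ)).comp_left
    (g := ContinuousAlternatingMap.alternatizeUncurryFinCLM ℝ E ℝ (n := k)) (map_zero _)

/-- On functions the operator applied to `dv` integrates the derivative of `v` along the kernel, and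
the divergence identity `integral_fderiv_homKernel` evaluates it. -/
theorem homotopy_zero {δ : ℝ} (hδ : 0 < δ) {v : E → E [⋀^Fin 0]→L[ℝ] ℝ}
    (hv : ContDiff ℝ ∞ v) (hc : HasCompactSupport v) (x : E) :
    homOp μ δ (extDeriv v) x = v x - mollify μ δ v x := by
  rw [mollify_eq, ← integral_fderiv_homKernel μ hδ (hv.of_le (by simp)) hc x, homOp,
    convolution_def]
  congr 1
  funext z
  rw [extDeriv, contract_alternatize_zero]

/-- Derivatives of the convolution fall on `v`. Under the integral sign Cartan's formula turns `d
ι_b v + ι_b dv` into the derivative of `v` along the kernel `b`, and the divergence identity for `b`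
finishes. -/
theorem homotopy_succ {δ : ℝ} (hδ : 0 < δ) {v : E → E [⋀^Fin (k + 1)]→L[ℝ] ℝ}
    (hv : ContDiff ℝ ∞ v) (hc : HasCompactSupport v) (x : E) :
    extDeriv (homOp μ δ v) x + homOp μ δ (extDeriv v) x = v x - mollify μ δ v x := by
  have hfc : Continuous (fderiv ℝ v) := hv.continuous_fderiv (by simp)
  have hi1 : Integrable (fun z => (contract E k (homKernel μ δ z)).comp
      (fderiv ℝ v (x - z))) μ :=
    integrable_homKernel_bilin μ hδ ((contract E k).precompR E) hfc (hc.fderiv (𝕜 := ℝ)) x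
  have hcont : Continuous (extDeriv v) :=
    (ContinuousAlternatingMap.alternatizeUncurryFinCLM ℝ E ℝ).continuous.comp hfc
  have hi2 : Integrable (fun z => contract E (k + 1) (homKernel μ δ z) (extDeriv v (x - z))) μ :=
    integrable_homKernel_bilin μ hδ (contract E (k + 1)) hcont (extDeriv_hasCompactSupport hc) x
  rw [mollify_eq, ← integral_fderiv_homKernel μ hδ (hv.of_le (by simp)) hc x]
  have h1 : extDeriv (homOp μ δ v) x = ∫ z, ContinuousAlternatingMap.alternatizeUncurryFinCLM ℝ E ℝ
      ((contract E k (homKernel μ δ z)).comp (fderiv ℝ v (x - z))) ∂μ := by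
    rw [ContinuousLinearMap.integral_comp_comm _ hi1, extDeriv,
      (hasFDerivAt_homOp μ hδ hv hc x).fderiv]
    rfl
  have h2 : homOp μ δ (extDeriv v) x =
      ∫ z, contract E (k + 1) (homKernel μ δ z) (extDeriv v (x - z)) ∂μ := rfl
  rw [h1, h2, ← integral_add (ContinuousLinearMap.integrable_comp _ hi1) hi2]
  congr 1
  funext z
  rw [← contract_alternatize_succ (fderiv ℝ v (x - z)) (homKernel μ δ z)]
  exact add_comm _ _

/-- In positive degree the commutator operator is wedge with `homOp v`, by integration of
`leibniz_succ`. -/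
theorem comOp_apply_succ {δ : ℝ} (hδ : 0 < δ) {v : E → E [⋀^Fin (k + 1)]→L[ℝ] ℝ}
    (hv : ContDiff ℝ ∞ v) (hc : HasCompactSupport v) (x : E) (l : E →L[ℝ] ℝ) :
    comOp μ δ v x l = wedge E k l (homOp μ δ v x) := by
  have hi1 := integrable_homKernel_bilin μ hδ (leibniz E (k + 1)) hv.continuous hc x
  have hi2 := integrable_homKernel_bilin μ hδ (contract E k) hv.continuous hc x
  rw [comOp, homOp, convolution_def, convolution_def,
    ← ContinuousLinearMap.integral_comp_comm _ hi2, ContinuousLinearMap.integral_apply hi1]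
  congr 1
  funext z
  exact leibniz_succ _ _ _

theorem comOp_apply_zero {δ : ℝ} (v : E → E [⋀^Fin 0]→L[ℝ] ℝ) (x : E) :
    comOp μ δ v x = 0 := by
  rw [comOp, convolution_def]
  have : ∀ z, leibniz E 0 (homKernel μ δ z) (v (x - z)) = 0 := fun z => by
    ext1 l; exact leibniz_zero _ _ l
  simp_rw [this, integral_zero]

/-- Up to a closed form, a form `u` is the sum of its regularisation and the image of its
exterior derivative under the homotopy operator, localised by `φ`. -/
theorem closed_correction {δ : ℝ} (hδ : 0 < δ) {u : E → E [⋀^Fin k]→L[ℝ] ℝ} {O : Set E}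
    (hO : IsOpen O) (hu : ContDiffOn ℝ ∞ u O) {χ φ : E → ℝ} (hχ : ContDiff ℝ ∞ χ)
    (hφ : ContDiff ℝ ∞ φ) (hχO : tsupport χ ⊆ O) (hχc : HasCompactSupport χ)
    (h1 : ∀ x ∈ tsupport φ, ∀ z, ‖z - x‖ < δ → χ z = 1) {e : E → E [⋀^Fin k]→L[ℝ] ℝ}
    (he : ∀ x, e x = φ x • u x - regOp μ δ φ (fun z => χ z • u z) x -
      φ x • homOp μ δ (fun z => χ z • extDeriv u z) x) :
    ContDiff ℝ ∞ e ∧ (∀ x, extDeriv e x = 0) ∧ ∀ x ∉ tsupport φ, e x = 0 := by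
  set v : E → E [⋀^Fin k]→L[ℝ] ℝ := fun z => χ z • u z with hv
  have hvs : ContDiff ℝ ∞ v := contDiff_smul_of_tsupport hχ hO hχO hu
  have hvc : HasCompactSupport v := hχc.smul_right
  have hoff : ∀ x ∉ tsupport φ, φ x = 0 ∧ fderiv ℝ φ x = 0 := fun x hx =>
    ⟨image_eq_zero_of_notMem_tsupport hx,
      image_eq_zero_of_notMem_tsupport (fun h => hx (tsupport_fderiv_subset ℝ h))⟩
  -- On the support of `φ` the cutoff is one throughout the ball of radius `δ`, so by locality `u`
  -- may be replaced by `v = χ u` and `χ du` by `dv`. Off that support `φ` and its derivative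
  -- vanish, and so do both sides.
  have he' : ∀ x, e x = φ x • (v x - mollify μ δ v x - homOp μ δ (extDeriv v) x) +
      comOp μ δ v x (fderiv ℝ φ x) := by
    intro x
    rw [he]
    by_cases hx : x ∈ tsupport φ
    · have e1 : u x = v x := by simp [hv, h1 x hx x (by simpa using hδ)]
      have e2 : homOp μ δ (fun z => χ z • extDeriv u z) x = homOp μ δ (extDeriv v) x := by
        refine convolution_congr μ _ (fun z hz => homKernel_eq_zero μ hδ hz) fun z hz => ?_
        simp only [h1 x hx z hz, one_smul]
        refine Filter.EventuallyEq.extDeriv_eq ?_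
        have : Metric.ball x δ ∈ nhds z := Metric.isOpen_ball.mem_nhds (by
          rwa [Metric.mem_ball, dist_eq_norm])
        filter_upwards [this] with y hy
        simp only [hv]
        rw [h1 x hx y (by rwa [Metric.mem_ball, dist_eq_norm] at hy), one_smul]
      rw [e2, e1, regOp]
      simp only [smul_sub]
      abel
    · simp [hoff x hx, regOp]
  have hzero : ∀ x ∉ tsupport φ, e x = 0 := fun x hx => by
    rw [he']; simp [hoff x hx]
  cases k with
  | zero =>
    -- For functions the bracket vanishes by the homotopy formula and there is no commutator term.
    have : e = fun _ => 0 := by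
      funext x
      rw [he', homotopy_zero μ hδ hvs hvc, comOp_apply_zero]
      simp
    subst this
    refine ⟨contDiff_const, fun x => ?_, fun _ _ => rfl⟩
    ext w
    rw [extDeriv_apply (differentiableAt_const _)]
    simp
  | succ j =>
    have hB := contDiff_homOp μ hδ hvs hvc
    have hd : ∀ x, DifferentiableAt ℝ (homOp μ δ v) x := fun x =>
      (hB.differentiable (by simp)).differentiableAt
    have hφd : ∀ x, DifferentiableAt ℝ φ x := fun x => (hφ.differentiable (by simp)).differentiableAt
    -- With `B` the homotopy operator, the bracket is `dBv`, so `e = φ dBv + dφ ∧ Bv = d(φ Bv)`;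
    -- this is why `e` is closed.
    have : e = extDeriv (fun x => φ x • homOp μ δ v x) := by
      funext x
      rw [he', extDeriv_smul_fun (hφd x) (hd x), comOp_apply_succ μ hδ hvs hvc,
        ← homotopy_succ μ hδ hvs hvc]
      simp only [smul_sub, smul_add]
      abel
    have hs : ContDiff ℝ ∞ (fun x => φ x • homOp μ δ v x) := hφ.smul hB
    refine ⟨?_, fun x => ?_, hzero⟩
    · rw [this, contDiff_iff_contDiffAt]
      exact fun x => contDiffAt_extDeriv hs.contDiffAt
    · rw [this]
      exact extDeriv_extDeriv_apply (r := ∞) hs.contDiffAt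
        (by rw [minSmoothness_of_isRCLikeNormedField]; exact ENat.LEInfty.out)

end Homotopy

end L2Forms
end

noncomputable section

namespace L2Forms

set_option maxSynthPendingDepth 5

/-! ### `L²` bounds and smoothness for the local operators. -/

section Bounds

variable {E : Type*} [NormedAddCommGroup E] [NormedSpace ℝ E] [FiniteDimensional ℝ E]
  [MeasurableSpace E] [BorelSpace E] (μ : Measure E) [μ.IsAddHaarMeasure] {k : ℕ}

theorem eLpNorm_two_sq {α F : Type*} [MeasurableSpace α] [NormedAddCommGroup F] (ν : Measure α)
    (f : α → F) : eLpNorm f 2 ν ^ 2 = ∫⁻ x, ‖f x‖ₑ ^ 2 ∂ν := by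
  rw [eLpNorm_eq_lintegral_rpow_enorm_toReal (by norm_num) (by norm_num), ← ENNReal.rpow_natCast,
    ← ENNReal.rpow_mul]
  norm_num

theorem eLpNorm_two_le {α β F F' : Type*} [MeasurableSpace α] [NormedAddCommGroup F]
    [MeasurableSpace β] [NormedAddCommGroup F'] {ν : Measure α} {ν' : Measure β}
    {f : α → F} {g : β → F'} {c : ENNReal}
    (h : ∫⁻ x, ‖f x‖ₑ ^ 2 ∂ν ≤ c ^ 2 * ∫⁻ x, ‖g x‖ₑ ^ 2 ∂ν') :
    eLpNorm f 2 ν ≤ c * eLpNorm g 2 ν' := by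
  rw [← eLpNorm_two_sq, ← eLpNorm_two_sq, ← mul_pow] at h
  exact (ENNReal.pow_le_pow_left_iff (by norm_num)).1 h

theorem eLpNorm_convolution_le {E₁ E₂ F : Type*} [NormedAddCommGroup E₁] [NormedSpace ℝ E₁]
    [NormedAddCommGroup E₂] [NormedSpace ℝ E₂] [NormedAddCommGroup F] [NormedSpace ℝ F]
    (L : E₁ →L[ℝ] E₂ →L[ℝ] F) {f : E → E₁} {g : E → E₂} (hf : AEStronglyMeasurable f μ)
    (hg : AEStronglyMeasurable g μ) :
    eLpNorm (convolution f g L μ) 2 μ ≤ (‖L‖ₑ * ∫⁻ z, ‖f z‖ₑ ∂μ) * eLpNorm g 2 μ :=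
  eLpNorm_two_le (lintegral_convolution_sq_le μ L hf hg)

theorem lintegral_enorm_homKernel_le {δ : ℝ} (hδ : 0 < δ) :
    ∫⁻ z, ‖homKernel (E := E) μ δ z‖ₑ ∂μ ≤ ENNReal.ofReal δ := by
  rw [← ofReal_integral_norm_eq_lintegral_enorm (integrable_homKernel μ hδ)]
  exact ENNReal.ofReal_le_ofReal (integral_norm_homKernel_le μ hδ)

/-- Young's inequality with a kernel of `L¹` norm at most `δ`. -/
theorem eLpNorm_homOp_le {δ : ℝ} (hδ : 0 < δ) {v : E → E [⋀^Fin (k + 1)]→L[ℝ] ℝ}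
    (hv : AEStronglyMeasurable v μ) :
    eLpNorm (homOp μ δ v) 2 μ ≤ (‖contract E k‖ₑ * ENNReal.ofReal δ) * eLpNorm v 2 μ :=
  (eLpNorm_convolution_le μ _ (integrable_homKernel μ hδ).aestronglyMeasurable hv).trans
    (by gcongr; exact lintegral_enorm_homKernel_le μ hδ)

theorem eLpNorm_comOp_le {δ : ℝ} (hδ : 0 < δ) {v : E → E [⋀^Fin k]→L[ℝ] ℝ}
    (hv : AEStronglyMeasurable v μ) :
    eLpNorm (comOp μ δ v) 2 μ ≤ (‖leibniz E k‖ₑ * ENNReal.ofReal δ) * eLpNorm v 2 μ :=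
  (eLpNorm_convolution_le μ _ (integrable_homKernel μ hδ).aestronglyMeasurable hv).trans
    (by gcongr; exact lintegral_enorm_homKernel_le μ hδ)

/-- Young's inequality with a nonnegative kernel of integral one. -/
theorem eLpNorm_mollify_le {δ : ℝ} {v : E → E [⋀^Fin k]→L[ℝ] ℝ}
    (hv : AEStronglyMeasurable v μ) : eLpNorm (mollify μ δ v) 2 μ ≤ eLpNorm v 2 μ := by
  refine (eLpNorm_convolution_le μ _ (integrable_moll μ δ).aestronglyMeasurable hv).trans ?_
  have h1 : ∫⁻ z, ‖moll (E := E) μ δ z‖ₑ ∂μ = 1 := by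
    rw [← ofReal_integral_norm_eq_lintegral_enorm (integrable_moll μ δ)]
    simp_rw [Real.norm_of_nonneg (moll_nonneg μ δ _)]
    rw [integral_moll, ENNReal.ofReal_one]
  have h2 : ‖(ContinuousLinearMap.lsmul ℝ ℝ : ℝ →L[ℝ] (E [⋀^Fin k]→L[ℝ] ℝ) →L[ℝ] _)‖ₑ ≤ 1 := by
    rw [← ofReal_norm, ← ENNReal.ofReal_one]
    exact ENNReal.ofReal_le_ofReal ContinuousLinearMap.opNorm_lsmul_le
  calc _ ≤ (1 * 1) * eLpNorm v 2 μ := by rw [h1]; gcongr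
    _ = _ := by simp

theorem aestronglyMeasurable_homOp {δ : ℝ} (hδ : 0 < δ) {v : E → E [⋀^Fin (k + 1)]→L[ℝ] ℝ}
    (hv : AEStronglyMeasurable v μ) : AEStronglyMeasurable (homOp μ δ v) μ :=
  aestronglyMeasurable_convolution μ _ (integrable_homKernel μ hδ).aestronglyMeasurable hv

theorem aestronglyMeasurable_comOp {δ : ℝ} (hδ : 0 < δ) {v : E → E [⋀^Fin k]→L[ℝ] ℝ}
    (hv : AEStronglyMeasurable v μ) : AEStronglyMeasurable (comOp μ δ v) μ :=
  aestronglyMeasurable_convolution μ _ (integrable_homKernel μ hδ).aestronglyMeasurable hv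

theorem aestronglyMeasurable_mollify {δ : ℝ} {v : E → E [⋀^Fin k]→L[ℝ] ℝ}
    (hv : AEStronglyMeasurable v μ) : AEStronglyMeasurable (mollify μ δ v) μ :=
  aestronglyMeasurable_convolution μ _ (integrable_moll μ δ).aestronglyMeasurable hv

theorem eLpNorm_smul_le_of_bound {F : Type*} [NormedAddCommGroup F] [NormedSpace ℝ F] {φ : E → ℝ}
    {C : ℝ} (hC : ∀ x, |φ x| ≤ C) (f : E → F) :
    eLpNorm (fun x => φ x • f x) 2 μ ≤ ENNReal.ofReal C * eLpNorm f 2 μ := by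
  refine eLpNorm_le_mul_eLpNorm_of_ae_le_mul (Filter.Eventually.of_forall fun x => ?_) 2
  rw [norm_smul]
  exact mul_le_mul_of_nonneg_right (hC x) (norm_nonneg _)

theorem eLpNorm_comOp_fderiv_le {δ : ℝ} (hδ : 0 < δ) {φ : E → ℝ} {C : ℝ}
    (hC : ∀ x, ‖fderiv ℝ φ x‖ ≤ C) {v : E → E [⋀^Fin k]→L[ℝ] ℝ}
    (hv : AEStronglyMeasurable v μ) :
    eLpNorm (fun x => comOp μ δ v x (fderiv ℝ φ x)) 2 μ ≤
      ENNReal.ofReal C * (‖leibniz E k‖ₑ * ENNReal.ofReal δ) * eLpNorm v 2 μ := by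
  have h : eLpNorm (fun x => comOp μ δ v x (fderiv ℝ φ x)) 2 μ ≤
      ENNReal.ofReal C * eLpNorm (comOp μ δ v) 2 μ := by
    refine eLpNorm_le_mul_eLpNorm_of_ae_le_mul (Filter.Eventually.of_forall fun x => ?_) 2
    rw [mul_comm]
    exact (ContinuousLinearMap.le_opNorm _ _).trans (by gcongr; exact hC x)
  refine h.trans ?_
  rw [mul_assoc]
  gcongr
  exact eLpNorm_comOp_le μ hδ hv

theorem aestronglyMeasurable_comOp_fderiv {δ : ℝ} (hδ : 0 < δ) {φ : E → ℝ}
    (hφ : ContDiff ℝ ∞ φ) {v : E → E [⋀^Fin k]→L[ℝ] ℝ} (hv : AEStronglyMeasurable v μ) :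
    AEStronglyMeasurable (fun x => comOp μ δ v x (fderiv ℝ φ x)) μ :=
  isBoundedBilinearMap_apply.continuous.comp_aestronglyMeasurable
    ((aestronglyMeasurable_comOp μ hδ hv).prodMk
      (hφ.continuous_fderiv (by simp)).aestronglyMeasurable)

theorem aestronglyMeasurable_regOp {δ : ℝ} (hδ : 0 < δ) {φ : E → ℝ}
    (hφ : ContDiff ℝ ∞ φ) {v : E → E [⋀^Fin k]→L[ℝ] ℝ} (hv : AEStronglyMeasurable v μ) :
    AEStronglyMeasurable (regOp μ δ φ v) μ :=
  (hφ.continuous.aestronglyMeasurable.smul (aestronglyMeasurable_mollify μ hv)).sub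
    (aestronglyMeasurable_comOp_fderiv μ hδ hφ hv)

theorem exists_bound_fderiv {φ : E → ℝ} (hφ : ContDiff ℝ ∞ φ) (hc : HasCompactSupport φ) :
    ∃ C : ℝ, 0 ≤ C ∧ (∀ x, |φ x| ≤ C) ∧ ∀ x, ‖fderiv ℝ φ x‖ ≤ C := by
  obtain ⟨C₁, h₁⟩ := hc.exists_bound_of_continuous hφ.continuous
  obtain ⟨C₂, h₂⟩ := (hc.fderiv (𝕜 := ℝ)).exists_bound_of_continuous
    (hφ.continuous_fderiv (by simp))
  exact ⟨max C₁ C₂, ((norm_nonneg _).trans (h₁ 0)).trans (le_max_left _ _),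
    fun x => (h₁ x).trans (le_max_left _ _), fun x => (h₂ x).trans (le_max_right _ _)⟩

/-- For fixed `δ` and `φ` the constant is uniform in the form, which suffices for passing to limits.
-/
theorem eLpNorm_regOp_le {δ : ℝ} (hδ : 0 < δ) {φ : E → ℝ} (hφ : ContDiff ℝ ∞ φ)
    (hc : HasCompactSupport φ) : ∃ C : NNReal, ∀ v : E → E [⋀^Fin k]→L[ℝ] ℝ,
    AEStronglyMeasurable v μ → eLpNorm (regOp μ δ φ v) 2 μ ≤ C * eLpNorm v 2 μ := by
  obtain ⟨C, hC0, hC1, hC2⟩ := exists_bound_fderiv hφ hc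
  refine ⟨Real.toNNReal C + Real.toNNReal C * (‖leibniz E k‖₊ * Real.toNNReal δ), fun v hv => ?_⟩
  refine (eLpNorm_sub_le (hφ.continuous.aestronglyMeasurable.smul
    (aestronglyMeasurable_mollify μ hv))
    (aestronglyMeasurable_comOp_fderiv μ hδ hφ hv) (by norm_num)).trans ?_
  push_cast
  rw [add_mul]
  refine add_le_add ?_ (eLpNorm_comOp_fderiv_le μ hδ hC2 hv)
  refine (eLpNorm_smul_le_of_bound μ hC1 _).trans ?_
  exact mul_le_mul_right (eLpNorm_mollify_le μ hv) _

theorem contDiff_mollify {δ : ℝ} {v : E → E [⋀^Fin k]→L[ℝ] ℝ} (hv : LocallyIntegrable v μ) :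
    ContDiff ℝ ∞ (mollify μ δ v) :=
  (hasCompactSupport_moll μ δ).contDiff_convolution_left (n := ⊤) _ (contDiff_moll μ δ) hv

/-- `regOp` is smooth where `φ` is locally constant and near points near which the form is
smooth. -/
theorem contDiffAt_regOp {δ : ℝ} (hδ : 0 < δ) {φ : E → ℝ} (hφ : ContDiff ℝ ∞ φ)
    {v : E → E [⋀^Fin k]→L[ℝ] ℝ} (hv : LocallyIntegrable v μ) {x : E}
    (h : (∀ᶠ z in nhds x, φ z = 1) ∨
      ∃ O, IsOpen O ∧ Metric.closedBall x (3 * δ) ⊆ O ∧ ContDiffOn ℝ ∞ v O) :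
    ContDiffAt ℝ ∞ (regOp μ δ φ v) x := by
  have h1 : ContDiffAt ℝ ∞ (fun x => φ x • mollify μ δ v x) x :=
    hφ.contDiffAt.smul (contDiff_mollify μ hv).contDiffAt
  refine ContDiffAt.sub h1 ?_
  rcases h with h | ⟨O, hO, hxO, hvO⟩
  -- Where `φ` is locally one, `dφ = 0` and the commutator term disappears, leaving a mollification,
  -- which is always smooth.
  · refine (contDiffAt_const (c := 0)).congr_of_eventuallyEq ?_
    filter_upwards [h.eventually_nhds] with z hz
    have : fderiv ℝ φ z = 0 := by
      have hz' : φ =ᶠ[nhds z] fun _ => 1 := hz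
      rw [hz'.fderiv_eq]; simp
    rw [this, map_zero]
  · have h2 : ContDiffAt ℝ ∞ (comOp μ δ v) x :=
      contDiffAt_convolution μ _ hδ (fun z hz => homKernel_eq_zero μ hδ hz)
        (locallyIntegrable_homKernel μ hδ) hO hxO hvO
    exact h2.clm_apply (hφ.fderiv_right (m := ∞) (by simp)).contDiffAt

end Bounds

/-! ### Mollification is finite rank up to a small error. -/

section FiniteRank

variable {E : Type*} [NormedAddCommGroup E] [NormedSpace ℝ E] [FiniteDimensional ℝ E]
  [MeasurableSpace E] [BorelSpace E] (μ : Measure E) [μ.IsAddHaarMeasure] {k : ℕ}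

/-- A compact set is covered by finitely many disjoint measurable sets of small diameter. -/
theorem exists_cells {K : Set E} (hK : IsCompact K) {η : ℝ} (hη : 0 < η) :
    ∃ (m : ℕ) (D : Fin m → Set E) (c : Fin m → E), (∀ j, MeasurableSet (D j)) ∧
      Pairwise (Function.onFun Disjoint D) ∧ K ⊆ ⋃ j, D j ∧ ∀ j, ∀ z ∈ D j, ‖z - c j‖ < η := by
  obtain ⟨t, -, htf, hcov⟩ := hK.finite_cover_balls hη
  obtain ⟨m, e, he⟩ := htf.fin_embedding
  refine ⟨m, disjointed fun j => Metric.ball (e j) η, e, fun j => ?_, disjoint_disjointed _, ?_, ?_⟩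
  · exact disjointedRec (p := MeasurableSet) (fun t i ht => ht.diff measurableSet_ball)
      measurableSet_ball
  · rw [iUnion_disjointed]
    refine hcov.trans ?_
    intro x hx
    simp only [Set.mem_iUnion] at hx ⊢
    obtain ⟨i, hi, hx⟩ := hx
    rw [← he] at hi
    obtain ⟨j, rfl⟩ := hi
    exact ⟨j, hx⟩
  · intro j z hz
    have := disjointed_subset _ _ hz
    rwa [Metric.mem_ball, dist_eq_norm] at this

/-- Up to a small error, the mollification of a form supported in a compact set is determined by
finitely many of its integrals. -/
theorem norm_mollify_le_cells {K : Set E} (hK : IsCompact K) (δ : ℝ) {ε : ℝ} (hε : 0 < ε) :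
    ∃ (m : ℕ) (D : Fin m → Set E) (C : ℝ), 0 ≤ C ∧ (∀ j, MeasurableSet (D j)) ∧
      ∀ v : E → E [⋀^Fin k]→L[ℝ] ℝ, Integrable v μ → (∀ x ∉ K, v x = 0) →
        ∀ x, ‖mollify μ δ v x‖ ≤ ε * ∫ z, ‖v z‖ ∂μ + C * ∑ j, ‖∫ z in D j, v z ∂μ‖ := by
  have hc := (contDiff_moll (E := E) μ δ).continuous
  obtain ⟨C, hC⟩ := (hasCompactSupport_moll (E := E) μ δ).exists_bound_of_continuous hc
  have huc : UniformContinuous (moll (E := E) μ δ) :=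
    (hasCompactSupport_moll (E := E) μ δ).uniformContinuous_of_continuous hc
  obtain ⟨η, hη, hηε⟩ := Metric.uniformContinuous_iff.1 huc ε hε
  obtain ⟨m, D, c, hDm, hDd, hDK, hDη⟩ := exists_cells hK hη
  refine ⟨m, D, C, (norm_nonneg _).trans (hC 0), hDm, fun v hvi hvK x => ?_⟩
  have hi : Integrable (fun z => moll μ δ (x - z) • v z) μ := by
    refine hvi.bdd_smul C (by fun_prop) (Filter.Eventually.of_forall fun z => hC _)
  have h1 : mollify μ δ v x = ∫ z, moll μ δ (x - z) • v z ∂μ := by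
    rw [mollify_eq, ← integral_sub_left_eq_self (fun z => moll μ δ (x - z) • v z) μ x]
    simp
  have hU : MeasurableSet (⋃ j, D j) := MeasurableSet.iUnion hDm
  have h0 : ∀ z ∉ ⋃ j, D j, v z = 0 := fun z hz => hvK z fun h => hz (hDK h)
  have h2 : ∫ z, moll μ δ (x - z) • v z ∂μ = ∑ j, ∫ z in D j, moll μ δ (x - z) • v z ∂μ := by
    rw [← setIntegral_eq_integral_of_forall_compl_eq_zero (s := ⋃ j, D j)
      (fun z hz => by rw [h0 z hz, smul_zero]), integral_iUnion_fintype hDm hDd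
      (fun j => hi.integrableOn)]
  have h3 : ∫ z, ‖v z‖ ∂μ = ∑ j, ∫ z in D j, ‖v z‖ ∂μ := by
    rw [← setIntegral_eq_integral_of_forall_compl_eq_zero (s := ⋃ j, D j)
      (fun z hz => by rw [h0 z hz, norm_zero]), integral_iUnion_fintype hDm hDd
      (fun j => hvi.norm.integrableOn)]
  rw [h1, h2, h3, Finset.mul_sum, Finset.mul_sum, ← Finset.sum_add_distrib]
  refine (norm_sum_le _ _).trans (Finset.sum_le_sum fun j _ => ?_)
  have hs : IntegrableOn (fun z => moll μ δ (x - c j) • v z) (D j) μ :=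
    (hvi.integrableOn (s := D j)).smul (moll μ δ (x - c j))
  -- On each cell the kernel is frozen at the centre. The error is at most `ε` by uniform
  -- continuity, and the frozen part depends only on the integral of `v` over the cell.
  have h4 : ∫ z in D j, moll μ δ (x - z) • v z ∂μ =
      ∫ z in D j, (moll μ δ (x - z) - moll μ δ (x - c j)) • v z ∂μ +
        moll μ δ (x - c j) • ∫ z in D j, v z ∂μ := by
    rw [← integral_smul, ← integral_add]
    · congr 1
      funext z
      rw [sub_smul, sub_add_cancel]
    · simp_rw [sub_smul]
      exact hi.integrableOn.sub hs
    · exact hs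
  rw [h4]
  refine (norm_add_le _ _).trans (add_le_add ?_ ?_)
  · rw [← integral_const_mul]
    refine norm_integral_le_of_norm_le (hvi.norm.integrableOn.const_mul ε) ?_
    filter_upwards [ae_restrict_mem (hDm j)] with z hz
    rw [norm_smul]
    refine mul_le_mul_of_nonneg_right ?_ (norm_nonneg _)
    have : dist (x - z) (x - c j) < η := by
      rw [dist_eq_norm]
      have : x - z - (x - c j) = -(z - c j) := by abel
      rw [this, norm_neg]
      exact hDη j z hz
    exact (hηε this).le
  · rw [norm_smul]
    exact mul_le_mul_of_nonneg_right (hC _) (norm_nonneg _)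

/-- Hölder on a set of finite measure outside which `v` vanishes. -/
theorem eLpNorm_one_le {F : Type*} [NormedAddCommGroup F] {K : Set E} (hK : IsCompact K) :
    ∃ C : NNReal, ∀ v : E → F, AEStronglyMeasurable v μ → (∀ x ∉ K, v x = 0) →
      eLpNorm v 1 μ ≤ C * eLpNorm v 2 μ := by
  have hfin : μ K ≠ ⊤ := hK.measure_lt_top.ne
  refine ⟨((μ K) ^ (1 / 2 : ℝ)).toNNReal, fun v hv h0 => ?_⟩
  rw [ENNReal.coe_toNNReal (by simp [hfin])]
  have h1 : ∀ p : ENNReal, eLpNorm v p μ = eLpNorm v p (μ.restrict K) := by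
    intro p
    rw [← eLpNorm_indicator_eq_eLpNorm_restrict hK.measurableSet]
    congr 1
    funext x
    by_cases hx : x ∈ K
    · simp [hx]
    · simp [hx, h0 x hx]
  rw [h1, h1]
  refine (eLpNorm_le_eLpNorm_mul_rpow_measure_univ (p := 1) (q := 2) (by norm_num)
    hv.restrict).trans ?_
  rw [mul_comm]
  norm_num

/-- Up to a small error in `L²`, the localised mollification of a form supported in a compact set
is determined by finitely many of its integrals. -/
theorem eLpNorm_mollify_le_cells {K : Set E} (hK : IsCompact K) (δ : ℝ) {φ : E → ℝ}
    (hφ : ContDiff ℝ ∞ φ) (hφc : HasCompactSupport φ) {ε : NNReal} (hε : 0 < ε) :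
    ∃ (m : ℕ) (D : Fin m → Set E) (C : NNReal), (∀ j, MeasurableSet (D j)) ∧
      ∀ v : E → E [⋀^Fin k]→L[ℝ] ℝ, MemLp v 2 μ → (∀ x ∉ K, v x = 0) →
        eLpNorm (fun x => φ x • mollify μ δ v x) 2 μ ≤
          ε * eLpNorm v 2 μ + C * ∑ j, ‖∫ z in D j, v z ∂μ‖ₑ := by
  obtain ⟨A, hA⟩ := eLpNorm_one_le (F := E [⋀^Fin k]→L[ℝ] ℝ) μ hK
  have hφL : MemLp φ 2 μ := hφ.continuous.memLp_of_hasCompactSupport hφc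
  set B : NNReal := (eLpNorm φ 2 μ).toNNReal with hB
  have hB' : eLpNorm φ 2 μ = B := (ENNReal.coe_toNNReal hφL.2.ne).symm
  -- `A` compares the `L¹` and `L²` norms on `K` and `B` is the `L²` norm of `φ`; the `+ 1` keeps
  -- the denominators positive.
  obtain ⟨m, D, C, hC0, hDm, hD⟩ := norm_mollify_le_cells (k := k) μ hK δ
    (ε := ε / ((A + 1) * (B + 1))) (by positivity)
  refine ⟨m, D, Real.toNNReal C * B, hDm, fun v hv hvK => ?_⟩
  have hv1 : eLpNorm v 1 μ ≤ A * eLpNorm v 2 μ := hA v hv.1 hvK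
  have hvi : Integrable v μ := by
    rw [← memLp_one_iff_integrable]
    exact ⟨hv.1, hv1.trans_lt (ENNReal.mul_lt_top ENNReal.coe_lt_top hv.2)⟩
  set R : ℝ := ε / ((A + 1) * (B + 1)) * ∫ z, ‖v z‖ ∂μ + C * ∑ j, ‖∫ z in D j, v z ∂μ‖ with hR
  have hint : 0 ≤ ∫ z, ‖v z‖ ∂μ := integral_nonneg fun _ => norm_nonneg _
  have hb : eLpNorm (fun x => φ x • mollify μ δ v x) 2 μ ≤ ENNReal.ofReal R * eLpNorm φ 2 μ := by
    refine eLpNorm_le_mul_eLpNorm_of_ae_le_mul (Filter.Eventually.of_forall fun x => ?_) 2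
    rw [norm_smul, mul_comm]
    exact mul_le_mul_of_nonneg_right (hD v hvi hvK x) (norm_nonneg _)
  refine hb.trans ?_
  rw [hB', hR, ENNReal.ofReal_add (by positivity) (by positivity), add_mul]
  refine add_le_add ?_ (le_of_eq ?_)
  · rw [ENNReal.ofReal_mul (by positivity), ofReal_integral_norm_eq_lintegral_enorm hvi,
      ← eLpNorm_one_eq_lintegral_enorm]
    have h5 : ENNReal.ofReal (ε / ((A + 1) * (B + 1))) * A * B ≤ ε := by
      have hA' : (A : ENNReal) = ENNReal.ofReal A := (ENNReal.ofReal_coe_nnreal).symm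
      have hB' : (B : ENNReal) = ENNReal.ofReal B := (ENNReal.ofReal_coe_nnreal).symm
      have hE' : (ε : ENNReal) = ENNReal.ofReal ε := (ENNReal.ofReal_coe_nnreal).symm
      rw [hA', hB', hE', ← ENNReal.ofReal_mul (by positivity), ← ENNReal.ofReal_mul (by positivity)]
      refine ENNReal.ofReal_le_ofReal ?_
      have h6 : 0 ≤ (A : ℝ) := A.2
      have h7 : 0 ≤ (B : ℝ) := B.2
      have h8 : (0 : ℝ) ≤ ε := ε.2
      rw [div_mul_eq_mul_div, div_mul_eq_mul_div, div_le_iff₀ (by positivity)]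
      nlinarith [mul_nonneg h6 h7, mul_nonneg h8 h6, mul_nonneg h8 h7]
    calc ENNReal.ofReal (ε / ((A + 1) * (B + 1))) * eLpNorm v 1 μ * B
        ≤ ENNReal.ofReal (ε / ((A + 1) * (B + 1))) * (A * eLpNorm v 2 μ) * B := by gcongr
      _ = (ENNReal.ofReal (ε / ((A + 1) * (B + 1))) * A * B) * eLpNorm v 2 μ := by ring
      _ ≤ _ := by gcongr
  · rw [ENNReal.ofReal_mul hC0, ENNReal.ofReal_sum_of_nonneg (fun _ _ => norm_nonneg _)]
    simp_rw [ofReal_norm]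
    rw [ENNReal.coe_mul, ENNReal.ofReal]
    ring

end FiniteRank
end L2Forms
end

noncomputable section

namespace L2Forms

set_option maxSynthPendingDepth 5

/-! ### An abstract closed range argument in Hilbert space. -/

section ClosedRange

open Filter Topology

variable {H₀ H₁ F Ω : Type*} [NormedAddCommGroup H₀] [InnerProductSpace ℝ H₀] [CompleteSpace H₀]
  [NormedAddCommGroup H₁] [NormedSpace ℝ H₁] [NormedAddCommGroup F] [NormedSpace ℝ F]
  [FiniteDimensional ℝ F] [AddCommGroup Ω] [Module ℝ Ω]
  (j₀ : Ω →ₗ[ℝ] H₀) (j₁ : Ω →ₗ[ℝ] H₁) (L : Ω →ₗ[ℝ] F)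

/-- The kernel of the closure of the relation `j₀ σ ↦ j₁ σ`. -/
def weakKernel : Submodule ℝ H₀ :=
  (LinearMap.range (j₀.prod j₁)).topologicalClosure.comap (LinearMap.inl ℝ H₀ H₁)

theorem mem_weakKernel {x : H₀} : x ∈ weakKernel j₀ j₁ ↔
    ∀ ε > 0, ∃ σ, ‖j₀ σ - x‖ < ε ∧ ‖j₁ σ‖ < ε := by
  change (x, (0 : H₁)) ∈ closure (Set.range (j₀.prod j₁)) ↔ _
  rw [Metric.mem_closure_range_iff]
  refine forall₂_congr fun ε _ => exists_congr fun σ => ?_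
  rw [dist_comm, dist_eq_norm, Prod.norm_def, max_lt_iff]
  simp

theorem isClosed_weakKernel : IsClosed (weakKernel j₀ j₁ : Set H₀) :=
  (Submodule.isClosed_topologicalClosure _).preimage (by fun_prop : Continuous fun x : H₀ =>
    (x, (0 : H₁)))

instance : CompleteSpace (weakKernel j₀ j₁) :=
  (isClosed_weakKernel j₀ j₁).completeSpace_coe

/-- Subtracting `z` changes `j₀ σ` only by an element of the weak kernel, hence leaves its component
orthogonal to that kernel unchanged. So the estimate for `j₀ (σ - z)` bounds this component, and the
term with factor `1 / 2` is absorbed on the left. -/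
theorem norm_le_of_correction {C : ℝ}
    (h : ∀ σ, ∃ z, j₁ z = 0 ∧ ‖j₀ (σ - z)‖ ≤ C * ‖j₁ σ‖ + 1 / 2 * ‖j₀ σ‖ + C * ‖L σ‖) (σ : Ω) :
    ‖j₀ σ‖ ≤ 2 * (C * ‖j₁ σ‖ + C * ‖L σ‖ + ‖(weakKernel j₀ j₁).starProjection (j₀ σ)‖) := by
  obtain ⟨z, hz, hσ⟩ := h σ
  set Q := (weakKernel j₀ j₁).starProjection
  have hzk : j₀ z ∈ weakKernel j₀ j₁ := (mem_weakKernel j₀ j₁).2 fun ε hε =>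
    ⟨z, by simpa using hε, by simpa [hz] using hε⟩
  have h1 : Q (j₀ z) = j₀ z := (Submodule.starProjection_eq_self_iff).2 hzk
  have h2 : j₀ σ - Q (j₀ σ) = j₀ (σ - z) - Q (j₀ (σ - z)) := by
    rw [map_sub, map_sub, h1]; abel
  have h3 : ‖j₀ (σ - z) - Q (j₀ (σ - z))‖ ≤ ‖j₀ (σ - z)‖ := by
    have := Submodule.norm_sq_eq_add_norm_sq_starProjection (j₀ (σ - z)) (weakKernel j₀ j₁)
    rw [Submodule.starProjection_orthogonal_val] at this
    nlinarith [norm_nonneg (j₀ (σ - z)), norm_nonneg (j₀ (σ - z) - Q (j₀ (σ - z))), sq_nonneg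
      ‖(weakKernel j₀ j₁).starProjection (j₀ (σ - z))‖]
  have h4 : ‖j₀ σ‖ ≤ ‖j₀ σ - Q (j₀ σ)‖ + ‖Q (j₀ σ)‖ := by
    simpa using norm_add_le (j₀ σ - Q (j₀ σ)) (Q (j₀ σ))
  rw [h2] at h4
  linarith

/-- `norm_le_of_correction` applied to differences of terms of the sequence. -/
theorem cauchySeq_of_correction {C : ℝ} (hC : 0 ≤ C)
    (h : ∀ σ, ∃ z, j₁ z = 0 ∧ ‖j₀ (σ - z)‖ ≤ C * ‖j₁ σ‖ + 1 / 2 * ‖j₀ σ‖ + C * ‖L σ‖)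
    {s : ℕ → Ω} (h₁ : CauchySeq fun n => j₁ (s n)) (hL : CauchySeq fun n => L (s n))
    (hQ : CauchySeq fun n => (weakKernel j₀ j₁).starProjection (j₀ (s n))) :
    CauchySeq fun n => j₀ (s n) := by
  rw [Metric.cauchySeq_iff'] at *
  intro ε hε
  obtain ⟨N₁, hN₁⟩ := (Metric.cauchySeq_iff.1 (Metric.cauchySeq_iff'.2 h₁))
    (ε / (6 * (C + 1))) (by positivity)
  obtain ⟨N₂, hN₂⟩ := (Metric.cauchySeq_iff.1 (Metric.cauchySeq_iff'.2 hL))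
    (ε / (6 * (C + 1))) (by positivity)
  obtain ⟨N₃, hN₃⟩ := (Metric.cauchySeq_iff.1 (Metric.cauchySeq_iff'.2 hQ))
    (ε / 6) (by positivity)
  refine ⟨max N₁ (max N₂ N₃), fun n hn => ?_⟩
  simp only [max_le_iff, ge_iff_le] at hn
  have a1 := hN₁ n hn.1 (max N₁ (max N₂ N₃)) (by simp)
  have a2 := hN₂ n hn.2.1 (max N₁ (max N₂ N₃)) (by simp)
  have a3 := hN₃ n hn.2.2 (max N₁ (max N₂ N₃)) (by simp)
  rw [dist_eq_norm, ← map_sub] at a1 a2 a3 ⊢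
  rw [← map_sub] at a3
  have key := norm_le_of_correction j₀ j₁ L h (s n - s (max N₁ (max N₂ N₃)))
  have b : ∀ t : ℝ, t < ε / (6 * (C + 1)) → C * t ≤ ε / 6 := by
    intro t ht
    have h1 : C * t ≤ C * (ε / (6 * (C + 1))) := by gcongr
    have h2 : C * (ε / (6 * (C + 1))) ≤ ε / 6 := by
      rw [mul_div_assoc', div_le_div_iff₀ (by positivity) (by positivity)]
      nlinarith
    exact h1.trans h2
  have b1 := b _ a1
  have b2 := b _ a2
  linarith

/-- If a relation `j₀ σ ↦ j₁ σ` satisfies an elliptic estimate up to elements of the kernel of `j₁`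
and a finite rank error, then every limit of values `j₁ σ` is a limit along which `j₀ σ`
converges. -/
theorem exists_tendsto_of_mem_closure {C : ℝ} (hC : 0 ≤ C) (hL : ∀ σ, ‖L σ‖ ≤ C * ‖j₀ σ‖)
    (h : ∀ σ, ∃ z, j₁ z = 0 ∧ ‖j₀ (σ - z)‖ ≤ C * ‖j₁ σ‖ + 1 / 2 * ‖j₀ σ‖ + C * ‖L σ‖)
    {τ : H₁} (hτ : τ ∈ closure (Set.range j₁)) :
    ∃ (s : ℕ → Ω) (x : H₀), Tendsto (fun n => j₁ (s n)) atTop (𝓝 τ) ∧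
      Tendsto (fun n => j₀ (s n)) atTop (𝓝 x) := by
  set Q := (weakKernel j₀ j₁).starProjection with hQdef
  have hQle : ∀ x, ‖Q x‖ ≤ ‖x‖ := fun x =>
    (weakKernel j₀ j₁).norm_starProjection_apply_le x
  -- The weak-kernel component of `j₀ σ` is approximated by some `j₀ ζ` with `j₁ ζ` tiny. Replacing
  -- `σ` by `σ - ζ` almost removes that component and hardly changes `j₁ σ`.
  have happ : ∀ n : ℕ, ∃ σ, ‖j₁ σ - τ‖ < 1 / ((n : ℝ) + 1) ∧ ‖Q (j₀ σ)‖ < 1 / ((n : ℝ) + 1) := by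
    intro n
    have hε : 0 < 1 / ((n : ℝ) + 1) := by positivity
    set ε := 1 / ((n : ℝ) + 1)
    obtain ⟨σ, hσ⟩ := Metric.mem_closure_range_iff.1 hτ (ε / 2) (by positivity)
    rw [dist_comm, dist_eq_norm] at hσ
    have hp : Q (j₀ σ) ∈ weakKernel j₀ j₁ := Submodule.starProjection_apply_mem _ _
    obtain ⟨ζ, hζ0, hζ1⟩ := (mem_weakKernel j₀ j₁).1 hp (ε / 2) (by positivity)
    refine ⟨σ - ζ, ?_, ?_⟩
    · rw [map_sub, sub_right_comm]
      refine (norm_sub_le _ _).trans_lt ?_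
      linarith
    · have : Q (j₀ (σ - ζ)) = -Q (j₀ ζ - Q (j₀ σ)) := by
        rw [map_sub, map_sub, map_sub, (Submodule.starProjection_eq_self_iff).2 hp]; abel
      rw [this, norm_neg]
      exact (hQle _).trans_lt (by linarith)
  choose s hs1 hs2 using happ
  have hlim : Tendsto (fun n : ℕ => 1 / ((n : ℝ) + 1)) atTop (𝓝 0) :=
    tendsto_one_div_add_atTop_nhds_zero_nat
  have t1 : Tendsto (fun n => j₁ (s n)) atTop (𝓝 τ) := by
    rw [tendsto_iff_norm_sub_tendsto_zero]
    exact squeeze_zero (fun _ => norm_nonneg _) (fun n => (hs1 n).le) hlim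
  have t2 : Tendsto (fun n => Q (j₀ (s n))) atTop (𝓝 0) :=
    squeeze_zero_norm (fun n => (hs2 n).le) hlim
  by_cases hb : ∃ R, ∀ n, ‖j₀ (s n)‖ ≤ R
  · obtain ⟨R, hR⟩ := hb
    -- In the bounded case `L` takes values in a bounded set of a finite dimensional space, so a
    -- subsequence converges there; this is where finite rank gives compactness.
    obtain ⟨l, -, φ, hφ, hl⟩ := tendsto_subseq_of_bounded (x := fun n => L (s n))
      (Metric.isBounded_closedBall (x := (0 : F)) (r := C * R)) (fun n => by
        rw [mem_closedBall_zero_iff]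
        exact (hL _).trans (by gcongr; exact hR n))
    have u1 := t1.comp hφ.tendsto_atTop
    have hc := cauchySeq_of_correction j₀ j₁ L hC h (s := s ∘ φ) u1.cauchySeq hl.cauchySeq
      (t2.comp hφ.tendsto_atTop).cauchySeq
    obtain ⟨x, hx⟩ := cauchySeq_tendsto_of_complete hc
    exact ⟨s ∘ φ, x, u1, hx⟩
  · exfalso
    push Not at hb
    choose f hf using fun n : ℕ => hb ((n : ℝ) + 1)
    have hpos : ∀ n, 0 < ‖j₀ (s (f n))‖ := fun n => lt_trans (by positivity) (hf n)
    -- In the unbounded case the elements are normalised. Then `j₁` and the weak-kernel component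
    -- tend to zero while the norm of `j₀` stays one. The indices `f n` need not increase, since
    -- only the growth of the norms is used.
    set t : ℕ → Ω := fun n => ‖j₀ (s (f n))‖⁻¹ • s (f n) with ht
    have hinv : ∀ n, ‖j₀ (s (f n))‖⁻¹ ≤ 1 / ((n : ℝ) + 1) := fun n => by
      rw [one_div]; exact inv_anti₀ (by positivity) (hf n).le
    have hzero : ∀ B : ℝ, Tendsto (fun n => ‖j₀ (s (f n))‖⁻¹ * B) atTop (𝓝 0) := fun B => by
      simpa using (squeeze_zero (fun n => by positivity) hinv hlim).mul_const B
    obtain ⟨B, hB⟩ := (Metric.isBounded_range_of_tendsto _ t1).exists_norm_le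
    have v1 : Tendsto (fun n => j₁ (t n)) atTop (𝓝 0) := by
      refine squeeze_zero_norm (fun n => ?_) (hzero B)
      rw [ht, map_smul, norm_smul, norm_inv, norm_norm]
      gcongr
      exact hB _ (Set.mem_range_self _)
    have v2 : Tendsto (fun n => Q (j₀ (t n))) atTop (𝓝 0) := by
      refine squeeze_zero_norm (fun n => ?_) (hzero 1)
      rw [ht, map_smul, map_smul, norm_smul, norm_inv, norm_norm]
      gcongr
      refine (hs2 _).le.trans ?_
      rw [div_le_one (by positivity)]
      have : (0 : ℝ) ≤ f n := (f n).cast_nonneg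
      linarith
    have v0 : ∀ n, ‖j₀ (t n)‖ = 1 := fun n => by
      rw [ht, map_smul, norm_smul, norm_inv, norm_norm, inv_mul_cancel₀ (hpos n).ne']
    obtain ⟨l, -, φ, hφ, hl⟩ := tendsto_subseq_of_bounded (x := fun n => L (t n))
      (Metric.isBounded_closedBall (x := (0 : F)) (r := C)) (fun n => by
        rw [mem_closedBall_zero_iff]
        simpa [v0] using hL (t n))
    have u1 := v1.comp hφ.tendsto_atTop
    have u2 := v2.comp hφ.tendsto_atTop
    have hc := cauchySeq_of_correction j₀ j₁ L hC h (s := t ∘ φ) u1.cauchySeq hl.cauchySeq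
      u2.cauchySeq
    obtain ⟨x, hx⟩ := cauchySeq_tendsto_of_complete hc
    have hx1 : ‖x‖ = 1 := by
      refine tendsto_nhds_unique hx.norm ?_
      simp only [Function.comp_apply, v0]
      exact tendsto_const_nhds
    have hxQ : Q x = 0 := tendsto_nhds_unique ((Q.continuous.tendsto x).comp hx) u2
    -- The limit lies in the weak kernel and is orthogonal to it, yet has norm one: a contradiction.
    have hxk : x ∈ weakKernel j₀ j₁ := by
      change (x, (0 : H₁)) ∈ closure (Set.range (j₀.prod j₁))
      exact mem_closure_of_tendsto (hx.prodMk_nhds u1)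
        (Eventually.of_forall fun n => Set.mem_range_self (t (φ n)))
    rw [hQdef, (Submodule.starProjection_eq_self_iff).2 hxk] at hxQ
    simp [hxQ] at hx1

end ClosedRange

end L2Forms
end

noncomputable section

namespace L2Forms

set_option maxSynthPendingDepth 5

/-! ### Measurability of forms and `L²` bounds under change of charts. -/

section Localisation

open scoped Topology

variable {E H : Type*} [NormedAddCommGroup E] [NormedSpace ℝ E] [TopologicalSpace H]
  (I : ModelWithCorners ℝ E H) [I.Boundaryless]
  {X : Type*} [TopologicalSpace X] [ChartedSpace H X] [IsManifold I ∞ X] [FiniteDimensional ℝ E]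
  [MeasurableSpace E] [BorelSpace E] (μ : Measure E) [μ.IsAddHaarMeasure] {k : ℕ}

/-- Measurability of a form up to null sets, in all charts. -/
def AEMeas (u : DForm I X k) : Prop :=
  ∀ x₀ : X, AEStronglyMeasurable (inChart I u x₀) (μ.restrict (extChartAt I x₀).target)

theorem inChart_sub (u v : DForm I X k) (x₀ : X) :
    inChart I (u - v) x₀ = inChart I u x₀ - inChart I v x₀ := rfl

theorem AEMeas.add {u v : DForm I X k} (hu : AEMeas I μ u) (hv : AEMeas I μ v) :
    AEMeas I μ (u + v) := fun x₀ => by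
  rw [inChart_add]; exact AEStronglyMeasurable.add (hu x₀) (hv x₀)

theorem AEMeas.sub {u v : DForm I X k} (hu : AEMeas I μ u) (hv : AEMeas I μ v) :
    AEMeas I μ (u - v) := fun x₀ => by
  rw [inChart_sub]; exact AEStronglyMeasurable.sub (hu x₀) (hv x₀)

theorem aeMeas_zero : AEMeas I μ (0 : DForm I X k) := fun x₀ => by
  rw [inChart_zero]; exact aestronglyMeasurable_zero

theorem AEMeas.sum {m : ℕ} {u : Fin m → DForm I X k} (hu : ∀ i, AEMeas I μ (u i)) :
    AEMeas I μ (∑ i, u i) :=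
  Finset.sum_induction _ _ (fun _ _ ha hb => ha.add I μ hb) (aeMeas_zero I μ) fun i _ => hu i

theorem IsSmooth.aeMeas {u : DForm I X k} (hu : IsSmooth I u) : AEMeas I μ u := fun x₀ =>
  (hu x₀).continuousOn.aestronglyMeasurable (isOpen_extChartAt_target x₀).measurableSet

theorem inChart_sum {m : ℕ} (u : Fin m → DForm I X k) (x₀ : X) :
    inChart I (∑ i, u i) x₀ = ∑ i, inChart I (u i) x₀ := by
  induction m with
  | zero => simp [inChart_zero]
  | succ m ih => rw [Fin.sum_univ_succ, Fin.sum_univ_succ, inChart_add, ih]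

/-- The preimage of `Z` lies in the image of a null set under the inverse transition map, and
differentiable maps between spaces of equal dimension preserve null sets. -/
theorem trans_preimage_null {x₀ x₁ : X} {Z : Set E} (hZ : μ Z = 0) :
    μ (transDom I x₀ x₁ ∩ trans I x₀ x₁ ⁻¹' Z) = 0 := by
  have h : transDom I x₀ x₁ ∩ trans I x₀ x₁ ⁻¹' Z ⊆
      trans I x₁ x₀ '' (transDom I x₁ x₀ ∩ Z) := fun y hy =>
    ⟨trans I x₀ x₁ y, ⟨trans_mem I hy.1, hy.2⟩, trans_trans I hy.1⟩
  refine measure_mono_null h ?_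
  refine addHaar_image_eq_zero_of_differentiableOn_of_addHaar_eq_zero μ
    (((contDiffOn_trans I x₁ x₀).differentiableOn (by simp)).mono Set.inter_subset_left) ?_
  exact measure_mono_null Set.inter_subset_right hZ

/-- Since preimages of null sets under transition maps are null, composing an almost everywhere
measurable expression with a transition map keeps it so; the pullback by the Jacobian is a
continuous operation on top. -/
theorem aeMeas_fromChart {x₁ : X} {f : E → E [⋀^Fin k]→L[ℝ] ℝ}
    (hf : AEStronglyMeasurable f μ) : AEMeas I μ (fromChart I x₁ f) := by
  intro x₀
  have hS := (isOpen_transDom I x₀ x₁).measurableSet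
  set g : E → E [⋀^Fin k]→L[ℝ] ℝ := (transDom I x₀ x₁).indicator fun y =>
    (f (trans I x₀ x₁ y)).compContinuousLinearMap (fderiv ℝ (trans I x₀ x₁) y) with hg
  have h1 : AEStronglyMeasurable g (μ.restrict (extChartAt I x₀).target) := by
    refine AEStronglyMeasurable.restrict ?_
    rw [hg, aestronglyMeasurable_indicator_iff hS]
    have hτ : AEMeasurable (trans I x₀ x₁) (μ.restrict (transDom I x₀ x₁)) :=
      (contDiffOn_trans I x₀ x₁).continuousOn.aemeasurable hS
    have hd : AEStronglyMeasurable (fderiv ℝ (trans I x₀ x₁)) (μ.restrict (transDom I x₀ x₁)) :=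
      ((contDiffOn_trans I x₀ x₁).continuousOn_fderiv_of_isOpen (isOpen_transDom I x₀ x₁)
        (by simp)).aestronglyMeasurable hS
    have hq : Measure.QuasiMeasurePreserving (hτ.mk _) (μ.restrict (transDom I x₀ x₁)) μ := by
      refine ⟨hτ.measurable_mk, Measure.AbsolutelyContinuous.mk fun Z hZm hZ => ?_⟩
      rw [Measure.map_apply hτ.measurable_mk hZm]
      have h0 : (μ.restrict (transDom I x₀ x₁)) (trans I x₀ x₁ ⁻¹' Z) = 0 := by
        rw [Measure.restrict_apply₀' hS.nullMeasurableSet, Set.inter_comm]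
        exact trans_preimage_null I μ hZ
      refine (measure_congr ?_).trans h0
      filter_upwards [hτ.ae_eq_mk] with y hy
      change (hτ.mk _ y ∈ Z) = (trans I x₀ x₁ y ∈ Z)
      rw [hy]
    have hfτ : AEStronglyMeasurable (fun y => f (trans I x₀ x₁ y))
        (μ.restrict (transDom I x₀ x₁)) := by
      refine (hf.comp_quasiMeasurePreserving hq).congr ?_
      filter_upwards [hτ.ae_eq_mk] with y hy
      rw [Function.comp_apply, ← hy]
    have hcont : Continuous fun p : (E [⋀^Fin k]→L[ℝ] ℝ) × (E →L[ℝ] E) =>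
        p.1.compContinuousLinearMap p.2 := by
      rw [← contDiff_zero (𝕜 := ℝ), contDiff_iff_contDiffAt]
      intro p
      exact contDiffAt_pullback contDiffAt_fst contDiffAt_snd
    exact hcont.comp_aestronglyMeasurable (hfτ.prodMk hd)
  refine h1.congr ?_
  filter_upwards [ae_restrict_mem (isOpen_extChartAt_target x₀).measurableSet] with y hy
  by_cases h : y ∈ transDom I x₀ x₁
  · rw [hg, Set.indicator_of_mem h, inChart_fromChart I f h]
  · rw [hg, Set.indicator_of_notMem h, inChart_fromChart_of_notMem I f fun h' => h ⟨hy, h'⟩]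

/-- Change of charts is bounded in `L²` over compact sets. -/
theorem eLpNorm_inChart_fromChart_le [T2Space X] {x₀ x₁ : X} {K₀ K₁ : Set E} (hK₀ : IsCompact K₀)
    (hK₁ : IsCompact K₁) (hK₀t : K₀ ⊆ (extChartAt I x₀).target)
    (hK₁t : K₁ ⊆ (extChartAt I x₁).target) :
    ∃ C : NNReal, ∀ f : E → E [⋀^Fin k]→L[ℝ] ℝ, (∀ y ∉ K₁, f y = 0) →
      eLpNorm (inChart I (fromChart I x₁ f) x₀) 2 (μ.restrict K₀) ≤ C * eLpNorm f 2 μ := by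
  set τ := trans I x₀ x₁ with hτ
  -- The points of `K₀` that correspond to points of `K₁` form a compact subset of the transition
  -- domain, on which the Jacobian and the inverse of its determinant are bounded. Off `S` the form
  -- vanishes.
  set S : Set E := K₀ ∩ (extChartAt I x₀).symm ⁻¹' ((extChartAt I x₁).symm '' K₁) with hS
  have hcl : IsClosed ((extChartAt I x₁).symm '' K₁) :=
    (hK₁.image_of_continuousOn ((continuousOn_extChartAt_symm x₁).mono hK₁t)).isClosed
  have hSc : IsCompact S := by
    refine hK₀.of_isClosed_subset ?_ Set.inter_subset_left
    exact ((continuousOn_extChartAt_symm x₀).mono hK₀t).preimage_isClosed_of_isClosed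
      hK₀.isClosed hcl
  have hSd : S ⊆ transDom I x₀ x₁ := by
    rintro y ⟨hy, z, hz, hzy⟩
    refine ⟨hK₀t hy, ?_⟩
    rw [Set.mem_preimage, ← hzy]
    exact (extChartAt I x₁).map_target (hK₁t hz)
  have hdc : ContinuousOn (fderiv ℝ τ) S :=
    ((contDiffOn_trans I x₀ x₁).continuousOn_fderiv_of_isOpen (isOpen_transDom I x₀ x₁)
      (by simp)).mono hSd
  obtain ⟨A, hA⟩ := hSc.exists_bound_of_continuousOn hdc
  have hdet : ∀ y ∈ S, (fderiv ℝ τ y).det ≠ 0 := by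
    intro y hy h0
    have h := congrArg ContinuousLinearMap.det (fderiv_trans_comp I (hSd hy))
    rw [ContinuousLinearMap.det, ContinuousLinearMap.toLinearMap_comp, LinearMap.det_comp] at h
    rw [ContinuousLinearMap.det] at h0
    rw [h0, mul_zero] at h
    simp [ContinuousLinearMap.det] at h
  have hdetc : ContinuousOn (fun y => |(fderiv ℝ τ y).det|⁻¹) S :=
    ((ContinuousLinearMap.continuous_det.comp_continuousOn hdc).abs).inv₀
      fun y hy => abs_ne_zero.2 (hdet y hy)
  obtain ⟨B, hB⟩ := hSc.exists_bound_of_continuousOn hdetc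
  have hinj : Set.InjOn τ S := by
    intro y hy z hz h
    rw [← trans_trans I (hSd hy), ← trans_trans I (hSd hz)]
    exact congrArg _ h
  set A' : NNReal := Real.toNNReal A with hA'
  set B' : NNReal := Real.toNNReal B with hB'
  -- For squared norms, pulling back a `k`-form costs `A' ^ (2 * k)` and the change of variables
  -- costs `B'`.
  refine ⟨NNReal.sqrt (A' ^ (2 * k) * B'), fun f hf => eLpNorm_two_le ?_⟩
  have hcv := lintegral_image_eq_lintegral_abs_det_fderiv_mul μ hSc.measurableSet
    (f := τ) (f' := fderiv ℝ τ) (fun y hy => ((contDiffOn_trans I x₀ x₁).differentiableOn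
      (by simp)).hasFDerivAt ((isOpen_transDom I x₀ x₁).mem_nhds (hSd hy)) |>.hasFDerivWithinAt)
    hinj (fun z => ‖f z‖ₑ ^ 2)
  have hpt : ∀ y ∈ K₀, ‖inChart I (fromChart I x₁ f) x₀ y‖ₑ ^ 2 ≤ S.indicator (fun y =>
      (A' ^ (2 * k) * B' : NNReal) * (ENNReal.ofReal |(fderiv ℝ τ y).det| * ‖f (τ y)‖ₑ ^ 2)) y := by
    intro y hy
    by_cases hyS : y ∈ S
    · rw [Set.indicator_of_mem hyS, inChart_fromChart I f (hSd hyS)]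
      have h1 : ‖(f (τ y)).compContinuousLinearMap (fderiv ℝ τ y)‖ₑ ≤ ‖f (τ y)‖ₑ * A' ^ k := by
        have h2 : ‖(f (τ y)).compContinuousLinearMap (fderiv ℝ τ y)‖₊ ≤ ‖f (τ y)‖₊ * A' ^ k := by
          rw [← NNReal.coe_le_coe]
          push_cast
          refine (norm_pullback_le _ _).trans ?_
          gcongr
          rw [hA']
          exact (hA y hyS).trans (Real.le_coe_toNNReal A)
        calc _ ≤ ((‖f (τ y)‖₊ * A' ^ k : NNReal) : ENNReal) := ENNReal.coe_le_coe.2 h2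
          _ = _ := by push_cast; rfl
      have h3 : (1 : ENNReal) ≤ B' * ENNReal.ofReal |(fderiv ℝ τ y).det| := by
        rw [hB', ← ENNReal.ofReal, ← ENNReal.ofReal_mul' (abs_nonneg _), ← ENNReal.ofReal_one]
        refine ENNReal.ofReal_le_ofReal ?_
        have h4 := (le_abs_self _).trans (hB y hyS)
        have h5 : 0 < |(fderiv ℝ τ y).det| := abs_pos.2 (hdet y hyS)
        rwa [inv_le_iff_one_le_mul₀ h5] at h4
      calc _ ≤ (‖f (τ y)‖ₑ * A' ^ k) ^ 2 * 1 := by rw [mul_one]; gcongr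
        _ ≤ (‖f (τ y)‖ₑ * A' ^ k) ^ 2 * (B' * ENNReal.ofReal |(fderiv ℝ τ y).det|) := by gcongr
        _ = _ := by push_cast; ring
    · rw [Set.indicator_of_notMem hyS]
      have : inChart I (fromChart I x₁ f) x₀ y = 0 := by
        by_cases h : (extChartAt I x₀).symm y ∈ (extChartAt I x₁).source
        · have hyd : y ∈ transDom I x₀ x₁ := ⟨hK₀t hy, h⟩
          rw [inChart_fromChart I f hyd, hf]
          · rfl
          · intro hK
            exact hyS ⟨hy, _, hK, symm_trans I hyd⟩
        · exact inChart_fromChart_of_notMem I f h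
      simp [this]
  calc ∫⁻ y in K₀, ‖inChart I (fromChart I x₁ f) x₀ y‖ₑ ^ 2 ∂μ
      ≤ ∫⁻ y in K₀, S.indicator (fun y => (A' ^ (2 * k) * B' : NNReal) *
          (ENNReal.ofReal |(fderiv ℝ τ y).det| * ‖f (τ y)‖ₑ ^ 2)) y ∂μ :=
        setLIntegral_mono' hK₀.measurableSet hpt
    _ ≤ ∫⁻ y, S.indicator (fun y => (A' ^ (2 * k) * B' : NNReal) *
          (ENNReal.ofReal |(fderiv ℝ τ y).det| * ‖f (τ y)‖ₑ ^ 2)) y ∂μ :=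
        setLIntegral_le_lintegral _ _
    _ = (A' ^ (2 * k) * B' : NNReal) * ∫⁻ y in τ '' S, ‖f y‖ₑ ^ 2 ∂μ := by
        rw [lintegral_indicator hSc.measurableSet, hcv,
          lintegral_const_mul' _ _ ENNReal.coe_ne_top]
    _ ≤ (A' ^ (2 * k) * B' : NNReal) * ∫⁻ y, ‖f y‖ₑ ^ 2 ∂μ := by
        exact mul_le_mul_right (setLIntegral_le_lintegral _ _) _
    _ = _ := by rw [← ENNReal.coe_pow, NNReal.sq_sqrt]

end Localisation

/-! ### Finite partitions of unity in chart coordinates. -/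

section Partition

open scoped Topology

variable {E H : Type*} [NormedAddCommGroup E] [NormedSpace ℝ E] [TopologicalSpace H]
  (I : ModelWithCorners ℝ E H) [I.Boundaryless]
  (X : Type*) [TopologicalSpace X] [ChartedSpace H X] [IsManifold I ∞ X] [FiniteDimensional ℝ E]

/-- A finite smooth partition of unity, subordinate to preferred charts and written in their
coordinates. -/
structure ChartPartition where
  /-- the number of charts -/
  m : ℕ
  /-- the centres of the charts -/
  c : Fin m → X
  /-- the functions of the partition -/
  φ : Fin m → E → ℝ
  contDiff : ∀ i, ContDiff ℝ ∞ (φ i)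
  compact : ∀ i, HasCompactSupport (φ i)
  subset : ∀ i, tsupport (φ i) ⊆ (extChartAt I (c i)).target
  nonneg : ∀ i y, 0 ≤ φ i y
  sum_eq_one : ∀ x, ∑ i, (extChartAt I (c i)).source.indicator
    (fun x => φ i (extChartAt I (c i) x)) x = 1

/-- A smooth partition of unity on the manifold, read in the charts of a finite subcover and
extended by zero. The extension is smooth because compactness makes the supports compact inside the
chart targets. -/
theorem nonempty_chartPartition [T2Space X] [CompactSpace X] : Nonempty (ChartPartition I X) := by
  obtain ⟨t, ht⟩ := CompactSpace.elim_nhds_subcover (fun x : X => (extChartAt I x).source)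
    (fun x => extChartAt_source_mem_nhds x)
  set c : Fin t.card → X := fun i => t.equivFin.symm i with hc
  have hcov : (Set.univ : Set X) ⊆ ⋃ i, (extChartAt I (c i)).source := by
    intro x _
    have hx : x ∈ ⋃ x ∈ t, (extChartAt I x).source := by
      have h : x ∈ (⊤ : Set X) := trivial
      rwa [← ht] at h
    simp only [Set.mem_iUnion] at hx ⊢
    obtain ⟨z, hz, hx⟩ := hx
    exact ⟨t.equivFin ⟨z, hz⟩, by simpa [hc] using hx⟩
  obtain ⟨f, hf⟩ := SmoothPartitionOfUnity.exists_isSubordinate I isClosed_univ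
    (fun i => (extChartAt I (c i)).source) (fun i => isOpen_extChartAt_source _) hcov
  set K : Fin t.card → Set E := fun i => extChartAt I (c i) '' tsupport (f i) with hK
  have hKc : ∀ i, IsCompact (K i) := fun i =>
    (isClosed_tsupport _).isCompact.image_of_continuousOn ((continuousOn_extChartAt _).mono (hf i))
  have hKt : ∀ i, K i ⊆ (extChartAt I (c i)).target := by
    rintro i _ ⟨x, hx, rfl⟩
    exact (extChartAt I (c i)).map_source (hf i hx)
  set φ : Fin t.card → E → ℝ := fun i => (extChartAt I (c i)).target.indicator
    fun y => f i ((extChartAt I (c i)).symm y) with hφ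
  have hφK : ∀ i, ∀ y ∉ K i, φ i y = 0 := by
    intro i y hy
    by_cases h : y ∈ (extChartAt I (c i)).target
    · rw [hφ]
      simp only [Set.indicator_of_mem h]
      by_contra h0
      exact hy ⟨_, subset_tsupport _ h0, (extChartAt I (c i)).right_inv h⟩
    · exact Set.indicator_of_notMem h _
  have hts : ∀ i, tsupport (φ i) ⊆ K i := fun i =>
    closure_minimal (fun y hy => by by_contra h; exact hy (hφK i y h)) (hKc i).isClosed
  refine ⟨⟨t.card, c, φ, fun i => ?_, fun i => ?_, fun i => (hts i).trans (hKt i), fun i y => ?_,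
    fun x => ?_⟩⟩
  · rw [contDiff_iff_contDiffAt]
    intro y
    by_cases hy : y ∈ K i
    · have hyt := hKt i hy
      have h1 : ContMDiffOn 𝓘(ℝ, E) 𝓘(ℝ) ∞ (fun y => f i ((extChartAt I (c i)).symm y))
          (extChartAt I (c i)).target :=
        (f i).contMDiff.comp_contMDiffOn (contMDiffOn_extChartAt_symm (c i))
      have h2 := contMDiffOn_iff_contDiffOn.1 h1
      have hn := (isOpen_extChartAt_target (I := I) (c i)).mem_nhds hyt
      refine (h2.contDiffAt hn).congr_of_eventuallyEq ?_
      filter_upwards [hn] with z hz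
      exact Set.indicator_of_mem hz _
    · refine contDiffAt_const (c := 0) |>.congr_of_eventuallyEq ?_
      filter_upwards [(hKc i).isClosed.isOpen_compl.mem_nhds hy] with z hz
      exact hφK i z hz
  · exact HasCompactSupport.intro (hKc i) (hφK i)
  · exact Set.indicator_nonneg (fun _ _ => f.nonneg i _) _
  · have h1 := f.sum_eq_one (Set.mem_univ x)
    rw [finsum_eq_sum_of_fintype] at h1
    rw [← h1]
    refine Finset.sum_congr rfl fun i _ => ?_
    by_cases h : x ∈ (extChartAt I (c i)).source
    · rw [Set.indicator_of_mem h, hφ]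
      simp only [Set.indicator_of_mem ((extChartAt I (c i)).map_source h)]
      rw [(extChartAt I (c i)).left_inv h]
    · rw [Set.indicator_of_notMem h]
      by_contra h0
      exact h (hf i (subset_tsupport _ fun h' => h0 h'.symm))

end Partition

end L2Forms
end

noncomputable section

namespace L2Forms

set_option maxSynthPendingDepth 5

/-! ### Cutoff functions. -/

section Cutoff

variable {E : Type*} [NormedAddCommGroup E] [NormedSpace ℝ E] [FiniteDimensional ℝ E]

/-- The uniform radius `δ` is the point: a convolution with a kernel of smaller radius, evaluated on
`K`, does not notice the cutoff. -/
theorem exists_cutoff {K U : Set E} (hK : IsCompact K) (hU : IsOpen U) (hKU : K ⊆ U) :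
    ∃ (χ : E → ℝ) (δ : ℝ), ContDiff ℝ ∞ χ ∧ HasCompactSupport χ ∧ tsupport χ ⊆ U ∧
      (∀ x, χ x ∈ Set.Icc (0 : ℝ) 1) ∧ 0 < δ ∧ ∀ x ∈ K, ∀ z, ‖z - x‖ < δ → χ z = 1 := by
  obtain ⟨δ, hδ, hδU⟩ := hK.exists_cthickening_subset_open hU hKU
  have hd : Disjoint (Metric.thickening δ K)ᶜ (Metric.cthickening (δ / 2) K) := by
    rw [Set.disjoint_compl_left_iff_subset]
    exact Metric.cthickening_subset_thickening' hδ (by linarith) K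
  obtain ⟨f, hf0, hf1, hf⟩ := exists_contMDiffMap_zero_one_of_isClosed (n := ⊤) 𝓘(ℝ, E)
    Metric.isOpen_thickening.isClosed_compl Metric.isClosed_cthickening hd
  have hts : tsupport f ⊆ Metric.cthickening δ K := by
    refine closure_minimal (fun x hx => ?_) Metric.isClosed_cthickening
    by_contra h
    exact hx (hf0 fun h' => h (Metric.thickening_subset_cthickening _ _ h'))
  refine ⟨f, δ / 2, f.contMDiff.contDiff, ?_, hts.trans hδU, hf, by positivity, ?_⟩
  · exact hK.cthickening.of_isClosed_subset (isClosed_tsupport _) hts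
  · intro x hx z hz
    refine hf1 (Metric.thickening_subset_cthickening _ _ ?_)
    rw [Metric.mem_thickening_iff]
    exact ⟨x, hx, by rwa [dist_eq_norm]⟩

variable [MeasurableSpace E] [BorelSpace E] (μ : Measure E) {F : Type*} [NormedAddCommGroup F]
  [NormedSpace ℝ F]

theorem aestronglyMeasurable_smul_of_tsupport {χ : E → ℝ} {U : Set E} {v : E → F}
    (hχ : Continuous χ) (hU : MeasurableSet U) (hχU : tsupport χ ⊆ U)
    (hv : AEStronglyMeasurable v (μ.restrict U)) :
    AEStronglyMeasurable (fun y => χ y • v y) μ := by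
  have : (fun y => χ y • v y) = U.indicator fun y => χ y • v y := by
    funext y
    by_cases hy : y ∈ U
    · rw [Set.indicator_of_mem hy]
    · rw [Set.indicator_of_notMem hy, image_eq_zero_of_notMem_tsupport fun h => hy (hχU h),
        zero_smul]
  rw [this, aestronglyMeasurable_indicator_iff hU]
  exact hχ.aestronglyMeasurable.smul hv

theorem eLpNorm_smul_le_restrict {χ : E → ℝ} {C : NNReal} (hC : ∀ y, |χ y| ≤ C) (v : E → F) :
    eLpNorm (fun y => χ y • v y) 2 μ ≤ C * eLpNorm v 2 (μ.restrict (tsupport χ)) := by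
  have h1 : (fun y => χ y • v y) = (tsupport χ).indicator fun y => χ y • v y := by
    funext y
    by_cases hy : y ∈ tsupport χ
    · rw [Set.indicator_of_mem hy]
    · rw [Set.indicator_of_notMem hy, image_eq_zero_of_notMem_tsupport hy, zero_smul]
  rw [h1, eLpNorm_indicator_eq_eLpNorm_restrict (isClosed_tsupport χ).measurableSet]
  refine (eLpNorm_le_mul_eLpNorm_of_ae_le_mul (g := v) (c := C)
    (Filter.Eventually.of_forall fun y => ?_) 2).trans_eq (by rw [ENNReal.ofReal_coe_nnreal])
  rw [norm_smul]
  exact mul_le_mul_of_nonneg_right (hC y) (norm_nonneg _)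

end Cutoff

/-! ### The `L²` norm by localisation, and the estimate in a single chart. -/

section Seminorm

open scoped Topology

variable {E H : Type*} [NormedAddCommGroup E] [NormedSpace ℝ E] [TopologicalSpace H]
  (I : ModelWithCorners ℝ E H) [I.Boundaryless]
  {X : Type*} [TopologicalSpace X] [ChartedSpace H X] [IsManifold I ∞ X] [FiniteDimensional ℝ E]
  [MeasurableSpace E] [BorelSpace E] (μ : Measure E) [μ.IsAddHaarMeasure] {k : ℕ}
  (P : ChartPartition I X)

/-- The localisation of a form to the `i`-th chart of a partition of unity. -/
def loc (i : Fin P.m) (u : DForm I X k) (y : E) : E [⋀^Fin k]→L[ℝ] ℝ :=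
  P.φ i y • inChart I u (P.c i) y

theorem loc_add (i : Fin P.m) (u v : DForm I X k) :
    loc I P i (u + v) = loc I P i u + loc I P i v := by
  funext y; simp [loc, inChart_add, smul_add]

theorem loc_sub (i : Fin P.m) (u v : DForm I X k) :
    loc I P i (u - v) = loc I P i u - loc I P i v := by
  funext y; simp [loc, inChart_sub, smul_sub]

theorem loc_smul (i : Fin P.m) (c : ℝ) (u : DForm I X k) :
    loc I P i (c • u) = c • loc I P i u := by
  funext y; simp [loc, inChart_smul, smul_comm c]

theorem loc_eq_zero (i : Fin P.m) (u : DForm I X k) {y : E} (hy : y ∉ tsupport (P.φ i)) :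
    loc I P i u y = 0 := by
  rw [loc, image_eq_zero_of_notMem_tsupport hy, zero_smul]

/-- The partition functions sum to one, and pulling a chart expression back to the manifold undoes
`inChart`. -/
theorem sum_fromChart_loc (u : DForm I X k) : ∑ i, fromChart I (P.c i) (loc I P i u) = u := by
  suffices h : ∀ x, ∑ i, formAt I (fromChart I (P.c i) (loc I P i u)) x = formAt I u x by
    funext x
    rw [Finset.sum_apply]
    exact h x
  intro x
  have h1 : ∀ i, formAt I (fromChart I (P.c i) (loc I P i u)) x =
      (extChartAt I (P.c i)).source.indicator (fun x => P.φ i (extChartAt I (P.c i) x)) x •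
        formAt I u x := by
    intro i
    by_cases hx : x ∈ (extChartAt I (P.c i)).source
    · rw [fromChart_of_mem I _ hx, Set.indicator_of_mem hx, formAt_eq I u hx, loc]
      rfl
    · rw [fromChart_of_notMem I _ hx, Set.indicator_of_notMem hx, zero_smul]
  simp_rw [h1]
  rw [← Finset.sum_smul, P.sum_eq_one, one_smul]

theorem AEMeas.loc {u : DForm I X k} (hu : AEMeas I μ u) (i : Fin P.m) :
    AEStronglyMeasurable (loc I P i u) μ :=
  aestronglyMeasurable_smul_of_tsupport μ (P.contDiff i).continuous
    (isOpen_extChartAt_target _).measurableSet (P.subset i) (hu _)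

theorem IsSmooth.contDiff_smul {u : DForm I X k} (hu : IsSmooth I u) {x₁ : X} {χ : E → ℝ}
    (hχ : ContDiff ℝ ∞ χ) (hs : tsupport χ ⊆ (extChartAt I x₁).target) :
    ContDiff ℝ ∞ fun y => χ y • inChart I u x₁ y :=
  contDiff_smul_of_tsupport hχ (isOpen_extChartAt_target _) hs (hu x₁)

theorem IsSmooth.contDiff_loc {u : DForm I X k} (hu : IsSmooth I u) (i : Fin P.m) :
    ContDiff ℝ ∞ (L2Forms.loc I P i u) := hu.contDiff_smul I (P.contDiff i) (P.subset i)

theorem hasCompactSupport_loc (u : DForm I X k) (i : Fin P.m) :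
    HasCompactSupport (loc I P i u) := (P.compact i).smul_right

/-- The `L²` norm of forms on a compact manifold, defined by a partition of unity. -/
def nrm (u : DForm I X k) : ENNReal := ∑ i, eLpNorm (loc I P i u) 2 μ

theorem nrm_add_le {u v : DForm I X k} (hu : AEMeas I μ u) (hv : AEMeas I μ v) :
    nrm I μ P (u + v) ≤ nrm I μ P u + nrm I μ P v := by
  rw [nrm, nrm, nrm, ← Finset.sum_add_distrib]
  refine Finset.sum_le_sum fun i _ => ?_
  rw [loc_add]
  exact eLpNorm_add_le (hu.loc I μ P i) (hv.loc I μ P i) (by norm_num)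

theorem nrm_sub_comm (u v : DForm I X k) : nrm I μ P (u - v) = nrm I μ P (v - u) := by
  refine Finset.sum_congr rfl fun i _ => ?_
  rw [loc_sub, loc_sub, eLpNorm_sub_comm]

theorem nrm_zero : nrm I μ P (0 : DForm I X k) = 0 := by
  refine Finset.sum_eq_zero fun i _ => ?_
  have : loc I P i (0 : DForm I X k) = 0 := by
    funext y; simp [loc, inChart_zero]
  rw [this, eLpNorm_zero]

theorem nrm_sum_le {m : ℕ} {u : Fin m → DForm I X k} (hu : ∀ i, AEMeas I μ (u i)) :
    nrm I μ P (∑ i, u i) ≤ ∑ i, nrm I μ P (u i) :=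
  Finset.le_sum_of_subadditive_on_pred (fun u : DForm I X k => nrm I μ P u)
    (fun u => AEMeas I μ u) (nrm_zero I μ P).le (fun _ _ hu hv => nrm_add_le I μ P hu hv)
    (fun _ _ hu hv => hu.add I μ hv) _ fun i _ => hu i

theorem IsSmooth.nrm_lt_top {u : DForm I X k} (hu : IsSmooth I u) : nrm I μ P u < ⊤ :=
  ENNReal.sum_lt_top.2 fun i _ =>
    ((hu.contDiff_loc I P i).continuous.memLp_of_hasCompactSupport
      (hasCompactSupport_loc I P u i)).2

theorem eLpNorm_loc_le (u : DForm I X k) (i : Fin P.m) :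
    eLpNorm (loc I P i u) 2 μ ≤ nrm I μ P u :=
  Finset.single_le_sum (f := fun i => eLpNorm (loc I P i u) 2 μ) (fun _ _ => zero_le)
    (Finset.mem_univ i)

theorem exists_nnbound {χ : E → ℝ} (hχ : Continuous χ) (hc : HasCompactSupport χ) :
    ∃ C : NNReal, ∀ y, |χ y| ≤ C := by
  obtain ⟨C, hC⟩ := hc.exists_bound_of_continuous hχ
  exact ⟨⟨C, (norm_nonneg _).trans (hC 0)⟩, hC⟩

/-- Decomposing `u` by the partition and changing charts piece by piece, `nrm` controls every
compactly localised coordinate expression, in any chart. -/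
theorem eLpNorm_smul_inChart_le [T2Space X] {x₀ : X} {χ : E → ℝ} (hχ : Continuous χ)
    (hc : HasCompactSupport χ) (hs : tsupport χ ⊆ (extChartAt I x₀).target) (k : ℕ) :
    ∃ C : NNReal, ∀ u : DForm I X k, AEMeas I μ u →
      eLpNorm (fun y => χ y • inChart I u x₀ y) 2 μ ≤ C * nrm I μ P u := by
  obtain ⟨B, hB⟩ := exists_nnbound hχ hc
  choose C hC using fun i => eLpNorm_inChart_fromChart_le I μ (k := k) (x₀ := x₀) hc
    (P.compact i) hs (P.subset i)
  refine ⟨B * ∑ i, C i, fun u hu => (eLpNorm_smul_le_restrict μ hB _).trans ?_⟩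
  rw [ENNReal.coe_mul, mul_assoc]
  gcongr
  have h1 : inChart I u x₀ = ∑ i, inChart I (fromChart I (P.c i) (loc I P i u)) x₀ := by
    rw [← inChart_sum, sum_fromChart_loc]
  rw [h1, ENNReal.ofNNReal_finsetSum, Finset.sum_mul]
  refine (eLpNorm_sum_le (fun i _ => ?_) (by norm_num)).trans (Finset.sum_le_sum fun i _ => ?_)
  · exact (aeMeas_fromChart I μ (hu.loc I μ P i) x₀).mono_measure (Measure.restrict_mono hs le_rfl)
  · refine (hC i _ fun y hy => loc_eq_zero I P i u hy).trans ?_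
    gcongr
    exact eLpNorm_loc_le I μ P u i

/-- The converse direction of control: forms supported in a fixed compact part of one chart are
bounded in `nrm` by their coordinate expression. -/
theorem nrm_fromChart_le [T2Space X] {x₁ : X} {K : Set E} (hK : IsCompact K)
    (hKt : K ⊆ (extChartAt I x₁).target) (k : ℕ) :
    ∃ C : NNReal, ∀ f : E → E [⋀^Fin k]→L[ℝ] ℝ, (∀ y ∉ K, f y = 0) →
      nrm I μ P (fromChart I x₁ f) ≤ C * eLpNorm f 2 μ := by
  choose B hB using fun i => exists_nnbound (P.contDiff i).continuous (P.compact i)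
  choose C hC using fun i => eLpNorm_inChart_fromChart_le I μ (k := k) (P.compact i) hK
    (P.subset i) hKt
  refine ⟨∑ i, B i * C i, fun f hf => ?_⟩
  rw [ENNReal.ofNNReal_finsetSum, Finset.sum_mul]
  refine Finset.sum_le_sum fun i _ => (eLpNorm_smul_le_restrict μ (hB i) _).trans ?_
  rw [ENNReal.coe_mul, mul_assoc]
  gcongr
  exact hC i f hf

/-- With `e` the closed form of `closed_correction`, `v` the cut-off form and `B` the homotopy
operator, `φ σ - e` is `φ (ρ*v) - dφ ∧ Bv + φ B(χ dσ)`. The first term is finite rank up to a small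
error, the second is of order `δ`, and the third is controlled by `dσ`. -/
theorem local_correction [T2Space X] {x₁ : X} {φ : E → ℝ} (hφ : ContDiff ℝ ∞ φ)
    (hφc : HasCompactSupport φ) (hφs : tsupport φ ⊆ (extChartAt I x₁).target) (k : ℕ)
    {θ : NNReal} (hθ : 0 < θ) :
    ∃ (M : ℕ) (χ : E → ℝ) (D : Fin M → Set E) (C : NNReal), ContDiff ℝ ∞ χ ∧
      HasCompactSupport χ ∧ tsupport χ ⊆ (extChartAt I x₁).target ∧ (∀ j, MeasurableSet (D j)) ∧
      ∀ σ : DForm I X k, IsSmooth I σ → ∃ e : E → E [⋀^Fin k]→L[ℝ] ℝ, ContDiff ℝ ∞ e ∧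
        extDeriv e = 0 ∧ (∀ y ∉ tsupport φ, e y = 0) ∧
        eLpNorm (fun y => φ y • inChart I σ x₁ y - e y) 2 μ ≤ θ * nrm I μ P σ +
          C * ∑ j, ‖∫ y in D j, χ y • inChart I σ x₁ y ∂μ‖ₑ + C * nrm I μ P (extD I σ) := by
  obtain ⟨χ, δ₀, hχ, hχc, hχs, -, hδ₀, hχ1⟩ := exists_cutoff hφc (isOpen_extChartAt_target x₁) hφs
  obtain ⟨A, hA⟩ := eLpNorm_smul_inChart_le I μ P hχ.continuous hχc hχs k
  obtain ⟨A', hA'⟩ := eLpNorm_smul_inChart_le I μ P hχ.continuous hχc hχs (k + 1)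
  obtain ⟨B, hB0, hB1, hB2⟩ := exists_bound_fderiv hφ hφc
  lift B to NNReal using hB0
  set Λ : NNReal := ‖leibniz E k‖₊ with hΛ
  -- The first bound keeps the kernels within reach of the cutoff; the second makes the commutator
  -- term at most `θ / 2` times the norm of `σ`. The cells are chosen afterwards, for this `δ`.
  set δ : NNReal := min (Real.toNNReal δ₀) (θ / 2 / (B * Λ * A + 1)) with hδdef
  have hδ : 0 < δ := by
    rw [hδdef, lt_min_iff]
    exact ⟨Real.toNNReal_pos.2 hδ₀, by positivity⟩
  have hδr : (0 : ℝ) < δ := hδ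
  have hδδ₀ : (δ : ℝ) ≤ δ₀ := by
    have : δ ≤ Real.toNNReal δ₀ := min_le_left _ _
    rw [← NNReal.coe_le_coe, Real.coe_toNNReal _ hδ₀.le] at this
    exact this
  have hδA : B * (Λ * δ) * A ≤ θ / 2 := by
    have h1 : δ ≤ θ / 2 / (B * Λ * A + 1) := min_le_right _ _
    calc B * (Λ * δ) * A = δ * (B * Λ * A) := by ring
      _ ≤ (θ / 2 / (B * Λ * A + 1)) * (B * Λ * A + 1) := by
          gcongr; exact le_self_add
      _ = θ / 2 := by field_simp
  -- The other half of `θ` is spent on the finite rank approximation; `A` is the cost of bounding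
  -- the cut-off form by `nrm`.
  obtain ⟨M, D, C, hDm, hD⟩ := eLpNorm_mollify_le_cells μ (k := k) hχc (δ : ℝ) hφ hφc
    (ε := θ / 2 / (A + 1)) (by positivity)
  have hεA : (θ / 2 / (A + 1)) * A ≤ θ / 2 := by
    calc (θ / 2 / (A + 1)) * A ≤ (θ / 2 / (A + 1)) * (A + 1) := by gcongr; exact le_self_add
      _ = θ / 2 := by field_simp
  refine ⟨M, χ, D, C + B * ((‖contract E k‖₊ * δ) * A'), hχ, hχc, hχs, hDm, fun σ hσ => ?_⟩
  set u := inChart I σ x₁ with hu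
  set v : E → E [⋀^Fin k]→L[ℝ] ℝ := fun z => χ z • u z with hv
  set w : E → E [⋀^Fin (k + 1)]→L[ℝ] ℝ := fun z => χ z • extDeriv u z with hw
  obtain ⟨he1, he2, he3⟩ := closed_correction μ hδr (isOpen_extChartAt_target x₁) (hσ x₁) hχ hφ hχs
    hχc (fun x hx z hz => hχ1 x hx z (hz.trans_le hδδ₀)) (e := fun x => φ x • u x -
      regOp μ δ φ v x - φ x • homOp μ δ w x) (fun x => rfl)
  refine ⟨_, he1, funext he2, he3, ?_⟩
  have hvc : ContDiff ℝ ∞ v := hσ.contDiff_smul I hχ hχs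
  have hw' : w = fun z => χ z • inChart I (extD I σ) x₁ z := by
    funext z
    by_cases hz : z ∈ tsupport χ
    · rw [hw, inChart_extD I (hχs hz) ((isSmooth_iff I).1 hσ _)]
    · simp [hw, image_eq_zero_of_notMem_tsupport hz]
  have hvm := hvc.continuous.aestronglyMeasurable (μ := μ)
  have hwm : AEStronglyMeasurable w μ := by
    rw [hw']
    exact (hσ.extD.contDiff_smul I hχ hχs).continuous.aestronglyMeasurable
  have hvL : MemLp v 2 μ := hvc.continuous.memLp_of_hasCompactSupport hχc.smul_right
  have hfun : (fun y => φ y • inChart I σ x₁ y - (φ y • u y - regOp μ δ φ v y -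
      φ y • homOp μ δ w y)) = ((fun y => φ y • mollify μ δ v y) -
      fun y => comOp μ δ v y (fderiv ℝ φ y)) + fun y => φ y • homOp μ δ w y := by
    funext y
    simp only [regOp, Pi.add_apply, Pi.sub_apply, ← hu]
    abel
  have m1 : AEStronglyMeasurable (fun y => φ y • mollify μ δ v y) μ :=
    hφ.continuous.aestronglyMeasurable.smul (aestronglyMeasurable_mollify μ hvm)
  have m2 := aestronglyMeasurable_comOp_fderiv μ hδr hφ hvm
  have m3 : AEStronglyMeasurable (fun y => φ y • homOp μ δ w y) μ :=
    hφ.continuous.aestronglyMeasurable.smul (aestronglyMeasurable_homOp μ hδr hwm)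
  have hvA : eLpNorm v 2 μ ≤ A * nrm I μ P σ := hA σ (hσ.aeMeas I μ)
  have hwA : eLpNorm w 2 μ ≤ A' * nrm I μ P (extD I σ) := by
    rw [hw']
    exact hA' _ (hσ.extD.aeMeas I μ)
  have b1 := hD v hvL fun x hx => by
    simp only [hv]
    rw [image_eq_zero_of_notMem_tsupport hx, zero_smul]
  have b2 := eLpNorm_comOp_fderiv_le μ hδr hB2 hvm
  have b3 := (eLpNorm_smul_le_of_bound μ hB1 (homOp μ δ w)).trans
    (mul_le_mul_right (eLpNorm_homOp_le μ hδr hwm) _)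
  rw [hfun]
  refine (eLpNorm_add_le (m1.sub m2) m3 (by norm_num)).trans ?_
  refine (add_le_add ((eLpNorm_sub_le m1 m2 (by norm_num)).trans (add_le_add b1 b2)) b3).trans ?_
  rw [ENNReal.ofReal_coe_nnreal, ENNReal.ofReal_coe_nnreal]
  set N := nrm I μ P σ
  set N' := nrm I μ P (extD I σ)
  set T := ∑ j, ‖∫ y in D j, v y ∂μ‖ₑ
  have c1 : ((θ / 2 / (A + 1) : NNReal) : ENNReal) * eLpNorm v 2 μ ≤ (θ / 2 : NNReal) * N := by
    refine (mul_le_mul_right hvA _).trans ?_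
    rw [← mul_assoc, ← ENNReal.coe_mul]
    gcongr
  have c2 : (B : ENNReal) * (‖leibniz E k‖ₑ * δ) * eLpNorm v 2 μ ≤ (θ / 2 : NNReal) * N := by
    refine (mul_le_mul_right hvA _).trans ?_
    rw [← mul_assoc]
    have h1 : (B : ENNReal) * (‖leibniz E k‖ₑ * δ) * A = (B * (Λ * δ) * A : NNReal) := by
      push_cast
      rfl
    rw [h1]
    gcongr
  have c3 : (B : ENNReal) * (‖contract E k‖ₑ * δ * eLpNorm w 2 μ) ≤
      (B * ((‖contract E k‖₊ * δ) * A') : NNReal) * N' := by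
    refine (mul_le_mul_right (mul_le_mul_right hwA _) _).trans (le_of_eq ?_)
    push_cast
    rw [enorm_eq_nnnorm]
    ring
  have hθ2 : (θ : ENNReal) = (θ / 2 : NNReal) + (θ / 2 : NNReal) := by
    rw [← ENNReal.coe_add, add_halves]
  calc _ ≤ ((θ / 2 : NNReal) * N + C * T + (θ / 2 : NNReal) * N) +
        (B * ((‖contract E k‖₊ * δ) * A') : NNReal) * N' :=
        add_le_add (add_le_add (add_le_add c1 le_rfl) c2) c3
    _ = θ * N + C * T + (B * ((‖contract E k‖₊ * δ) * A') : NNReal) * N' := by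
        rw [hθ2]; ring
    _ ≤ _ := by
        gcongr
        · exact_mod_cast le_self_add
        · exact_mod_cast le_add_self

end Seminorm

end L2Forms
end

noncomputable section

namespace L2Forms

set_option maxSynthPendingDepth 5

/-! ### The global estimate and convergence of primitives. -/

section ClosedRangeForms

open scoped Topology
open Filter

variable {E H : Type*} [NormedAddCommGroup E] [NormedSpace ℝ E] [TopologicalSpace H]
  (I : ModelWithCorners ℝ E H) [I.Boundaryless]
  {X : Type*} [TopologicalSpace X] [ChartedSpace H X] [IsManifold I ∞ X] [FiniteDimensional ℝ E]
  [MeasurableSpace E] [BorelSpace E] (μ : Measure E) [μ.IsAddHaarMeasure] {k : ℕ}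
  (P : ChartPartition I X)

instance : FiniteDimensional ℝ (E [⋀^Fin k]→L[ℝ] ℝ) :=
  FiniteDimensional.of_injective (coords (Module.finBasis ℝ E)).toLinearMap (coords_injective _)

/-- The space of smooth forms. -/
def smoothForms (X : Type*) [TopologicalSpace X] [ChartedSpace H X] (k : ℕ) :
    Submodule ℝ (DForm I X k) where
  carrier := {u | IsSmooth I u}
  add_mem' := fun ha hb => ha.add I hb
  zero_mem' := isSmooth_zero I
  smul_mem' := fun c _ ha => ha.smul I c

/-- The exterior derivative on smooth forms. -/
def dMap (X : Type*) [TopologicalSpace X] [ChartedSpace H X] [IsManifold I ∞ X] (k : ℕ) :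
    smoothForms I X k →ₗ[ℝ] smoothForms I X (k + 1) where
  toFun u := ⟨extD I u, IsSmooth.extD I u.2⟩
  map_add' u v := Subtype.ext (extD_add I u.2 v.2)
  map_smul' c _ := Subtype.ext (extD_smul I c _)

theorem integral_cell_bound [T2Space X] {x₁ : X} {χ : E → ℝ} (hχ : ContDiff ℝ ∞ χ)
    (hc : HasCompactSupport χ) (hs : tsupport χ ⊆ (extChartAt I x₁).target) (k : ℕ) (D : Set E) :
    ∃ C : NNReal, ∀ σ : DForm I X k, IsSmooth I σ →
      ‖∫ y in D, χ y • inChart I σ x₁ y ∂μ‖ₑ ≤ C * nrm I μ P σ := by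
  obtain ⟨A, hA⟩ := eLpNorm_smul_inChart_le I μ P hχ.continuous hc hs k
  obtain ⟨B, hB⟩ := eLpNorm_one_le (F := E [⋀^Fin k]→L[ℝ] ℝ) μ hc
  refine ⟨B * A, fun σ hσ => ?_⟩
  have h1 := hB (fun y => χ y • inChart I σ x₁ y)
    (hσ.contDiff_smul I hχ hs).continuous.aestronglyMeasurable
    (fun x hx => by rw [image_eq_zero_of_notMem_tsupport hx, zero_smul])
  calc ‖∫ y in D, χ y • inChart I σ x₁ y ∂μ‖ₑ
      ≤ ∫⁻ y in D, ‖χ y • inChart I σ x₁ y‖ₑ ∂μ := enorm_integral_le_lintegral_enorm _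
    _ ≤ ∫⁻ y, ‖χ y • inChart I σ x₁ y‖ₑ ∂μ := setLIntegral_le_lintegral _ _
    _ = eLpNorm (fun y => χ y • inChart I σ x₁ y) 1 μ := eLpNorm_one_eq_lintegral_enorm.symm
    _ ≤ B * (A * nrm I μ P σ) := h1.trans (mul_le_mul_right (hA σ (hσ.aeMeas I μ)) _)
    _ = _ := by push_cast; ring

theorem enorm_pi_le_sum {κ G : Type*} [Fintype κ] [NormedAddCommGroup G] (x : κ → G) :
    ‖x‖ₑ ≤ ∑ p, ‖x p‖ₑ := by
  have h : ‖x‖₊ ≤ ∑ p, ‖x p‖₊ := (pi_nnnorm_le_iff).2 fun p =>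
    Finset.single_le_sum (f := fun p => ‖x p‖₊) (fun _ _ => zero_le) (Finset.mem_univ p)
  simp only [enorm_eq_nnnorm, ← ENNReal.ofNNReal_finsetSum]
  exact ENNReal.coe_le_coe.2 h

theorem enorm_apply_le_pi {κ G : Type*} [Fintype κ] [NormedAddCommGroup G] (x : κ → G) (p : κ) :
    ‖x p‖ₑ ≤ ‖x‖ₑ := ENNReal.coe_le_coe.2 (nnnorm_le_pi_nnnorm x p)

/-- The elliptic estimate: modulo closed forms, a form is controlled by its exterior derivative
and finitely many linear functionals, up to an arbitrarily small multiple of itself. -/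
theorem global_correction [T2Space X] (k : ℕ) {θ : NNReal} (hθ : 0 < θ) :
    ∃ (κ : Type) (_ : Fintype κ) (L : smoothForms I X k →ₗ[ℝ] (κ → E [⋀^Fin k]→L[ℝ] ℝ))
      (C : NNReal), (∀ σ, ‖L σ‖ₑ ≤ C * nrm I μ P (σ : DForm I X k)) ∧
      ∀ σ : smoothForms I X k, ∃ z : smoothForms I X k, extD I (z : DForm I X k) = 0 ∧
        nrm I μ P (σ - z : DForm I X k) ≤ θ * nrm I μ P (σ : DForm I X k) + C * ‖L σ‖ₑ +
          C * nrm I μ P (extD I (σ : DForm I X k)) := by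
  choose B hB using fun i => nrm_fromChart_le I μ P (P.compact i) (P.subset i) k
  -- Transferring chart `i` to the manifold costs `B i`, and `P.m` charts are summed; the division
  -- makes the total error at most `θ`.
  choose M χ D C hχ hχc hχs hDm hloc using fun i => local_correction I μ P (P.contDiff i)
    (P.compact i) (P.subset i) k (θ := θ / ((P.m + 1) * (B i + 1))) (by positivity)
  choose A hA using fun p : Σ i, Fin (M i) =>
    integral_cell_bound I μ P (hχ p.1) (hχc p.1) (hχs p.1) k (D p.1 p.2)
  have hint : ∀ i (σ : smoothForms I X k) (S : Set E),
      IntegrableOn (fun y => χ i y • inChart I (σ : DForm I X k) (P.c i) y) S μ := fun i σ S =>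
    ((IsSmooth.contDiff_smul I σ.2 (hχ i) (hχs i)).continuous.integrable_of_hasCompactSupport
      (hχc i).smul_right).integrableOn
  let L : smoothForms I X k →ₗ[ℝ] ((Σ i, Fin (M i)) → E [⋀^Fin k]→L[ℝ] ℝ) :=
    { toFun := fun σ p =>
        ∫ y in D p.1 p.2, χ p.1 y • inChart I (σ : DForm I X k) (P.c p.1) y ∂μ
      map_add' := fun σ τ => by
        funext p
        rw [Pi.add_apply, ← integral_add (hint _ _ _) (hint _ _ _)]
        congr 1
        funext y
        rw [← smul_add]
        rfl
      map_smul' := fun c σ => by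
        funext p
        rw [RingHom.id_apply, Pi.smul_apply, ← integral_smul]
        congr 1
        funext y
        rw [smul_comm]
        rfl }
  refine ⟨Σ i, Fin (M i), inferInstance, L, ∑ p, A p + ∑ i, B i * (C i * (M i + 1)), fun σ => ?_,
    fun σ => ?_⟩
  · refine (enorm_pi_le_sum _).trans ?_
    calc ∑ p, ‖L σ p‖ₑ ≤ ∑ p, (A p : ENNReal) * nrm I μ P (σ : DForm I X k) :=
          Finset.sum_le_sum fun p _ => hA p _ σ.2
      _ = (∑ p, A p : NNReal) * nrm I μ P (σ : DForm I X k) := by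
          rw [← Finset.sum_mul, ENNReal.ofNNReal_finsetSum]
      _ ≤ _ := by gcongr; exact le_self_add
  choose e he1 he2 he3 he4 using fun i => hloc i σ σ.2
  -- The closed corrections of the charts, extended by zero, are closed on the manifold and so is
  -- their sum; the error then splits over the charts.
  have hz : ∑ i, fromChart I (P.c i) (e i) ∈ closedForms I X k :=
    Submodule.sum_mem _ fun i _ => ⟨isSmooth_fromChart I (P.compact i) (P.subset i) (he3 i) (he1 i),
      extD_fromChart_eq_zero I (P.compact i) (P.subset i) (he3 i) (he1 i) (he2 i)⟩
  refine ⟨⟨_, hz.1⟩, hz.2, ?_⟩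
  have hσz : (σ : DForm I X k) - ∑ i, fromChart I (P.c i) (e i) =
      ∑ i, fromChart I (P.c i) (loc I P i (σ : DForm I X k) - e i) := by
    simp_rw [fromChart_sub]
    rw [Finset.sum_sub_distrib, sum_fromChart_loc]
  simp only
  rw [hσz]
  set N := nrm I μ P (σ : DForm I X k)
  set N' := nrm I μ P (extD I (σ : DForm I X k))
  refine (nrm_sum_le I μ P fun i => aeMeas_fromChart I μ ?_).trans ?_
  · exact ((IsSmooth.contDiff_loc I P σ.2 i).continuous.sub
      (he1 i).continuous).aestronglyMeasurable
  have hi : ∀ i, nrm I μ P (fromChart I (P.c i) (loc I P i (σ : DForm I X k) - e i)) ≤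
      (θ / (P.m + 1) : NNReal) * N + ((B i * (C i * (M i + 1)) : NNReal) * ‖L σ‖ₑ +
        (B i * (C i * (M i + 1)) : NNReal) * N') := by
    intro i
    have h1 := hB i (loc I P i (σ : DForm I X k) - e i) fun y hy => by
      rw [Pi.sub_apply, loc_eq_zero I P i _ hy, he3 i y hy, sub_zero]
    refine h1.trans ((mul_le_mul_right (he4 i) _).trans ?_)
    have h2 : ∑ j, ‖∫ y in D i j, χ i y • inChart I (σ : DForm I X k) (P.c i) y ∂μ‖ₑ ≤
        M i * ‖L σ‖ₑ := by
      refine (Finset.sum_le_sum fun j _ => enorm_apply_le_pi (L σ) ⟨i, j⟩).trans ?_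
      simp
    have h3 : B i * (θ / ((P.m + 1) * (B i + 1))) ≤ θ / (P.m + 1) := by
      rw [← div_div, mul_div_assoc', div_le_iff₀ (by positivity), mul_comm]
      gcongr
      exact le_self_add
    have h4 : (B i : ENNReal) * (C i * ∑ j, ‖∫ y in D i j,
        χ i y • inChart I (σ : DForm I X k) (P.c i) y ∂μ‖ₑ) ≤
        (B i * (C i * (M i + 1)) : NNReal) * ‖L σ‖ₑ := by
      calc _ ≤ (B i : ENNReal) * (C i * ((M i + 1 : NNReal) * ‖L σ‖ₑ)) := by
            gcongr
            refine h2.trans ?_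
            gcongr
            push_cast
            exact le_self_add
        _ = _ := by push_cast; ring
    have h5 : (B i : ENNReal) * (C i * N') ≤ (B i * (C i * (M i + 1)) : NNReal) * N' := by
      calc (B i : ENNReal) * (C i * N') ≤ B i * (C i * ((M i + 1 : NNReal) * N')) := by
            gcongr
            refine le_mul_of_one_le_left' ?_
            push_cast
            exact le_add_self
        _ = _ := by push_cast; ring
    rw [mul_add, mul_add, add_assoc, ← mul_assoc, ← ENNReal.coe_mul]
    exact add_le_add (mul_le_mul_left (ENNReal.coe_le_coe.2 h3) _) (add_le_add h4 h5)
  refine (Finset.sum_le_sum fun i _ => hi i).trans ?_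
  rw [Finset.sum_add_distrib, Finset.sum_add_distrib, ← Finset.sum_mul, ← Finset.sum_mul,
    ← Finset.sum_mul, ← ENNReal.ofNNReal_finsetSum, ← ENNReal.ofNNReal_finsetSum, ← add_assoc]
  gcongr
  · rw [Finset.sum_const, Finset.card_univ, Fintype.card_fin, nsmul_eq_mul, mul_div_assoc',
      div_le_iff₀ (by positivity), mul_comm]
    gcongr
    exact le_self_add
  · exact le_add_self
  · exact le_add_self

variable {ι : Type*} [Fintype ι] (b : Module.Basis ι ℝ E)

/-- The coordinates of an alternating form, as an element of a Euclidean space. -/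
def euclCoords (k : ℕ) : (E [⋀^Fin k]→L[ℝ] ℝ) →L[ℝ] EuclideanSpace ℝ (Fin k → ι) :=
  ((EuclideanSpace.equiv (Fin k → ι) ℝ).symm : _ →L[ℝ] _).comp (coords b)

/-- A left inverse of `euclCoords`. -/
def euclRecon (k : ℕ) : EuclideanSpace ℝ (Fin k → ι) →L[ℝ] (E [⋀^Fin k]→L[ℝ] ℝ) :=
  (recon b).comp ((EuclideanSpace.equiv (Fin k → ι) ℝ) : _ →L[ℝ] _)

theorem euclRecon_euclCoords (α : E [⋀^Fin k]→L[ℝ] ℝ) :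
    euclRecon b k (euclCoords b k α) = α := by
  exact recon_coords b α

theorem euclCoords_apply (α : E [⋀^Fin k]→L[ℝ] ℝ) (J : Fin k → ι) :
    euclCoords b k α J = α fun a => b (J a) := rfl

theorem eLpNorm_clm_le {α F G : Type*} [MeasurableSpace α] {ν : Measure α} [NormedAddCommGroup F]
    [NormedSpace ℝ F] [NormedAddCommGroup G] [NormedSpace ℝ G] (A : F →L[ℝ] G) (f : α → F) :
    eLpNorm (fun x => A (f x)) 2 ν ≤ ‖A‖₊ * eLpNorm f 2 ν :=
  eLpNorm_le_nnreal_smul_eLpNorm_of_ae_le_mul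
    (Eventually.of_forall fun x => A.le_opNNNorm (f x)) 2

theorem memLp_euclCoords_loc {u : DForm I X k} (hu : IsSmooth I u) (i : Fin P.m) :
    MemLp (fun y => euclCoords b k (loc I P i u y)) 2 μ :=
  (euclCoords b k).comp_memLp' ((hu.contDiff_loc I P i).continuous.memLp_of_hasCompactSupport
    (hasCompactSupport_loc I P u i))

/-- The Hilbert space of tuples of localised square integrable forms. -/
abbrev LocL2 (k m : ℕ) : Type _ :=
  PiLp 2 fun _ : Fin m => Lp (EuclideanSpace ℝ (Fin k → ι)) 2 μ

/-- The embedding of the smooth forms into a Hilbert space, by localisation. -/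
def jMap (k : ℕ) : smoothForms I X k →ₗ[ℝ] LocL2 μ (ι := ι) k P.m where
  toFun u := WithLp.toLp 2 fun i => (memLp_euclCoords_loc I μ P b u.2 i).toLp _
  map_add' u v := by
    ext1 i
    have hu := memLp_euclCoords_loc I μ P b u.2 i
    have hv := memLp_euclCoords_loc I μ P b v.2 i
    refine (MemLp.toLp_congr (memLp_euclCoords_loc I μ P b (u + v).2 i) (hu.add hv)
      (Eventually.of_forall fun y => ?_)).trans (MemLp.toLp_add hu hv)
    simp [loc_add]
  map_smul' c u := by
    ext1 i
    have hu := memLp_euclCoords_loc I μ P b u.2 i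
    refine (MemLp.toLp_congr (memLp_euclCoords_loc I μ P b (c • u).2 i) (hu.const_smul c)
      (Eventually.of_forall fun y => ?_)).trans (MemLp.toLp_const_smul c hu)
    simp [loc_smul]

theorem jMap_apply (u : smoothForms I X k) (i : Fin P.m) :
    jMap I μ P b k u i = (memLp_euclCoords_loc I μ P b u.2 i).toLp _ := rfl

theorem enorm_piLp_le_sum {m : ℕ} {G : Type*} [NormedAddCommGroup G]
    (x : PiLp 2 fun _ : Fin m => G) : ‖x‖ₑ ≤ ∑ i, ‖x i‖ₑ := by
  have h : ‖x‖₊ ≤ ∑ i, ‖x i‖₊ := by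
    rw [← NNReal.coe_le_coe]
    push_cast
    rw [PiLp.norm_eq_of_L2]
    refine Real.sqrt_le_iff.2 ⟨Finset.sum_nonneg fun _ _ => norm_nonneg _, ?_⟩
    exact Finset.sum_sq_le_sq_sum_of_nonneg fun _ _ => norm_nonneg _
  simp only [enorm_eq_nnnorm, ← ENNReal.ofNNReal_finsetSum]
  exact ENNReal.coe_le_coe.2 h

theorem enorm_piLp_apply_le {m : ℕ} {G : Type*} [NormedAddCommGroup G]
    (x : PiLp 2 fun _ : Fin m => G) (i : Fin m) : ‖x i‖ₑ ≤ ‖x‖ₑ :=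
  ENNReal.coe_le_coe.2 (PiLp.nnnorm_apply_le x i)

/-- Together with `nrm_le_enorm_jMap` this makes `nrm` equivalent to the norm of a Hilbert space, as
the orthogonal projections of the closed range argument require. -/
theorem enorm_jMap_le (u : smoothForms I X k) :
    ‖jMap I μ P b k u‖ₑ ≤ ‖euclCoords b k‖₊ * nrm I μ P (u : DForm I X k) := by
  refine (enorm_piLp_le_sum _).trans ?_
  rw [nrm, Finset.mul_sum]
  refine Finset.sum_le_sum fun i _ => ?_
  rw [jMap_apply, Lp.enorm_toLp]
  exact eLpNorm_clm_le _ _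

/-- A point of the Hilbert space need not vanish off the supports of the partition; truncating it
there costs nothing, because localised forms do vanish. -/
theorem eLpNorm_loc_sub_le (u : smoothForms I X k) (x : LocL2 μ (ι := ι) k P.m) (i : Fin P.m) :
    eLpNorm (fun y => loc I P i (u : DForm I X k) y - (tsupport (P.φ i)).indicator
      (fun y => euclRecon b k (x i y)) y) 2 μ ≤
      ‖euclRecon (E := E) b k‖₊ * ‖jMap I μ P b k u - x‖ₑ := by
  have h1 : eLpNorm (fun y => loc I P i (u : DForm I X k) y - (tsupport (P.φ i)).indicator
      (fun y => euclRecon b k (x i y)) y) 2 μ ≤ ‖euclRecon (E := E) b k‖₊ *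
      eLpNorm (fun y => euclCoords b k (loc I P i (u : DForm I X k) y) - x i y) 2 μ := by
    refine eLpNorm_le_nnreal_smul_eLpNorm_of_ae_le_mul (Eventually.of_forall fun y => ?_) 2
    by_cases hy : y ∈ tsupport (P.φ i)
    · rw [Set.indicator_of_mem hy]
      refine le_trans (le_of_eq ?_) ((euclRecon (E := E) b k).le_opNNNorm _)
      rw [map_sub, euclRecon_euclCoords]
    · rw [Set.indicator_of_notMem hy, loc_eq_zero I P i _ hy]
      simp
  refine h1.trans (mul_le_mul_right ?_ _)
  refine le_trans (le_of_eq ?_) (enorm_piLp_apply_le _ i)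
  rw [PiLp.sub_apply, jMap_apply, Lp.enorm_def]
  refine eLpNorm_congr_ae ?_
  filter_upwards [Lp.coeFn_sub ((memLp_euclCoords_loc I μ P b u.2 i).toLp _) (x i),
    (memLp_euclCoords_loc I μ P b u.2 i).coeFn_toLp] with y h1 h2
  rw [h1, Pi.sub_apply, h2]

theorem nrm_le_enorm_jMap (u : smoothForms I X k) :
    nrm I μ P (u : DForm I X k) ≤
      (P.m * ‖euclRecon (E := E) b k‖₊ : NNReal) * ‖jMap I μ P b k u‖ₑ := by
  have h : ∀ i, eLpNorm (loc I P i (u : DForm I X k)) 2 μ ≤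
      ‖euclRecon (E := E) b k‖₊ * ‖jMap I μ P b k u‖ₑ := by
    intro i
    have h1 : eLpNorm (loc I P i (u : DForm I X k)) 2 μ ≤ ‖euclRecon (E := E) b k‖₊ *
        eLpNorm (fun y => euclCoords b k (loc I P i (u : DForm I X k) y)) 2 μ := by
      refine le_trans (le_of_eq ?_) (eLpNorm_clm_le _ _)
      simp_rw [euclRecon_euclCoords]
    refine h1.trans (mul_le_mul_right (le_trans (le_of_eq ?_) (enorm_piLp_apply_le _ i)) _)
    rw [jMap_apply, Lp.enorm_toLp]
  refine (Finset.sum_le_sum fun i _ => h i).trans (le_of_eq ?_)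
  rw [Finset.sum_const, Finset.card_univ, Fintype.card_fin, nsmul_eq_mul]
  push_cast
  ring

/-- The coefficient of `a` is at most `C₁ C₂ / (2 (C₁ C₂ + 1)) ≤ 1 / 2`, the factor demanded by the
closed range argument. -/
theorem correction_arith (C₁ C₂ C₃ C a l c : NNReal) :
    (C₁ * (1 / 2 / (C₁ * C₂ + 1) * (C₂ * a) + C * l + C * (C₃ * c)) : ℝ) ≤
      (C * C₂ + C₁ * C + C₁ * C * C₃) * c + 1 / 2 * a + (C * C₂ + C₁ * C + C₁ * C * C₃) * l := by
  have q1 : (C₁ : ℝ) * (1 / 2 / (C₁ * C₂ + 1) * (C₂ * a)) ≤ 1 / 2 * a := by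
    have h0 : (0 : ℝ) < C₁ * C₂ + 1 := by positivity
    have h5 : (C₁ : ℝ) * (1 / 2 / (C₁ * C₂ + 1) * (C₂ * a)) =
        1 / 2 * (C₁ * C₂ / (C₁ * C₂ + 1)) * a := by ring
    rw [h5]
    gcongr
    refine mul_le_of_le_one_right (by norm_num) ?_
    rw [div_le_one h0]
    linarith
  have q2 : (0 : ℝ) ≤ C * C₂ * c + C₁ * C * c + (C * C₂ * l + C₁ * C * C₃ * l) := by positivity
  nlinarith

/-- `exists_tendsto_of_mem_closure` applied to forms and their derivatives, with `global_correction`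
as the required estimate. The Hilbert space limit of the localisations is glued back to a form that
is only measurable. -/
theorem exists_tendsto_nrm [T2Space X] (h : smoothForms I X (k + 1))
    (hcl : jMap I μ P b (k + 1) h ∈
      closure (Set.range ((jMap I μ P b (k + 1)).comp (dMap I X k)))) :
    ∃ (s : ℕ → smoothForms I X k) (σ : DForm I X k), AEMeas I μ σ ∧
      Tendsto (fun n => nrm I μ P (s n - σ : DForm I X k)) atTop (𝓝 0) ∧
      Tendsto (fun n => nrm I μ P (extD I (s n : DForm I X k) - (h : DForm I X (k + 1)))) atTop (𝓝 0) := by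
  set C₁ : NNReal := ‖euclCoords b k‖₊ with hC₁
  set C₂ : NNReal := P.m * ‖euclRecon (E := E) b k‖₊ with hC₂
  set C₃ : NNReal := P.m * ‖euclRecon (E := E) b (k + 1)‖₊ with hC₃
  -- `C₁` and `C₂` are the equivalence constants in degree `k`; this `θ` leaves at most one half
  -- after both conversions.
  have hθ : (0 : NNReal) < 1 / 2 / (C₁ * C₂ + 1) := by positivity
  obtain ⟨κ, _, L, C, hL, hcorr⟩ := global_correction I μ P k hθ
  set C' : NNReal := C * C₂ + C₁ * C + C₁ * C * C₃ with hC'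
  have hL' : ∀ σ, ‖L σ‖ ≤ C' * ‖jMap I μ P b k σ‖ := by
    intro σ
    have h1 : ‖L σ‖ₑ ≤ (C * C₂ : NNReal) * ‖jMap I μ P b k σ‖ₑ := by
      refine (hL σ).trans ((mul_le_mul_right (nrm_le_enorm_jMap I μ P b σ) _).trans (le_of_eq ?_))
      rw [ENNReal.coe_mul C C₂, mul_assoc]
    have h2 : ‖L σ‖₊ ≤ C * C₂ * ‖jMap I μ P b k σ‖₊ := by
      rw [← ENNReal.coe_le_coe, ENNReal.coe_mul]
      exact h1
    have h3 : ‖L σ‖₊ ≤ C' * ‖jMap I μ P b k σ‖₊ := by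
      refine h2.trans ?_
      gcongr
      rw [hC', add_assoc]
      exact le_self_add
    exact_mod_cast h3
  have hcorr' : ∀ σ, ∃ z, ((jMap I μ P b (k + 1)).comp (dMap I X k)) z = 0 ∧
      ‖jMap I μ P b k (σ - z)‖ ≤ C' * ‖((jMap I μ P b (k + 1)).comp (dMap I X k)) σ‖ +
        1 / 2 * ‖jMap I μ P b k σ‖ + C' * ‖L σ‖ := by
    intro σ
    obtain ⟨z, hz, hσz⟩ := hcorr σ
    refine ⟨z, ?_, ?_⟩
    · have : dMap I X k z = 0 := Subtype.ext hz
      rw [LinearMap.comp_apply, this, map_zero]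
    have h1 : ‖jMap I μ P b k (σ - z)‖ₑ ≤ ((C₁ * (1 / 2 / (C₁ * C₂ + 1) * (C₂ *
        ‖jMap I μ P b k σ‖₊) + C * ‖L σ‖₊ + C * (C₃ * ‖jMap I μ P b (k + 1) (dMap I X k σ)‖₊)) :
        NNReal) : ENNReal) := by
      refine (enorm_jMap_le I μ P b (σ - z)).trans ?_
      rw [ENNReal.coe_mul]
      refine mul_le_mul_right (hσz.trans ?_) _
      simp only [ENNReal.coe_add, ENNReal.coe_mul]
      refine add_le_add (add_le_add ?_ le_rfl) ?_
      · refine mul_le_mul_right ((nrm_le_enorm_jMap I μ P b σ).trans (le_of_eq ?_)) _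
        rfl
      · refine mul_le_mul_right ((nrm_le_enorm_jMap I μ P b (dMap I X k σ)).trans (le_of_eq ?_)) _
        rfl
    have h2 := ENNReal.coe_le_coe.1 h1
    rw [← NNReal.coe_le_coe] at h2
    push_cast at h2
    rw [LinearMap.comp_apply]
    refine h2.trans ((correction_arith C₁ C₂ C₃ C ‖jMap I μ P b k σ‖₊ ‖L σ‖₊
      ‖jMap I μ P b (k + 1) (dMap I X k σ)‖₊).trans (le_of_eq ?_))
    rw [hC']
    push_cast
    rfl
  obtain ⟨s, x, hs1, hs0⟩ := exists_tendsto_of_mem_closure (jMap I μ P b k)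
    ((jMap I μ P b (k + 1)).comp (dMap I X k)) L C'.2 hL' hcorr' hcl
  -- Components of the limit, decoded to forms and truncated to the supports so that they extend by
  -- zero.
  set f : Fin P.m → E → E [⋀^Fin k]→L[ℝ] ℝ := fun i => (tsupport (P.φ i)).indicator
    fun y => euclRecon b k (x i y) with hf
  have hfm : ∀ i, AEStronglyMeasurable (f i) μ := fun i =>
    ((euclRecon b k).continuous.comp_aestronglyMeasurable
      (Lp.aestronglyMeasurable (x i))).indicator (isClosed_tsupport _).measurableSet
  have t0 : Tendsto (fun n => ‖jMap I μ P b k (s n) - x‖ₑ) atTop (𝓝 0) := by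
    have := (tendsto_iff_edist_tendsto_0).1 hs0
    simpa only [edist_eq_enorm_sub] using this
  have t1 : Tendsto (fun n => ‖jMap I μ P b (k + 1) (dMap I X k (s n)) -
      jMap I μ P b (k + 1) h‖ₑ) atTop (𝓝 0) := by
    have := (tendsto_iff_edist_tendsto_0).1 hs1
    simpa only [edist_eq_enorm_sub, LinearMap.comp_apply] using this
  refine ⟨s, ∑ i, fromChart I (P.c i) (f i),
    AEMeas.sum I μ fun i => aeMeas_fromChart I μ (hfm i), ?_, ?_⟩
  · choose B hB using fun i => nrm_fromChart_le I μ P (P.compact i) (P.subset i) k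
    have hle : ∀ n, nrm I μ P (s n - ∑ i, fromChart I (P.c i) (f i) : DForm I X k) ≤
        (∑ i, B i * ‖euclRecon (E := E) b k‖₊ : NNReal) * ‖jMap I μ P b k (s n) - x‖ₑ := by
      intro n
      have h1 : (s n : DForm I X k) - ∑ i, fromChart I (P.c i) (f i) =
          ∑ i, fromChart I (P.c i) (loc I P i (s n : DForm I X k) - f i) := by
        simp_rw [fromChart_sub]
        rw [Finset.sum_sub_distrib, sum_fromChart_loc]
      rw [h1]
      refine (nrm_sum_le I μ P fun i => aeMeas_fromChart I μ ?_).trans ?_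
      · exact (IsSmooth.contDiff_loc I P (s n).2 i).continuous.aestronglyMeasurable.sub (hfm i)
      rw [ENNReal.ofNNReal_finsetSum, Finset.sum_mul]
      refine Finset.sum_le_sum fun i _ => (hB i _ fun y hy => ?_).trans ?_
      · rw [Pi.sub_apply, loc_eq_zero I P i _ hy, hf]
        simp only [Set.indicator_of_notMem hy, sub_zero]
      · rw [ENNReal.coe_mul, mul_assoc]
        exact mul_le_mul_right (eLpNorm_loc_sub_le I μ P b (s n) x i) _
    refine tendsto_of_tendsto_of_tendsto_of_le_of_le tendsto_const_nhds ?_ (fun _ => zero_le) hle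
    have := ENNReal.Tendsto.const_mul (a := (∑ i, B i * ‖euclRecon (E := E) b k‖₊ : NNReal)) t0
      (Or.inr ENNReal.coe_ne_top)
    rwa [mul_zero] at this
  · refine tendsto_of_tendsto_of_tendsto_of_le_of_le tendsto_const_nhds
      (h := fun n => (C₃ : ENNReal) * ‖jMap I μ P b (k + 1) (dMap I X k (s n)) -
      jMap I μ P b (k + 1) h‖ₑ) ?_ (fun _ => zero_le) fun n => ?_
    · simpa using ENNReal.Tendsto.const_mul t1 (Or.inr ENNReal.coe_ne_top)
    · have := nrm_le_enorm_jMap I μ P b (dMap I X k (s n) - h)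
      rw [map_sub] at this
      exact this

end ClosedRangeForms

end L2Forms
end

noncomputable section

namespace L2Forms

set_option maxSynthPendingDepth 5

/-! ### Almost everywhere linearity of the operators, and vanishing of integrals of exact forms. -/

section ConvolutionSub

variable {E : Type*} [NormedAddCommGroup E] [NormedSpace ℝ E] [FiniteDimensional ℝ E]
  [MeasurableSpace E] [BorelSpace E] (μ : Measure E) [μ.IsAddHaarMeasure] {k : ℕ}

/-- For merely integrable functions the convolution integral converges only almost everywhere, so
linearity can be claimed only there. -/
theorem convolution_sub_ae {E₁ E₂ F : Type*} [NormedAddCommGroup E₁] [NormedSpace ℝ E₁]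
    [NormedAddCommGroup E₂] [NormedSpace ℝ E₂] [NormedAddCommGroup F] [NormedSpace ℝ F]
    (L : E₁ →L[ℝ] E₂ →L[ℝ] F) {f : E → E₁} {g g' : E → E₂} (hf : Integrable f μ)
    (hg : Integrable g μ) (hg' : Integrable g' μ) :
    ∀ᵐ x ∂μ, convolution f (g - g') L μ x = convolution f g L μ x - convolution f g' L μ x := by
  filter_upwards [hf.ae_convolution_exists L hg, hf.ae_convolution_exists L hg'] with x h h'
  rw [convolution_def, convolution_def, convolution_def, ← integral_sub h h']
  congr 1
  funext z
  rw [Pi.sub_apply, map_sub]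

theorem regOp_sub_ae {δ : ℝ} (hδ : 0 < δ) (φ : E → ℝ) {v v' : E → E [⋀^Fin k]→L[ℝ] ℝ}
    (hv : Integrable v μ) (hv' : Integrable v' μ) :
    ∀ᵐ x ∂μ, regOp μ δ φ (v - v') x = regOp μ δ φ v x - regOp μ δ φ v' x := by
  filter_upwards [convolution_sub_ae μ (ContinuousLinearMap.lsmul ℝ ℝ) (integrable_moll μ δ) hv hv',
    convolution_sub_ae μ (leibniz E k) (integrable_homKernel μ hδ) hv hv'] with x h1 h2
  simp only [regOp, mollify, comOp, h1, h2, smul_sub, sub_apply]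
  abel

theorem integrable_of_memLp_two {F : Type*} [NormedAddCommGroup F] {K : Set E} (hK : IsCompact K)
    {v : E → F} (hv : MemLp v 2 μ) (h0 : ∀ x ∉ K, v x = 0) : Integrable v μ := by
  obtain ⟨C, hC⟩ := eLpNorm_one_le (F := F) μ hK
  rw [← memLp_one_iff_integrable]
  exact ⟨hv.1, (hC v hv.1 h0).trans_lt (ENNReal.mul_lt_top ENNReal.coe_lt_top hv.2)⟩

/-- Integration by parts against the constant one: directional derivatives of a compactly supported
function have integral zero. -/
theorem integral_extDeriv_eq_zero {v : E → E [⋀^Fin k]→L[ℝ] ℝ} (hv : ContDiff ℝ ∞ v)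
    (hc : HasCompactSupport v) : ∫ x, extDeriv v x ∂μ = 0 := by
  have hfc : Continuous (fderiv ℝ v) := hv.continuous_fderiv (by simp)
  have hi : Integrable (fderiv ℝ v) μ := hfc.integrable_of_hasCompactSupport (hc.fderiv (𝕜 := ℝ))
  have h0 : ∫ x, fderiv ℝ v x ∂μ = 0 := by
    refine ContinuousLinearMap.ext fun z => ?_
    rw [ContinuousLinearMap.integral_apply hi]
    have h := integral_smul_fderiv_eq_neg_fderiv_smul_of_integrable (μ := μ) (𝕜 := ℝ)
      (f := fun _ => (1 : ℝ)) (g := v) (v := z) (by simp)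
      (by simpa using hi.apply_continuousLinearMap z)
      (by simpa using hv.continuous.integrable_of_hasCompactSupport hc)
      (fun x _ => differentiableAt_const _)
      (fun x _ => (hv.differentiable (by simp)) x)
    simpa using h
  change ∫ x, ContinuousAlternatingMap.alternatizeUncurryFinCLM ℝ E ℝ (fderiv ℝ v x) ∂μ = 0
  rw [ContinuousLinearMap.integral_comp_comm _ hi, h0, map_zero]

end ConvolutionSub

/-! ### Smoothing a weak limit in one chart. -/

section Regularity

open scoped Topology
open Filter

variable {E H : Type*} [NormedAddCommGroup E] [NormedSpace ℝ E] [TopologicalSpace H]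
  (I : ModelWithCorners ℝ E H) [I.Boundaryless]
  {X : Type*} [TopologicalSpace X] [ChartedSpace H X] [IsManifold I ∞ X] [FiniteDimensional ℝ E]
  [MeasurableSpace E] [BorelSpace E] (μ : Measure E) [μ.IsAddHaarMeasure] {k : ℕ}
  (P : ChartPartition I X)

theorem nrm_sub_le {u v : DForm I X k} (hu : AEMeas I μ u) (hv : AEMeas I μ v) :
    nrm I μ P (u - v) ≤ nrm I μ P u + nrm I μ P v := by
  rw [nrm, nrm, nrm, ← Finset.sum_add_distrib]
  refine Finset.sum_le_sum fun i _ => ?_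
  rw [loc_sub]
  exact eLpNorm_sub_le (hu.loc I μ P i) (hv.loc I μ P i) (by norm_num)

/-- `σ` is a limit of smooth forms whose exterior derivatives converge to `h`. -/
structure IsWeakLimit (s : ℕ → DForm I X k) (σ : DForm I X k) (h : DForm I X (k + 1)) : Prop where
  smooth : ∀ n, IsSmooth I (s n)
  meas : AEMeas I μ σ
  tendsto : Tendsto (fun n => nrm I μ P (s n - σ)) atTop (𝓝 0)
  tendsto_extD : Tendsto (fun n => nrm I μ P (extD I (s n) - h)) atTop (𝓝 0)

theorem IsWeakLimit.nrm_lt_top {s : ℕ → DForm I X k} {σ : DForm I X k} {h : DForm I X (k + 1)}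
    (hs : IsWeakLimit I μ P s σ h) : nrm I μ P σ < ⊤ := by
  obtain ⟨n, hn⟩ := (hs.tendsto.eventually (gt_mem_nhds zero_lt_one)).exists
  have h1 := nrm_add_le I μ P (hs.meas.sub I μ ((hs.smooth n).aeMeas I μ))
    ((hs.smooth n).aeMeas I μ)
  rw [sub_add_cancel, nrm_sub_comm] at h1
  exact h1.trans_lt (ENNReal.add_lt_top.2 ⟨hn.trans ENNReal.one_lt_top,
    (hs.smooth n).nrm_lt_top I μ P⟩)

theorem extD_sub {u v : DForm I X k} (hu : IsSmooth I u) (hv : IsSmooth I v) :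
    extD I (u - v) = extD I u - extD I v := by
  rw [sub_eq_add_neg, ← neg_one_smul ℝ v, extD_add I hu (hv.smul I _), extD_smul, neg_one_smul,
    sub_eq_add_neg]

theorem IsSmooth.sub {u v : DForm I X k} (hu : IsSmooth I u) (hv : IsSmooth I v) :
    IsSmooth I (u - v) := by
  rw [sub_eq_add_neg, ← neg_one_smul ℝ v]
  exact hu.add I (hv.smul I _)

theorem memLp_smul_inChart [T2Space X] {x₁ : X} {χ : E → ℝ} (hχ : Continuous χ)
    (hc : HasCompactSupport χ) (hs : tsupport χ ⊆ (extChartAt I x₁).target) {u : DForm I X k}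
    (hu : AEMeas I μ u) (hn : nrm I μ P u < ⊤) :
    MemLp (fun y => χ y • inChart I u x₁ y) 2 μ := by
  obtain ⟨C, hC⟩ := eLpNorm_smul_inChart_le I μ P hχ hc hs k
  exact ⟨aestronglyMeasurable_smul_of_tsupport μ hχ (isOpen_extChartAt_target _).measurableSet hs
    (hu x₁), (hC u hu).trans_lt (ENNReal.mul_lt_top ENNReal.coe_lt_top hn)⟩

/-- A weak limit may be replaced, without changing its exterior derivative, by one which is smooth
where the cutoff `ψ` equals one, preserving smoothness elsewhere. -/
theorem IsWeakLimit.regularise [T2Space X] [NormalSpace X] {s : ℕ → DForm I X k} {σ : DForm I X k}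
    {h : DForm I X (k + 1)} (hs : IsWeakLimit I μ P s σ h) (hh : IsSmooth I h) {A C U : Set X}
    (hA : IsOpen A) (hAσ : ∀ x ∈ A, SmoothAt I σ x) (hC : IsClosed C) (hCA : C ⊆ A) {x₁ : X}
    {ψ : E → ℝ} (hψ : ContDiff ℝ ∞ ψ) (hψc : HasCompactSupport ψ)
    (hψs : tsupport ψ ⊆ (extChartAt I x₁).target) (hU : IsOpen U)
    (hUs : U ⊆ (extChartAt I x₁).source) (hU1 : ∀ x ∈ U, ψ (extChartAt I x₁ x) = 1) :
    ∃ (s' : ℕ → DForm I X k) (σ' : DForm I X k) (A' : Set X), IsWeakLimit I μ P s' σ' h ∧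
      IsOpen A' ∧ C ∪ U ⊆ A' ∧ ∀ x ∈ A', SmoothAt I σ' x := by
  -- A little room is given up: smoothness will be kept on `A₁`, whose closure lies in `A`, so that
  -- kernels of small radius see only the smooth region.
  obtain ⟨A₁, hA₁, hCA₁, hA₁A⟩ := normal_exists_closure_subset hC hA hCA
  obtain ⟨χ, δ₀, hχ, hχc, hχs, -, hδ₀, hχ1⟩ := exists_cutoff hψc (isOpen_extChartAt_target x₁) hψs
  set O : Set E := (extChartAt I x₁).target ∩ (extChartAt I x₁).symm ⁻¹' A with hOdef
  have hO : IsOpen O := (continuousOn_extChartAt_symm x₁).isOpen_inter_preimage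
    (isOpen_extChartAt_target x₁) hA
  set K : Set E := tsupport ψ ∩ (extChartAt I x₁).symm ⁻¹' closure A₁ with hKdef
  have hK : IsCompact K := by
    refine hψc.isCompact.of_isClosed_subset ?_ Set.inter_subset_left
    exact ((continuousOn_extChartAt_symm x₁).mono hψs).preimage_isClosed_of_isClosed
      (isClosed_tsupport _) isClosed_closure
  have hKO : K ⊆ O := fun y hy => ⟨hψs hy.1, hA₁A hy.2⟩
  obtain ⟨δ₁, hδ₁, hδ₁O⟩ := hK.exists_cthickening_subset_open hO hKO
  -- The first bound hides the cutoff `χ`; the second keeps balls of radius `3δ` around `K` inside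
  -- the smooth region, as `contDiffAt_regOp` requires.
  set δ : ℝ := min δ₀ (δ₁ / 3) with hδdef
  have hδ : 0 < δ := lt_min hδ₀ (by positivity)
  have hball : ∀ y ∈ K, Metric.closedBall y (3 * δ) ⊆ O := fun y hy =>
    ((Metric.closedBall_subset_closedBall (by
      have : δ ≤ δ₁ / 3 := min_le_right _ _
      linarith)).trans (Metric.closedBall_subset_cthickening hy δ₁)).trans hδ₁O
  set u : ℕ → E → E [⋀^Fin k]→L[ℝ] ℝ := fun n => inChart I (s n) x₁ with hu
  set v : E → E [⋀^Fin k]→L[ℝ] ℝ := fun z => χ z • inChart I σ x₁ z with hv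
  set w : E → E [⋀^Fin (k + 1)]→L[ℝ] ℝ := fun z => χ z • inChart I h x₁ z with hw
  set e : ℕ → E → E [⋀^Fin k]→L[ℝ] ℝ := fun n x => ψ x • u n x -
    regOp μ δ ψ (fun z => χ z • u n z) x -
    ψ x • homOp μ δ (fun z => χ z • extDeriv (u n) z) x with he
  -- The limit of the closed corrections `e n`. As `σ` has only a weak derivative, `h` takes the
  -- place of `dσ`.
  set g : E → E [⋀^Fin k]→L[ℝ] ℝ := fun x => ψ x • inChart I σ x₁ x - regOp μ δ ψ v x -
    ψ x • homOp μ δ w x with hg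
  have hcor := fun n => closed_correction μ hδ (isOpen_extChartAt_target x₁) (hs.smooth n x₁) hχ hψ
    hχs hχc (fun x hx z hz => hχ1 x hx z (hz.trans_le (min_le_left _ _))) (e := e n) fun x => rfl
  have hes : ∀ n, IsSmooth I (fromChart I x₁ (e n)) := fun n =>
    isSmooth_fromChart I hψc hψs (hcor n).2.2 (hcor n).1
  have hed : ∀ n, extD I (fromChart I x₁ (e n)) = 0 := fun n =>
    extD_fromChart_eq_zero I hψc hψs (hcor n).2.2 (hcor n).1 (funext (hcor n).2.1)
  have hg0 : ∀ y ∉ tsupport ψ, g y = 0 := by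
    intro y hy
    have h1 : ψ y = 0 := image_eq_zero_of_notMem_tsupport hy
    have h2 : fderiv ℝ ψ y = 0 := image_eq_zero_of_notMem_tsupport
      fun h => hy (tsupport_fderiv_subset ℝ h)
    simp [hg, regOp, h1, h2]
  have hvL : MemLp v 2 μ := memLp_smul_inChart I μ P hχ.continuous hχc hχs hs.meas
    (hs.nrm_lt_top I μ P)
  have hvi : Integrable v μ := integrable_of_memLp_two μ hχc hvL fun x hx => by
    simp only [hv]; rw [image_eq_zero_of_notMem_tsupport hx, zero_smul]
  have hwc : ContDiff ℝ ∞ w := hh.contDiff_smul I hχ hχs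
  have hwcs : HasCompactSupport w := hχc.smul_right
  have hwi : Integrable w μ := hwc.continuous.integrable_of_hasCompactSupport hwcs
  have hψσ : AEStronglyMeasurable (fun y => ψ y • inChart I σ x₁ y) μ :=
    aestronglyMeasurable_smul_of_tsupport μ hψ.continuous
      (isOpen_extChartAt_target _).measurableSet hψs (hs.meas x₁)
  have hgm : AEStronglyMeasurable g μ :=
    (hψσ.sub (aestronglyMeasurable_regOp μ hδ hψ hvL.1)).sub
      (hψ.continuous.aestronglyMeasurable.smul (aestronglyMeasurable_homOp μ hδ hwi.1))
  have hhom : ContDiff ℝ ∞ (homOp μ δ w) := contDiff_homOp μ hδ hwc hwcs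
  -- Subtracting closed forms leaves the derivatives of the sequence unchanged. In the chart, `σ -
  -- g` is `(1 - ψ) σ + regOp v + ψ homOp w`, which is smooth where `ψ = 1` whatever `σ` is.
  refine ⟨fun n => s n - fromChart I x₁ (e n), σ - fromChart I x₁ g, A₁ ∪ U,
    ⟨fun n => (hs.smooth n).sub I (hes n), hs.meas.sub I μ (aeMeas_fromChart I μ hgm), ?_, ?_⟩,
    hA₁.union hU, Set.union_subset_union_left _ hCA₁, ?_⟩
  · obtain ⟨B, hB⟩ := nrm_fromChart_le I μ P (K := tsupport ψ) hψc hψs k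
    obtain ⟨C₁, hC₁⟩ := eLpNorm_smul_inChart_le I μ P hψ.continuous hψc hψs k
    obtain ⟨C₂, hC₂⟩ := eLpNorm_smul_inChart_le I μ P hχ.continuous hχc hχs k
    obtain ⟨C₃, hC₃⟩ := eLpNorm_smul_inChart_le I μ P hχ.continuous hχc hχs (k + 1)
    obtain ⟨C₄, hC₄⟩ := eLpNorm_regOp_le μ (k := k) hδ hψ hψc
    obtain ⟨C₅, hC₅⟩ := exists_nnbound hψ.continuous hψc
    have hle : ∀ n, nrm I μ P (s n - fromChart I x₁ (e n) - (σ - fromChart I x₁ g)) ≤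
        nrm I μ P (s n - σ) + B * (C₁ * nrm I μ P (s n - σ) + C₄ * (C₂ * nrm I μ P (s n - σ)) +
          C₅ * ((‖contract E k‖ₑ * ENNReal.ofReal δ) *
            (C₃ * nrm I μ P (extD I (s n) - h)))) := by
      intro n
      have h1 : s n - fromChart I x₁ (e n) - (σ - fromChart I x₁ g) =
          (s n - σ) - fromChart I x₁ (e n - g) := by
        rw [fromChart_sub]; abel
      have hsm := (hs.smooth n).aeMeas I μ
      have hem : AEStronglyMeasurable (e n) μ := (hcor n).1.continuous.aestronglyMeasurable
      have hsub := hsm.sub I μ hs.meas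
      have hfm := aeMeas_fromChart I μ (x₁ := x₁) (hem.sub hgm)
      rw [h1]
      have h2 : nrm I μ P ((s n - σ) - fromChart I x₁ (e n - g)) ≤
          nrm I μ P (s n - σ) + nrm I μ P (fromChart I x₁ (e n - g)) :=
        nrm_sub_le I μ P hsub hfm
      refine h2.trans ?_
      gcongr
      refine (hB _ fun y hy => by rw [Pi.sub_apply, hg0 y hy, (hcor n).2.2 y hy, sub_zero]).trans ?_
      gcongr
      set vn : E → E [⋀^Fin k]→L[ℝ] ℝ := fun z => χ z • u n z with hvn
      set wn : E → E [⋀^Fin (k + 1)]→L[ℝ] ℝ := fun z => χ z • extDeriv (u n) z with hwn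
      have hwn' : wn = fun z => χ z • inChart I (extD I (s n)) x₁ z := by
        funext z
        by_cases hz : z ∈ tsupport χ
        · rw [hwn, inChart_extD I (hχs hz) ((isSmooth_iff I).1 (hs.smooth n) _)]
        · simp [hwn, image_eq_zero_of_notMem_tsupport hz]
      have hvnc : ContDiff ℝ ∞ vn := (hs.smooth n).contDiff_smul I hχ hχs
      have hwnc : ContDiff ℝ ∞ wn := by
        rw [hwn']
        exact ((hs.smooth n).extD I).contDiff_smul I hχ hχs
      have hvni : Integrable vn μ :=
        hvnc.continuous.integrable_of_hasCompactSupport hχc.smul_right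
      have hwni : Integrable wn μ :=
        hwnc.continuous.integrable_of_hasCompactSupport hχc.smul_right
      have hvd : vn - v = fun z => χ z • inChart I (s n - σ) x₁ z := by
        funext z; simp [hvn, hv, hu, inChart_sub, smul_sub]
      have hwd : wn - w = fun z => χ z • inChart I (extD I (s n) - h) x₁ z := by
        rw [hwn']; funext z; simp [hw, inChart_sub, smul_sub]
      have heg : e n - g =ᵐ[μ] (((fun y => ψ y • inChart I (s n - σ) x₁ y) -
          regOp μ δ ψ (vn - v)) - fun y => ψ y • homOp μ δ (wn - w) y) := by
        filter_upwards [regOp_sub_ae μ hδ ψ hvni hvi, convolution_sub_ae μ (contract E k)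
          (integrable_homKernel μ hδ) hwni hwi] with y hy1 hy2
        have hy2' : homOp μ δ (wn - w) y = homOp μ δ wn y - homOp μ δ w y := hy2
        simp only [Pi.sub_apply, he, hg, hy1, hy2', inChart_sub, smul_sub, hu]
        abel
      rw [eLpNorm_congr_ae heg]
      have hm1 : AEStronglyMeasurable (fun y => ψ y • inChart I (s n - σ) x₁ y) μ :=
        aestronglyMeasurable_smul_of_tsupport μ hψ.continuous
          (isOpen_extChartAt_target _).measurableSet hψs (hsub x₁)
      have hm2 := aestronglyMeasurable_regOp μ hδ hψ (hvni.1.sub hvi.1)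
      have hm3 := aestronglyMeasurable_homOp μ hδ (hwni.1.sub hwi.1)
      have hm4 : AEStronglyMeasurable (fun y => ψ y • homOp μ δ (wn - w) y) μ :=
        hψ.continuous.aestronglyMeasurable.smul hm3
      refine (eLpNorm_sub_le (hm1.sub hm2) hm4 (by norm_num)).trans (add_le_add
        ((eLpNorm_sub_le hm1 hm2 (by norm_num)).trans (add_le_add (hC₁ _ hsub) ?_)) ?_)
      · refine (hC₄ _ (hvni.1.sub hvi.1)).trans ?_
        gcongr
        rw [hvd]
        exact hC₂ _ hsub
      · refine (eLpNorm_smul_le_of_bound μ hC₅ _).trans ?_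
        rw [ENNReal.ofReal_coe_nnreal]
        gcongr
        refine (eLpNorm_homOp_le μ hδ (hwni.1.sub hwi.1)).trans ?_
        gcongr
        rw [hwd]
        exact hC₃ _ ((((hs.smooth n).extD I).sub I hh).aeMeas I μ)
    refine tendsto_of_tendsto_of_tendsto_of_le_of_le tendsto_const_nhds ?_ (fun _ => zero_le) hle
    have tc : ∀ {a : ℕ → ENNReal} (c : ENNReal), c ≠ ⊤ → Tendsto a atTop (𝓝 0) →
        Tendsto (fun n => c * a n) atTop (𝓝 0) := by
      intro a c hc ha
      have := ENNReal.Tendsto.const_mul (a := c) ha (Or.inr hc)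
      rwa [mul_zero] at this
    have t0 := hs.tendsto
    have t1 := hs.tendsto_extD
    have t2 := ((tc C₁ ENNReal.coe_ne_top t0).add
      (tc C₄ ENNReal.coe_ne_top (tc C₂ ENNReal.coe_ne_top t0))).add
      (tc C₅ ENNReal.coe_ne_top (tc (‖contract E k‖ₑ * ENNReal.ofReal δ)
        (ENNReal.mul_ne_top enorm_ne_top ENNReal.ofReal_ne_top) (tc C₃ ENNReal.coe_ne_top t1)))
    rw [add_zero, add_zero] at t2
    have t3 := t0.add (tc B ENNReal.coe_ne_top t2)
    rwa [add_zero] at t3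
  · refine hs.tendsto_extD.congr fun n => ?_
    rw [extD_sub I (hs.smooth n) (hes n), hed n, sub_zero]
  · rintro x (hx | hx)
    -- On `A₁` old smoothness survives: either `x` is off the support of the correction, or all
    -- three terms of `g` are smooth, `regOp` because its input is smooth on a ball of radius `3δ`.
    · by_cases hxs : x ∈ (extChartAt I x₁).symm '' tsupport ψ
      · obtain ⟨y, hy, rfl⟩ := hxs
        have hyK : y ∈ K := ⟨hy, subset_closure hx⟩
        have hσx := hAσ _ (hA₁A (subset_closure hx))
        refine hσx.sub I (smoothAt_fromChart I ((extChartAt I x₁).map_target (hψs hy)) ?_)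
        rw [(extChartAt I x₁).right_inv (hψs hy)]
        have hvO : ContDiffOn ℝ ∞ v O := fun z hz =>
          (hχ.contDiffAt.smul ((hAσ _ hz.2).contDiffAt I hz.1)).contDiffWithinAt
        exact ((hψ.contDiffAt.smul (hσx.contDiffAt I (hψs hy))).sub
          (contDiffAt_regOp μ hδ hψ hvi.locallyIntegrable
            (Or.inr ⟨O, hO, hball y hyK, hvO⟩))).sub (hψ.contDiffAt.smul hhom.contDiffAt)
      · refine (hAσ x (hA₁A (subset_closure hx))).congr I ?_
        filter_upwards [eventually_fromChart_eq_zero I hψc hψs hg0 hxs] with z hz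
        have hz' : fromChart I x₁ g z = 0 := hz
        rw [Pi.sub_apply, hz', sub_zero]
    -- On `U` the cutoff `ψ` is one nearby, so the form is `regOp v + homOp w`: a mollification plus
    -- the homotopy operator on a smooth form.
    · rw [smoothAt_iff I (hUs hx)]
      set y := extChartAt I x₁ x with hy
      have hN : (extChartAt I x₁).target ∩ (extChartAt I x₁).symm ⁻¹' U ∈ 𝓝 y := by
        refine ((continuousOn_extChartAt_symm x₁).isOpen_inter_preimage
          (isOpen_extChartAt_target x₁) hU).mem_nhds ⟨(extChartAt I x₁).map_source (hUs hx), ?_⟩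
        rwa [Set.mem_preimage, hy, (extChartAt I x₁).left_inv (hUs hx)]
      have h1 : ∀ᶠ z in 𝓝 y, ψ z = 1 := by
        filter_upwards [hN] with z hz
        have := hU1 _ hz.2
        rwa [(extChartAt I x₁).right_inv hz.1] at this
      have h2 : ContDiffAt ℝ ∞ (fun z => regOp μ δ ψ v z + homOp μ δ w z) y :=
        (contDiffAt_regOp μ hδ hψ hvi.locallyIntegrable (Or.inl h1)).add hhom.contDiffAt
      refine h2.congr_of_eventuallyEq ?_
      filter_upwards [h1, (isOpen_extChartAt_target (I := I) x₁).mem_nhds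
        ((extChartAt I x₁).map_source (hUs hx))] with z hz1 hz2
      rw [inChart_sub, Pi.sub_apply, inChart_fromChart_self I _ hz2, hg]
      simp only [hz1, one_smul]
      abel

end Regularity

end L2Forms
end

noncomputable section

namespace L2Forms

set_option maxSynthPendingDepth 5

/-! ### Exactness is an `L²`-closed condition on smooth forms, and the resulting current. -/

section Primitive

open scoped Topology
open Filter

variable {E H : Type*} [NormedAddCommGroup E] [NormedSpace ℝ E] [TopologicalSpace H]
  (I : ModelWithCorners ℝ E H) [I.Boundaryless]
  {X : Type*} [TopologicalSpace X] [ChartedSpace H X] [IsManifold I ∞ X] [FiniteDimensional ℝ E]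
  [MeasurableSpace E] [BorelSpace E] (μ : Measure E) [μ.IsAddHaarMeasure] {k : ℕ}
  (P : ChartPartition I X)

theorem lintegral_smul_inChart_le [T2Space X] {x₁ : X} {χ : E → ℝ} (hχ : ContDiff ℝ ∞ χ)
    (hc : HasCompactSupport χ) (hs : tsupport χ ⊆ (extChartAt I x₁).target) (k : ℕ) :
    ∃ C : NNReal, ∀ σ : DForm I X k, IsSmooth I σ →
      ∫⁻ y, ‖χ y • inChart I σ x₁ y‖ₑ ∂μ ≤ C * nrm I μ P σ := by
  obtain ⟨A, hA⟩ := eLpNorm_smul_inChart_le I μ P hχ.continuous hc hs k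
  obtain ⟨B, hB⟩ := eLpNorm_one_le (F := E [⋀^Fin k]→L[ℝ] ℝ) μ hc
  refine ⟨B * A, fun σ hσ => ?_⟩
  have h1 := hB (fun y => χ y • inChart I σ x₁ y)
    (hσ.contDiff_smul I hχ hs).continuous.aestronglyMeasurable
    (fun x hx => by rw [image_eq_zero_of_notMem_tsupport hx, zero_smul])
  rw [← eLpNorm_one_eq_lintegral_enorm, ENNReal.coe_mul, mul_assoc]
  exact h1.trans (mul_le_mul_right (hA σ (hσ.aeMeas I μ)) _)

/-- The integral of `d(ζ σ)` vanishes, so `∫ ζ dσ = -∫ dζ ∧ σ`: integrated against a test function,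
`dσ` is controlled by `σ` alone. -/
theorem enorm_integral_smul_extD_le [T2Space X] {x₁ : X} {ζ : E → ℝ} (hζ : ContDiff ℝ ∞ ζ)
    (hc : HasCompactSupport ζ) (hs : tsupport ζ ⊆ (extChartAt I x₁).target) (k : ℕ) :
    ∃ C : NNReal, ∀ σ : DForm I X k, IsSmooth I σ →
      ‖∫ y, ζ y • inChart I (extD I σ) x₁ y ∂μ‖ₑ ≤ C * nrm I μ P σ := by
  obtain ⟨χ, δ₀, hχ, hχc, hχs, -, hδ₀, hχ1⟩ := exists_cutoff hc (isOpen_extChartAt_target x₁) hs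
  obtain ⟨A, hA⟩ := lintegral_smul_inChart_le I μ P hχ hχc hχs k
  obtain ⟨B, hB0, -, hB⟩ := exists_bound_fderiv hζ hc
  lift B to NNReal using hB0
  refine ⟨‖wedge E k‖₊ * B * A, fun σ hσ => ?_⟩
  set u := inChart I σ x₁ with hu
  have hd : ∀ y ∈ tsupport ζ, DifferentiableAt ℝ u y := fun y hy =>
    ((hσ x₁).contDiffAt ((isOpen_extChartAt_target x₁).mem_nhds (hs hy))).differentiableAt (by simp)
  have hζ0 : ∀ y ∉ tsupport ζ, ζ y = 0 ∧ fderiv ℝ ζ y = 0 := fun y hy =>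
    ⟨image_eq_zero_of_notMem_tsupport hy, image_eq_zero_of_notMem_tsupport
      fun h => hy (tsupport_fderiv_subset ℝ h)⟩
  have hsm : ContDiff ℝ ∞ fun y => ζ y • u y := hσ.contDiff_smul I hζ hs
  have h0 := integral_extDeriv_eq_zero μ hsm hc.smul_right
  have h1 : ∀ y, extDeriv (fun y => ζ y • u y) y =
      wedge E k (fderiv ℝ ζ y) (u y) + ζ y • inChart I (extD I σ) x₁ y := by
    intro y
    by_cases hy : y ∈ tsupport ζ
    · rw [extDeriv_smul_fun (hζ.differentiable (by simp) y) (hd y hy), inChart_extD I (hs hy)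
        ((isSmooth_iff I).1 hσ _)]
    · have h2 : (fun y => ζ y • u y) =ᶠ[𝓝 y] fun _ => 0 := by
        filter_upwards [(isClosed_tsupport ζ).isOpen_compl.mem_nhds hy] with z hz
        rw [(hζ0 z hz).1, zero_smul]
      rw [extDeriv, h2.fderiv_eq, (hζ0 y hy).1, (hζ0 y hy).2, fderiv_const_apply, map_zero,
        _root_.zero_apply, zero_smul, add_zero]
      exact map_zero (ContinuousAlternatingMap.alternatizeUncurryFinCLM ℝ E ℝ)
  have hi2 : Integrable (fun y => ζ y • inChart I (extD I σ) x₁ y) μ :=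
    ((hσ.extD I).contDiff_smul I hζ hs).continuous.integrable_of_hasCompactSupport hc.smul_right
  have hi0 : Integrable (extDeriv fun y => ζ y • u y) μ :=
    (contDiff_iff_contDiffAt.2 fun y =>
      contDiffAt_extDeriv hsm.contDiffAt).continuous.integrable_of_hasCompactSupport
      (extDeriv_hasCompactSupport hc.smul_right)
  have hi1 : Integrable (fun y => wedge E k (fderiv ℝ ζ y) (u y)) μ := by
    refine (hi0.sub hi2).congr (Eventually.of_forall fun y => ?_)
    simp only [Pi.sub_apply, h1 y]
    abel
  have h2 : ∫ y, ζ y • inChart I (extD I σ) x₁ y ∂μ =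
      -∫ y, wedge E k (fderiv ℝ ζ y) (u y) ∂μ := by
    simp_rw [h1] at h0
    rw [integral_add hi1 hi2] at h0
    exact eq_neg_of_add_eq_zero_right h0
  have h3 : ∀ y, ‖wedge E k (fderiv ℝ ζ y) (u y)‖ₑ ≤ (‖wedge E k‖₊ * B : NNReal) *
      ‖χ y • u y‖ₑ := by
    intro y
    by_cases hy : y ∈ tsupport ζ
    · rw [hχ1 y hy y (by simpa using hδ₀), one_smul]
      have h4 : ‖wedge E k (fderiv ℝ ζ y) (u y)‖₊ ≤ ‖wedge E k‖₊ * B * ‖u y‖₊ := by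
        refine ((wedge E k (fderiv ℝ ζ y)).le_opNNNorm _).trans ?_
        gcongr
        refine ((wedge E k).le_opNNNorm _).trans ?_
        gcongr
        exact hB y
      rw [enorm_eq_nnnorm, enorm_eq_nnnorm, ← ENNReal.coe_mul]
      exact ENNReal.coe_le_coe.2 h4
    · rw [(hζ0 y hy).2]
      simp
  rw [h2, enorm_neg]
  calc _ ≤ ∫⁻ y, ‖wedge E k (fderiv ℝ ζ y) (u y)‖ₑ ∂μ := enorm_integral_le_lintegral_enorm _
    _ ≤ ∫⁻ y, (‖wedge E k‖₊ * B : NNReal) * ‖χ y • u y‖ₑ ∂μ := lintegral_mono h3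
    _ = (‖wedge E k‖₊ * B : NNReal) * ∫⁻ y, ‖χ y • u y‖ₑ ∂μ :=
        lintegral_const_mul' _ _ ENNReal.coe_ne_top
    _ ≤ (‖wedge E k‖₊ * B : NNReal) * (A * nrm I μ P σ) := by gcongr; exact hA σ hσ
    _ = _ := by push_cast; ring

/-- Integrated against a test function `ζ`, `h - dσ` equals `d(sₙ - σ) - (dsₙ - h)`. Both parts tend
to zero, the first after moving the derivative onto `ζ`. A continuous function with vanishing test
integrals is zero. -/
theorem IsWeakLimit.extD_eq [T2Space X] {s : ℕ → DForm I X k} {σ : DForm I X k}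
    {h : DForm I X (k + 1)} (hs : IsWeakLimit I μ P s σ h) (hσ : IsSmooth I σ) (hh : IsSmooth I h) :
    extD I σ = h := by
  set g : DForm I X (k + 1) := h - extD I σ with hgdef
  have hg : IsSmooth I g := hh.sub I (hσ.extD I)
  have key : ∀ x₁ : X, ∀ y ∈ (extChartAt I x₁).target, inChart I g x₁ y = 0 := by
    intro x₁
    have hO := isOpen_extChartAt_target (I := I) x₁
    have hae : ∀ᵐ y ∂μ, y ∈ (extChartAt I x₁).target → inChart I g x₁ y = 0 := by
      refine hO.ae_eq_zero_of_integral_contDiff_smul_eq_zero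
        ((hg x₁).continuousOn.locallyIntegrableOn hO.measurableSet) fun ζ hζ hc hsζ => ?_
      obtain ⟨C, hC⟩ := lintegral_smul_inChart_le I μ P hζ hc hsζ (k + 1)
      obtain ⟨C', hC'⟩ := enorm_integral_smul_extD_le I μ P hζ hc hsζ k
      have hi : ∀ {v : DForm I X (k + 1)}, IsSmooth I v →
          Integrable (fun y => ζ y • inChart I v x₁ y) μ := fun hv =>
        (hv.contDiff_smul I hζ hsζ).continuous.integrable_of_hasCompactSupport hc.smul_right
      have hle : ∀ n, ‖∫ y, ζ y • inChart I g x₁ y ∂μ‖ₑ ≤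
          C * nrm I μ P (extD I (s n) - h) + C' * nrm I μ P (s n - σ) := by
        intro n
        have hw := (hs.smooth n).sub I hσ
        have e1 : extD I (s n - σ) - (extD I (s n) - h) = g := by
          rw [extD_sub I (hs.smooth n) hσ, hgdef]; abel
        have hv : IsSmooth I (extD I (s n) - h) := ((hs.smooth n).extD I).sub I hh
        have e2 : ∫ y, ζ y • inChart I g x₁ y ∂μ = ∫ y, ζ y • inChart I (extD I (s n - σ)) x₁ y ∂μ -
            ∫ y, ζ y • inChart I (extD I (s n) - h) x₁ y ∂μ := by
          rw [← integral_sub (hi (hw.extD I)) (hi hv)]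
          simp_rw [← smul_sub]
          rw [← e1]
          rfl
        rw [e2, add_comm (_ * _)]
        refine enorm_sub_le.trans (add_le_add (hC' _ hw) ?_)
        exact (enorm_integral_le_lintegral_enorm _).trans (hC _ hv)
      have ht : Tendsto (fun n => (C : ENNReal) * nrm I μ P (extD I (s n) - h) +
          C' * nrm I μ P (s n - σ)) atTop (𝓝 (C * 0 + C' * 0)) :=
        (ENNReal.Tendsto.const_mul hs.tendsto_extD (Or.inr ENNReal.coe_ne_top)).add
          (ENNReal.Tendsto.const_mul hs.tendsto (Or.inr ENNReal.coe_ne_top))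
      rw [mul_zero, mul_zero, add_zero] at ht
      have := ge_of_tendsto' ht hle
      simpa using this
    have h1 : inChart I g x₁ =ᵐ[μ.restrict (extChartAt I x₁).target] fun _ => 0 :=
      (ae_restrict_iff' hO.measurableSet).2 hae
    exact Measure.eqOn_open_of_ae_eq h1 hO (hg x₁).continuousOn continuousOn_const
  have hg0 : ∀ x, formAt I g x = 0 := fun x => by
    rw [formAt_eq I g (mem_extChartAt_source x), key x _ (mem_extChartAt_target x)]
    rfl
  have : g = 0 := funext hg0
  exact (sub_eq_zero.1 this).symm

/-- A smooth form which is the weak exterior derivative of a limit of smooth forms is exact. -/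
theorem IsWeakLimit.exists_primitive [T2Space X] [CompactSpace X] {s : ℕ → DForm I X k}
    {σ : DForm I X k} {h : DForm I X (k + 1)} (hs : IsWeakLimit I μ P s σ h) (hh : IsSmooth I h) :
    ∃ σ' : DForm I X k, IsSmooth I σ' ∧ extD I σ' = h := by
  set m := P.m with hm
  -- Since `m` nonnegative functions sum to one, at every point one of them is at least `1 / m`;
  -- these compact sets therefore cover the manifold.
  set C : Fin P.m → Set X := fun i => (extChartAt I (P.c i)).symm ''
    (tsupport (P.φ i) ∩ {y | 1 / (m : ℝ) ≤ P.φ i y}) with hC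
  have hCc : ∀ i, IsClosed (C i) := by
    intro i
    refine IsCompact.isClosed (IsCompact.image_of_continuousOn ?_
      ((continuousOn_extChartAt_symm _).mono (Set.inter_subset_left.trans (P.subset i))))
    exact (P.compact i).isCompact.inter_right
      (isClosed_le continuous_const (P.contDiff i).continuous)
  -- Induction over the charts: each regularisation makes the limit smooth near one more of the
  -- covering sets and keeps it smooth near the earlier ones.
  have hind : ∀ F : Finset (Fin P.m), ∃ (s' : ℕ → DForm I X k) (σ' : DForm I X k) (A : Set X),
      IsWeakLimit I μ P s' σ' h ∧ IsOpen A ∧ (⋃ i ∈ F, C i) ⊆ A ∧ ∀ x ∈ A, SmoothAt I σ' x := by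
    intro F
    induction F using Finset.induction_on with
    | empty => exact ⟨s, σ, ∅, hs, isOpen_empty, by simp, by simp⟩
    | insert i F _ ih =>
      obtain ⟨s', σ', A, hs', hA, hFA, hAσ⟩ := ih
      have hmi : (0 : ℝ) < m := by
        have := i.pos
        exact_mod_cast this
      -- Equal to one where `φ i` exceeds `1 / (2m)`, an open neighbourhood of the set where `φ i ≥
      -- 1 / m`.
      set ψ : E → ℝ := fun y => Real.smoothTransition (2 * m * P.φ i y) with hψ
      have hψs : tsupport ψ ⊆ tsupport (P.φ i) := by
        refine closure_mono fun y hy => ?_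
        by_contra h0
        have h1 : P.φ i y = 0 := by simpa using h0
        apply hy
        simp [hψ, h1]
      have hψd : ContDiff ℝ ∞ ψ :=
        (Real.smoothTransition.contDiff (n := ⊤)).comp (contDiff_const.mul (P.contDiff i))
      set U : Set X := (extChartAt I (P.c i)).source ∩
        extChartAt I (P.c i) ⁻¹' {y | 1 / (2 * (m : ℝ)) < P.φ i y} with hU
      have hUo : IsOpen U := (continuousOn_extChartAt (P.c i)).isOpen_inter_preimage
        (isOpen_extChartAt_source (P.c i)) (isOpen_lt continuous_const (P.contDiff i).continuous)
      obtain ⟨s'', σ'', A', hs'', hA', hsub, hA'σ⟩ := hs'.regularise I μ P hh hA hAσ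
        (isClosed_biUnion_finset fun i _ => hCc i) hFA hψd
        ((P.compact i).of_isClosed_subset (isClosed_tsupport _) hψs) (hψs.trans (P.subset i)) hUo
        Set.inter_subset_left (fun x hx => by
          refine Real.smoothTransition.one_of_one_le ?_
          have h2 : 1 / (2 * (m : ℝ)) < P.φ i (extChartAt I (P.c i) x) := hx.2
          rw [div_lt_iff₀ (by positivity)] at h2
          linarith)
      refine ⟨s'', σ'', A', hs'', hA', ?_, hA'σ⟩
      rw [Finset.set_biUnion_insert, Set.union_comm]
      refine (Set.union_subset_union_right _ ?_).trans hsub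
      rintro _ ⟨y, ⟨hy1, hy2⟩, rfl⟩
      have hyt := P.subset i hy1
      refine ⟨(extChartAt I (P.c i)).map_target hyt, ?_⟩
      rw [Set.mem_preimage, (extChartAt I (P.c i)).right_inv hyt]
      have h3 : 1 / (2 * (m : ℝ)) < 1 / m := by
        apply one_div_lt_one_div_of_lt hmi
        linarith
      exact h3.trans_le hy2
  obtain ⟨s', σ', A, hs', -, hFA, hAσ⟩ := hind Finset.univ
  have hσ' : IsSmooth I σ' := by
    rw [isSmooth_iff]
    intro x
    refine hAσ x (hFA ?_)
    have h1 := P.sum_eq_one x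
    obtain ⟨i, hi⟩ : ∃ i, 1 / (m : ℝ) ≤ (extChartAt I (P.c i)).source.indicator
        (fun x => P.φ i (extChartAt I (P.c i) x)) x := by
      by_contra! hlt
      have hne : Nonempty (Fin P.m) := by
        by_contra hne
        rw [not_nonempty_iff] at hne
        rw [Finset.univ_eq_empty, Finset.sum_empty] at h1
        exact zero_ne_one h1
      have h2 := Finset.sum_lt_sum_of_nonempty (Finset.univ_nonempty) fun i _ => hlt i
      rw [h1, Finset.sum_const, Finset.card_univ, Fintype.card_fin, nsmul_eq_mul] at h2
      have h3 : (m : ℝ) ≠ 0 := by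
        have := (Classical.arbitrary (Fin P.m)).pos
        exact_mod_cast this.ne'
      rw [mul_one_div_cancel h3] at h2
      exact lt_irrefl _ h2
    have hmi : 0 < 1 / (m : ℝ) := by
      have := i.pos
      rw [hm]
      positivity
    have hxs : x ∈ (extChartAt I (P.c i)).source := by
      by_contra hx
      rw [Set.indicator_of_notMem hx] at hi
      linarith
    rw [Set.indicator_of_mem hxs] at hi
    simp only [Set.mem_iUnion]
    refine ⟨i, Finset.mem_univ i, extChartAt I (P.c i) x, ⟨subset_tsupport _ ?_, hi⟩,
      (extChartAt I (P.c i)).left_inv hxs⟩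
    exact (hmi.trans_le hi).ne'
  exact ⟨σ', hσ', hs'.extD_eq I μ P hσ' hh⟩

variable {ι : Type*} [Fintype ι] (b : Module.Basis ι ℝ E)

/-- In degree zero the exact forms are zero and only the definiteness of the norm is needed. In
positive degree, `exists_tendsto_nrm` provides convergent primitives with a weak limit, and
`IsWeakLimit.exists_primitive` makes it smooth. -/
theorem mem_exactForms_of_mem_closure [T2Space X] [CompactSpace X] (h : smoothForms I X k)
    (hcl : jMap I μ P b k h ∈ closure (jMap I μ P b k '' {u | (u : DForm I X k) ∈
      exactForms I X k})) : (h : DForm I X k) ∈ exactForms I X k := by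
  cases k with
  | zero =>
    have h1 : {u : smoothForms I X 0 | (u : DForm I X 0) ∈ exactForms I X 0} = {0} := by
      ext u
      change (u : DForm I X 0) ∈ (⊥ : Submodule ℝ (DForm I X 0)) ↔ u = 0
      rw [Submodule.mem_bot, ZeroMemClass.coe_eq_zero]
    rw [h1, Set.image_singleton, closure_singleton, map_zero, Set.mem_singleton_iff] at hcl
    change (h : DForm I X 0) ∈ (⊥ : Submodule ℝ (DForm I X 0))
    rw [Submodule.mem_bot]
    have h2 := nrm_le_enorm_jMap I μ P b h
    rw [hcl, enorm_zero, mul_zero] at h2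
    have h3 : ∀ i, loc I P i (h : DForm I X 0) = 0 := by
      intro i
      have h4 := (eLpNorm_loc_le I μ P (h : DForm I X 0) i).trans h2
      have hc := IsSmooth.contDiff_loc I P h.2 i
      rw [nonpos_iff_eq_zero, eLpNorm_eq_zero_iff hc.continuous.aestronglyMeasurable
        (by norm_num)] at h4
      exact (Continuous.ae_eq_iff_eq μ hc.continuous continuous_const).1 h4
    rw [← sum_fromChart_loc I P (h : DForm I X 0)]
    refine Finset.sum_eq_zero fun i _ => ?_
    rw [h3]
    have := fromChart_sub I (P.c i) (0 : E → E [⋀^Fin 0]→L[ℝ] ℝ) 0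
    rwa [sub_self, sub_self] at this
  | succ k =>
    have h1 : jMap I μ P b (k + 1) '' {u | (u : DForm I X (k + 1)) ∈ exactForms I X (k + 1)} =
        Set.range ((jMap I μ P b (k + 1)).comp (dMap I X k)) := by
      ext z
      constructor
      · rintro ⟨u, ⟨σ, hσ, hu⟩, rfl⟩
        refine ⟨⟨σ, hσ⟩, ?_⟩
        rw [LinearMap.comp_apply]
        congr 1
        exact Subtype.ext hu
      · rintro ⟨σ, rfl⟩
        exact ⟨dMap I X k σ, ⟨σ, σ.2, rfl⟩, rfl⟩
    rw [h1] at hcl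
    obtain ⟨s, σ, hσ, t0, t1⟩ := exists_tendsto_nrm I μ P b h hcl
    have hw : IsWeakLimit I μ P (fun n => (s n : DForm I X k)) σ (h : DForm I X (k + 1)) :=
      ⟨fun n => (s n).2, hσ, t0, t1⟩
    exact hw.exists_primitive I μ P h.2

theorem mem_smoothForms_of_exact {u : DForm I X k} (hu : u ∈ exactForms I X k) :
    IsSmooth I u := by
  cases k with
  | zero =>
    have : u = 0 := (Submodule.mem_bot ℝ).1 hu
    rw [this]
    exact isSmooth_zero I
  | succ k =>
    obtain ⟨σ, hσ, rfl⟩ := hu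
    exact hσ.extD I

/-- A smooth form which is not exact is detected by a square integrable current which vanishes
on exact forms. -/
theorem exists_current [T2Space X] [CompactSpace X] {h : DForm I X k} (hh : IsSmooth I h)
    (hex : h ∉ exactForms I X k) :
    ∃ W : Fin P.m → (Fin k → ι) → E → ℝ, (∀ i J, Measurable (W i J)) ∧
      (∀ i J, MemLp (W i J) 2 μ) ∧ (∀ i J, ∀ y ∉ tsupport (P.φ i), W i J y = 0) ∧
      (∀ u ∈ exactForms I X k,
        ∑ i, ∑ J, ∫ y, W i J y * inChart I u (P.c i) y (fun a => b (J a)) ∂μ = 0) ∧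
      ∑ i, ∑ J, ∫ y, W i J y * inChart I h (P.c i) y (fun a => b (J a)) ∂μ ≠ 0 := by
  set S : Submodule ℝ (smoothForms I X k) :=
    (exactForms I X k).comap (smoothForms I X k).subtype with hS
  set Y : Submodule ℝ (LocL2 μ (ι := ι) k P.m) := (S.map (jMap I μ P b k)).topologicalClosure
    with hY
  have hcompl : CompleteSpace Y := (Submodule.isClosed_topologicalClosure _).completeSpace_coe
  set z := jMap I μ P b k ⟨h, hh⟩ with hz
  have hzY : z ∉ Y := by
    intro hzY
    refine hex (mem_exactForms_of_mem_closure I μ P b ⟨h, hh⟩ ?_)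
    exact hzY
  -- The component of `h` orthogonal to the closure of the exact forms; it is nonzero because `h` is
  -- not in that closure, and pairing with it is the desired functional.
  set w := z - Y.starProjection z with hw
  have hwY : ∀ y ∈ Y, inner ℝ w y = 0 := fun y hy => by
    have h1 : w ∈ Yᗮ := Y.sub_starProjection_mem_orthogonal z
    exact Submodule.inner_left_of_mem_orthogonal hy h1
  have hwz : inner ℝ w z ≠ 0 := by
    intro h0
    have h1 : inner ℝ w w = 0 := by
      have h2 := hwY _ (Submodule.starProjection_apply_mem Y z)
      have h3 : inner ℝ w w = inner ℝ w z - inner ℝ w (Y.starProjection z) := by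
        rw [← inner_sub_right]
      rw [h3, h0, h2, sub_zero]
    rw [inner_self_eq_zero, hw, sub_eq_zero] at h1
    rw [h1] at hzY
    exact hzY (Submodule.starProjection_apply_mem Y z)
  have hwL : ∀ i (J : Fin k → ι), MemLp (fun y => w i y J) 2 μ := fun i J =>
    (EuclideanSpace.proj (𝕜 := ℝ) J).comp_memLp' (Lp.memLp (w i))
  have huL : ∀ (u : smoothForms I X k) i (J : Fin k → ι), MemLp (fun y => P.φ i y *
      inChart I (u : DForm I X k) (P.c i) y (fun a => b (J a))) 2 μ := fun u i J =>
    (EuclideanSpace.proj (𝕜 := ℝ) J).comp_memLp' (memLp_euclCoords_loc I μ P b u.2 i)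
  have hinner : ∀ u : smoothForms I X k, inner ℝ w (jMap I μ P b k u) =
      ∑ i, ∑ J, ∫ y, (P.φ i y * w i y J) * inChart I (u : DForm I X k) (P.c i) y
        (fun a => b (J a)) ∂μ := by
    intro u
    rw [PiLp.inner_apply]
    refine Finset.sum_congr rfl fun i _ => ?_
    rw [L2.inner_def, ← integral_finsetSum]
    · refine integral_congr_ae ?_
      filter_upwards [(memLp_euclCoords_loc I μ P b u.2 i).coeFn_toLp] with y hy
      rw [jMap_apply, hy, PiLp.inner_apply]
      refine Finset.sum_congr rfl fun J _ => ?_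
      rw [euclCoords_apply, loc]
      simp only [ContinuousAlternatingMap.smul_apply, smul_eq_mul]
      rw [RCLike.inner_apply, conj_trivial]
      ring
    · intro J _
      refine ((hwL i J).integrable_mul (huL u i J)).congr (Eventually.of_forall fun y => ?_)
      simp only [Pi.mul_apply]
      ring
  -- The partition function that localises the form is moved to the current, which thereby acquires
  -- compact support in the chart.
  refine ⟨fun i J y => P.φ i y * w i y J, fun i J => ?_, fun i J => ?_, fun i J y hy => ?_,
    fun u hu => ?_, ?_⟩
  · exact (P.contDiff i).continuous.measurable.mul ((EuclideanSpace.proj (𝕜 := ℝ) J).measurable.comp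
      (Lp.stronglyMeasurable (w i)).measurable)
  · obtain ⟨C, hC⟩ := exists_nnbound (P.contDiff i).continuous (P.compact i)
    refine MemLp.of_le_mul (c := C) (hwL i J)
      ((P.contDiff i).continuous.aestronglyMeasurable.mul (hwL i J).1)
      (Eventually.of_forall fun y => ?_)
    rw [norm_mul]
    gcongr
    exact hC y
  · simp only [image_eq_zero_of_notMem_tsupport hy, zero_mul]
  · have hus := mem_smoothForms_of_exact I hu
    rw [← hinner ⟨u, hus⟩]
    exact hwY _ (Submodule.le_topologicalClosure _ ⟨⟨u, hus⟩, hu, rfl⟩)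
  · rw [← hinner ⟨h, hh⟩]
    exact hwz

end Primitive

end L2Forms
end

noncomputable section

namespace L2Forms

set_option maxSynthPendingDepth 5

/-! ### Kronecker powers of matrices. -/

section KroneckerPower

variable {ι : Type*} [Fintype ι] [DecidableEq ι]

/-- The `k`-th Kronecker power of a matrix. -/
def kpow (A : Matrix ι ι ℝ) (k : ℕ) : Matrix (Fin k → ι) (Fin k → ι) ℝ :=
  Matrix.of fun i j => ∏ a, A (i a) (j a)

/-- Distributivity: a product of sums over one index is a sum over tuples of indices. -/
theorem kpow_mul (A B : Matrix ι ι ℝ) (k : ℕ) : kpow (A * B) k = kpow A k * kpow B k := by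
  ext i j
  simp only [kpow, Matrix.of_apply, Matrix.mul_apply, ← Finset.prod_mul_distrib]
  rw [Finset.prod_univ_sum, Fintype.piFinset_univ]

theorem kpow_transpose (A : Matrix ι ι ℝ) (k : ℕ) : kpow A.transpose k = (kpow A k).transpose := rfl

theorem kpow_one (k : ℕ) : kpow (1 : Matrix ι ι ℝ) k = 1 := by
  ext i j
  simp only [kpow, Matrix.of_apply, Matrix.one_apply]
  by_cases h : i = j
  · subst h; simp
  · rw [if_neg h]
    obtain ⟨a, ha⟩ := Function.ne_iff.1 h
    exact Finset.prod_eq_zero (Finset.mem_univ a) (if_neg ha)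

end KroneckerPower

/-! ### The inner product on alternating forms. -/

section InnerProduct

open scoped MatrixOrder Matrix.Norms.L2Operator

variable {E : Type*} [NormedAddCommGroup E] [NormedSpace ℝ E] [FiniteDimensional ℝ E]
  {ι : Type*} [Fintype ι] [DecidableEq ι] (b : Module.Basis ι ℝ E) {k : ℕ}
  (B : E →L[ℝ] E →L[ℝ] ℝ)

/-- The Gram matrix of a bilinear form. -/
def gramOf : Matrix ι ι ℝ := Matrix.of fun i j => B (b i) (b j)

/-- The inner product of alternating forms induced by a bilinear form. -/
def cInner (α β : E [⋀^Fin k]→L[ℝ] ℝ) : ℝ :=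
  (1 / (k.factorial : ℝ)) * ∑ i : Fin k → ι, ∑ j : Fin k → ι,
    (∏ a, (gramOf b B)⁻¹ (i a) (j a)) * (α (fun a => b (i a)) * β (fun a => b (j a)))

/-- The sum over pairs of tuples is the bilinear form of the Kronecker power of the inverse Gram
matrix; its properties then follow from those of `kpow`. -/
theorem cInner_eq (α β : E [⋀^Fin k]→L[ℝ] ℝ) : cInner b B α β =
    (1 / (k.factorial : ℝ)) *
      (coords b α ⬝ᵥ (Matrix.mulVec (kpow (gramOf b B)⁻¹ k) (coords b β))) := by
  rw [cInner]
  congr 1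
  refine Finset.sum_congr rfl fun i _ => ?_
  rw [Matrix.mulVec, dotProduct, Finset.mul_sum]
  refine Finset.sum_congr rfl fun j _ => ?_
  simp only [coords_apply, kpow, Matrix.of_apply]
  ring

theorem coords_pullback (α : E [⋀^Fin k]→L[ℝ] ℝ) (D : E →L[ℝ] E) :
    coords b (α.compContinuousLinearMap D) =
      Matrix.mulVec (kpow (LinearMap.toMatrix b b D.toLinearMap) k).transpose (coords b α) := by
  ext i
  rw [coords_apply, ContinuousAlternatingMap.compContinuousLinearMap_apply,
    apply_eq_sum_coords b α]
  refine Finset.sum_congr rfl fun j _ => ?_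
  simp only [kpow, Matrix.transpose_apply, Matrix.of_apply, LinearMap.toMatrix_apply]
  rfl

theorem gramOf_pullback (D : E →L[ℝ] E) : gramOf b (B.bilinearComp D D) =
    (LinearMap.toMatrix b b D.toLinearMap).transpose * gramOf b B *
      LinearMap.toMatrix b b D.toLinearMap := by
  ext i j
  have hD : ∀ l, D (b l) = ∑ p, LinearMap.toMatrix b b D.toLinearMap p l • b p := fun l => by
    simp only [LinearMap.toMatrix_apply]
    exact (b.sum_repr (D (b l))).symm
  simp only [gramOf, Matrix.of_apply, ContinuousLinearMap.bilinearComp_apply]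
  rw [hD i, hD j, Matrix.mul_assoc, Matrix.mul_apply]
  simp only [map_sum, map_smul, _root_.sum_apply, _root_.smul_apply,
    smul_eq_mul, Matrix.mul_apply, Matrix.transpose_apply, Matrix.of_apply, Finset.mul_sum]
  rw [Finset.sum_comm]
  refine Finset.sum_congr rfl fun p _ => Finset.sum_congr rfl fun q _ => ?_
  ring

/-- With `P` the invertible matrix of `D` and `G` the Gram matrix, `P (Pᵀ G P)⁻¹ Pᵀ = G⁻¹`;
Kronecker powers carry this to `k`-forms. It is the independence of coordinates. -/
theorem cInner_pullback (α β : E [⋀^Fin k]→L[ℝ] ℝ) {D D' : E →L[ℝ] E}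
    (h : D.comp D' = ContinuousLinearMap.id ℝ E) :
    cInner b (B.bilinearComp D D) (α.compContinuousLinearMap D) (β.compContinuousLinearMap D) =
      cInner b B α β := by
  set P := LinearMap.toMatrix b b D.toLinearMap with hP
  have hPP : P * LinearMap.toMatrix b b D'.toLinearMap = 1 := by
    rw [hP, ← LinearMap.toMatrix_comp]
    have : D.toLinearMap ∘ₗ D'.toLinearMap = LinearMap.id := by
      ext v; exact DFunLike.congr_fun h v
    rw [this, LinearMap.toMatrix_id]
  have hdet : IsUnit P.det := by
    have := congrArg Matrix.det hPP
    rw [Matrix.det_mul, Matrix.det_one] at this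
    exact IsUnit.of_mul_eq_one _ this
  have hinv : P * (P.transpose * gramOf b B * P)⁻¹ * P.transpose = (gramOf b B)⁻¹ := by
    rw [Matrix.mul_inv_rev, Matrix.mul_inv_rev, ← Matrix.mul_assoc, Matrix.mul_nonsing_inv _ hdet,
      Matrix.one_mul, Matrix.mul_assoc, Matrix.nonsing_inv_mul, Matrix.mul_one]
    rwa [Matrix.det_transpose]
  rw [cInner_eq, cInner_eq, coords_pullback, coords_pullback, gramOf_pullback, ← hP, ← hinv,
    kpow_mul, kpow_mul, kpow_transpose]
  congr 1
  rw [Matrix.dotProduct_mulVec, Matrix.dotProduct_mulVec, Matrix.mulVec_transpose,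
    Matrix.vecMul_vecMul, ← Matrix.dotProduct_mulVec, ← Matrix.dotProduct_mulVec,
    Matrix.mulVec_mulVec, Matrix.mul_assoc (kpow P k)]

/-- Writing `G⁻¹ = Cᵀ C`, multiplicativity of Kronecker powers exhibits the form as a sum of
squares. -/
theorem cInner_self_nonneg (hB : (gramOf b B).PosDef) (α : E [⋀^Fin k]→L[ℝ] ℝ) :
    0 ≤ cInner b B α α := by
  obtain ⟨C, hC⟩ : ∃ C : Matrix ι ι ℝ, (gramOf b B)⁻¹ = C.transpose * C := by
    obtain ⟨C, hC⟩ := CStarAlgebra.nonneg_iff_eq_star_mul_self.mp hB.inv.posSemidef.nonneg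
    rw [Matrix.star_eq_conjTranspose] at hC
    exact ⟨C, by rw [hC, Matrix.conjTranspose_eq_transpose_of_trivial]⟩
  rw [cInner_eq, hC, kpow_mul, kpow_transpose, ← Matrix.mulVec_mulVec, Matrix.dotProduct_mulVec,
    Matrix.vecMul_transpose]
  refine mul_nonneg (by positivity) (Finset.sum_nonneg fun i _ => mul_self_nonneg _)

theorem cInner_add_left (α α' β : E [⋀^Fin k]→L[ℝ] ℝ) :
    cInner b B (α + α') β = cInner b B α β + cInner b B α' β := by
  simp only [cInner_eq, map_add, add_dotProduct, mul_add]

theorem cInner_add_right (α β β' : E [⋀^Fin k]→L[ℝ] ℝ) :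
    cInner b B α (β + β') = cInner b B α β + cInner b B α β' := by
  simp only [cInner_eq, map_add, Matrix.mulVec_add, dotProduct_add, mul_add]

theorem cInner_smul_left (c : ℝ) (α β : E [⋀^Fin k]→L[ℝ] ℝ) :
    cInner b B (c • α) β = c * cInner b B α β := by
  simp only [cInner_eq, map_smul, smul_dotProduct, smul_eq_mul]
  ring

theorem cInner_smul_right (c : ℝ) (α β : E [⋀^Fin k]→L[ℝ] ℝ) :
    cInner b B α (c • β) = c * cInner b B α β := by
  simp only [cInner_eq, map_smul, Matrix.mulVec_smul, dotProduct_smul, smul_eq_mul]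
  ring

theorem cInner_zero_left (β : E [⋀^Fin k]→L[ℝ] ℝ) : cInner b B 0 β = 0 := by
  simpa using cInner_smul_left b B 0 0 β

theorem cInner_zero_right (β : E [⋀^Fin k]→L[ℝ] ℝ) : cInner b B β 0 = 0 := by
  simpa using cInner_smul_right b B 0 β 0

theorem cInner_sum_right {κ : Type*} (s : Finset κ) (α : E [⋀^Fin k]→L[ℝ] ℝ)
    (β : κ → E [⋀^Fin k]→L[ℝ] ℝ) :
    cInner b B α (∑ i ∈ s, β i) = ∑ i ∈ s, cInner b B α (β i) := by
  classical
  induction s using Finset.induction_on with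
  | empty => simp [cInner_zero_right]
  | insert a s ha ih => rw [Finset.sum_insert ha, Finset.sum_insert ha, cInner_add_right, ih]

theorem cInner_add_self_le (hB : (gramOf b B).PosDef) (α β : E [⋀^Fin k]→L[ℝ] ℝ) :
    cInner b B (α + β) (α + β) ≤ 2 * cInner b B α α + 2 * cInner b B β β := by
  have h := cInner_self_nonneg b B hB (α + (-1 : ℝ) • β)
  simp only [cInner_add_left, cInner_add_right, cInner_smul_left, cInner_smul_right] at h ⊢
  linarith

/-- The form `v ↦ det B(b_{J a}, v_c)` dual to the coordinate `α ↦ α(b_J)`. -/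
def lower (J : Fin k → ι) : E [⋀^Fin k]→L[ℝ] ℝ :=
  { (Matrix.detRowAlternating (R := ℝ) (n := Fin k)).compLinearMap
      (LinearMap.pi fun a => (B (b (J a))).toLinearMap) with
    cont := by
      change Continuous fun v : Fin k → E =>
        Matrix.det (Matrix.of fun c a => B (b (J a)) (v c))
      exact Continuous.matrix_det (continuous_matrix fun c a =>
        (B (b (J a))).continuous.comp (continuous_apply c)) }

theorem lower_apply (J : Fin k → ι) (v : Fin k → E) :
    lower b B J v = Matrix.det (Matrix.of fun c a => B (b (J a)) (v c)) := rfl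

/-- The Leibniz expansion of the determinant, one term for each permutation. -/
theorem coords_lower (J : Fin k → ι) : coords b (lower b B J) =
    ∑ σ : Equiv.Perm (Fin k), (Equiv.Perm.sign σ : ℝ) •
      Matrix.mulVec (kpow (gramOf b B) k).transpose (Pi.single (J ∘ σ) 1) := by
  ext i
  rw [coords_apply, lower_apply, ← Matrix.det_transpose, Matrix.det_apply', Finset.sum_apply]
  refine Finset.sum_congr rfl fun σ _ => ?_
  rw [Pi.smul_apply, Matrix.mulVec_single_one, smul_eq_mul]
  rfl

/-- The Gram matrix cancels its inverse, and each permutation contributes the same value because its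
sign occurs twice. The `k!` equal terms cancel the factor `1 / k!`. -/
theorem cInner_lower (hB : (gramOf b B).PosDef) (α : E [⋀^Fin k]→L[ℝ] ℝ) (J : Fin k → ι) :
    cInner b B α (lower b B J) = α (fun a => b (J a)) := by
  have hs : (gramOf b B).transpose = gramOf b B := by
    have := hB.isHermitian
    rwa [Matrix.IsHermitian, Matrix.conjTranspose_eq_transpose_of_trivial] at this
  have hu : IsUnit (gramOf b B).det := hB.det_pos.ne'.isUnit
  have key : ∀ w : (Fin k → ι) → ℝ, Matrix.mulVec (kpow (gramOf b B)⁻¹ k)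
      (Matrix.mulVec (kpow (gramOf b B) k).transpose w) = w := fun w => by
    rw [← kpow_transpose, hs, Matrix.mulVec_mulVec, ← kpow_mul, Matrix.nonsing_inv_mul _ hu,
      kpow_one, Matrix.one_mulVec]
  rw [cInner_eq, coords_lower, Matrix.mulVec_sum, dotProduct_sum]
  have h2 : ∀ σ : Equiv.Perm (Fin k), coords b α ⬝ᵥ Matrix.mulVec (kpow (gramOf b B)⁻¹ k)
      ((Equiv.Perm.sign σ : ℝ) •
        Matrix.mulVec (kpow (gramOf b B) k).transpose (Pi.single (J ∘ σ) 1)) =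
        α (fun a => b (J a)) := fun σ => by
    rw [Matrix.mulVec_smul, key, dotProduct_smul, dotProduct_single, coords_apply, mul_one]
    have := α.toAlternatingMap.map_perm (fun a => b (J a)) σ
    change α (fun a => b (J (σ a))) = _ at this
    simp only [Function.comp_apply]
    rw [this]
    change (Equiv.Perm.sign σ : ℝ) * ((Equiv.Perm.sign σ : ℤˣ) • α (fun a => b (J a))) = _
    rw [Units.smul_def, zsmul_eq_mul, ← mul_assoc, ← Int.cast_mul, ← Units.val_mul,
      Int.units_mul_self]
    simp
  simp only [h2, Finset.sum_const, Finset.card_univ, Fintype.card_perm, Fintype.card_fin,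
    nsmul_eq_mul]
  have : (k.factorial : ℝ) ≠ 0 := by positivity
  field_simp

end InnerProduct

end L2Forms
end

noncomputable section

namespace L2Forms

set_option maxSynthPendingDepth 5

/-! ### The metric in charts. -/

section ChartMetric

variable {E H : Type*} [NormedAddCommGroup E] [NormedSpace ℝ E] [TopologicalSpace H]
  (I : ModelWithCorners ℝ E H) [I.Boundaryless]
  {X : Type*} [TopologicalSpace X] [ChartedSpace H X] [IsManifold I ∞ X] [FiniteDimensional ℝ E]
  {ι : Type*} [Fintype ι] [DecidableEq ι] (b : Module.Basis ι ℝ E) (g : MetricField I X) {k : ℕ}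

/-- The metric at a point, as a bilinear form on the model space. -/
def metricAt (x : X) : E →L[ℝ] E →L[ℝ] ℝ := g x

/-- The metric in the coordinates of a preferred chart. -/
def chartMetric (x₀ : X) (y : E) : E →L[ℝ] E →L[ℝ] ℝ :=
  (metricAt I g ((extChartAt I x₀).symm y)).bilinearComp (dSymm I x₀ y) (dSymm I x₀ y)

theorem chartGram_eq (x₀ : X) (y : E) : chartGram I b g x₀ y = gramOf b (chartMetric I g x₀ y) :=
  rfl

theorem formInner_eq (x : X) (u v : DForm I X k) :
    formInner I b g x (u x) (v x) = cInner b (metricAt I g x) (formAt I u x) (formAt I v x) := rfl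

/-- By `cInner_pullback`, the pointwise inner product may be computed in any chart through the
point. -/
theorem formInner_symm {x₀ : X} {y : E} (hy : y ∈ (extChartAt I x₀).target) (u v : DForm I X k) :
    formInner I b g ((extChartAt I x₀).symm y) (u ((extChartAt I x₀).symm y))
      (v ((extChartAt I x₀).symm y)) =
        cInner b (chartMetric I g x₀ y) (inChart I u x₀ y) (inChart I v x₀ y) := by
  rw [formInner_eq, inChart_eq, inChart_eq, chartMetric,
    cInner_pullback b _ _ _ (dSymm_comp_dChart I hy)]

theorem chartMetric_trans {x₀ x₁ : X} {y : E} (hy : y ∈ transDom I x₀ x₁) :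
    chartMetric I g x₀ y = (chartMetric I g x₁ (trans I x₀ x₁ y)).bilinearComp
      (fderiv ℝ (trans I x₀ x₁) y) (fderiv ℝ (trans I x₀ x₁) y) := by
  rw [chartMetric, chartMetric, symm_trans I hy, fderiv_trans I hy]
  have h1 := dSymm_comp_dChart' I hy.2
  have h2 : ∀ v, dSymm I x₁ (trans I x₀ x₁ y) (dChart I x₁ ((extChartAt I x₀).symm y)
      (dSymm I x₀ y v)) = dSymm I x₀ y v := fun v => DFunLike.congr_fun h1 (dSymm I x₀ y v)
  ext v w
  simp only [ContinuousLinearMap.bilinearComp_apply, ContinuousLinearMap.comp_apply, h2]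

/-- The Jacobian enters squared, so after the square root the volume density scales by its absolute
value, as the change of variables formula requires. -/
theorem det_chartGram_trans {x₀ x₁ : X} {y : E} (hy : y ∈ transDom I x₀ x₁) :
    (chartGram I b g x₀ y).det =
      (fderiv ℝ (trans I x₀ x₁) y).det ^ 2 * (chartGram I b g x₁ (trans I x₀ x₁ y)).det := by
  rw [chartGram_eq, chartMetric_trans I g hy, gramOf_pullback, Matrix.det_mul, Matrix.det_mul,
    Matrix.det_transpose, LinearMap.det_toMatrix, chartGram_eq]
  change LinearMap.det _ * _ * LinearMap.det _ = (LinearMap.det _) ^ 2 * _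
  ring

/-- The coordinate expressions of the metric are positive definite and continuous. -/
structure IsRiem : Prop where
  posDef : ∀ x₀, ∀ y ∈ (extChartAt I x₀).target, (chartGram I b g x₀ y).PosDef
  continuousOn : ∀ x₀, ContinuousOn (chartGram I b g x₀) (extChartAt I x₀).target

variable {I b g}

variable (I b g) in
theorem formInner_chart {x₀ x : X} (hx : x ∈ (extChartAt I x₀).source) (u v : DForm I X k) :
    formInner I b g x (u x) (v x) = cInner b (chartMetric I g x₀ (extChartAt I x₀ x))
      (inChart I u x₀ (extChartAt I x₀ x)) (inChart I v x₀ (extChartAt I x₀ x)) := by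
  rw [← formInner_symm I b g ((extChartAt I x₀).map_source hx)]
  exact (congrArg (fun z => formInner I b g z (u z) (v z)) ((extChartAt I x₀).left_inv hx)).symm

theorem IsRiem.formInner_add_le (hg : IsRiem I b g) (x : X) (u v : DForm I X k) :
    formInner I b g x ((u + v) x) ((u + v) x) ≤
      2 * formInner I b g x (u x) (u x) + 2 * formInner I b g x (v x) (v x) := by
  rw [formInner_chart I b g (mem_extChartAt_source x) u, formInner_chart I b g
    (mem_extChartAt_source x) v, formInner_chart I b g (mem_extChartAt_source x) (u + v),
    inChart_add]
  refine cInner_add_self_le b _ ?_ _ _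
  rw [← chartGram_eq]
  exact hg.posDef x _ (mem_extChartAt_target x)

theorem IsRiem.continuousOn_inv (hg : IsRiem I b g) (x₀ : X) :
    ContinuousOn (fun y => (chartGram I b g x₀ y)⁻¹) (extChartAt I x₀).target := by
  have h1 : ContinuousOn (fun y => (chartGram I b g x₀ y).det) (extChartAt I x₀).target :=
    (Continuous.matrix_det continuous_id).comp_continuousOn (hg.continuousOn x₀)
  have h2 : ContinuousOn (fun y => (chartGram I b g x₀ y).adjugate) (extChartAt I x₀).target :=
    (Continuous.matrix_adjugate continuous_id).comp_continuousOn (hg.continuousOn x₀)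
  refine ((h1.inv₀ fun y hy => (hg.posDef x₀ y hy).det_pos.ne').smul h2).congr fun y hy => ?_
  rw [Matrix.inv_def, Ring.inverse_eq_inv']
  rfl

variable (I b g)

/-- The density of the Riemannian volume in the coordinates of a preferred chart. -/
def volDensity (x₀ : X) (y : E) : ℝ := Real.sqrt (chartGram I b g x₀ y).det

variable {I b g}

theorem IsRiem.continuousOn_volDensity (hg : IsRiem I b g) (x₀ : X) :
    ContinuousOn (volDensity I b g x₀) (extChartAt I x₀).target :=
  ((Continuous.matrix_det continuous_id).comp_continuousOn (hg.continuousOn x₀)).sqrt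

theorem IsRiem.volDensity_pos (hg : IsRiem I b g) {x₀ : X} {y : E}
    (hy : y ∈ (extChartAt I x₀).target) : 0 < volDensity I b g x₀ y :=
  Real.sqrt_pos.2 (hg.posDef x₀ y hy).det_pos

theorem IsRiem.continuousOn_density_mul_cInner (hg : IsRiem I b g) {u : DForm I X k}
    (hu : IsSmooth I u) (x₀ : X) :
    ContinuousOn (fun y => volDensity I b g x₀ y * cInner b (chartMetric I g x₀ y)
      (inChart I u x₀ y) (inChart I u x₀ y)) (extChartAt I x₀).target := by
  have h1 : ∀ i : Fin k → ι, ContinuousOn (fun y => inChart I u x₀ y fun a => b (i a))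
      (extChartAt I x₀).target := fun i =>
    (ContinuousAlternatingMap.apply ℝ E ℝ (fun a => b (i a))).continuous.comp_continuousOn
      (hu x₀).continuousOn
  have h2 : ∀ i j, ContinuousOn (fun y => (chartGram I b g x₀ y)⁻¹ i j)
      (extChartAt I x₀).target := fun i j =>
    (continuous_id.matrix_elem i j).comp_continuousOn (hg.continuousOn_inv x₀)
  refine (hg.continuousOn_volDensity x₀).mul (continuousOn_const.mul ?_)
  exact continuousOn_finsetSum _ fun i _ => continuousOn_finsetSum _ fun j _ =>
    (continuousOn_finsetProd _ fun a _ => h2 _ _).mul ((h1 i).mul (h1 j))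

end ChartMetric

/-! ### The Riemannian volume measure in charts. -/

section Volume

variable {E H : Type*} [NormedAddCommGroup E] [NormedSpace ℝ E] [TopologicalSpace H]
  {I : ModelWithCorners ℝ E H} [I.Boundaryless]
  {X : Type*} [TopologicalSpace X] [ChartedSpace H X] [IsManifold I ∞ X] [FiniteDimensional ℝ E]
  {ι : Type*} [Fintype ι] [DecidableEq ι] {b : Module.Basis ι ℝ E} {g : MetricField I X} {k : ℕ}
  [MeasurableSpace E] [BorelSpace E] [MeasurableSpace X] [BorelSpace X]

/-- The inverse chart is an open embedding of its domain. Integrals against image measures can then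
be pulled back without any measurability of the integrand. -/
theorem measurableEmbedding_chart_symm (x₀ : X) :
    MeasurableEmbedding fun y : (extChartAt I x₀).target => (extChartAt I x₀).symm (y : E) := by
  have hc := (continuousOn_extChartAt_symm (I := I) x₀).domRestrict
  have ho : IsOpen (extChartAt I x₀).target := isOpen_extChartAt_target x₀
  refine Topology.IsOpenEmbedding.measurableEmbedding
    (Topology.IsOpenEmbedding.of_continuous_injective_isOpenMap hc ?_ ?_)
  · intro y z h
    exact Subtype.ext ((extChartAt I x₀).symm.injOn y.2 z.2 h)
  · intro U hU
    have h1 : IsOpen (Subtype.val '' U) := ho.isOpenMap_subtype_val U hU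
    have h2 : (fun y : (extChartAt I x₀).target => (extChartAt I x₀).symm (y : E)) '' U =
        (extChartAt I x₀).source ∩ extChartAt I x₀ ⁻¹' (Subtype.val '' U) := by
      ext x
      constructor
      · rintro ⟨y, hy, rfl⟩
        refine ⟨(extChartAt I x₀).map_target y.2, y, hy, ?_⟩
        exact ((extChartAt I x₀).right_inv y.2).symm
      · rintro ⟨hx, y, hy, hyx⟩
        refine ⟨y, hy, ?_⟩
        simp only [hyx]
        exact (extChartAt I x₀).left_inv hx
    change IsOpen ((fun y : (extChartAt I x₀).target => (extChartAt I x₀).symm (y : E)) '' U)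
    rw [h2]
    exact (continuousOn_extChartAt x₀).isOpen_inter_preimage (isOpen_extChartAt_source x₀) h1

theorem map_chart_symm (x₀ : X) (ν : Measure E) :
    (ν.restrict (extChartAt I x₀).target).map (extChartAt I x₀).symm =
      (ν.comap (Subtype.val : (extChartAt I x₀).target → E)).map
        (fun y : (extChartAt I x₀).target => (extChartAt I x₀).symm (y : E)) := by
  have hT : MeasurableSet (extChartAt I x₀).target := (isOpen_extChartAt_target x₀).measurableSet
  have hm : AEMeasurable (extChartAt I x₀).symm (ν.restrict (extChartAt I x₀).target) :=
    (continuousOn_extChartAt_symm x₀).aemeasurable hT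
  rw [← map_comap_subtype_coe hT] at hm ⊢
  exact AEMeasurable.map_map_of_aemeasurable hm measurable_subtype_coe.aemeasurable

theorem lintegral_map_chart_symm (x₀ : X) (ν : Measure E) (F : X → ENNReal) :
    ∫⁻ x, F x ∂((ν.restrict (extChartAt I x₀).target).map (extChartAt I x₀).symm) =
      ∫⁻ y in (extChartAt I x₀).target, F ((extChartAt I x₀).symm y) ∂ν := by
  have hT : MeasurableSet (extChartAt I x₀).target := (isOpen_extChartAt_target x₀).measurableSet
  rw [map_chart_symm, (measurableEmbedding_chart_symm x₀).lintegral_map,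
    ← map_comap_subtype_coe hT, (MeasurableEmbedding.subtype_coe hT).lintegral_map]

theorem integral_map_chart_symm (x₀ : X) (ν : Measure E) (F : X → ℝ) :
    ∫ x, F x ∂((ν.restrict (extChartAt I x₀).target).map (extChartAt I x₀).symm) =
      ∫ y in (extChartAt I x₀).target, F ((extChartAt I x₀).symm y) ∂ν := by
  have hT : MeasurableSet (extChartAt I x₀).target := (isOpen_extChartAt_target x₀).measurableSet
  rw [map_chart_symm, (measurableEmbedding_chart_symm x₀).integral_map,
    ← map_comap_subtype_coe hT, (MeasurableEmbedding.subtype_coe hT).integral_map]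

theorem integrable_map_chart_symm (x₀ : X) (ν : Measure E) (F : X → ℝ) :
    Integrable F ((ν.restrict (extChartAt I x₀).target).map (extChartAt I x₀).symm) ↔
      IntegrableOn (fun y => F ((extChartAt I x₀).symm y)) (extChartAt I x₀).target ν := by
  have hT : MeasurableSet (extChartAt I x₀).target := (isOpen_extChartAt_target x₀).measurableSet
  rw [map_chart_symm, (measurableEmbedding_chart_symm x₀).integrable_map_iff, IntegrableOn,
    ← map_comap_subtype_coe hT, (MeasurableEmbedding.subtype_coe hT).integrable_map_iff]
  rfl

theorem aemeasurable_map_chart_symm (x₀ : X) (ν : Measure E) (F : X → ENNReal) :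
    AEMeasurable F ((ν.restrict (extChartAt I x₀).target).map (extChartAt I x₀).symm) ↔
      AEMeasurable (fun y => F ((extChartAt I x₀).symm y))
        (ν.restrict (extChartAt I x₀).target) := by
  have hT : MeasurableSet (extChartAt I x₀).target := (isOpen_extChartAt_target x₀).measurableSet
  rw [map_chart_symm, (measurableEmbedding_chart_symm x₀).aemeasurable_map_iff,
    ← map_comap_subtype_coe hT, (MeasurableEmbedding.subtype_coe hT).aemeasurable_map_iff]
  rfl

theorem chartVolume_eq (x₀ : X) : chartVolume I b g x₀ =
    (((b.addHaar).withDensity (fun y => ENNReal.ofReal (volDensity I b g x₀ y))).restrict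
      (extChartAt I x₀).target).map (extChartAt I x₀).symm := by
  rw [restrict_withDensity (isOpen_extChartAt_target x₀).measurableSet]
  rfl

theorem chartVolume_apply (x₀ : X) {A : Set X} (hA : MeasurableSet A) :
    chartVolume I b g x₀ A = ∫⁻ y in (extChartAt I x₀).target ∩ (extChartAt I x₀).symm ⁻¹' A,
      ENNReal.ofReal (volDensity I b g x₀ y) ∂b.addHaar := by
  have hT : MeasurableSet (extChartAt I x₀).target := (isOpen_extChartAt_target x₀).measurableSet
  have hS : MeasurableSet ((extChartAt I x₀).target ∩ (extChartAt I x₀).symm ⁻¹' A) := by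
    have := hT.subtype_image ((measurableEmbedding_chart_symm (I := I) x₀).measurable hA)
    convert this using 1
    ext y
    simp only [Set.mem_inter_iff, Set.mem_preimage, Set.mem_image, Subtype.exists,
      exists_and_left, exists_prop]
    constructor
    · rintro ⟨h1, h2⟩; exact ⟨y, h2, h1, rfl⟩
    · rintro ⟨z, h2, h1, rfl⟩; exact ⟨h1, h2⟩
  rw [← withDensity_apply _ hS, chartVolume_eq, Measure.map_apply_of_aemeasurable
    ((continuousOn_extChartAt_symm x₀).aemeasurable hT) hA, Measure.restrict_apply₀']
  · rw [Set.inter_comm]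
  · exact hT.nullMeasurableSet

/-- Change of variables along the transition map, with the transformation law of the density. -/
theorem chartVolume_eq_of_subset {x₀ x₁ : X} {A : Set X} (hA : MeasurableSet A)
    (h₀ : A ⊆ (extChartAt I x₀).source) (h₁ : A ⊆ (extChartAt I x₁).source) :
    chartVolume I b g x₁ A = chartVolume I b g x₀ A := by
  rw [chartVolume_apply x₀ hA, chartVolume_apply x₁ hA]
  set S₀ := (extChartAt I x₀).target ∩ (extChartAt I x₀).symm ⁻¹' A with hS₀
  have hS : MeasurableSet S₀ := by
    have hT : MeasurableSet (extChartAt I x₀).target := (isOpen_extChartAt_target x₀).measurableSet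
    have := hT.subtype_image ((measurableEmbedding_chart_symm (I := I) x₀).measurable hA)
    convert this using 1
    ext y
    simp only [hS₀, Set.mem_inter_iff, Set.mem_preimage, Set.mem_image, Subtype.exists,
      exists_and_left, exists_prop]
    constructor
    · rintro ⟨h1, h2⟩; exact ⟨y, h2, h1, rfl⟩
    · rintro ⟨z, h2, h1, rfl⟩; exact ⟨h1, h2⟩
  have hd : ∀ y ∈ S₀, y ∈ transDom I x₀ x₁ := fun y hy => ⟨hy.1, h₁ hy.2⟩
  have himg : (extChartAt I x₁).target ∩ (extChartAt I x₁).symm ⁻¹' A = trans I x₀ x₁ '' S₀ := by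
    ext z
    constructor
    · rintro ⟨hz, hzA⟩
      have hz' : z ∈ transDom I x₁ x₀ := ⟨hz, h₀ hzA⟩
      refine ⟨trans I x₁ x₀ z, ⟨(trans_mem I hz').1, ?_⟩, trans_trans I hz'⟩
      rw [Set.mem_preimage, symm_trans I hz']
      exact hzA
    · rintro ⟨y, hy, rfl⟩
      refine ⟨(trans_mem I (hd y hy)).1, ?_⟩
      rw [Set.mem_preimage, symm_trans I (hd y hy)]
      exact hy.2
  rw [himg, lintegral_image_eq_lintegral_abs_det_fderiv_mul b.addHaar hS
    (f' := fderiv ℝ (trans I x₀ x₁))]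
  · refine setLIntegral_congr_fun hS fun y hy => ?_
    simp only [volDensity]
    rw [det_chartGram_trans I b g (hd y hy), Real.sqrt_mul (sq_nonneg _), Real.sqrt_sq_eq_abs,
      ENNReal.ofReal_mul (abs_nonneg _)]
  · intro y hy
    exact (((contDiffOn_trans I x₀ x₁).contDiffAt ((isOpen_transDom I x₀ x₁).mem_nhds
      (hd y hy))).differentiableAt (by simp)).hasFDerivAt.hasFDerivWithinAt
  · intro y hy z hz h
    rw [← trans_trans I (hd y hy), h, trans_trans I (hd z hz)]

/-- The measure of chart `x₁` ignores whatever part of `A` lies outside its domain, and on the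
remaining part the two measures agree. -/
theorem chartVolume_le {x₀ x₁ : X} {A : Set X} (hA : MeasurableSet A)
    (h₀ : A ⊆ (extChartAt I x₀).source) :
    chartVolume I b g x₁ A ≤ chartVolume I b g x₀ A := by
  have hs : MeasurableSet (extChartAt I x₁).source := (isOpen_extChartAt_source x₁).measurableSet
  have h1 : chartVolume I b g x₁ A = chartVolume I b g x₁ (A ∩ (extChartAt I x₁).source) := by
    rw [chartVolume_apply x₁ hA, chartVolume_apply x₁ (hA.inter hs)]
    congr 2
    ext y
    simp only [Set.mem_inter_iff, Set.mem_preimage]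
    constructor
    · rintro ⟨h1, h2⟩; exact ⟨h1, h2, (extChartAt I x₁).map_target h1⟩
    · rintro ⟨h1, h2, -⟩; exact ⟨h1, h2⟩
  rw [h1, chartVolume_eq_of_subset (x₀ := x₀) (hA.inter hs)
    (Set.inter_subset_left.trans h₀) Set.inter_subset_right]
  exact measure_mono Set.inter_subset_left

/-- On the domain of a preferred chart, the Riemannian volume is given by the volume density. -/
theorem vol_restrict_source (x₀ : X) :
    (vol I b g).restrict (extChartAt I x₀).source = chartVolume I b g x₀ := by
  have hs : MeasurableSet (extChartAt I x₀).source := (isOpen_extChartAt_source x₀).measurableSet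
  -- The right side dominates every chart volume: on the source by comparison of charts, off the
  -- source because it contains `vol` itself. The supremum therefore cannot exceed it.
  have hle : vol I b g ≤ chartVolume I b g x₀ +
      (vol I b g).restrict (extChartAt I x₀).sourceᶜ := by
    refine iSup_le fun x₁ => Measure.le_iff.2 fun A hA => ?_
    rw [Measure.add_apply, Measure.restrict_apply hA, ← measure_inter_add_sdiff A hs]
    exact add_le_add ((chartVolume_le (hA.inter hs) Set.inter_subset_right).trans
        (measure_mono Set.inter_subset_left))
      ((le_iSup (fun x₁ : X => chartVolume I b g x₁) x₁) _)
  have h0 : chartVolume I b g x₀ (extChartAt I x₀).sourceᶜ = 0 := by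
    rw [chartVolume_apply x₀ hs.compl]
    have : (extChartAt I x₀).target ∩ (extChartAt I x₀).symm ⁻¹' (extChartAt I x₀).sourceᶜ = ∅ := by
      ext y
      simp only [Set.mem_inter_iff, Set.mem_preimage, Set.mem_compl_iff, Set.mem_empty_iff_false,
        iff_false, not_and, not_not]
      exact fun h => (extChartAt I x₀).map_target h
    rw [this]; simp
  refine le_antisymm (Measure.le_iff.2 fun A hA => ?_) (Measure.le_iff.2 fun A hA => ?_)
  · rw [Measure.restrict_apply hA]
    refine (hle _).trans ?_
    rw [Measure.add_apply, Measure.restrict_apply (hA.inter hs)]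
    have : A ∩ (extChartAt I x₀).source ∩ (extChartAt I x₀).sourceᶜ = ∅ := by
      rw [Set.inter_assoc, Set.inter_compl_self, Set.inter_empty]
    rw [this, measure_empty, add_zero]
    exact measure_mono Set.inter_subset_left
  · rw [Measure.restrict_apply hA]
    refine (le_of_eq ?_).trans ((le_iSup (fun x₁ : X => chartVolume I b g x₁) x₀) _)
    rw [← measure_inter_add_sdiff A hs]
    have : chartVolume I b g x₀ (A \ (extChartAt I x₀).source) = 0 :=
      measure_mono_null (fun x hx => hx.2) h0
    rw [this, add_zero]

theorem IsRiem.aemeasurable_density (hg : IsRiem I b g) (x₀ : X) :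
    AEMeasurable (fun y => ENNReal.ofReal (volDensity I b g x₀ y))
      ((b.addHaar).restrict (extChartAt I x₀).target) :=
  ((hg.continuousOn_volDensity x₀).aemeasurable
    (isOpen_extChartAt_target x₀).measurableSet).ennreal_ofReal

theorem IsRiem.setLIntegral_vol (hg : IsRiem I b g) (x₀ : X) (F : X → ENNReal) :
    ∫⁻ x in (extChartAt I x₀).source, F x ∂(vol I b g) = ∫⁻ y in (extChartAt I x₀).target,
      ENNReal.ofReal (volDensity I b g x₀ y) * F ((extChartAt I x₀).symm y) ∂b.addHaar := by
  rw [vol_restrict_source, chartVolume_eq, lintegral_map_chart_symm,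
    restrict_withDensity (isOpen_extChartAt_target x₀).measurableSet,
    lintegral_withDensity_eq_lintegral_mul_non_measurable₀ _ (hg.aemeasurable_density x₀)
      (Filter.Eventually.of_forall fun _ => ENNReal.ofReal_lt_top)]
  rfl

theorem IsRiem.setIntegral_vol (hg : IsRiem I b g) (x₀ : X) (F : X → ℝ) :
    ∫ x in (extChartAt I x₀).source, F x ∂(vol I b g) = ∫ y in (extChartAt I x₀).target,
      volDensity I b g x₀ y * F ((extChartAt I x₀).symm y) ∂b.addHaar := by
  rw [vol_restrict_source, chartVolume_eq, integral_map_chart_symm,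
    restrict_withDensity (isOpen_extChartAt_target x₀).measurableSet,
    integral_withDensity_eq_integral_toReal_smul₀ (hg.aemeasurable_density x₀)
      (Filter.Eventually.of_forall fun _ => ENNReal.ofReal_lt_top)]
  refine integral_congr_ae (Filter.Eventually.of_forall fun y => ?_)
  simp only [smul_eq_mul]
  rw [volDensity, ENNReal.toReal_ofReal (Real.sqrt_nonneg _)]

theorem IsRiem.integrableOn_vol (hg : IsRiem I b g) (x₀ : X) (F : X → ℝ) :
    IntegrableOn F (extChartAt I x₀).source (vol I b g) ↔
      IntegrableOn (fun y => volDensity I b g x₀ y * F ((extChartAt I x₀).symm y))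
        (extChartAt I x₀).target b.addHaar := by
  rw [IntegrableOn, vol_restrict_source, chartVolume_eq, integrable_map_chart_symm, IntegrableOn,
    restrict_withDensity (isOpen_extChartAt_target x₀).measurableSet,
    integrable_withDensity_iff_integrable_smul₀' (hg.aemeasurable_density x₀)
      (Filter.Eventually.of_forall fun _ => ENNReal.ofReal_lt_top), IntegrableOn]
  refine integrable_congr (Filter.Eventually.of_forall fun y => ?_)
  simp only [smul_eq_mul]
  rw [volDensity, ENNReal.toReal_ofReal (Real.sqrt_nonneg _)]

theorem IsRiem.aemeasurable_vol (x₀ : X) {F : X → ENNReal}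
    (hF : AEMeasurable (fun y => F ((extChartAt I x₀).symm y))
      ((b.addHaar).restrict (extChartAt I x₀).target)) :
    AEMeasurable F ((vol I b g).restrict (extChartAt I x₀).source) := by
  rw [vol_restrict_source, chartVolume_eq, aemeasurable_map_chart_symm,
    restrict_withDensity (isOpen_extChartAt_target x₀).measurableSet]
  exact hF.mono_ac (withDensity_absolutelyContinuous _ _)

end Volume

end L2Forms
end

noncomputable section

namespace L2Forms

set_option maxSynthPendingDepth 5

/-! ### Forms dual to coordinate functionals, and criteria for square integrability. -/

section Pairing

variable {E H : Type*} [NormedAddCommGroup E] [NormedSpace ℝ E] [TopologicalSpace H]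
  {I : ModelWithCorners ℝ E H} [I.Boundaryless]
  {X : Type*} [TopologicalSpace X] [ChartedSpace H X] [IsManifold I ∞ X] [FiniteDimensional ℝ E]
  {ι : Type*} [Fintype ι] [DecidableEq ι] {b : Module.Basis ι ℝ E} {g : MetricField I X} {k : ℕ}
  [MeasurableSpace E] [BorelSpace E] [MeasurableSpace X] [BorelSpace X]

theorem formInner_of_formAt_left {u : DForm I X k} {x : X} (hu : formAt I u x = 0)
    (v : DForm I X k) : formInner I b g x (u x) (v x) = 0 := by
  rw [formInner_eq, hu, cInner_zero_left]

theorem formInner_of_formAt_right {v : DForm I X k} {x : X} (hv : formAt I v x = 0)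
    (u : DForm I X k) : formInner I b g x (u x) (v x) = 0 := by
  rw [formInner_eq, hv, cInner_zero_right]

theorem formInner_fromChart_of_notMem {x₀ x : X} (hx : x ∉ (extChartAt I x₀).source)
    (u : DForm I X k) (f : E → E [⋀^Fin k]→L[ℝ] ℝ) :
    formInner I b g x (u x) (fromChart I x₀ f x) = 0 :=
  formInner_of_formAt_right (fromChart_of_notMem I f hx) u

theorem formInner_fromChart_symm {x₀ : X} {y : E} (hy : y ∈ (extChartAt I x₀).target)
    (u : DForm I X k) (f : E → E [⋀^Fin k]→L[ℝ] ℝ) :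
    formInner I b g ((extChartAt I x₀).symm y) (u ((extChartAt I x₀).symm y))
      (fromChart I x₀ f ((extChartAt I x₀).symm y)) =
        cInner b (chartMetric I g x₀ y) (inChart I u x₀ y) (f y) := by
  rw [formInner_symm I b g hy, inChart_fromChart_self I f hy]

theorem IsRiem.integral_formInner_fromChart (hg : IsRiem I b g) (x₀ : X) (u : DForm I X k)
    (f : E → E [⋀^Fin k]→L[ℝ] ℝ) :
    ∫ x, formInner I b g x (u x) (fromChart I x₀ f x) ∂(vol I b g) =
      ∫ y in (extChartAt I x₀).target,
        volDensity I b g x₀ y * cInner b (chartMetric I g x₀ y) (inChart I u x₀ y) (f y)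
          ∂b.addHaar := by
  rw [← setIntegral_eq_integral_of_forall_compl_eq_zero
    (fun x hx => formInner_fromChart_of_notMem (b := b) (g := g) (x₀ := x₀) hx u f),
    hg.setIntegral_vol]
  refine setIntegral_congr_fun (isOpen_extChartAt_target x₀).measurableSet fun y hy => ?_
  rw [formInner_fromChart_symm hy]

theorem IsRiem.integrable_formInner_fromChart (hg : IsRiem I b g) (x₀ : X) (u : DForm I X k)
    (f : E → E [⋀^Fin k]→L[ℝ] ℝ)
    (h : IntegrableOn (fun y => volDensity I b g x₀ y *
      cInner b (chartMetric I g x₀ y) (inChart I u x₀ y) (f y)) (extChartAt I x₀).target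
        b.addHaar) :
    Integrable (fun x => formInner I b g x (u x) (fromChart I x₀ f x)) (vol I b g) := by
  rw [← integrableOn_iff_integrable_of_support_subset (s := (extChartAt I x₀).source),
    hg.integrableOn_vol]
  · refine h.congr_fun (fun y hy => ?_) (isOpen_extChartAt_target x₀).measurableSet
    simp only []
    rw [formInner_fromChart_symm hy]
  · intro x hx
    by_contra hxs
    exact hx (formInner_fromChart_of_notMem hxs u f)

theorem formInner_sum_right {κ : Type*} (s : Finset κ) (x : X) (u : DForm I X k)
    (v : κ → DForm I X k) : formInner I b g x (u x) ((∑ i ∈ s, v i) x) =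
      ∑ i ∈ s, formInner I b g x (u x) (v i x) := by
  simp only [formInner_eq]
  rw [← cInner_sum_right]
  congr 1
  exact Finset.sum_apply x s v

/-- The form in a chart whose pairing with `u` is the integral of `c` times the `J`-th coordinate
of `u`. -/
def dualForm (I : ModelWithCorners ℝ E H) (b : Module.Basis ι ℝ E) (g : MetricField I X) (x₀ : X)
    (J : Fin k → ι) (c : E → ℝ) : E → E [⋀^Fin k]→L[ℝ] ℝ :=
  (extChartAt I x₀).target.indicator fun y =>
    (c y / volDensity I b g x₀ y) • lower b (chartMetric I g x₀ y) J

theorem IsRiem.density_mul_cInner_dualForm (hg : IsRiem I b g) {x₀ : X} {y : E}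
    (hy : y ∈ (extChartAt I x₀).target) (J : Fin k → ι) (c : E → ℝ) (α : E [⋀^Fin k]→L[ℝ] ℝ) :
    volDensity I b g x₀ y * cInner b (chartMetric I g x₀ y) α (dualForm I b g x₀ J c y) =
      c y * α (fun a => b (J a)) := by
  have hp := hg.posDef x₀ y hy
  rw [chartGram_eq] at hp
  rw [dualForm, Set.indicator_of_mem hy, cInner_smul_right, cInner_lower b _ hp, ← mul_assoc,
    mul_div_cancel₀ _ (hg.volDensity_pos hy).ne']

/-- Pairing the dual form with itself evaluates it on its own index, which gives a principal minor
of the Gram matrix. For the warped metric this makes the power of `r` in its norm explicit. -/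
theorem IsRiem.density_mul_cInner_dualForm_self (hg : IsRiem I b g) {x₀ : X} {y : E}
    (hy : y ∈ (extChartAt I x₀).target) (J : Fin k → ι) (c : E → ℝ) :
    volDensity I b g x₀ y * cInner b (chartMetric I g x₀ y) (dualForm I b g x₀ J c y)
      (dualForm I b g x₀ J c y) =
      c y ^ 2 * (((chartGram I b g x₀ y).submatrix J J).det / volDensity I b g x₀ y) := by
  rw [hg.density_mul_cInner_dualForm hy, dualForm, Set.indicator_of_mem hy,
    ContinuousAlternatingMap.smul_apply, lower_apply, ← Matrix.det_transpose, smul_eq_mul]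
  have : (Matrix.of fun c a => (chartMetric I g x₀ y) (b (J a)) (b (J c))).transpose =
    (chartGram I b g x₀ y).submatrix J J := rfl
  rw [this]
  ring

theorem IsRiem.aestronglyMeasurable_dualForm (hg : IsRiem I b g) (x₀ : X) (J : Fin k → ι)
    {c : E → ℝ} (hc : Measurable c) (μ : Measure E) :
    AEStronglyMeasurable (dualForm I b g x₀ J c) μ := by
  have hT : MeasurableSet (extChartAt I x₀).target := (isOpen_extChartAt_target x₀).measurableSet
  rw [dualForm, aestronglyMeasurable_indicator_iff hT]
  have hv := hg.continuousOn_volDensity x₀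
  have h1 : AEStronglyMeasurable (fun y => c y / volDensity I b g x₀ y)
      (μ.restrict (extChartAt I x₀).target) :=
    (hc.aemeasurable.div (hv.aemeasurable hT)).aestronglyMeasurable
  refine h1.smul (ContinuousOn.aestronglyMeasurable ?_ hT)
  have h2 : ContinuousOn (fun y => coords b (lower b (chartMetric I g x₀ y) J))
      (extChartAt I x₀).target := by
    refine continuousOn_pi.2 fun i => ?_
    have h3 : Continuous fun A : Matrix ι ι ℝ => Matrix.det (Matrix.of fun (c a : Fin k) =>
      A (J a) (i c)) := Continuous.matrix_det (continuous_matrix fun c a =>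
        (continuous_id.matrix_elem _ _))
    exact h3.comp_continuousOn (hg.continuousOn x₀)
  refine ((recon b (k := k)).continuous.comp_continuousOn h2).congr fun y hy => ?_
  exact (recon_coords b _).symm

theorem IsRiem.l2Inner_sum_dualForm (hg : IsRiem I b g) {κ : Type*} [Fintype κ] (x₀ : κ → X)
    (J : κ → Fin k → ι) (c : κ → E → ℝ) (u : DForm I X k)
    (h : ∀ i, IntegrableOn (fun y => c i y * inChart I u (x₀ i) y (fun a => b (J i a)))
      (extChartAt I (x₀ i)).target b.addHaar) :
    l2Inner I b g u (∑ i, fromChart I (x₀ i) (dualForm I b g (x₀ i) (J i) (c i))) =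
      ∑ i, ∫ y in (extChartAt I (x₀ i)).target,
        c i y * inChart I u (x₀ i) y (fun a => b (J i a)) ∂b.addHaar := by
  have hcongr : ∀ i, ∀ y ∈ (extChartAt I (x₀ i)).target,
      volDensity I b g (x₀ i) y * cInner b (chartMetric I g (x₀ i) y) (inChart I u (x₀ i) y)
        (dualForm I b g (x₀ i) (J i) (c i) y) =
      c i y * inChart I u (x₀ i) y (fun a => b (J i a)) := fun i y hy =>
    hg.density_mul_cInner_dualForm hy _ _ _
  rw [l2Inner]
  simp only [formInner_sum_right]
  rw [integral_finsetSum]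
  · refine Finset.sum_congr rfl fun i _ => ?_
    rw [hg.integral_formInner_fromChart]
    exact setIntegral_congr_fun (isOpen_extChartAt_target _).measurableSet (hcongr i)
  · intro i _
    refine hg.integrable_formInner_fromChart _ _ _ ((h i).congr_fun (fun y hy => ?_)
      (isOpen_extChartAt_target _).measurableSet)
    exact (hcongr i y hy).symm

/-! ### Square integrability -/

variable (I b g) in
/-- Square integrable forms with measurable pointwise norm. -/
def SqInt (u : DForm I X k) : Prop :=
  FormMeasurable I b u ∧
    AEMeasurable (fun x => ENNReal.ofReal (formInner I b g x (u x) (u x))) (vol I b g) ∧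
      ∫⁻ x, ENNReal.ofReal (formInner I b g x (u x) (u x)) ∂(vol I b g) < ⊤

/-- The lower integral of a sum splits once one summand is measurable, which is what `SqInt` adds to
`MemL2`. -/
theorem IsRiem.memL2_add (hg : IsRiem I b g) {u v : DForm I X k} (hu : SqInt I b g u)
    (hv : MemL2 I b g v) : MemL2 I b g (u + v) := by
  refine ⟨AEMeas.add I b.addHaar hu.1 hv.1, ?_⟩
  have h : ∀ x, ENNReal.ofReal (formInner I b g x ((u + v) x) ((u + v) x)) ≤
      2 * ENNReal.ofReal (formInner I b g x (u x) (u x)) +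
        2 * ENNReal.ofReal (formInner I b g x (v x) (v x)) := fun x => by
    refine (ENNReal.ofReal_le_ofReal (hg.formInner_add_le x u v)).trans ?_
    refine ENNReal.ofReal_add_le.trans (le_of_eq ?_)
    rw [ENNReal.ofReal_mul (by norm_num), ENNReal.ofReal_mul (by norm_num)]
    simp
  refine (lintegral_mono h).trans_lt ?_
  rw [lintegral_add_left' (hu.2.1.const_mul 2), lintegral_const_mul' _ _ (by simp),
    lintegral_const_mul' _ _ (by simp)]
  exact ENNReal.add_lt_top.2 ⟨ENNReal.mul_lt_top (by simp) hu.2.2,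
    ENNReal.mul_lt_top (by simp) hv.2⟩

theorem memL2_zero : MemL2 I b g (0 : DForm I X k) := by
  refine ⟨aeMeas_zero I b.addHaar, ?_⟩
  have : ∀ x, formInner I b g x ((0 : DForm I X k) x) ((0 : DForm I X k) x) = 0 := fun x => by
    have h0 : formAt I (0 : DForm I X k) x = 0 := rfl
    rw [formInner_eq, h0, cInner_zero_left]
  simp only [this, ENNReal.ofReal_zero, lintegral_zero]
  exact ENNReal.zero_lt_top

theorem IsRiem.memL2_sum (hg : IsRiem I b g) {κ : Type*} (s : Finset κ) {u : κ → DForm I X k}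
    (hu : ∀ i, SqInt I b g (u i)) : MemL2 I b g (∑ i ∈ s, u i) := by
  classical
  induction s using Finset.induction_on with
  | empty => exact memL2_zero
  | insert a s ha ih =>
    have := hg.memL2_add (hu a) ih
    rwa [← Finset.sum_insert ha] at this

theorem IsRiem.sqInt_dualForm (hg : IsRiem I b g) (x₀ : X) (J : Fin k → ι)
    {c : E → ℝ} (hc : Measurable c)
    (h : ∫⁻ y in (extChartAt I x₀).target, ENNReal.ofReal (c y ^ 2 *
      (((chartGram I b g x₀ y).submatrix J J).det / volDensity I b g x₀ y)) ∂b.addHaar < ⊤) :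
    SqInt I b g (fromChart I x₀ (dualForm I b g x₀ J c)) := by
  have hT : MeasurableSet (extChartAt I x₀).target := (isOpen_extChartAt_target x₀).measurableSet
  set u : DForm I X k := fromChart I x₀ (dualForm I b g x₀ J c) with hu
  have hpt : ∀ y ∈ (extChartAt I x₀).target, volDensity I b g x₀ y *
      formInner I b g ((extChartAt I x₀).symm y) (u ((extChartAt I x₀).symm y))
        (u ((extChartAt I x₀).symm y)) =
      c y ^ 2 * (((chartGram I b g x₀ y).submatrix J J).det / volDensity I b g x₀ y) := by
    intro y hy
    rw [formInner_symm I b g hy, hu, inChart_fromChart_self I _ hy,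
      hg.density_mul_cInner_dualForm_self hy]
  have hsupp : ∀ x ∉ (extChartAt I x₀).source,
      ENNReal.ofReal (formInner I b g x (u x) (u x)) = 0 := fun x hx => by
    rw [formInner_fromChart_of_notMem hx, ENNReal.ofReal_zero]
  have hs : MeasurableSet (extChartAt I x₀).source := (isOpen_extChartAt_source x₀).measurableSet
  refine ⟨aeMeas_fromChart I b.addHaar (hg.aestronglyMeasurable_dualForm x₀ J hc _), ?_, ?_⟩
  · have hind : (fun x => ENNReal.ofReal (formInner I b g x (u x) (u x))) =
        (extChartAt I x₀).source.indicator fun x =>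
          ENNReal.ofReal (formInner I b g x (u x) (u x)) := by
      funext x
      by_cases hx : x ∈ (extChartAt I x₀).source
      · rw [Set.indicator_of_mem hx]
      · rw [Set.indicator_of_notMem hx, hsupp x hx]
    rw [hind, aemeasurable_indicator_iff hs]
    refine IsRiem.aemeasurable_vol x₀ (AEMeasurable.ennreal_ofReal ?_)
    have hv := (hg.continuousOn_volDensity x₀).aemeasurable (μ := b.addHaar) hT
    have hd : AEMeasurable (fun y => ((chartGram I b g x₀ y).submatrix J J).det)
        (b.addHaar.restrict (extChartAt I x₀).target) := by
      refine ContinuousOn.aemeasurable ?_ hT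
      have h3 : Continuous fun A : Matrix ι ι ℝ => (A.submatrix J J).det :=
        Continuous.matrix_det (continuous_id.matrix_submatrix _ _)
      exact h3.comp_continuousOn (hg.continuousOn x₀)
    have := (((hc.aemeasurable (μ := b.addHaar.restrict (extChartAt I x₀).target)).pow_const
      2).mul (hd.div hv)).div hv
    refine this.congr ?_
    filter_upwards [ae_restrict_mem hT] with y hy
    simp only [Pi.div_apply, Pi.mul_apply]
    rw [← hpt y hy, mul_div_cancel_left₀ _ (hg.volDensity_pos hy).ne']
  · rw [← setLIntegral_eq_of_support_subset (s := (extChartAt I x₀).source), hg.setLIntegral_vol]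
    · refine lt_of_eq_of_lt (setLIntegral_congr_fun hT fun y hy => ?_) h
      rw [← ENNReal.ofReal_mul (hg.volDensity_pos hy).le, hpt y hy]
    · intro x hx
      by_contra hxs
      exact hx (hsupp x hxs)

/-- A form is square integrable if it is on the pieces of a finite cover by subsets of charts. -/
theorem IsRiem.memL2_of_cover (hg : IsRiem I b g) {u : DForm I X k} (hu : FormMeasurable I b u)
    {κ : Type*} [Finite κ] (x₀ : κ → X) (A : κ → Set E) (hA : ∀ i, MeasurableSet (A i))
    (hcov : ∀ x, ∃ i, x ∈ (extChartAt I (x₀ i)).source ∧ extChartAt I (x₀ i) x ∈ A i)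
    (h : ∀ i, ∫⁻ y in (extChartAt I (x₀ i)).target ∩ A i,
      ENNReal.ofReal (volDensity I b g (x₀ i) y * cInner b (chartMetric I g (x₀ i) y)
        (inChart I u (x₀ i) y) (inChart I u (x₀ i) y)) ∂b.addHaar < ⊤) : MemL2 I b g u := by
  refine ⟨hu, ?_⟩
  set F : X → ENNReal := fun x => ENNReal.ofReal (formInner I b g x (u x) (u x)) with hF
  set S : κ → Set X := fun i => (extChartAt I (x₀ i)).source ∩ extChartAt I (x₀ i) ⁻¹' A i
  have hS : ∀ i, MeasurableSet (S i) := fun i => by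
    have hs : MeasurableSet (extChartAt I (x₀ i)).source :=
      (isOpen_extChartAt_source _).measurableSet
    have := hs.subtype_image ((continuousOn_extChartAt (I := I) (x₀ i)).domRestrict.measurable
      (hA i))
    convert this using 1
    ext y
    simp only [S, Set.mem_inter_iff, Set.mem_preimage, Set.mem_image, Subtype.exists]
    constructor
    · rintro ⟨h1, h2⟩; exact ⟨y, h1, h2, rfl⟩
    · rintro ⟨z, h1, h2, rfl⟩; exact ⟨h1, h2⟩
  have hU : (⋃ i, S i) = Set.univ := Set.eq_univ_of_forall fun x => by
    obtain ⟨i, h1, h2⟩ := hcov x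
    exact Set.mem_iUnion.2 ⟨i, h1, h2⟩
  rw [← setLIntegral_univ, ← hU]
  refine (lintegral_iUnion_le _ _).trans_lt ?_
  have := Fintype.ofFinite κ
  rw [tsum_fintype]
  refine ENNReal.sum_lt_top.2 fun i _ => lt_of_le_of_lt (le_of_eq ?_) (h i)
  have hT : MeasurableSet (extChartAt I (x₀ i)).target :=
    (isOpen_extChartAt_target _).measurableSet
  have h1 : ∫⁻ x in S i, F x ∂vol I b g =
      ∫⁻ x in (extChartAt I (x₀ i)).source, (S i).indicator F x ∂vol I b g := by
    rw [setLIntegral_indicator (hS i), Set.inter_eq_self_of_subset_left Set.inter_subset_left]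
  rw [h1, hg.setLIntegral_vol, Set.inter_comm, ← setLIntegral_indicator (hA i)]
  refine setLIntegral_congr_fun hT fun y hy => ?_
  by_cases hyA : y ∈ A i
  · rw [Set.indicator_of_mem hyA, Set.indicator_of_mem, hF,
      ← ENNReal.ofReal_mul (hg.volDensity_pos hy).le, formInner_symm I b g hy]
    refine ⟨(extChartAt I (x₀ i)).map_target hy, ?_⟩
    rw [Set.mem_preimage, (extChartAt I (x₀ i)).right_inv hy]
    exact hyA
  · rw [Set.indicator_of_notMem hyA, Set.indicator_of_notMem, mul_zero]
    rintro ⟨-, h2⟩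
    rw [Set.mem_preimage, (extChartAt I (x₀ i)).right_inv hy] at h2
    exact hyA h2

end Pairing

end L2Forms
end

noncomputable section

namespace L2Forms

set_option maxSynthPendingDepth 5

/-! ### Charts of the half line. -/

section HalfLine

theorem rplus_source (r : RPlus) : (extChartAt 𝓘(ℝ, ℝ) r).source = Set.univ := by
  rw [extChartAt_source, TopologicalSpace.Opens.chartAt_eq]
  simp only [OpenPartialHomeomorph.subtypeRestr_source, chartAt_self_eq,
    OpenPartialHomeomorph.refl_source, Set.preimage_univ]

theorem rplus_apply (r r' : RPlus) : extChartAt 𝓘(ℝ, ℝ) r r' = (r' : ℝ) := rfl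

theorem rplus_target (r : RPlus) : (extChartAt 𝓘(ℝ, ℝ) r).target = Set.Ioi 0 := by
  ext y
  constructor
  · intro hy
    have h := (extChartAt 𝓘(ℝ, ℝ) r).right_inv hy
    rw [rplus_apply] at h
    rw [← h]
    exact ((extChartAt 𝓘(ℝ, ℝ) r).symm y).2
  · intro hy
    exact (extChartAt 𝓘(ℝ, ℝ) r).map_source (x := ⟨y, hy⟩) (by rw [rplus_source]; trivial)

theorem rplus_symm (r : RPlus) {s : ℝ} (hs : 0 < s) :
    (extChartAt 𝓘(ℝ, ℝ) r).symm s = ⟨s, hs⟩ := by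
  refine Subtype.ext ?_
  have h := (extChartAt 𝓘(ℝ, ℝ) r).right_inv (by rw [rplus_target]; exact hs)
  rwa [rplus_apply] at h

theorem dSymm_rplus (r : RPlus) {s : ℝ} (hs : 0 < s) :
    dSymm 𝓘(ℝ, ℝ) r s = ContinuousLinearMap.id ℝ ℝ := by
  have h := dChart_comp_dSymm 𝓘(ℝ, ℝ) (x₀ := r) (y := s) (by rw [rplus_target]; exact hs)
  -- All preferred charts of the half line are the inclusion in `ℝ`, so the chart around `r` is also
  -- the preferred chart at the point considered and has identity derivative there.
  have h2 : dChart 𝓘(ℝ, ℝ) r ((extChartAt 𝓘(ℝ, ℝ) r).symm s) = ContinuousLinearMap.id ℝ ℝ :=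
    dChart_self 𝓘(ℝ, ℝ) ((extChartAt 𝓘(ℝ, ℝ) r).symm s)
  rwa [h2, ContinuousLinearMap.id_comp] at h

end HalfLine

/-! ### Charts of the product manifold. -/

section ProductChart

variable {n₁ n₂ : ℕ}
  {N₁ : Type*} [TopologicalSpace N₁] [ChartedSpace (Euc n₁) N₁] [IsManifold (𝓡 n₁) ∞ N₁]
  {N₂ : Type*} [TopologicalSpace N₂] [ChartedSpace (Euc n₂) N₂] [IsManifold (𝓡 n₂) ∞ N₂]

theorem extChartAt_modelM (r : RPlus) (x₁ : N₁) (x₂ : N₂) :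
    extChartAt (modelM n₁ n₂) (r, x₁, x₂) = (extChartAt 𝓘(ℝ, ℝ) r).prod
      ((extChartAt (𝓡 n₁) x₁).prod (extChartAt (𝓡 n₂) x₂)) := by
  rw [modelM, extChartAt_prod, extChartAt_prod]

theorem modelM_apply (r : RPlus) (x₁ : N₁) (x₂ : N₂) (p : RPlus × N₁ × N₂) :
    extChartAt (modelM n₁ n₂) (r, x₁, x₂) p =
      ((p.1 : ℝ), extChartAt (𝓡 n₁) x₁ p.2.1, extChartAt (𝓡 n₂) x₂ p.2.2) := by
  rw [extChartAt_modelM]; rfl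

theorem modelM_target (r : RPlus) (x₁ : N₁) (x₂ : N₂) :
    (extChartAt (modelM n₁ n₂) (r, x₁, x₂)).target =
      Set.Ioi 0 ×ˢ ((extChartAt (𝓡 n₁) x₁).target ×ˢ (extChartAt (𝓡 n₂) x₂).target) := by
  rw [extChartAt_modelM, PartialEquiv.prod_target, PartialEquiv.prod_target, rplus_target]

theorem mem_modelM_source {r : RPlus} {x₁ : N₁} {x₂ : N₂} {p : RPlus × N₁ × N₂} :
    p ∈ (extChartAt (modelM n₁ n₂) (r, x₁, x₂)).source ↔
      p.2.1 ∈ (extChartAt (𝓡 n₁) x₁).source ∧ p.2.2 ∈ (extChartAt (𝓡 n₂) x₂).source := by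
  rw [extChartAt_modelM, PartialEquiv.prod_source, PartialEquiv.prod_source, rplus_source]
  simp only [Set.mem_prod, Set.mem_univ, true_and]

theorem modelM_symm (r : RPlus) (x₁ : N₁) (x₂ : N₂) {s : ℝ} (hs : 0 < s) (X : Euc n₁)
    (Y : Euc n₂) : (extChartAt (modelM n₁ n₂) (r, x₁, x₂)).symm (s, X, Y) =
      ((⟨s, hs⟩ : RPlus), (extChartAt (𝓡 n₁) x₁).symm X, (extChartAt (𝓡 n₂) x₂).symm Y) := by
  rw [← rplus_symm r hs, extChartAt_modelM]
  rfl

theorem mdifferentiableAt_chart_symm {E H : Type*} [NormedAddCommGroup E] [NormedSpace ℝ E]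
    [TopologicalSpace H] (I : ModelWithCorners ℝ E H) [I.Boundaryless] {X : Type*}
    [TopologicalSpace X] [ChartedSpace H X] [IsManifold I ∞ X] {x₀ : X} {y : E}
    (hy : y ∈ (extChartAt I x₀).target) :
    MDifferentiableAt 𝓘(ℝ, E) I (extChartAt I x₀).symm y := by
  have : IsManifold I 1 X := IsManifold.of_le (n := ∞) (by norm_num)
  have := mdifferentiableWithinAt_extChartAt_symm (I := I) hy
  rwa [I.range_eq_univ, mdifferentiableWithinAt_univ] at this

/-- The model space of the product carries its own trivial model and also the product of the trivial
models of the factors. The two agree, but product rules for derivatives speak of the second. -/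
theorem mfderiv_self_prod {A B C E H : Type*} [NormedAddCommGroup A] [NormedSpace ℝ A]
    [NormedAddCommGroup B] [NormedSpace ℝ B] [NormedAddCommGroup C] [NormedSpace ℝ C]
    [NormedAddCommGroup E] [NormedSpace ℝ E] [TopologicalSpace H] (I : ModelWithCorners ℝ E H)
    {X : Type*} [TopologicalSpace X] [ChartedSpace H X] (f : A × B × C → X) (p : A × B × C) :
    (mfderiv 𝓘(ℝ, A × B × C) I f p : A × B × C →L[ℝ] E) =
      mfderiv (𝓘(ℝ, A).prod (𝓘(ℝ, B).prod 𝓘(ℝ, C))) I f p := by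
  rw [modelWithCornersSelf_prod, modelWithCornersSelf_prod, ← chartedSpaceSelf_prod,
    ← chartedSpaceSelf_prod]

theorem dSymm_modelM (r : RPlus) (x₁ : N₁) (x₂ : N₂) {s : ℝ} (hs : 0 < s) {X : Euc n₁}
    {Y : Euc n₂} (hX : X ∈ (extChartAt (𝓡 n₁) x₁).target)
    (hY : Y ∈ (extChartAt (𝓡 n₂) x₂).target) :
    dSymm (modelM n₁ n₂) (r, x₁, x₂) (s, X, Y) = (ContinuousLinearMap.id ℝ ℝ).prodMap
      ((dSymm (𝓡 n₁) x₁ X).prodMap (dSymm (𝓡 n₂) x₂ Y)) := by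
  have hs' : s ∈ (extChartAt 𝓘(ℝ, ℝ) r).target := by rw [rplus_target]; exact hs
  have h0 := mdifferentiableAt_chart_symm 𝓘(ℝ, ℝ) hs'
  have h1 := mdifferentiableAt_chart_symm (𝓡 n₁) hX
  have h2 := mdifferentiableAt_chart_symm (𝓡 n₂) hY
  have h12 := h1.prodMap h2
  have e1 := mfderiv_prodMap (p := (X, Y)) h1 h2
  have e2 := mfderiv_prodMap (p := (s, X, Y)) h0 h12
  rw [e1] at e2
  have e3 : mfderiv 𝓘(ℝ, ℝ) 𝓘(ℝ, ℝ) (extChartAt 𝓘(ℝ, ℝ) r).symm s =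
    ContinuousLinearMap.id ℝ ℝ := dSymm_rplus r hs
  have hfun : ((extChartAt (modelM n₁ n₂) (r, x₁, x₂)).symm : ℝ × Euc n₁ × Euc n₂ → _) =
      Prod.map (extChartAt 𝓘(ℝ, ℝ) r).symm
        (Prod.map (extChartAt (𝓡 n₁) x₁).symm (extChartAt (𝓡 n₂) x₂).symm) := by
    rw [extChartAt_modelM]; rfl
  rw [dSymm, hfun, mfderiv_self_prod]
  refine e2.trans ?_
  rw [e3]
  rfl

end ProductChart

/-! ### Positive definite Gram matrices. -/

section Metric

variable {E : Type*} [NormedAddCommGroup E] [NormedSpace ℝ E] {ι : Type*} [Fintype ι]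
  [DecidableEq ι] (b : Module.Basis ι ℝ E)

theorem posDef_gramOf {B : E →L[ℝ] E →L[ℝ] ℝ} (hs : ∀ v w, B v w = B w v)
    (hp : ∀ v, v ≠ 0 → 0 < B v v) : (gramOf b B).PosDef := by
  refine Matrix.PosDef.of_dotProduct_mulVec_pos (Matrix.IsHermitian.ext fun i j => ?_)
    fun x hx => ?_
  · simp only [gramOf, Matrix.of_apply, star_trivial]
    exact hs _ _
  · have h1 : B (∑ i, x i • b i) (∑ i, x i • b i) = star x ⬝ᵥ (gramOf b B).mulVec x := by
      simp only [map_sum, map_smul, _root_.sum_apply, _root_.smul_apply, smul_eq_mul, dotProduct,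
        Matrix.mulVec, gramOf, Matrix.of_apply, Finset.mul_sum, star_trivial]
      rw [Finset.sum_comm]
      refine Finset.sum_congr rfl fun p _ => Finset.sum_congr rfl fun q _ => ?_
      ring
    rw [← h1]
    refine hp _ fun h0 => hx ?_
    funext i
    exact (Fintype.linearIndependent_iff.1 b.linearIndependent x h0) i

end Metric

/-! ### Coordinate expressions of a smooth metric. -/

section SmoothMetric

variable {n : ℕ} {N : Type*} [TopologicalSpace N] [ChartedSpace (Euc n) N]
  [IsManifold (𝓡 n) ∞ N]

/-- The field of bilinear forms of a smooth metric. -/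
def SmoothMetric.field (g : SmoothMetric n N) : MetricField (𝓡 n) N := fun x => g.inner x

/-- The standard basis of Euclidean space. -/
abbrev stdBasis (n : ℕ) : Module.Basis (Fin n) ℝ (Euc n) :=
  (EuclideanSpace.basisFun (Fin n) ℝ).toBasis

theorem dSymm_ne_zero {E H : Type*} [NormedAddCommGroup E] [NormedSpace ℝ E]
    [FiniteDimensional ℝ E] [TopologicalSpace H] (I : ModelWithCorners ℝ E H) [I.Boundaryless]
    {X : Type*} [TopologicalSpace X] [ChartedSpace H X] [IsManifold I ∞ X] {x₀ : X} {y : E}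
    (hy : y ∈ (extChartAt I x₀).target) {v : E} (hv : v ≠ 0) : dSymm I x₀ y v ≠ 0 := fun h => by
  have h2 := DFunLike.congr_fun (dChart_comp_dSymm I hy) v
  rw [ContinuousLinearMap.comp_apply, h, map_zero] at h2
  exact hv h2.symm

/-- Coordinate vector fields are the tangent map of the inverse chart applied to constant fields,
hence continuous sections; the metric is a continuous section of bilinear forms, and pairing them is
continuous. -/
theorem SmoothMetric.continuousOn_gram (g : SmoothMetric n N) (x₀ : N) :
    ContinuousOn (chartGram (𝓡 n) (stdBasis n) g.field x₀) (extChartAt (𝓡 n) x₀).target := by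
  have : IsManifold (𝓡 n) 1 N := IsManifold.of_le (n := ∞) (by norm_num)
  have hT : IsOpen (extChartAt (𝓡 n) x₀).target := isOpen_extChartAt_target x₀
  have hvec : ∀ v : Euc n, ∀ y ∈ (extChartAt (𝓡 n) x₀).target,
      ContMDiffAt 𝓘(ℝ, Euc n) (𝓡 n).tangent 0
        (fun y => (⟨(extChartAt (𝓡 n) x₀).symm y, dSymm (𝓡 n) x₀ y v⟩ : TangentBundle (𝓡 n) N))
        y := by
    intro v y hy
    have h1 : ContMDiffOn 𝓘(ℝ, Euc n) (𝓡 n) ∞ (extChartAt (𝓡 n) x₀).symm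
      (extChartAt (𝓡 n) x₀).target := contMDiffOn_extChartAt_symm x₀
    have h2 := h1.contMDiffOn_tangentMapWithin (m := 0) (by simp) hT.uniqueMDiffOn
    have h3 : ContMDiff 𝓘(ℝ, Euc n) 𝓘(ℝ, Euc n).tangent 0
        (fun y => (⟨y, v⟩ : TangentBundle 𝓘(ℝ, Euc n) (Euc n))) :=
      contMDiff_vectorSpace_iff_contDiff.2 contDiff_const
    have hmem : (Bundle.TotalSpace.proj ⁻¹' (extChartAt (𝓡 n) x₀).target :
        Set (TangentBundle 𝓘(ℝ, Euc n) (Euc n))) ∈ nhds (⟨y, v⟩ : TangentBundle 𝓘(ℝ, Euc n) _) :=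
      (hT.preimage (FiberBundle.continuous_proj (Euc n) (TangentSpace 𝓘(ℝ, Euc n)))).mem_nhds hy
    have h4 := (h2.contMDiffAt hmem).comp y h3.contMDiffAt
    refine h4.congr_of_eventuallyEq ?_
    filter_upwards [hT.mem_nhds hy] with z hz
    simp only [Function.comp_apply, tangentMapWithin]
    rw [mfderivWithin_of_isOpen hT hz]
    rfl
  refine continuousOn_pi.2 fun i => continuousOn_pi.2 fun j => ?_
  intro y hy
  have hg : ContMDiffAt 𝓘(ℝ, Euc n) ((𝓡 n).prod 𝓘(ℝ, Euc n →L[ℝ] Euc n →L[ℝ] ℝ)) 0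
      (fun y => Bundle.TotalSpace.mk' (Euc n →L[ℝ] Euc n →L[ℝ] ℝ)
        (E := fun x : N => TangentSpace (𝓡 n) x →L[ℝ] TangentSpace (𝓡 n) x →L[ℝ] ℝ)
        ((extChartAt (𝓡 n) x₀).symm y) (g.inner ((extChartAt (𝓡 n) x₀).symm y))) y :=
    ContMDiffAt.comp y (g.contMDiff.of_le (by simp)).contMDiffAt
      (((contMDiffOn_extChartAt_symm (n := ∞) x₀).contMDiffAt (hT.mem_nhds hy)).of_le (by simp))
  have key : ContMDiffAt 𝓘(ℝ, Euc n) ((𝓡 n).prod 𝓘(ℝ)) 0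
      (fun y => Bundle.TotalSpace.mk' ℝ (E := Bundle.Trivial N ℝ)
        ((extChartAt (𝓡 n) x₀).symm y) (g.inner ((extChartAt (𝓡 n) x₀).symm y)
          (dSymm (𝓡 n) x₀ y (stdBasis n i)) (dSymm (𝓡 n) x₀ y (stdBasis n j)))) y :=
    ContMDiffAt.clm_bundle_apply₂ (F₁ := Euc n) (F₂ := Euc n) hg (hvec _ y hy) (hvec _ y hy)
  rw [Bundle.contMDiffAt_totalSpace] at key
  exact key.2.continuousAt.continuousWithinAt

end SmoothMetric

end L2Forms
end

noncomputable section

namespace L2Forms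

set_option maxSynthPendingDepth 5

/-! ### The warped metric: Gram matrix, volume density and powers of `r`. -/

section Warped

variable {n₁ n₂ : ℕ}
  {N₁ : Type*} [TopologicalSpace N₁] [ChartedSpace (Euc n₁) N₁] [IsManifold (𝓡 n₁) ∞ N₁]
  {N₂ : Type*} [TopologicalSpace N₂] [ChartedSpace (Euc n₂) N₂] [IsManifold (𝓡 n₂) ∞ N₂]
  (α₁ α₂ : ℝ) (g₁ : SmoothMetric n₁ N₁) (g₂ : SmoothMetric n₂ N₂)

theorem SmoothMetric.chartMetric_comm {n : ℕ} {N : Type*} [TopologicalSpace N]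
    [ChartedSpace (Euc n) N] [IsManifold (𝓡 n) ∞ N] (g : SmoothMetric n N) (x₀ : N)
    (y v w : Euc n) : chartMetric (𝓡 n) g.field x₀ y v w = chartMetric (𝓡 n) g.field x₀ y w v :=
  g.symm ((extChartAt (𝓡 n) x₀).symm y) (dSymm (𝓡 n) x₀ y v) (dSymm (𝓡 n) x₀ y w)

theorem SmoothMetric.chartMetric_pos {n : ℕ} {N : Type*} [TopologicalSpace N]
    [ChartedSpace (Euc n) N] [IsManifold (𝓡 n) ∞ N] (g : SmoothMetric n N) {x₀ : N}
    {y v : Euc n} (hy : y ∈ (extChartAt (𝓡 n) x₀).target) (hv : v ≠ 0) :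
    0 < chartMetric (𝓡 n) g.field x₀ y v v :=
  g.pos ((extChartAt (𝓡 n) x₀).symm y) (dSymm (𝓡 n) x₀ y v) (dSymm_ne_zero (𝓡 n) hy hv)

theorem SmoothMetric.isRiem {n : ℕ} {N : Type*} [TopologicalSpace N] [ChartedSpace (Euc n) N]
    [IsManifold (𝓡 n) ∞ N] (g : SmoothMetric n N) : IsRiem (𝓡 n) (stdBasis n) g.field where
  posDef x₀ y hy := by
    rw [chartGram_eq]
    exact posDef_gramOf _ (fun v w => g.chartMetric_comm x₀ y v w) fun v hv =>
      g.chartMetric_pos hy hv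
  continuousOn := g.continuousOn_gram

theorem chartMetric_warped (r : RPlus) (x₁ : N₁) (x₂ : N₂) {s : ℝ} (hs : 0 < s) {X : Euc n₁}
    {Y : Euc n₂} (hX : X ∈ (extChartAt (𝓡 n₁) x₁).target)
    (hY : Y ∈ (extChartAt (𝓡 n₂) x₂).target) (v w : ℝ × Euc n₁ × Euc n₂) :
    chartMetric (modelM n₁ n₂) (warpedMetric α₁ α₂ g₁ g₂) (r, x₁, x₂) (s, X, Y) v w =
      v.1 * w.1 + s ^ (2 * α₁) * chartMetric (𝓡 n₁) g₁.field x₁ X v.2.1 w.2.1 +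
        s ^ (2 * α₂) * chartMetric (𝓡 n₂) g₂.field x₂ Y v.2.2 w.2.2 := by
  rw [chartMetric, ContinuousLinearMap.bilinearComp_apply, dSymm_modelM r x₁ x₂ hs hX hY,
    modelM_symm r x₁ x₂ hs]
  exact warpedMetric_apply α₁ α₂ g₁ g₂ ⟨s, hs⟩ _ _ _ _ _ _ _ _

theorem basisM_inl (u : Unit) : basisM n₁ n₂ (Sum.inl u) = (1, 0, 0) := by
  simp [basisM, Prod.ext_iff]

theorem basisM_inr_inl (i : Fin n₁) :
    basisM n₁ n₂ (Sum.inr (Sum.inl i)) = (0, stdBasis n₁ i, 0) := by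
  simp [basisM]

theorem basisM_inr_inr (i : Fin n₂) :
    basisM n₁ n₂ (Sum.inr (Sum.inr i)) = (0, 0, stdBasis n₂ i) := by
  simp [basisM]

theorem chartGram_warped (r : RPlus) (x₁ : N₁) (x₂ : N₂) {s : ℝ} (hs : 0 < s) {X : Euc n₁}
    {Y : Euc n₂} (hX : X ∈ (extChartAt (𝓡 n₁) x₁).target)
    (hY : Y ∈ (extChartAt (𝓡 n₂) x₂).target) :
    chartGram (modelM n₁ n₂) (basisM n₁ n₂) (warpedMetric α₁ α₂ g₁ g₂) (r, x₁, x₂) (s, X, Y) =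
      Matrix.fromBlocks 1 0 0 (Matrix.fromBlocks
        (s ^ (2 * α₁) • chartGram (𝓡 n₁) (stdBasis n₁) g₁.field x₁ X) 0 0
        (s ^ (2 * α₂) • chartGram (𝓡 n₂) (stdBasis n₂) g₂.field x₂ Y)) := by
  ext i j
  rw [chartGram_eq, gramOf, Matrix.of_apply, chartMetric_warped α₁ α₂ g₁ g₂ r x₁ x₂ hs hX hY]
  rcases i with i | i | i <;> rcases j with j | j | j <;>
    simp only [basisM_inl, basisM_inr_inl, basisM_inr_inr, map_zero, _root_.zero_apply, mul_zero,
      add_zero, zero_add, mul_one, Matrix.fromBlocks_apply₁₁, Matrix.fromBlocks_apply₁₂,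
      Matrix.fromBlocks_apply₂₁, Matrix.fromBlocks_apply₂₂, Matrix.zero_apply, Matrix.smul_apply,
      smul_eq_mul, Matrix.one_apply_eq] <;> rfl

theorem warped_pos {x₁ : N₁} {x₂ : N₂} {r : RPlus} {z : ℝ × Euc n₁ × Euc n₂}
    (hz : z ∈ (extChartAt (modelM n₁ n₂) (r, x₁, x₂)).target) :
    0 < z.1 ∧ z.2.1 ∈ (extChartAt (𝓡 n₁) x₁).target ∧ z.2.2 ∈ (extChartAt (𝓡 n₂) x₂).target := by
  rw [modelM_target] at hz
  exact hz

theorem isRiem_warped : IsRiem (modelM n₁ n₂) (basisM n₁ n₂) (warpedMetric α₁ α₂ g₁ g₂) where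
  posDef := by
    rintro ⟨r, x₁, x₂⟩ ⟨s, X, Y⟩ hz
    obtain ⟨hs, hX, hY⟩ := warped_pos hz
    rw [chartGram_eq]
    refine posDef_gramOf _ (fun v w => ?_) fun v hv => ?_
    · simp only [chartMetric_warped α₁ α₂ g₁ g₂ r x₁ x₂ hs hX hY]
      rw [g₁.chartMetric_comm x₁ X v.2.1, g₂.chartMetric_comm x₂ Y v.2.2, mul_comm v.1]
    · rw [chartMetric_warped α₁ α₂ g₁ g₂ r x₁ x₂ hs hX hY]
      have p1 : 0 < s ^ (2 * α₁) := Real.rpow_pos_of_pos hs _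
      have p2 : 0 < s ^ (2 * α₂) := Real.rpow_pos_of_pos hs _
      have q1 : ∀ w, w ≠ 0 → 0 < chartMetric (𝓡 n₁) g₁.field x₁ X w w := fun w hw =>
        g₁.chartMetric_pos hX hw
      have q2 : ∀ w, w ≠ 0 → 0 < chartMetric (𝓡 n₂) g₂.field x₂ Y w w := fun w hw =>
        g₂.chartMetric_pos hY hw
      have q1' : ∀ w, 0 ≤ chartMetric (𝓡 n₁) g₁.field x₁ X w w := fun w => by
        by_cases hw : w = 0
        · rw [hw, map_zero]
        · exact (q1 w hw).le
      have q2' : ∀ w, 0 ≤ chartMetric (𝓡 n₂) g₂.field x₂ Y w w := fun w => by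
        by_cases hw : w = 0
        · rw [hw, map_zero]
        · exact (q2 w hw).le
      have t0 : 0 ≤ v.1 * v.1 := mul_self_nonneg _
      have t1 := mul_nonneg p1.le (q1' v.2.1)
      have t2 := mul_nonneg p2.le (q2' v.2.2)
      by_cases h1 : v.2.1 = 0
      · by_cases h2 : v.2.2 = 0
        · have h0 : v.1 ≠ 0 := fun h0 => hv (Prod.ext h0 (Prod.ext h1 h2))
          have := mul_self_pos.2 h0
          linarith
        · have := mul_pos p2 (q2 _ h2)
          linarith
      · have := mul_pos p1 (q1 _ h1)
        linarith
  continuousOn := by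
    rintro ⟨r, x₁, x₂⟩
    have hm : ∀ z ∈ (extChartAt (modelM n₁ n₂) (r, x₁, x₂)).target,
        chartGram (modelM n₁ n₂) (basisM n₁ n₂) (warpedMetric α₁ α₂ g₁ g₂) (r, x₁, x₂) z =
      Matrix.fromBlocks 1 0 0 (Matrix.fromBlocks
        (z.1 ^ (2 * α₁) • chartGram (𝓡 n₁) (stdBasis n₁) g₁.field x₁ z.2.1) 0 0
        (z.1 ^ (2 * α₂) • chartGram (𝓡 n₂) (stdBasis n₂) g₂.field x₂ z.2.2)) := fun z hz => by
      obtain ⟨hs, hX, hY⟩ := warped_pos hz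
      exact chartGram_warped α₁ α₂ g₁ g₂ r x₁ x₂ hs hX hY
    refine ContinuousOn.congr ?_ hm
    have c0 : ∀ a : ℝ, ContinuousOn (fun z : ℝ × Euc n₁ × Euc n₂ => z.1 ^ a)
        (extChartAt (modelM n₁ n₂) (r, x₁, x₂)).target := fun a =>
      continuousOn_fst.rpow_const fun z hz => Or.inl (warped_pos hz).1.ne'
    have c1 := (g₁.continuousOn_gram x₁).comp
      (continuous_fst.comp continuous_snd : Continuous fun z : ℝ × Euc n₁ × Euc n₂ => z.2.1
        ).continuousOn (fun z (hz : z ∈ (extChartAt (modelM n₁ n₂) (r, x₁, x₂)).target) =>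
          (warped_pos hz).2.1)
    have c2 := (g₂.continuousOn_gram x₂).comp
      (continuous_snd.comp continuous_snd : Continuous fun z : ℝ × Euc n₁ × Euc n₂ => z.2.2
        ).continuousOn (fun z (hz : z ∈ (extChartAt (modelM n₁ n₂) (r, x₁, x₂)).target) =>
          (warped_pos hz).2.2)
    rw [continuousOn_iff_continuous_domRestrict] at c1 c2 ⊢
    have c01 := continuousOn_iff_continuous_domRestrict.1 (c0 (2 * α₁))
    have c02 := continuousOn_iff_continuous_domRestrict.1 (c0 (2 * α₂))
    exact Continuous.matrix_fromBlocks continuous_const continuous_const continuous_const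
      (Continuous.matrix_fromBlocks (c01.smul c1) continuous_const continuous_const (c02.smul c2))

theorem rpow_two_mul_pow {s : ℝ} (hs : 0 < s) (a : ℝ) (n : ℕ) :
    (s ^ (2 * a)) ^ n = (s ^ (a * n)) ^ 2 := by
  rw [← Real.rpow_natCast, ← Real.rpow_natCast, ← Real.rpow_mul hs.le, ← Real.rpow_mul hs.le]
  congr 1
  push_cast
  ring

theorem volDensity_warped (r : RPlus) (x₁ : N₁) (x₂ : N₂) {s : ℝ} (hs : 0 < s) {X : Euc n₁}
    {Y : Euc n₂} (hX : X ∈ (extChartAt (𝓡 n₁) x₁).target)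
    (hY : Y ∈ (extChartAt (𝓡 n₂) x₂).target) :
    volDensity (modelM n₁ n₂) (basisM n₁ n₂) (warpedMetric α₁ α₂ g₁ g₂) (r, x₁, x₂) (s, X, Y) =
      s ^ (α₁ * n₁ + α₂ * n₂) * (volDensity (𝓡 n₁) (stdBasis n₁) g₁.field x₁ X *
        volDensity (𝓡 n₂) (stdBasis n₂) g₂.field x₂ Y) := by
  rw [volDensity, chartGram_warped α₁ α₂ g₁ g₂ r x₁ x₂ hs hX hY, Matrix.det_fromBlocks_zero₂₁,
    Matrix.det_fromBlocks_zero₂₁, Matrix.det_one, one_mul, Matrix.det_smul, Matrix.det_smul,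
    Fintype.card_fin, Fintype.card_fin, rpow_two_mul_pow hs, rpow_two_mul_pow hs, volDensity,
    volDensity, Real.rpow_add hs, Real.sqrt_mul, Real.sqrt_mul (sq_nonneg _),
    Real.sqrt_mul (sq_nonneg _), Real.sqrt_sq (Real.rpow_nonneg hs.le _),
    Real.sqrt_sq (Real.rpow_nonneg hs.le _)]
  · ring
  · exact mul_nonneg (sq_nonneg _) (g₁.isRiem.posDef x₁ X hX).det_pos.le

theorem inv_chartGram_warped (r : RPlus) (x₁ : N₁) (x₂ : N₂) {s : ℝ} (hs : 0 < s) {X : Euc n₁}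
    {Y : Euc n₂} (hX : X ∈ (extChartAt (𝓡 n₁) x₁).target)
    (hY : Y ∈ (extChartAt (𝓡 n₂) x₂).target) (i j : Fin n₂) :
    (chartGram (modelM n₁ n₂) (basisM n₁ n₂) (warpedMetric α₁ α₂ g₁ g₂) (r, x₁, x₂)
      (s, X, Y))⁻¹ (Sum.inr (Sum.inr i)) (Sum.inr (Sum.inr j)) =
        s ^ (-(2 * α₂)) * (chartGram (𝓡 n₂) (stdBasis n₂) g₂.field x₂ Y)⁻¹ i j := by
  set G₁ := chartGram (𝓡 n₁) (stdBasis n₁) g₁.field x₁ X with hG₁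
  set G₂ := chartGram (𝓡 n₂) (stdBasis n₂) g₂.field x₂ Y with hG₂
  have u1 : IsUnit G₁.det := (g₁.isRiem.posDef x₁ X hX).det_pos.ne'.isUnit
  have u2 : IsUnit G₂.det := (g₂.isRiem.posDef x₂ Y hY).det_pos.ne'.isUnit
  have e : ∀ a : ℝ, s ^ (-a) * s ^ a = 1 := fun a => by
    rw [← Real.rpow_add hs, neg_add_cancel, Real.rpow_zero]
  have h : (chartGram (modelM n₁ n₂) (basisM n₁ n₂) (warpedMetric α₁ α₂ g₁ g₂) (r, x₁, x₂)
      (s, X, Y))⁻¹ = Matrix.fromBlocks 1 0 0 (Matrix.fromBlocks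
        (s ^ (-(2 * α₁)) • G₁⁻¹) 0 0 (s ^ (-(2 * α₂)) • G₂⁻¹)) := by
    refine Matrix.inv_eq_right_inv ?_
    rw [chartGram_warped α₁ α₂ g₁ g₂ r x₁ x₂ hs hX hY, Matrix.fromBlocks_multiply,
      Matrix.fromBlocks_multiply]
    simp only [Matrix.mul_one, Matrix.mul_zero, add_zero, Matrix.zero_mul, zero_add,
      Matrix.smul_mul, Matrix.mul_smul, smul_smul, e, ← hG₁, ← hG₂, Matrix.mul_nonsing_inv _ u1,
      Matrix.mul_nonsing_inv _ u2, one_smul, smul_zero, Matrix.fromBlocks_one]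
  rw [h]
  rfl

/-- Indices of `N₂`-directions. -/
def idxN (n₁ : ℕ) {k : ℕ} (J : Fin k → Fin n₂) : Fin k → Unit ⊕ (Fin n₁ ⊕ Fin n₂) :=
  fun a => Sum.inr (Sum.inr (J a))

/-- The radial index followed by indices of `N₂`-directions. -/
def idxR (n₁ : ℕ) {k : ℕ} (J : Fin k → Fin n₂) : Fin (k + 1) → Unit ⊕ (Fin n₁ ⊕ Fin n₂) :=
  Fin.cons (Sum.inl ()) (idxN n₁ J)

/-- Only the `N₂` block is met, and each of the `k` rows contributes `s ^ (2 * α₂)`. -/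
theorem det_submatrix_idxN {k : ℕ} (r : RPlus) (x₁ : N₁) (x₂ : N₂) {s : ℝ} (hs : 0 < s)
    {X : Euc n₁} {Y : Euc n₂} (hX : X ∈ (extChartAt (𝓡 n₁) x₁).target)
    (hY : Y ∈ (extChartAt (𝓡 n₂) x₂).target) (J : Fin k → Fin n₂) :
    ((chartGram (modelM n₁ n₂) (basisM n₁ n₂) (warpedMetric α₁ α₂ g₁ g₂) (r, x₁, x₂)
      (s, X, Y)).submatrix (idxN n₁ J) (idxN n₁ J)).det = s ^ (2 * α₂ * k) *
        ((chartGram (𝓡 n₂) (stdBasis n₂) g₂.field x₂ Y).submatrix J J).det := by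
  rw [chartGram_warped α₁ α₂ g₁ g₂ r x₁ x₂ hs hX hY]
  have : (Matrix.fromBlocks (1 : Matrix Unit Unit ℝ) 0 0 (Matrix.fromBlocks
        (s ^ (2 * α₁) • chartGram (𝓡 n₁) (stdBasis n₁) g₁.field x₁ X) 0 0
        (s ^ (2 * α₂) • chartGram (𝓡 n₂) (stdBasis n₂) g₂.field x₂ Y))).submatrix
        (idxN n₁ J) (idxN n₁ J) =
      s ^ (2 * α₂) • (chartGram (𝓡 n₂) (stdBasis n₂) g₂.field x₂ Y).submatrix J J := rfl
  rw [this, Matrix.det_smul, Fintype.card_fin, ← Real.rpow_natCast, ← Real.rpow_mul hs.le]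

/-- The radial direction has length one and is orthogonal to the rest, so adjoining it leaves the
minor unchanged: `dr` costs no power of `r`. -/
theorem det_submatrix_idxR {k : ℕ} (r : RPlus) (x₁ : N₁) (x₂ : N₂) {s : ℝ} (hs : 0 < s)
    {X : Euc n₁} {Y : Euc n₂} (hX : X ∈ (extChartAt (𝓡 n₁) x₁).target)
    (hY : Y ∈ (extChartAt (𝓡 n₂) x₂).target) (J : Fin k → Fin n₂) :
    ((chartGram (modelM n₁ n₂) (basisM n₁ n₂) (warpedMetric α₁ α₂ g₁ g₂) (r, x₁, x₂)
      (s, X, Y)).submatrix (idxR n₁ J) (idxR n₁ J)).det = s ^ (2 * α₂ * k) *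
        ((chartGram (𝓡 n₂) (stdBasis n₂) g₂.field x₂ Y).submatrix J J).det := by
  rw [← det_submatrix_idxN α₁ α₂ g₁ g₂ r x₁ x₂ hs hX hY J,
    chartGram_warped α₁ α₂ g₁ g₂ r x₁ x₂ hs hX hY, Matrix.det_succ_row_zero, Fin.sum_univ_succ]
  rw [Finset.sum_eq_zero]
  · simp only [Fin.val_zero, pow_zero, one_mul, add_zero, Matrix.submatrix_apply, idxR,
      Fin.cons_zero, Matrix.fromBlocks_apply₁₁, Matrix.one_apply_eq]
    rfl
  · intro i _
    have : (Matrix.fromBlocks (1 : Matrix Unit Unit ℝ) 0 0 (Matrix.fromBlocks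
        (s ^ (2 * α₁) • chartGram (𝓡 n₁) (stdBasis n₁) g₁.field x₁ X) 0 0
        (s ^ (2 * α₂) • chartGram (𝓡 n₂) (stdBasis n₂) g₂.field x₂ Y))).submatrix
        (idxR n₁ J) (idxR n₁ J) 0 i.succ = 0 := rfl
    rw [this]
    simp

/-- The projection of the model space to the `N₂`-directions. -/
def projN (n₁ n₂ : ℕ) : ℝ × Euc n₁ × Euc n₂ →L[ℝ] Euc n₂ :=
  (ContinuousLinearMap.snd ℝ (Euc n₁) (Euc n₂)).comp
    (ContinuousLinearMap.snd ℝ ℝ (Euc n₁ × Euc n₂))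

theorem pullback_basisM_idxN {k : ℕ} (β : Euc n₂ [⋀^Fin k]→L[ℝ] ℝ) (J : Fin k → Fin n₂) :
    (β.compContinuousLinearMap (projN n₁ n₂)) (fun a => basisM n₁ n₂ (idxN n₁ J a)) =
      β (fun a => stdBasis n₂ (J a)) := by
  simp only [ContinuousAlternatingMap.compContinuousLinearMap_apply]
  congr 1
  funext a
  simp only [Function.comp_apply, idxN, basisM_inr_inr]
  rfl

theorem pullback_basisM_eq_zero {k : ℕ} (β : Euc n₂ [⋀^Fin k]→L[ℝ] ℝ)
    {i : Fin k → Unit ⊕ (Fin n₁ ⊕ Fin n₂)} (hi : i ∉ Set.range (idxN (n₂ := n₂) n₁ (k := k))) :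
    (β.compContinuousLinearMap (projN n₁ n₂)) (fun a => basisM n₁ n₂ (i a)) = 0 := by
  have : ∃ a, projN n₁ n₂ (basisM n₁ n₂ (i a)) = 0 := by
    by_contra! hne
    refine hi ?_
    have : ∀ a, ∃ j : Fin n₂, i a = Sum.inr (Sum.inr j) := fun a => by
      have h := hne a
      rcases h' : i a with u | j | j
      · rw [h', basisM_inl] at h; exact absurd rfl h
      · rw [h', basisM_inr_inl] at h; exact absurd rfl h
      · exact ⟨j, rfl⟩
    choose J hJ using this
    exact ⟨J, funext fun a => (hJ a).symm⟩
  obtain ⟨a, ha⟩ := this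
  rw [ContinuousAlternatingMap.compContinuousLinearMap_apply]
  exact β.map_coord_zero a ha

/-- A `k`-form from `N₂` has square norm proportional to `s ^ (-2 α₂ k)` and the volume density to
`s ^ (α₁ n₁ + α₂ n₂)`. In the critical degree the product does not depend on `s`. -/
theorem density_mul_cInner_pullback {k : ℕ} (hk : 2 * α₂ * k = α₁ * n₁ + α₂ * n₂) (r : RPlus)
    (x₁ : N₁) (x₂ : N₂) {s : ℝ} (hs : 0 < s)
    {X : Euc n₁} {Y : Euc n₂} (hX : X ∈ (extChartAt (𝓡 n₁) x₁).target)
    (hY : Y ∈ (extChartAt (𝓡 n₂) x₂).target) (β : Euc n₂ [⋀^Fin k]→L[ℝ] ℝ) :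
    volDensity (modelM n₁ n₂) (basisM n₁ n₂) (warpedMetric α₁ α₂ g₁ g₂) (r, x₁, x₂) (s, X, Y) *
      cInner (basisM n₁ n₂) (chartMetric (modelM n₁ n₂) (warpedMetric α₁ α₂ g₁ g₂) (r, x₁, x₂)
        (s, X, Y)) (β.compContinuousLinearMap (projN n₁ n₂))
        (β.compContinuousLinearMap (projN n₁ n₂)) =
      volDensity (𝓡 n₁) (stdBasis n₁) g₁.field x₁ X *
        (volDensity (𝓡 n₂) (stdBasis n₂) g₂.field x₂ Y *
          cInner (stdBasis n₂) (chartMetric (𝓡 n₂) g₂.field x₂ Y) β β) := by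
  have hinj : Function.Injective (idxN (n₂ := n₂) n₁ (k := k)) := fun J J' h => by
    funext a
    have := congrFun h a
    simpa [idxN] using this
  have hc : cInner (basisM n₁ n₂) (chartMetric (modelM n₁ n₂) (warpedMetric α₁ α₂ g₁ g₂)
      (r, x₁, x₂) (s, X, Y)) (β.compContinuousLinearMap (projN n₁ n₂))
        (β.compContinuousLinearMap (projN n₁ n₂)) = s ^ (-(2 * α₂ * k)) *
      cInner (stdBasis n₂) (chartMetric (𝓡 n₂) g₂.field x₂ Y) β β := by
    rw [cInner, cInner, ← chartGram_eq, ← chartGram_eq, mul_left_comm]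
    congr 1
    rw [Finset.mul_sum]
    refine (Fintype.sum_of_injective (idxN n₁ (k := k)) hinj _ _ (fun i hi => ?_) fun J => ?_).symm
    · refine Finset.sum_eq_zero fun j _ => ?_
      rw [pullback_basisM_eq_zero β hi]
      ring
    · rw [Finset.mul_sum]
      refine Fintype.sum_of_injective (idxN n₁ (k := k)) hinj _ _ (fun j hj => ?_) fun J' => ?_
      · rw [pullback_basisM_eq_zero β hj]
        ring
      · rw [pullback_basisM_idxN, pullback_basisM_idxN]
        simp only [idxN]
        simp only [inv_chartGram_warped α₁ α₂ g₁ g₂ r x₁ x₂ hs hX hY, Finset.prod_mul_distrib,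
          Finset.prod_const, Finset.card_univ, Fintype.card_fin]
        rw [← Real.rpow_natCast, ← Real.rpow_mul hs.le]
        have : -(2 * α₂) * (k : ℝ) = -(2 * α₂ * k) := by ring
        rw [this]
        ring
  rw [hc, volDensity_warped α₁ α₂ g₁ g₂ r x₁ x₂ hs hX hY, ← hk]
  have e : s ^ (2 * α₂ * k) * s ^ (-(2 * α₂ * k)) = 1 := by
    rw [← Real.rpow_add hs, add_neg_cancel, Real.rpow_zero]
  linear_combination (volDensity (𝓡 n₁) (stdBasis n₁) g₁.field x₁ X *
        volDensity (𝓡 n₂) (stdBasis n₂) g₂.field x₂ Y *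
          cInner (stdBasis n₂) (chartMetric (𝓡 n₂) g₂.field x₂ Y) β β) * e

end Warped

end L2Forms
end

noncomputable section

namespace L2Forms

set_option maxSynthPendingDepth 5

/-! ### Cartan's formula for the radial vector in coordinates. -/

section Model

variable {n₁ n₂ : ℕ}

/-- The inclusion of the `N₂`-directions into the model space. -/
def inclN (n₁ n₂ : ℕ) : Euc n₂ →L[ℝ] ℝ × Euc n₁ × Euc n₂ :=
  (ContinuousLinearMap.inr ℝ ℝ (Euc n₁ × Euc n₂)).comp
    (ContinuousLinearMap.inr ℝ (Euc n₁) (Euc n₂))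

/-- The radial unit vector. -/
def radial (n₁ n₂ : ℕ) : ℝ × Euc n₁ × Euc n₂ := (1, 0, 0)

theorem basisM_comp_idxN {k : ℕ} (J : Fin k → Fin n₂) :
    (fun a => basisM n₁ n₂ (idxN n₁ J a)) = fun a => inclN n₁ n₂ (stdBasis n₂ (J a)) := by
  funext a
  rw [idxN, basisM_inr_inr]; rfl

theorem basisM_comp_idxR {k : ℕ} (J : Fin k → Fin n₂) :
    (fun a => basisM n₁ n₂ (idxR n₁ J a)) =
      Matrix.vecCons (radial n₁ n₂) fun a => inclN n₁ n₂ (stdBasis n₂ (J a)) := by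
  funext a
  refine Fin.cases ?_ (fun a => ?_) a
  · exact basisM_inl ()
  · change basisM n₁ n₂ (idxN n₁ J a) = _
    rw [idxN, basisM_inr_inr]; rfl

theorem hasFDerivAt_slice (s : ℝ) (X : Euc n₁) (Y : Euc n₂) :
    HasFDerivAt (fun Y : Euc n₂ => ((s, X, Y) : ℝ × Euc n₁ × Euc n₂)) (inclN n₁ n₂) Y :=
  ((hasFDerivAt_const s Y).prodMk ((hasFDerivAt_const X Y).prodMk (hasFDerivAt_id Y))).congr_fderiv
    rfl

theorem contDiff_slice (s : ℝ) (X : Euc n₁) :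
    ContDiff ℝ ∞ (fun Y : Euc n₂ => ((s, X, Y) : ℝ × Euc n₁ × Euc n₂)) :=
  contDiff_const.prodMk (contDiff_const.prodMk contDiff_id)

/-- The restriction to the `N₂`-directions of the contraction with the radial vector. -/
def radialSlice {k : ℕ} (α : (ℝ × Euc n₁ × Euc n₂) [⋀^Fin (k + 1)]→L[ℝ] ℝ) :
    Euc n₂ [⋀^Fin k]→L[ℝ] ℝ :=
  (contract _ k (radial n₁ n₂) α).compContinuousLinearMap (inclN n₁ n₂)

/-- Cartan's formula for the constant radial vector `∂_r` gives `ι_∂r df = ∂_r f - d(ι_∂r f)`.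
Restriction to a slice is a pullback and commutes with `d`, so the correction is the exterior
derivative of a form on the slice. -/
theorem extDeriv_radial_succ {k : ℕ}
    {f : ℝ × Euc n₁ × Euc n₂ → (ℝ × Euc n₁ × Euc n₂) [⋀^Fin (k + 1)]→L[ℝ] ℝ}
    {s : ℝ} {X : Euc n₁} {Y : Euc n₂} (hf : ContDiffAt ℝ ∞ f (s, X, Y)) (v : Fin (k + 1) → Euc n₂) :
    extDeriv f (s, X, Y) (Matrix.vecCons (radial n₁ n₂) fun a => inclN n₁ n₂ (v a)) =
      fderiv ℝ f (s, X, Y) (radial n₁ n₂) (fun a => inclN n₁ n₂ (v a)) -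
        extDeriv (fun Y => radialSlice (f (s, X, Y))) Y v := by
  have hd : DifferentiableAt ℝ f (s, X, Y) := hf.differentiableAt (by simp)
  have h1 := contract_alternatize_succ (fderiv ℝ f (s, X, Y)) (radial n₁ n₂)
  have h2 : ContinuousAlternatingMap.alternatizeUncurryFin
      ((contract _ k (radial n₁ n₂)).comp (fderiv ℝ f (s, X, Y))) =
      extDeriv (fun z => contract _ k (radial n₁ n₂) (f z)) (s, X, Y) := by
    rw [extDeriv]
    congr 1
    exact ((contract _ k (radial n₁ n₂)).hasFDerivAt.comp (s, X, Y) hd.hasFDerivAt).fderiv.symm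
  have hd' : DifferentiableAt ℝ (fun z => contract _ k (radial n₁ n₂) (f z)) (s, X, Y) :=
    (contract _ k (radial n₁ n₂)).differentiableAt.comp _ hd
  have h3 := extDeriv_pullback (r := ∞) (x := Y)
    (f := fun Y : Euc n₂ => ((s, X, Y) : ℝ × Euc n₁ × Euc n₂)) hd' (contDiff_slice s X).contDiffAt
    (by rw [minSmoothness_of_isRCLikeNormedField]; exact ENat.LEInfty.out)
  simp only [(hasFDerivAt_slice s X _).fderiv] at h3
  have h4 : extDeriv (fun Y => radialSlice (f (s, X, Y))) Y v =
      extDeriv (fun z => contract _ k (radial n₁ n₂) (f z)) (s, X, Y)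
        (fun a => inclN n₁ n₂ (v a)) := by
    change extDeriv (fun Y => (contract _ k (radial n₁ n₂)
      (f (s, X, Y))).compContinuousLinearMap (inclN n₁ n₂)) Y v = _
    rw [h3]
    rfl
  rw [h4, ← h2, ← h1, ContinuousAlternatingMap.add_apply, contract_apply, extDeriv]
  ring

theorem extDeriv_radial_zero
    {f : ℝ × Euc n₁ × Euc n₂ → (ℝ × Euc n₁ × Euc n₂) [⋀^Fin 0]→L[ℝ] ℝ}
    {z : ℝ × Euc n₁ × Euc n₂} (v : Fin 0 → Euc n₂) :
    extDeriv f z (Matrix.vecCons (radial n₁ n₂) fun a => inclN n₁ n₂ (v a)) =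
      fderiv ℝ f z (radial n₁ n₂) (fun a => inclN n₁ n₂ (v a)) := by
  rw [← contract_alternatize_zero (fderiv ℝ f z) (radial n₁ n₂), contract_apply, extDeriv]

end Model

/-! ### Forms pulled back from `N₂`, and slices of forms on the product. -/

section PulledBack

variable {n₁ n₂ : ℕ}
  {N₁ : Type*} [TopologicalSpace N₁] [ChartedSpace (Euc n₁) N₁] [IsManifold (𝓡 n₁) ∞ N₁]
  {N₂ : Type*} [TopologicalSpace N₂] [ChartedSpace (Euc n₂) N₂] [IsManifold (𝓡 n₂) ∞ N₂] {k : ℕ}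

variable (N₁) in
/-- The form `φ(r) h` on `ℝ₊ × N₁ × N₂`, for a function `φ` and a form `h` on `N₂`. -/
def pullForm (φ : ℝ → ℝ) (h : DForm (𝓡 n₂) N₂ k) : DForm (modelM n₁ n₂) (RPlus × N₁ × N₂) k :=
  let F : RPlus × N₁ × N₂ → (ℝ × Euc n₁ × Euc n₂) [⋀^Fin k]→L[ℝ] ℝ := fun p =>
    φ p.1 • (formAt (𝓡 n₂) h p.2.2).compContinuousLinearMap (projN n₁ n₂)
  F

theorem formAt_pullForm (φ : ℝ → ℝ) (h : DForm (𝓡 n₂) N₂ k) (p : RPlus × N₁ × N₂) :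
    formAt (modelM n₁ n₂) (pullForm N₁ φ h) p =
      φ p.1 • (formAt (𝓡 n₂) h p.2.2).compContinuousLinearMap (projN n₁ n₂) := rfl

theorem inChart_pullForm (φ : ℝ → ℝ) (h : DForm (𝓡 n₂) N₂ k) {r : RPlus} {x₁ : N₁} {x₂ : N₂}
    {z : ℝ × Euc n₁ × Euc n₂} (hz : z ∈ (extChartAt (modelM n₁ n₂) (r, x₁, x₂)).target) :
    inChart (modelM n₁ n₂) (pullForm N₁ φ h) (r, x₁, x₂) z =
      φ z.1 • (inChart (𝓡 n₂) h x₂ z.2.2).compContinuousLinearMap (projN n₁ n₂) := by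
  obtain ⟨s, X, Y⟩ := z
  obtain ⟨hs, hX, hY⟩ := warped_pos hz
  rw [inChart_eq, dSymm_modelM r x₁ x₂ hs hX hY, modelM_symm r x₁ x₂ hs, formAt_pullForm,
    inChart_eq]
  rfl

theorem isSmooth_pullForm {φ : ℝ → ℝ} (hφ : ContDiff ℝ ∞ φ) {h : DForm (𝓡 n₂) N₂ k}
    (hh : IsSmooth (𝓡 n₂) h) : IsSmooth (modelM n₁ n₂) (pullForm N₁ φ h) := by
  rintro ⟨r, x₁, x₂⟩ z hz
  have hz' := warped_pos hz
  refine ContDiffAt.contDiffWithinAt ?_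
  have h1 : ContDiffAt ℝ ∞ (inChart (𝓡 n₂) h x₂) z.2.2 :=
    (hh x₂).contDiffAt ((isOpen_extChartAt_target x₂).mem_nhds hz'.2.2)
  have h2 : ContDiffAt ℝ ∞ (fun z : ℝ × Euc n₁ × Euc n₂ => inChart (𝓡 n₂) h x₂ z.2.2) z :=
    h1.comp z (projN n₁ n₂).contDiff.contDiffAt
  have h3 : ContDiffAt ℝ ∞ (fun z : ℝ × Euc n₁ × Euc n₂ => φ z.1 •
      (inChart (𝓡 n₂) h x₂ z.2.2).compContinuousLinearMap (projN n₁ n₂)) z :=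
    (hφ.contDiffAt.comp z contDiff_fst.contDiffAt).smul (contDiffAt_pullback h2 contDiffAt_const)
  refine h3.congr_of_eventuallyEq ?_
  filter_upwards [(isOpen_extChartAt_target (I := modelM n₁ n₂) (r, x₁, x₂)).mem_nhds hz] with w hw
  exact inChart_pullForm φ h hw

/-- Two smooth forms which agree near a point have the same exterior derivative there. -/
theorem formAt_extD_congr {E H : Type*} [NormedAddCommGroup E] [NormedSpace ℝ E]
    [TopologicalSpace H] (I : ModelWithCorners ℝ E H) [I.Boundaryless] {X : Type*}
    [TopologicalSpace X] [ChartedSpace H X] [IsManifold I ∞ X] [FiniteDimensional ℝ E]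
    {u v : DForm I X k} {x : X} (h : ∀ᶠ z in nhds x, formAt I u z = formAt I v z) :
    formAt I (extD I u) x = formAt I (extD I v) x := by
  have : inChart I u x =ᶠ[nhds (extChartAt I x x)] inChart I v x := by
    filter_upwards [eventually_inChart I h] with y hy
    rw [inChart_eq, inChart_eq, hy]
  change (extDeriv (inChart I u x) (extChartAt I x x)).compContinuousLinearMap (dChart I x x) =
    (extDeriv (inChart I v x) (extChartAt I x x)).compContinuousLinearMap (dChart I x x)
  rw [this.extDeriv_eq]

/-- In a product chart the form is the pullback under a linear projection, and the exterior
derivative is natural. -/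
theorem extD_pullForm_one {h : DForm (𝓡 n₂) N₂ k} (hh : IsSmooth (𝓡 n₂) h)
    (hd : extD (𝓡 n₂) h = 0) (p : RPlus × N₁ × N₂) :
    formAt (modelM n₁ n₂) (extD (modelM n₁ n₂) (pullForm N₁ (fun _ => 1) h)) p = 0 := by
  obtain ⟨r, x₁, x₂⟩ := p
  set x : RPlus × N₁ × N₂ := (r, x₁, x₂) with hx
  set z := extChartAt (modelM n₁ n₂) x x with hz
  have hzt : z ∈ (extChartAt (modelM n₁ n₂) x).target := mem_extChartAt_target x
  have hz' := warped_pos hzt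
  change (extDeriv (inChart (modelM n₁ n₂) (pullForm N₁ (fun _ => 1) h) x) z
    ).compContinuousLinearMap (dChart (modelM n₁ n₂) x x) = 0
  have h1 : inChart (modelM n₁ n₂) (pullForm N₁ (fun _ => 1) h) x =ᶠ[nhds z]
      fun z => (inChart (𝓡 n₂) h x₂ (projN n₁ n₂ z)).compContinuousLinearMap
        (fderiv ℝ (projN n₁ n₂) z) := by
    filter_upwards [(isOpen_extChartAt_target (I := modelM n₁ n₂) x).mem_nhds hzt] with w hw
    rw [inChart_pullForm _ h hw, one_smul, (projN n₁ n₂).fderiv]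
    rfl
  have h2 : ContDiffAt ℝ ∞ (inChart (𝓡 n₂) h x₂) (projN n₁ n₂ z) :=
    (hh x₂).contDiffAt ((isOpen_extChartAt_target x₂).mem_nhds hz'.2.2)
  rw [h1.extDeriv_eq, extDeriv_pullback (r := ∞) (h2.differentiableAt (by simp))
    (projN n₁ n₂).contDiff.contDiffAt
    (by rw [minSmoothness_of_isRCLikeNormedField]; exact ENat.LEInfty.out)]
  have h3 : extDeriv (inChart (𝓡 n₂) h x₂) (projN n₁ n₂ z) = 0 := by
    rw [← inChart_extD (𝓡 n₂) (y := projN n₁ n₂ z) hz'.2.2 ((isSmooth_iff (𝓡 n₂)).1 hh _), hd]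
    rfl
  rw [h3]
  rfl

/-- The contraction of a form with the radial vector, restricted to a slice `{r} × {x} × N₂`. -/
def sliceForm (θ : DForm (modelM n₁ n₂) (RPlus × N₁ × N₂) (k + 1)) (r : RPlus) (x : N₁) :
    DForm (𝓡 n₂) N₂ k :=
  let F : N₂ → Euc n₂ [⋀^Fin k]→L[ℝ] ℝ := fun y => radialSlice (formAt (modelM n₁ n₂) θ (r, x, y))
  F

theorem inChart_sliceForm (θ : DForm (modelM n₁ n₂) (RPlus × N₁ × N₂) (k + 1)) (r : RPlus)
    (x₁ : N₁) (x₂ : N₂) {s : ℝ} (hs : 0 < s) {X : Euc n₁} (hX : X ∈ (extChartAt (𝓡 n₁) x₁).target)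
    {Y : Euc n₂} (hY : Y ∈ (extChartAt (𝓡 n₂) x₂).target) :
    inChart (𝓡 n₂) (sliceForm θ ⟨s, hs⟩ ((extChartAt (𝓡 n₁) x₁).symm X)) x₂ Y =
      radialSlice (inChart (modelM n₁ n₂) θ (r, x₁, x₂) (s, X, Y)) := by
  rw [inChart_eq, inChart_eq, dSymm_modelM r x₁ x₂ hs hX hY, modelM_symm r x₁ x₂ hs]
  ext v
  simp only [radialSlice, ContinuousAlternatingMap.compContinuousLinearMap_apply, contract_apply]
  change (formAt (modelM n₁ n₂) θ _) _ = (formAt (modelM n₁ n₂) θ _) _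
  congr 1
  funext a
  refine Fin.cases ?_ (fun a => ?_) a
  · simp [radial]
  · simp [inclN]

theorem isSmooth_sliceForm {θ : DForm (modelM n₁ n₂) (RPlus × N₁ × N₂) (k + 1)}
    (hθ : IsSmooth (modelM n₁ n₂) θ) {s : ℝ} (hs : 0 < s) {x₁ : N₁} {X : Euc n₁}
    (hX : X ∈ (extChartAt (𝓡 n₁) x₁).target) :
    IsSmooth (𝓡 n₂) (sliceForm θ ⟨s, hs⟩ ((extChartAt (𝓡 n₁) x₁).symm X)) := by
  intro x₂ Y hY
  have hz : (s, X, Y) ∈ (extChartAt (modelM n₁ n₂) ((⟨s, hs⟩ : RPlus), x₁, x₂)).target := by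
    rw [modelM_target]; exact ⟨hs, hX, hY⟩
  have h1 := (hθ ((⟨s, hs⟩ : RPlus), x₁, x₂)).contDiffAt ((isOpen_extChartAt_target _).mem_nhds hz)
  have h2 := h1.comp Y (contDiff_slice (n₂ := n₂) s X).contDiffAt
  have h3 : ContDiffAt ℝ ∞ (fun Y => radialSlice (inChart (modelM n₁ n₂) θ
      ((⟨s, hs⟩ : RPlus), x₁, x₂) (s, X, Y))) Y :=
    contDiffAt_pullback ((contract _ k (radial n₁ n₂)).contDiff.contDiffAt.comp Y h2)
      contDiffAt_const
  refine (h3.congr_of_eventuallyEq ?_).contDiffWithinAt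
  filter_upwards [(isOpen_extChartAt_target (I := 𝓡 n₂) x₂).mem_nhds hY] with W hW
  exact inChart_sliceForm θ ⟨s, hs⟩ x₁ x₂ hs hX hW

end PulledBack

end L2Forms
end

/-! ### Square integrability on the product. -/

noncomputable section

namespace L2Forms

set_option maxSynthPendingDepth 5

theorem stdBasis_addHaar (n : ℕ) : (stdBasis n).addHaar = volume :=
  (EuclideanSpace.basisFun (Fin n) ℝ).addHaar_eq_volume

theorem basisM_addHaar (n₁ n₂ : ℕ) : (basisM n₁ n₂).addHaar = volume := by
  rw [basisM, Module.Basis.prod_addHaar, Module.Basis.prod_addHaar, stdBasis_addHaar,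
    stdBasis_addHaar, ← OrthonormalBasis.toBasis_singleton, OrthonormalBasis.addHaar_eq_volume]
  rfl

theorem ChartPartition.exists_mem_tsupport {E H : Type*} [NormedAddCommGroup E] [NormedSpace ℝ E]
    [TopologicalSpace H] {I : ModelWithCorners ℝ E H} {X : Type*} [TopologicalSpace X]
    [ChartedSpace H X] (P : ChartPartition I X) (x : X) :
    ∃ i, x ∈ (extChartAt I (P.c i)).source ∧ extChartAt I (P.c i) x ∈ tsupport (P.φ i) := by
  by_contra! h
  have h1 := P.sum_eq_one x
  rw [Finset.sum_eq_zero] at h1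
  · exact zero_ne_one h1
  · intro i _
    by_cases hx : x ∈ (extChartAt I (P.c i)).source
    · rw [Set.indicator_of_mem hx, image_eq_zero_of_notMem_tsupport (h i hx)]
    · rw [Set.indicator_of_notMem hx]

theorem secondCountable_of_compact_charted (n : ℕ) (N : Type*) [TopologicalSpace N]
    [ChartedSpace (Euc n) N] [CompactSpace N] : SecondCountableTopology N :=
  ChartedSpace.secondCountable_of_sigmaCompact (Euc n) N

section SquareIntegrable

variable {n₁ n₂ : ℕ}
  {N₁ : Type*} [TopologicalSpace N₁] [ChartedSpace (Euc n₁) N₁] [IsManifold (𝓡 n₁) ∞ N₁]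
  [MeasurableSpace N₁]
  {N₂ : Type*} [TopologicalSpace N₂] [ChartedSpace (Euc n₂) N₂] [IsManifold (𝓡 n₂) ∞ N₂]
  [MeasurableSpace N₂] [BorelSpace (RPlus × N₁ × N₂)] {k : ℕ}
  {α₁ α₂ : ℝ} {g₁ : SmoothMetric n₁ N₁} {g₂ : SmoothMetric n₂ N₂}

/-- The point `1` of the half line. -/
def onePos : RPlus := ⟨1, Set.mem_Ioi.2 one_pos⟩

/-- The partition supports cover the compact factors by finitely many compact pieces, and the radial
variable is confined to `(0, ε]`. On these sets of finite volume a bound for the weighted square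
norm suffices. -/
theorem memL2_of_bound (P₁ : ChartPartition (𝓡 n₁) N₁)
    (P₂ : ChartPartition (𝓡 n₂) N₂) {u : DForm (modelM n₁ n₂) (RPlus × N₁ × N₂) k}
    (hu : IsSmooth (modelM n₁ n₂) u) (ε : ℝ) (hε : ∀ p, ε < (p.1 : ℝ) → formAt (modelM n₁ n₂) u p = 0)
    (h : ∀ i j, ∃ C : ℝ, ∀ z ∈ Set.Ioc 0 ε ×ˢ (tsupport (P₁.φ i) ×ˢ tsupport (P₂.φ j)),
      volDensity (modelM n₁ n₂) (basisM n₁ n₂) (warpedMetric α₁ α₂ g₁ g₂)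
        (onePos, P₁.c i, P₂.c j) z *
      cInner (basisM n₁ n₂) (chartMetric (modelM n₁ n₂) (warpedMetric α₁ α₂ g₁ g₂)
        (onePos, P₁.c i, P₂.c j) z) (inChart (modelM n₁ n₂) u (onePos, P₁.c i, P₂.c j) z)
        (inChart (modelM n₁ n₂) u (onePos, P₁.c i, P₂.c j) z) ≤ C) :
    MemL2 (modelM n₁ n₂) (basisM n₁ n₂) (warpedMetric α₁ α₂ g₁ g₂) u := by
  have hg := isRiem_warped α₁ α₂ g₁ g₂
  have hm : ∀ (i : Fin P₁.m) (j : Fin P₂.m) (t : Set ℝ), MeasurableSet t →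
      MeasurableSet (t ×ˢ (tsupport (P₁.φ i) ×ˢ tsupport (P₂.φ j))) := fun i j t ht =>
    ht.prod ((isClosed_tsupport _).measurableSet.prod (isClosed_tsupport _).measurableSet)
  refine hg.memL2_of_cover (IsSmooth.aeMeas (modelM n₁ n₂) (basisM n₁ n₂).addHaar hu)
    (κ := Fin P₁.m × Fin P₂.m) (fun p => (onePos, P₁.c p.1, P₂.c p.2))
    (fun p => Set.Ioi 0 ×ˢ (tsupport (P₁.φ p.1) ×ˢ tsupport (P₂.φ p.2)))
    (fun p => hm p.1 p.2 _ measurableSet_Ioi) ?_ ?_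
  · rintro ⟨r, x, y⟩
    obtain ⟨i, hi, hi'⟩ := P₁.exists_mem_tsupport x
    obtain ⟨j, hj, hj'⟩ := P₂.exists_mem_tsupport y
    refine ⟨(i, j), mem_modelM_source.2 ⟨hi, hj⟩, ?_⟩
    rw [modelM_apply]
    exact ⟨r.2, hi', hj'⟩
  · rintro ⟨i, j⟩
    obtain ⟨C, hC⟩ := h i j
    have hT : MeasurableSet (extChartAt (modelM n₁ n₂) (onePos, P₁.c i, P₂.c j)).target :=
      (isOpen_extChartAt_target _).measurableSet
    have hb := hm i j _ (measurableSet_Ioc (a := (0 : ℝ)) (b := ε))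
    have hfin : volume (Set.Ioc 0 ε ×ˢ (tsupport (P₁.φ i) ×ˢ tsupport (P₂.φ j))) < ⊤ := by
      change (volume.prod (volume.prod volume)) _ < ⊤
      rw [Measure.prod_prod, Measure.prod_prod]
      exact ENNReal.mul_lt_top measure_Ioc_lt_top (ENNReal.mul_lt_top
        (P₁.compact i).measure_lt_top (P₂.compact j).measure_lt_top)
    calc _ ≤ ∫⁻ z in (extChartAt (modelM n₁ n₂) (onePos, P₁.c i, P₂.c j)).target ∩
          (Set.Ioi 0 ×ˢ (tsupport (P₁.φ i) ×ˢ tsupport (P₂.φ j))),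
          (Set.Ioc 0 ε ×ˢ (tsupport (P₁.φ i) ×ˢ tsupport (P₂.φ j))).indicator
            (fun _ => ENNReal.ofReal C) z ∂(basisM n₁ n₂).addHaar := by
          refine setLIntegral_mono' (hT.inter (hm i j _ measurableSet_Ioi)) ?_
          rintro ⟨s, X, Y⟩ ⟨hzT, hzA⟩
          by_cases hs : s ≤ ε
          · have hmem : (s, X, Y) ∈ Set.Ioc 0 ε ×ˢ (tsupport (P₁.φ i) ×ˢ tsupport (P₂.φ j)) :=
              ⟨⟨hzA.1, hs⟩, hzA.2⟩
            rw [Set.indicator_of_mem hmem]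
            exact ENNReal.ofReal_le_ofReal (hC _ hmem)
          · have h0 : inChart (modelM n₁ n₂) u (onePos, P₁.c i, P₂.c j) (s, X, Y) = 0 := by
              rw [inChart_eq, modelM_symm _ _ _ hzA.1, hε]
              · rfl
              · exact not_le.1 hs
            simp only [h0, cInner_zero_left, mul_zero, ENNReal.ofReal_zero]
            exact bot_le
      _ ≤ ∫⁻ z, (Set.Ioc 0 ε ×ˢ (tsupport (P₁.φ i) ×ˢ tsupport (P₂.φ j))).indicator
            (fun _ => ENNReal.ofReal C) z ∂(basisM n₁ n₂).addHaar := setLIntegral_le_lintegral _ _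
      _ < ⊤ := by
        rw [lintegral_indicator hb, setLIntegral_const, basisM_addHaar]
        exact ENNReal.mul_lt_top ENNReal.ofReal_lt_top hfin

/-- The form `φ(r) h` is square integrable, because the weights cancel in the critical degree. -/
theorem memL2_pullForm (P₁ : ChartPartition (𝓡 n₁) N₁)
    (P₂ : ChartPartition (𝓡 n₂) N₂) (hk : 2 * α₂ * k = α₁ * n₁ + α₂ * n₂) {φ : ℝ → ℝ} (hφ : ContDiff ℝ ∞ φ)
    (h1 : ∀ s, |φ s| ≤ 1) (ε : ℝ) (hε : ∀ s, ε < s → φ s = 0) {h : DForm (𝓡 n₂) N₂ k}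
    (hh : IsSmooth (𝓡 n₂) h) :
    MemL2 (modelM n₁ n₂) (basisM n₁ n₂) (warpedMetric α₁ α₂ g₁ g₂) (pullForm N₁ φ h) := by
  refine memL2_of_bound P₁ P₂ (isSmooth_pullForm hφ hh) ε (fun p hp => ?_) fun i j => ?_
  · rw [formAt_pullForm, hε _ hp, zero_smul]
  · have hK := (P₁.compact i).prod (P₂.compact j)
    have c1 := (g₁.isRiem.continuousOn_volDensity (P₁.c i)).mono (P₁.subset i)
    have c2 := (g₂.isRiem.continuousOn_density_mul_cInner hh (P₂.c j)).mono (P₂.subset j)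
    have c3 := (c1.comp continuousOn_fst (fun z (hz : z ∈ tsupport (P₁.φ i) ×ˢ
      tsupport (P₂.φ j)) => hz.1)).mul (c2.comp continuousOn_snd (fun z hz => hz.2))
    obtain ⟨C, hC⟩ := hK.exists_bound_of_continuousOn c3
    refine ⟨C, ?_⟩
    rintro ⟨s, X, Y⟩ ⟨hs, hX, hY⟩
    have hX' := P₁.subset i hX
    have hY' := P₂.subset j hY
    have hz : (s, X, Y) ∈ (extChartAt (modelM n₁ n₂) (onePos, P₁.c i, P₂.c j)).target := by
      rw [modelM_target]; exact ⟨hs.1, hX', hY'⟩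
    rw [inChart_pullForm φ h hz, cInner_smul_left, cInner_smul_right]
    have key := density_mul_cInner_pullback α₁ α₂ g₁ g₂ hk onePos (P₁.c i) (P₂.c j) hs.1 hX' hY'
      (inChart (𝓡 n₂) h (P₂.c j) Y)
    have hb := hC (X, Y) ⟨hX, hY⟩
    rw [Real.norm_eq_abs] at hb
    set D := volDensity (𝓡 n₁) (stdBasis n₁) g₁.field (P₁.c i) X *
        (volDensity (𝓡 n₂) (stdBasis n₂) g₂.field (P₂.c j) Y *
          cInner (stdBasis n₂) (chartMetric (𝓡 n₂) g₂.field (P₂.c j) Y)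
            (inChart (𝓡 n₂) h (P₂.c j) Y) (inChart (𝓡 n₂) h (P₂.c j) Y)) with hD
    have hb' : |D| ≤ C := hb
    calc _ = φ s ^ 2 * D := by rw [← key]; ring
      _ ≤ |φ s| ^ 2 * |D| := by rw [sq_abs]; exact mul_le_mul_of_nonneg_left (le_abs_self D) (sq_nonneg _)
      _ ≤ 1 ^ 2 * |D| := by gcongr; exact h1 s
      _ ≤ C := by rw [one_pow, one_mul]; exact hb'

/-- Away from `r = 0` nothing degenerates: the weighted square norm is continuous on compact sets
inside the charts, whatever the degree. -/
theorem memL2_of_radial_support (P₁ : ChartPartition (𝓡 n₁) N₁)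
    (P₂ : ChartPartition (𝓡 n₂) N₂) {u : DForm (modelM n₁ n₂) (RPlus × N₁ × N₂) k}
    (hu : IsSmooth (modelM n₁ n₂) u) {δ ε : ℝ} (hδ : 0 < δ)
    (hsupp : ∀ p, (p.1 : ℝ) ∉ Set.Icc δ ε → formAt (modelM n₁ n₂) u p = 0) :
    MemL2 (modelM n₁ n₂) (basisM n₁ n₂) (warpedMetric α₁ α₂ g₁ g₂) u := by
  refine memL2_of_bound P₁ P₂ hu ε (fun p hp => hsupp p fun h => hp.not_ge h.2) fun i j => ?_
  have hK := (isCompact_Icc (a := δ) (b := ε)).prod ((P₁.compact i).prod (P₂.compact j))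
  have hsub : Set.Icc δ ε ×ˢ (tsupport (P₁.φ i) ×ˢ tsupport (P₂.φ j)) ⊆
      (extChartAt (modelM n₁ n₂) (onePos, P₁.c i, P₂.c j)).target := by
    rw [modelM_target]
    rintro z ⟨h1, h2, h3⟩
    exact ⟨hδ.trans_le h1.1, P₁.subset i h2, P₂.subset j h3⟩
  obtain ⟨C, hC⟩ := hK.exists_bound_of_continuousOn
    (((isRiem_warped α₁ α₂ g₁ g₂).continuousOn_density_mul_cInner hu _).mono hsub)
  refine ⟨max C 0, ?_⟩
  rintro ⟨s, X, Y⟩ ⟨hs, hXY⟩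
  by_cases hs' : s ∈ Set.Icc δ ε
  · exact ((le_abs_self _).trans (hC _ ⟨hs', hXY⟩)).trans (le_max_left _ _)
  · have h0 : inChart (modelM n₁ n₂) u (onePos, P₁.c i, P₂.c j) (s, X, Y) = 0 := by
      rw [inChart_eq, modelM_symm _ _ _ hs.1, hsupp _ hs']
      rfl
    rw [h0, cInner_zero_left, mul_zero]
    exact le_max_right _ _

end SquareIntegrable

end L2Forms
end

/-! ### Stokes' formula for radial pairings with a current. -/

noncomputable section

namespace L2Forms

set_option maxSynthPendingDepth 5

theorem integrable_mul_of_continuousOn {α : Type*} [TopologicalSpace α]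
    [MeasurableSpace α] [OpensMeasurableSpace α] {μ : Measure α} {K : Set α} (hK : IsCompact K)
    (hKm : MeasurableSet K) {w A : α → ℝ} (hw : Integrable w μ) (h0 : ∀ z ∉ K, w z = 0)
    (hA : ContinuousOn A K) : Integrable (fun z => w z * A z) μ := by
  obtain ⟨C, hC⟩ := hK.exists_bound_of_continuousOn hA
  have h1 : AEStronglyMeasurable (K.indicator A) μ :=
    (aestronglyMeasurable_indicator_iff hKm).2 (hA.aestronglyMeasurable hKm)
  refine (hw.bdd_mul (c := max C 0) h1 (Filter.Eventually.of_forall fun z => ?_)).congr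
    (Filter.Eventually.of_forall fun z => ?_)
  · by_cases hz : z ∈ K
    · rw [Set.indicator_of_mem hz]
      exact (hC z hz).trans (le_max_left _ _)
    · rw [Set.indicator_of_notMem hz, norm_zero]
      exact le_max_right _ _
  · by_cases hz : z ∈ K
    · simp only [Set.indicator_of_mem hz, mul_comm]
    · simp only [Set.indicator_of_notMem hz, h0 z hz, mul_zero, zero_mul]

/-- Integration by parts on the half line. -/
theorem integral_mul_deriv_halfLine {f a a' : ℝ → ℝ} (hf : ContDiff ℝ ∞ f)
    (hc : HasCompactSupport f) (hs : tsupport f ⊆ Set.Ioi 0)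
    (ha : ∀ s, 0 < s → HasDerivAt a (a' s) s) (ha' : ContinuousOn a' (Set.Ioi 0)) :
    ∫ s, f s * a' s = ∫ s, -deriv f s * a s := by
  have hK : IsCompact (tsupport f) := hc
  have hKm : MeasurableSet (tsupport f) := (isClosed_tsupport f).measurableSet
  have hfd : ∀ s, HasDerivAt f (deriv f s) s := fun s =>
    (hf.differentiable (by simp) s).hasDerivAt
  have hdc : Continuous (deriv f) := hf.continuous_deriv (by simp)
  have h0 : ∀ s ∉ tsupport f, deriv f s = 0 := fun s hs' => by
    by_contra hne
    exact hs' (support_deriv_subset hne)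
  have ha0 : ContinuousOn a (Set.Ioi 0) := fun s hs' => (ha s hs').continuousAt.continuousWithinAt
  have i1 : Integrable (fun s => f s * a' s) :=
    integrable_mul_of_continuousOn hK hKm (hf.continuous.integrable_of_hasCompactSupport hc)
      (fun z hz => image_eq_zero_of_notMem_tsupport hz) (ha'.mono hs)
  have i2 : Integrable (fun s => deriv f s * a s) :=
    integrable_mul_of_continuousOn hK hKm (hdc.integrable_of_hasCompactSupport hc.deriv)
      h0 (ha0.mono hs)
  have i3 : Integrable (fun s => f s * a s) :=
    integrable_mul_of_continuousOn hK hKm (hf.continuous.integrable_of_hasCompactSupport hc)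
      (fun z hz => image_eq_zero_of_notMem_tsupport hz) (ha0.mono hs)
  -- Off the support of `f` nothing is known about `a`, but the product vanishes nearby; hence it is
  -- differentiable on the whole line.
  have hderiv : ∀ s, HasDerivAt (fun s => f s * a s) (deriv f s * a s + f s * a' s) s := by
    intro s
    by_cases hs' : s ∈ tsupport f
    · exact (hfd s).mul (ha s (hs hs'))
    · rw [h0 s hs', image_eq_zero_of_notMem_tsupport hs', zero_mul, zero_mul, add_zero]
      refine (hasDerivAt_const s (0 : ℝ)).congr_of_eventuallyEq ?_
      filter_upwards [(isClosed_tsupport f).isOpen_compl.mem_nhds hs'] with t ht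
      rw [image_eq_zero_of_notMem_tsupport ht, zero_mul]
  have h := integral_eq_zero_of_hasDerivAt_of_integrable hderiv (i2.add i1) i3
  rw [integral_add i2 i1] at h
  simp only [neg_mul]
  rw [integral_neg]
  linarith

/-- Only the innermost integral, over the `N₂` variable, need vanish; Fubini does the rest. -/
theorem integral_eq_zero_of_slices {A B C : Type*} [MeasureSpace A] [MeasureSpace B]
    [MeasureSpace C] [SFinite (volume : Measure A)] [SFinite (volume : Measure B)]
    [SFinite (volume : Measure C)] {S : A × B × C → ℝ} (hS : Integrable S)
    (h : ∀ a b, ∫ c, S (a, b, c) = 0) : ∫ z, S z = 0 := by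
  have hS' : Integrable S ((volume : Measure A).prod (volume : Measure (B × C))) := hS
  have h1 : ∫ z, S z = ∫ a, ∫ z, S (a, z) := integral_prod S hS'
  rw [h1]
  refine integral_eq_zero_of_ae ?_
  filter_upwards [hS'.prod_right_ae] with a ha
  have ha' : Integrable (fun z => S (a, z)) ((volume : Measure B).prod (volume : Measure C)) := ha
  have h2 : ∫ z, S (a, z) = ∫ b, ∫ c, S (a, b, c) := integral_prod _ ha'
  rw [h2]
  simp only [h, integral_zero, Pi.zero_apply]

section RadialPairing

variable {n₁ n₂ : ℕ}
  {N₁ : Type*} [TopologicalSpace N₁] [ChartedSpace (Euc n₁) N₁] [IsManifold (𝓡 n₁) ∞ N₁]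
  {N₂ : Type*} [TopologicalSpace N₂] [ChartedSpace (Euc n₂) N₂] [IsManifold (𝓡 n₂) ∞ N₂] {k : ℕ}

/-- The radial component of `dθ` on a slice is the radial derivative up to an exact form. -/
theorem exists_exact_slice {θ : DForm (modelM n₁ n₂) (RPlus × N₁ × N₂) k}
    (hθ : IsSmooth (modelM n₁ n₂) θ) (r : RPlus) {s : ℝ} (hs : 0 < s) {x₁ : N₁} {X : Euc n₁}
    (hX : X ∈ (extChartAt (𝓡 n₁) x₁).target) :
    ∃ u ∈ exactForms (𝓡 n₂) N₂ k, ∀ x₂, ∀ Y ∈ (extChartAt (𝓡 n₂) x₂).target,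
      ∀ J : Fin k → Fin n₂, inChart (modelM n₁ n₂) (extD (modelM n₁ n₂) θ) (r, x₁, x₂) (s, X, Y)
        (fun a => basisM n₁ n₂ (idxR n₁ J a)) =
          fderiv ℝ (inChart (modelM n₁ n₂) θ (r, x₁, x₂)) (s, X, Y) (radial n₁ n₂)
            (fun a => basisM n₁ n₂ (idxN n₁ J a)) -
          inChart (𝓡 n₂) u x₂ Y (fun a => stdBasis n₂ (J a)) := by
  have hz : ∀ x₂ : N₂, ∀ Y ∈ (extChartAt (𝓡 n₂) x₂).target,
      (s, X, Y) ∈ (extChartAt (modelM n₁ n₂) (r, x₁, x₂)).target := fun x₂ Y hY => by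
    rw [modelM_target]; exact ⟨hs, hX, hY⟩
  have hext : ∀ x₂ : N₂, ∀ Y ∈ (extChartAt (𝓡 n₂) x₂).target,
      inChart (modelM n₁ n₂) (extD (modelM n₁ n₂) θ) (r, x₁, x₂) (s, X, Y) =
        extDeriv (inChart (modelM n₁ n₂) θ (r, x₁, x₂)) (s, X, Y) := fun x₂ Y hY =>
    inChart_extD (modelM n₁ n₂) (hz x₂ Y hY) ((isSmooth_iff (modelM n₁ n₂)).1 hθ _)
  cases k with
  | zero =>
    refine ⟨0, Submodule.zero_mem _, fun x₂ Y hY J => ?_⟩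
    rw [hext x₂ Y hY, basisM_comp_idxR, basisM_comp_idxN, extDeriv_radial_zero]
    exact (sub_zero _).symm
  | succ k =>
    have hsm := isSmooth_sliceForm hθ hs hX
    -- The primitive is the slice of `ι_∂r θ`, a global form on `N₂`; it does not depend on `x₂`, so
    -- a single exact form serves all charts.
    refine ⟨_, ⟨_, hsm, rfl⟩, fun x₂ Y hY J => ?_⟩
    have hc := (hθ (r, x₁, x₂)).contDiffAt ((isOpen_extChartAt_target _).mem_nhds (hz x₂ Y hY))
    rw [hext x₂ Y hY, basisM_comp_idxR, basisM_comp_idxN, extDeriv_radial_succ hc]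
    congr 1
    rw [inChart_extD (𝓡 n₂) hY ((isSmooth_iff (𝓡 n₂)).1 hsm _)]
    have : inChart (𝓡 n₂) (sliceForm θ ⟨s, hs⟩ ((extChartAt (𝓡 n₁) x₁).symm X)) x₂ =ᶠ[nhds Y]
        fun Y => radialSlice (inChart (modelM n₁ n₂) θ (r, x₁, x₂) (s, X, Y)) := by
      filter_upwards [(isOpen_extChartAt_target (I := 𝓡 n₂) x₂).mem_nhds hY] with Z hZ
      exact inChart_sliceForm θ r x₁ x₂ hs hX hZ
    rw [this.extDeriv_eq]

/-- The coefficient `f(s) 1_C(X) w(Y)`. -/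
def coef (f : ℝ → ℝ) (C : Set (Euc n₁)) (w : Euc n₂ → ℝ) (z : ℝ × Euc n₁ × Euc n₂) : ℝ :=
  f z.1 * (C.indicator 1 z.2.1 * w z.2.2)

theorem coef_eq_zero {f : ℝ → ℝ} {C : Set (Euc n₁)} {w : Euc n₂ → ℝ} {K₀ : Set ℝ}
    {K : Set (Euc n₂)} (hf : ∀ s ∉ K₀, f s = 0) (hw : ∀ Y ∉ K, w Y = 0)
    {z : ℝ × Euc n₁ × Euc n₂} (hz : z ∉ K₀ ×ˢ (C ×ˢ K)) : coef f C w z = 0 := by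
  rw [coef]
  by_cases h0 : z.1 ∈ K₀
  · by_cases h1 : z.2.1 ∈ C
    · rw [hw z.2.2 fun h2 => hz ⟨h0, h1, h2⟩, mul_zero, mul_zero]
    · rw [Set.indicator_of_notMem h1, zero_mul, mul_zero]
  · rw [hf z.1 h0, zero_mul]

theorem integrable_coef {f : ℝ → ℝ} (hf : Integrable f) {C : Set (Euc n₁)} (hC : IsCompact C)
    {w : Euc n₂ → ℝ} (hw : Integrable w) : Integrable (coef f C w) := by
  have h1 : Integrable (C.indicator (1 : Euc n₁ → ℝ)) :=
    (integrable_indicator_iff hC.measurableSet).2 (integrableOn_const hC.measure_lt_top.ne)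
  exact hf.mul_prod (h1.mul_prod hw)

theorem integrable_coef_mul {f : ℝ → ℝ} (hf : Continuous f) {K₀ : Set ℝ} (hK₀ : IsCompact K₀)
    (hfK : ∀ s ∉ K₀, f s = 0) {C : Set (Euc n₁)} (hC : IsCompact C)
    {w : Euc n₂ → ℝ} (hw : Integrable w) {K : Set (Euc n₂)} (hK : IsCompact K)
    (hwK : ∀ Y ∉ K, w Y = 0) {A : ℝ × Euc n₁ × Euc n₂ → ℝ} (hA : ContinuousOn A (K₀ ×ˢ (C ×ˢ K))) :
    Integrable (fun z => coef f C w z * A z) :=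
  integrable_mul_of_continuousOn (hK₀.prod (hC.prod hK))
    (hK₀.measurableSet.prod (hC.measurableSet.prod hK.measurableSet))
    (integrable_coef (hf.integrable_of_hasCompactSupport (HasCompactSupport.intro hK₀ hfK)) hC hw)
    (fun _ hz => coef_eq_zero hfK hwK hz) hA

/-- Stokes' theorem for the pairing of forms on `ℝ₊ × N₁ × N₂` with the product of a function of
`r`, the indicator function of a compact subset of `N₁` and a current on `N₂` which vanishes on
exact forms. -/
theorem sum_integral_coef_extD (P : ChartPartition (𝓡 n₂) N₂)
    {W : Fin P.m → (Fin k → Fin n₂) → Euc n₂ → ℝ} (hWi : ∀ i J, Integrable (W i J))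
    (hWs : ∀ i J, ∀ Y ∉ tsupport (P.φ i), W i J Y = 0)
    (hWe : ∀ u ∈ exactForms (𝓡 n₂) N₂ k, ∑ i, ∑ J, ∫ Y, W i J Y *
      inChart (𝓡 n₂) u (P.c i) Y (fun a => stdBasis n₂ (J a)) = 0)
    {x₁ : N₁} {C : Set (Euc n₁)} (hC : IsCompact C) (hCt : C ⊆ (extChartAt (𝓡 n₁) x₁).target)
    {f : ℝ → ℝ} (hf : ContDiff ℝ ∞ f) (hc : HasCompactSupport f) (hs : tsupport f ⊆ Set.Ioi 0)
    {θ : DForm (modelM n₁ n₂) (RPlus × N₁ × N₂) k} (hθ : IsSmooth (modelM n₁ n₂) θ) (r : RPlus) :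
    ∑ i, ∑ J, ∫ z, coef f C (W i J) z * inChart (modelM n₁ n₂) (extD (modelM n₁ n₂) θ)
        (r, x₁, P.c i) z (fun a => basisM n₁ n₂ (idxR n₁ J a)) =
      ∑ i, ∑ J, ∫ z, coef (fun s => -deriv f s) C (W i J) z *
        inChart (modelM n₁ n₂) θ (r, x₁, P.c i) z (fun a => basisM n₁ n₂ (idxN n₁ J a)) := by
  have hT : ∀ i, tsupport f ×ˢ (C ×ˢ tsupport (P.φ i)) ⊆
      (extChartAt (modelM n₁ n₂) (r, x₁, P.c i)).target := fun i => by
    rw [modelM_target]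
    exact Set.prod_mono hs (Set.prod_mono hCt (P.subset i))
  have hKm : ∀ i, MeasurableSet (tsupport (P.φ i)) := fun i => (isClosed_tsupport _).measurableSet
  have hf0 : ∀ s ∉ tsupport f, f s = 0 := fun s h => image_eq_zero_of_notMem_tsupport h
  have hf1 : ∀ s ∉ tsupport f, -deriv f s = 0 := fun s hs' => by
    rw [neg_eq_zero]
    by_contra hne
    exact hs' (support_deriv_subset hne)
  have hdc : Continuous fun s => -deriv f s := (hf.continuous_deriv (by simp)).neg
  have hap : ∀ {m : ℕ} (v : Fin m → ℝ × Euc n₁ × Euc n₂), Continuous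
      fun α : (ℝ × Euc n₁ × Euc n₂) [⋀^Fin m]→L[ℝ] ℝ => α v := fun v =>
    (ContinuousAlternatingMap.apply ℝ _ ℝ v).continuous
  set a : ∀ i, (Fin k → Fin n₂) → ℝ × Euc n₁ × Euc n₂ → ℝ := fun i J z =>
    inChart (modelM n₁ n₂) θ (r, x₁, P.c i) z (fun a => basisM n₁ n₂ (idxN n₁ J a)) with ha
  set a' : ∀ i, (Fin k → Fin n₂) → ℝ × Euc n₁ × Euc n₂ → ℝ := fun i J z =>
    fderiv ℝ (inChart (modelM n₁ n₂) θ (r, x₁, P.c i)) z (radial n₁ n₂)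
      (fun a => basisM n₁ n₂ (idxN n₁ J a)) with ha'
  set e : ∀ i, (Fin k → Fin n₂) → ℝ × Euc n₁ × Euc n₂ → ℝ := fun i J z =>
    inChart (modelM n₁ n₂) (extD (modelM n₁ n₂) θ) (r, x₁, P.c i) z
      (fun a => basisM n₁ n₂ (idxR n₁ J a)) with he
  have hθd : ∀ i, ∀ z ∈ (extChartAt (modelM n₁ n₂) (r, x₁, P.c i)).target,
      ContDiffAt ℝ ∞ (inChart (modelM n₁ n₂) θ (r, x₁, P.c i)) z := fun i z hz =>
    (hθ _).contDiffAt ((isOpen_extChartAt_target _).mem_nhds hz)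
  have ca : ∀ i J, ContinuousOn (a i J) (extChartAt (modelM n₁ n₂) (r, x₁, P.c i)).target :=
    fun i J => (hap _).comp_continuousOn (hθ _).continuousOn
  have ce : ∀ i J, ContinuousOn (e i J) (extChartAt (modelM n₁ n₂) (r, x₁, P.c i)).target :=
    fun i J => (hap _).comp_continuousOn (hθ.extD (modelM n₁ n₂) _).continuousOn
  have ca' : ∀ i J, ContinuousOn (a' i J) (extChartAt (modelM n₁ n₂) (r, x₁, P.c i)).target :=
    fun i J => (hap _).comp_continuousOn fun z hz =>
      ((((hθd i z hz).fderiv_right (m := ∞) (by simp)).clm_apply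
        contDiffAt_const).continuousAt.continuousWithinAt)
  have ia : ∀ i J, Integrable fun z => coef (fun s => -deriv f s) C (W i J) z * a i J z :=
    fun i J => integrable_coef_mul hdc hc hf1 hC (hWi i J) (P.compact i) (hWs i J)
      ((ca i J).mono (hT i))
  have ia' : ∀ i J, Integrable fun z => coef f C (W i J) z * a' i J z :=
    fun i J => integrable_coef_mul hf.continuous hc hf0 hC (hWi i J) (P.compact i) (hWs i J)
      ((ca' i J).mono (hT i))
  have ie : ∀ i J, Integrable fun z => coef f C (W i J) z * e i J z :=
    fun i J => integrable_coef_mul hf.continuous hc hf0 hC (hWi i J) (P.compact i) (hWs i J)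
      ((ce i J).mono (hT i))
  -- Integration by parts in `s` at fixed `(X, Y)`; the remaining factors do not depend on `s`.
  have step1 : ∀ i J, ∫ z, coef f C (W i J) z * a' i J z =
      ∫ z, coef (fun s => -deriv f s) C (W i J) z * a i J z := by
    intro i J
    have e1 := integral_prod_symm (μ := (volume : Measure ℝ))
      (ν := (volume : Measure (Euc n₁ × Euc n₂))) _ (ia' i J)
    have e2 := integral_prod_symm (μ := (volume : Measure ℝ))
      (ν := (volume : Measure (Euc n₁ × Euc n₂))) _ (ia i J)
    refine e1.trans (Eq.trans ?_ e2.symm)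
    refine integral_congr_ae (Filter.Eventually.of_forall ?_)
    rintro ⟨X, Y⟩
    simp only [coef]
    by_cases hX : X ∈ C
    · by_cases hY : Y ∈ tsupport (P.φ i)
      · have hz : ∀ s, 0 < s → (s, X, Y) ∈ (extChartAt (modelM n₁ n₂) (r, x₁, P.c i)).target :=
          fun s hs => by rw [modelM_target]; exact ⟨hs, hCt hX, P.subset i hY⟩
        have hline : ∀ s : ℝ, HasDerivAt (fun s : ℝ => ((s, X, Y) : ℝ × Euc n₁ × Euc n₂))
            (radial n₁ n₂) s := fun s => (hasDerivAt_id s).prodMk (hasDerivAt_const s (X, Y))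
        have hpart := integral_mul_deriv_halfLine (a := fun s => a i J (s, X, Y))
          (a' := fun s => a' i J (s, X, Y)) hf hc hs (fun s hs => by
            have h1 := ((hθd i _ (hz s hs)).differentiableAt (by simp)).hasFDerivAt
            have h2 := h1.comp_hasDerivAt s (hline s)
            exact ((ContinuousAlternatingMap.apply ℝ _ ℝ
              (fun a => basisM n₁ n₂ (idxN n₁ J a))).hasFDerivAt).comp_hasDerivAt s h2)
          ((ca' i J).comp (Continuous.continuousOn (by fun_prop)) fun s hs => hz s hs)
        have l1 : ∀ s, f s * (C.indicator 1 X * W i J Y) * a' i J (s, X, Y) =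
          (C.indicator 1 X * W i J Y) * (f s * a' i J (s, X, Y)) := fun s => by ring
        have l2 : ∀ s, -deriv f s * (C.indicator 1 X * W i J Y) * a i J (s, X, Y) =
          (C.indicator 1 X * W i J Y) * (-deriv f s * a i J (s, X, Y)) := fun s => by ring
        simp only [l1, l2]
        rw [integral_const_mul, integral_const_mul, hpart]
      · simp only [hWs i J Y hY, mul_zero, zero_mul]
    · simp only [Set.indicator_of_notMem hX, mul_zero, zero_mul]
  -- For fixed `(s, X)` the difference is `f(s)` times the pairing of `W` with the exact form of the
  -- slice. It vanishes only after summation over all charts and indices, so the sum is taken inside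
  -- the integral first.
  have step2 : ∑ i, ∑ J, ∫ z, (coef f C (W i J) z * a' i J z - coef f C (W i J) z * e i J z) =
      0 := by
    have hint : ∀ i J, Integrable fun z =>
        coef f C (W i J) z * a' i J z - coef f C (W i J) z * e i J z := fun i J =>
      (ia' i J).sub (ie i J)
    have hsum : ∑ i, ∑ J, ∫ z, (coef f C (W i J) z * a' i J z - coef f C (W i J) z * e i J z) =
        ∫ z, ∑ i, ∑ J, (coef f C (W i J) z * a' i J z - coef f C (W i J) z * e i J z) := by
      rw [integral_finsetSum _ fun i _ => integrable_finsetSum _ fun J _ => hint i J]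
      exact Finset.sum_congr rfl fun i _ => (integral_finsetSum _ fun J _ => hint i J).symm
    rw [hsum]
    refine integral_eq_zero_of_slices
      (integrable_finsetSum _ fun i _ => integrable_finsetSum _ fun J _ => hint i J) ?_
    intro s X
    by_cases hsX : s ∈ tsupport f ∧ X ∈ C
    · obtain ⟨u, hu, hueq⟩ := exists_exact_slice hθ r (hs hsX.1) (hCt hsX.2)
      have hus := mem_smoothForms_of_exact (𝓡 n₂) hu
      have hpt : ∀ Y i J, coef f C (W i J) (s, X, Y) * a' i J (s, X, Y) -
          coef f C (W i J) (s, X, Y) * e i J (s, X, Y) = f s * (W i J Y *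
            inChart (𝓡 n₂) u (P.c i) Y (fun a => stdBasis n₂ (J a))) := by
        intro Y i J
        simp only [coef, Set.indicator_of_mem hsX.2, Pi.one_apply, one_mul]
        by_cases hY : Y ∈ tsupport (P.φ i)
        · simp only [ha', he]
          rw [hueq (P.c i) Y (P.subset i hY) J]
          ring
        · simp only [hWs i J Y hY, mul_zero, zero_mul, sub_zero]
      simp only [hpt]
      have hi2 : ∀ i J, Integrable fun Y => f s * (W i J Y *
            inChart (𝓡 n₂) u (P.c i) Y (fun a => stdBasis n₂ (J a))) := fun i J =>
        (integrable_mul_of_continuousOn (P.compact i) (hKm i) (hWi i J) (hWs i J)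
          (((ContinuousAlternatingMap.apply ℝ _ ℝ _).continuous.comp_continuousOn
            (hus (P.c i)).continuousOn).mono (P.subset i))).const_mul _
      rw [integral_finsetSum _ fun i _ => integrable_finsetSum _ fun J _ => hi2 i J]
      have hz := hWe u hu
      calc _ = ∑ i, ∑ J, f s * ∫ Y, W i J Y *
            inChart (𝓡 n₂) u (P.c i) Y (fun a => stdBasis n₂ (J a)) := by
            refine Finset.sum_congr rfl fun i _ => ?_
            rw [integral_finsetSum _ fun J _ => hi2 i J]
            exact Finset.sum_congr rfl fun J _ => integral_const_mul _ _
        _ = 0 := by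
            simp only [← Finset.mul_sum]
            rw [hz, mul_zero]
    · have h0 : ∀ Y i J, coef f C (W i J) (s, X, Y) = 0 := fun Y i J =>
        coef_eq_zero hf0 (hWs i J) fun h => hsX ⟨h.1, h.2.1⟩
      simp only [h0, zero_mul, sub_zero, Finset.sum_const_zero, integral_zero]
  have step3 : ∀ i J, ∫ z, (coef f C (W i J) z * a' i J z - coef f C (W i J) z * e i J z) =
      (∫ z, coef (fun s => -deriv f s) C (W i J) z * a i J z) -
        ∫ z, coef f C (W i J) z * e i J z := fun i J => by
    rw [integral_sub (ia' i J) (ie i J), step1]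
  simp only [step3, Finset.sum_sub_distrib] at step2
  exact (sub_eq_zero.1 step2).symm

end RadialPairing

end L2Forms
end

/-! ### Radial step functions and forms built from a current. -/

noncomputable section

namespace L2Forms

set_option maxSynthPendingDepth 5

theorem exists_smooth_step {a b : ℝ} (hab : a < b) : ∃ φ : ℝ → ℝ, ContDiff ℝ ∞ φ ∧
    (∀ s ≤ a, φ s = 1) ∧ (∀ s, b ≤ s → φ s = 0) ∧ ∀ s, |φ s| ≤ 1 := by
  refine ⟨fun s => Real.smoothTransition ((b - s) / (b - a)),
    Real.smoothTransition.contDiff.comp ((contDiff_const.sub contDiff_id).div_const _),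
    fun s hs => ?_, fun s hs => ?_, fun s => ?_⟩
  · exact Real.smoothTransition.one_of_one_le ((one_le_div (sub_pos.2 hab)).2 (by linarith))
  · exact Real.smoothTransition.zero_of_nonpos
      (div_nonpos_of_nonpos_of_nonneg (by linarith) (by linarith))
  · rw [abs_of_nonneg (Real.smoothTransition.nonneg _)]
    exact Real.smoothTransition.le_one _

/-- The drop of `f` from one to zero; this is the source of the nonzero boundary term. -/
theorem integral_neg_deriv_of_step {f : ℝ → ℝ} (hf : ContDiff ℝ ∞ f) {a b : ℝ}
    (ha : ∀ s ≤ a, f s = 1) (hb : ∀ s, b ≤ s → f s = 0) (hi : Integrable (deriv f)) :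
    ∫ s, -deriv f s = 1 := by
  have h := integral_of_hasDerivAt_of_tendsto (m := 1) (n := 0)
    (fun s => (hf.differentiable (by simp) s).hasDerivAt) hi
    (tendsto_const_nhds.congr' (by
      filter_upwards [Filter.eventually_le_atBot a] with s hs using (ha s hs).symm))
    (tendsto_const_nhds.congr' (by
      filter_upwards [Filter.eventually_ge_atTop b] with s hs using (hb s hs).symm))
  rw [integral_neg, h]
  norm_num

theorem deriv_step_eq_zero {f : ℝ → ℝ} {a b : ℝ}
    (ha : ∀ s ≤ a, f s = 1) (hb : ∀ s, b ≤ s → f s = 0) {s : ℝ} (hs : s ∉ Set.Icc a b) :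
    deriv f s = 0 := by
  rcases lt_or_ge s a with h | h
  · have : f =ᶠ[nhds s] fun _ => 1 := by
      filter_upwards [gt_mem_nhds h] with t ht using ha t ht.le
    rw [this.deriv_eq, deriv_const]
  · have hsb : b < s := not_le.1 fun h' => hs ⟨h, h'⟩
    have : f =ᶠ[nhds s] fun _ => 0 := by
      filter_upwards [lt_mem_nhds hsb] with t ht using hb t ht.le
    rw [this.deriv_eq, deriv_const]

section CurrentForm

variable {n₁ n₂ : ℕ}
  {N₁ : Type*} [TopologicalSpace N₁] [ChartedSpace (Euc n₁) N₁] [IsManifold (𝓡 n₁) ∞ N₁]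
  [MeasurableSpace N₁]
  {N₂ : Type*} [TopologicalSpace N₂] [ChartedSpace (Euc n₂) N₂] [IsManifold (𝓡 n₂) ∞ N₂]
  [MeasurableSpace N₂] [BorelSpace (RPlus × N₁ × N₂)] {k m : ℕ}

theorem eventually_radial {p : RPlus × N₁ × N₂} {S : Set ℝ} (hS : S ∈ nhds (p.1 : ℝ)) :
    ∀ᶠ q : RPlus × N₁ × N₂ in nhds p, (q.1 : ℝ) ∈ S :=
  (continuous_subtype_val.comp continuous_fst).continuousAt hS

/-- The range of the radial variable on the support of a compactly supported form. -/
theorem HasCompactSupp.exists_radial {u : DForm (modelM n₁ n₂) (RPlus × N₁ × N₂) m}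
    (hu : HasCompactSupp (modelM n₁ n₂) u) : ∃ K : Set ℝ, IsCompact K ∧ K ⊆ Set.Ioi 0 ∧
      ∀ p, (p.1 : ℝ) ∉ K → formAt (modelM n₁ n₂) u p = 0 := by
  obtain ⟨K, hK, h0⟩ := hu
  refine ⟨(fun p : RPlus × N₁ × N₂ => (p.1 : ℝ)) '' K,
    hK.image (continuous_subtype_val.comp continuous_fst), ?_, fun p hp => h0 p fun hpK =>
      hp ⟨p, hpK, rfl⟩⟩
  rintro _ ⟨p, -, rfl⟩
  exact p.1.2

theorem formAt_extD_of_radial {u : DForm (modelM n₁ n₂) (RPlus × N₁ × N₂) m} {K : Set ℝ}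
    (hK : IsClosed K) (h : ∀ p, (p.1 : ℝ) ∉ K → formAt (modelM n₁ n₂) u p = 0)
    {p : RPlus × N₁ × N₂} (hp : (p.1 : ℝ) ∉ K) :
    formAt (modelM n₁ n₂) (extD (modelM n₁ n₂) u) p = 0 := by
  rw [formAt_extD_congr (modelM n₁ n₂) (v := 0), extD_zero]
  · rfl
  · filter_upwards [eventually_radial (hK.isOpen_compl.mem_nhds hp)] with q hq
    rw [h q hq]
    rfl

/-- The form on `ℝ₊ × N₁ × N₂` whose pairing with `u` is the sum of the integrals of
`f(s) 1_C(X) W_{iJ}(Y)` times the coordinate of `u` of index `ν J`. -/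
def currentForm (α₁ α₂ : ℝ) (g₁ : SmoothMetric n₁ N₁) (g₂ : SmoothMetric n₂ N₂)
    (P : ChartPartition (𝓡 n₂) N₂) (W : Fin P.m → (Fin k → Fin n₂) → Euc n₂ → ℝ) (x₁ : N₁)
    (C : Set (Euc n₁)) (ν : (Fin k → Fin n₂) → Fin m → Unit ⊕ (Fin n₁ ⊕ Fin n₂)) (f : ℝ → ℝ) :
    DForm (modelM n₁ n₂) (RPlus × N₁ × N₂) m :=
  ∑ p : Fin P.m × (Fin k → Fin n₂), fromChart (modelM n₁ n₂) (onePos, x₁, P.c p.1)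
    (dualForm (modelM n₁ n₂) (basisM n₁ n₂) (warpedMetric α₁ α₂ g₁ g₂) (onePos, x₁, P.c p.1)
      (ν p.2) (coef f C (W p.1 p.2)))

variable {α₁ α₂ : ℝ} {g₁ : SmoothMetric n₁ N₁} {g₂ : SmoothMetric n₂ N₂}
  {P : ChartPartition (𝓡 n₂) N₂} {W : Fin P.m → (Fin k → Fin n₂) → Euc n₂ → ℝ} {x₁ : N₁}
  {C : Set (Euc n₁)} {ν : (Fin k → Fin n₂) → Fin m → Unit ⊕ (Fin n₁ ⊕ Fin n₂)}

theorem formAt_currentForm_eq_zero {f : ℝ → ℝ} {p : RPlus × N₁ × N₂} (hp : f p.1 = 0) :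
    formAt (modelM n₁ n₂) (currentForm α₁ α₂ g₁ g₂ P W x₁ C ν f) p = 0 := by
  have h : formAt (modelM n₁ n₂) (currentForm α₁ α₂ g₁ g₂ P W x₁ C ν f) p =
      ∑ q : Fin P.m × (Fin k → Fin n₂), formAt (modelM n₁ n₂)
        (fromChart (modelM n₁ n₂) (onePos, x₁, P.c q.1)
          (dualForm (modelM n₁ n₂) (basisM n₁ n₂) (warpedMetric α₁ α₂ g₁ g₂)
            (onePos, x₁, P.c q.1) (ν q.2) (coef f C (W q.1 q.2)))) p :=
    Finset.sum_apply p _ _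
  rw [h]
  refine Finset.sum_eq_zero fun q _ => ?_
  by_cases hq : p ∈ (extChartAt (modelM n₁ n₂) (onePos, x₁, P.c q.1)).source
  · rw [fromChart_of_mem _ _ hq, dualForm,
      Set.indicator_of_mem ((extChartAt (modelM n₁ n₂) _).map_source hq), modelM_apply, coef, hp,
      zero_mul, zero_div, zero_smul]
    rfl
  · exact fromChart_of_notMem _ _ hq

/-- By `hν` the Gram minor contributes `s ^ (2 * α₂ * k)`, which the critical degree cancels against
the volume density. What remains is `f²`, bounded with bounded support, times the square of `W`,
times a continuous factor on a compact set. The hypothesis covers both index families, with and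
without `dr`. -/
theorem memL2_currentForm (hk : 2 * α₂ * k = α₁ * n₁ + α₂ * n₂)
    (hν : ∀ (x₂ : N₂) (s : ℝ), 0 < s → ∀ X ∈ (extChartAt (𝓡 n₁) x₁).target,
      ∀ Y ∈ (extChartAt (𝓡 n₂) x₂).target, ∀ J,
      ((chartGram (modelM n₁ n₂) (basisM n₁ n₂) (warpedMetric α₁ α₂ g₁ g₂) (onePos, x₁, x₂)
        (s, X, Y)).submatrix (ν J) (ν J)).det = s ^ (2 * α₂ * k) *
          ((chartGram (𝓡 n₂) (stdBasis n₂) g₂.field x₂ Y).submatrix J J).det)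
    (hWm : ∀ i J, Measurable (W i J)) (hW : ∀ i J, MemLp (W i J) 2)
    (hWs : ∀ i J, ∀ Y ∉ tsupport (P.φ i), W i J Y = 0)
    (hC : IsCompact C) (hCt : C ⊆ (extChartAt (𝓡 n₁) x₁).target)
    {f : ℝ → ℝ} (hf : Continuous f) {B : ℝ} (hB : ∀ s, |f s| ≤ B) {ε : ℝ}
    (hε : ∀ s, ε < s → f s = 0) :
    MemL2 (modelM n₁ n₂) (basisM n₁ n₂) (warpedMetric α₁ α₂ g₁ g₂)
      (currentForm α₁ α₂ g₁ g₂ P W x₁ C ν f) := by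
  have hg := isRiem_warped α₁ α₂ g₁ g₂
  refine hg.memL2_sum _ fun q => ?_
  obtain ⟨i, J⟩ := q
  have hCm := hC.measurableSet
  have hcm : Measurable (coef f C (W i J)) := by
    refine (hf.measurable.comp measurable_fst).mul (Measurable.mul ?_ ?_)
    · exact (measurable_one.indicator hCm).comp (measurable_fst.comp measurable_snd)
    · exact (hWm i J).comp (measurable_snd.comp measurable_snd)
  refine hg.sqInt_dualForm _ _ hcm ?_
  have hK := hC.prod (P.compact i)
  have c1 := (g₁.isRiem.continuousOn_volDensity x₁).mono hCt
  have c2 := (g₂.isRiem.continuousOn_volDensity (P.c i)).mono (P.subset i)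
  have c3 : ContinuousOn (fun Y => ((chartGram (𝓡 n₂) (stdBasis n₂) g₂.field (P.c i) Y).submatrix
      J J).det) (tsupport (P.φ i)) := by
    have h3 : Continuous fun A : Matrix (Fin n₂) (Fin n₂) ℝ => (A.submatrix J J).det :=
      Continuous.matrix_det (continuous_id.matrix_submatrix _ _)
    exact (h3.comp_continuousOn (g₂.isRiem.continuousOn (P.c i))).mono (P.subset i)
  have c4 : ContinuousOn (fun z : Euc n₁ × Euc n₂ =>
      ((chartGram (𝓡 n₂) (stdBasis n₂) g₂.field (P.c i) z.2).submatrix J J).det /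
        (volDensity (𝓡 n₁) (stdBasis n₁) g₁.field x₁ z.1 *
          volDensity (𝓡 n₂) (stdBasis n₂) g₂.field (P.c i) z.2)) (C ×ˢ tsupport (P.φ i)) := by
    refine (c3.comp continuousOn_snd fun z hz => hz.2).div
      ((c1.comp continuousOn_fst fun z hz => hz.1).mul
        (c2.comp continuousOn_snd fun z hz => hz.2)) fun z hz => ?_
    exact (mul_pos (g₁.isRiem.volDensity_pos (hCt hz.1))
      (g₂.isRiem.volDensity_pos (P.subset i hz.2))).ne'
  obtain ⟨D, hD⟩ := hK.exists_bound_of_continuousOn c4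
  have hB0 : 0 ≤ B := (abs_nonneg _).trans (hB 0)
  -- The dominating function: an integrable product of indicators in `s` and `X` with `W²` in `Y`.
  set G : ℝ × Euc n₁ × Euc n₂ → ℝ := fun z => (Set.Ioc 0 ε).indicator 1 z.1 *
    (C.indicator 1 z.2.1 * W i J z.2.2 ^ 2) with hG
  have hGi : Integrable G := by
    have i1 : Integrable ((Set.Ioc 0 ε).indicator (1 : ℝ → ℝ)) :=
      (integrable_indicator_iff measurableSet_Ioc).2 (integrableOn_const measure_Ioc_lt_top.ne)
    have i2 : Integrable (C.indicator (1 : Euc n₁ → ℝ)) :=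
      (integrable_indicator_iff hCm).2 (integrableOn_const hC.measure_lt_top.ne)
    exact i1.mul_prod (i2.mul_prod (hW i J).integrable_sq)
  have hT : MeasurableSet (extChartAt (modelM n₁ n₂) ((onePos, x₁, P.c i) :
    RPlus × N₁ × N₂)).target := (isOpen_extChartAt_target _).measurableSet
  rw [basisM_addHaar]
  calc _ ≤ ∫⁻ z in (extChartAt (modelM n₁ n₂) ((onePos, x₁, P.c i) : RPlus × N₁ × N₂)).target,
        ENNReal.ofReal (B ^ 2 * D * G z) := by
        refine setLIntegral_mono' hT ?_
        rintro ⟨s, X, Y⟩ hz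
        obtain ⟨hs, hX, hY⟩ := warped_pos hz
        refine ENNReal.ofReal_le_ofReal ?_
        simp only at hs hX hY
        rw [hν (P.c i) s hs X hX Y hY J, volDensity_warped α₁ α₂ g₁ g₂ _ _ _ hs hX hY, hk,
          mul_div_mul_left _ _ (Real.rpow_pos_of_pos hs _).ne']
        by_cases hsε : s ≤ ε
        · by_cases hXC : X ∈ C
          · by_cases hYK : Y ∈ tsupport (P.φ i)
            · have hb := hD (X, Y) ⟨hXC, hYK⟩
              have hD' := (le_abs_self _).trans hb
              have hf2 : f s ^ 2 ≤ B ^ 2 := sq_le_sq' (by linarith [neg_abs_le (f s), hB s])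
                ((le_abs_self _).trans (hB s))
              have hD0 : 0 ≤ D := (norm_nonneg _).trans hb
              simp only [coef, hG, Set.indicator_of_mem hXC,
                Set.indicator_of_mem (show s ∈ Set.Ioc 0 ε from ⟨hs, hsε⟩), Pi.one_apply, one_mul]
              calc _ ≤ (f s * W i J Y) ^ 2 * D := mul_le_mul_of_nonneg_left hD' (sq_nonneg _)
                _ = f s ^ 2 * (D * W i J Y ^ 2) := by ring
                _ ≤ B ^ 2 * (D * W i J Y ^ 2) :=
                  mul_le_mul_of_nonneg_right hf2 (mul_nonneg hD0 (sq_nonneg _))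
                _ = _ := by ring
            · simp [coef, hG, hWs i J Y hYK]
          · simp [coef, hG, Set.indicator_of_notMem hXC]
        · simp [coef, hG, hε s (not_le.1 hsε), hsε]
    _ ≤ ∫⁻ z, ENNReal.ofReal (B ^ 2 * D * G z) := setLIntegral_le_lintegral _ _
    _ < ⊤ := (hGi.const_mul _).lintegral_lt_top

/-- The radial profile `f` may be nonzero down to `r = 0`, where chart integrals are out of control;
only its values where `u` does not vanish matter, so it may be exchanged for a compactly supported
`f₀`. -/
theorem l2Inner_currentForm (hWi : ∀ i J, Integrable (W i J))
    (hWs : ∀ i J, ∀ Y ∉ tsupport (P.φ i), W i J Y = 0)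
    (hC : IsCompact C) (hCt : C ⊆ (extChartAt (𝓡 n₁) x₁).target)
    {u : DForm (modelM n₁ n₂) (RPlus × N₁ × N₂) m} (hu : IsSmooth (modelM n₁ n₂) u)
    {f f₀ : ℝ → ℝ} (hf₀ : Continuous f₀) {K : Set ℝ} (hK : IsCompact K) (hK0 : K ⊆ Set.Ioi 0)
    (hfK : ∀ s ∉ K, f₀ s = 0)
    (h : ∀ p : RPlus × N₁ × N₂, f p.1 = f₀ p.1 ∨ formAt (modelM n₁ n₂) u p = 0) :
    l2Inner (modelM n₁ n₂) (basisM n₁ n₂) (warpedMetric α₁ α₂ g₁ g₂) u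
      (currentForm α₁ α₂ g₁ g₂ P W x₁ C ν f) =
      ∑ i, ∑ J, ∫ z, coef f₀ C (W i J) z *
        inChart (modelM n₁ n₂) u (onePos, x₁, P.c i) z (fun a => basisM n₁ n₂ (ν J a)) := by
  have hT : ∀ i, MeasurableSet (extChartAt (modelM n₁ n₂) ((onePos, x₁, P.c i) :
    RPlus × N₁ × N₂)).target := fun i => (isOpen_extChartAt_target _).measurableSet
  have hKT : ∀ i, K ×ˢ (C ×ˢ tsupport (P.φ i)) ⊆
      (extChartAt (modelM n₁ n₂) ((onePos, x₁, P.c i) : RPlus × N₁ × N₂)).target := fun i => by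
    rw [modelM_target]
    exact Set.prod_mono hK0 (Set.prod_mono hCt (P.subset i))
  have hint : ∀ i J, Integrable fun z => coef f₀ C (W i J) z *
      inChart (modelM n₁ n₂) u (onePos, x₁, P.c i) z (fun a => basisM n₁ n₂ (ν J a)) := fun i J =>
    integrable_coef_mul hf₀ hK hfK hC (hWi i J) (P.compact i) (hWs i J)
      (((ContinuousAlternatingMap.apply ℝ _ ℝ _).continuous.comp_continuousOn
        (hu _).continuousOn).mono (hKT i))
  have hcongr : ∀ i J, ∀ z ∈ (extChartAt (modelM n₁ n₂) ((onePos, x₁, P.c i) :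
      RPlus × N₁ × N₂)).target, coef f₀ C (W i J) z *
      inChart (modelM n₁ n₂) u (onePos, x₁, P.c i) z (fun a => basisM n₁ n₂ (ν J a)) =
      coef f C (W i J) z *
      inChart (modelM n₁ n₂) u (onePos, x₁, P.c i) z (fun a => basisM n₁ n₂ (ν J a)) := by
    rintro i J ⟨s, X, Y⟩ hz
    obtain ⟨hs, hX, hY⟩ := warped_pos hz
    rcases h ((extChartAt (modelM n₁ n₂) ((onePos, x₁, P.c i) :
      RPlus × N₁ × N₂)).symm (s, X, Y)) with h1 | h1
    · rw [modelM_symm _ _ _ hs] at h1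
      have h1' : f s = f₀ s := h1
      rw [coef, coef, h1']
    · rw [inChart_eq, h1]
      have h0 : ((0 : (ℝ × Euc n₁ × Euc n₂) [⋀^Fin m]→L[ℝ] ℝ).compContinuousLinearMap
        (dSymm (modelM n₁ n₂) ((onePos, x₁, P.c i) : RPlus × N₁ × N₂) (s, X, Y)))
          (fun a => basisM n₁ n₂ (ν J a)) = 0 := rfl
      rw [h0, mul_zero, mul_zero]
  rw [currentForm, (isRiem_warped α₁ α₂ g₁ g₂).l2Inner_sum_dualForm, basisM_addHaar,
    Fintype.sum_prod_type]
  · refine Finset.sum_congr rfl fun i _ => Finset.sum_congr rfl fun J _ => ?_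
    refine (setIntegral_congr_fun (hT i) (hcongr i J)).symm.trans
      (setIntegral_eq_integral_of_forall_compl_eq_zero fun z hz => ?_)
    rw [coef_eq_zero hfK (hWs i J) fun h => hz (hKT i h), zero_mul]
  · rintro ⟨i, J⟩
    rw [basisM_addHaar]
    exact (hint i J).integrableOn.congr_fun (hcongr i J) (hT i)

end CurrentForm

end L2Forms
end

/-! ### Membership in the maximal domains, and the boundary term. -/

noncomputable section

namespace L2Forms

set_option maxSynthPendingDepth 5

section MaximalDomains

variable {n₁ n₂ : ℕ}
  {N₁ : Type*} [TopologicalSpace N₁] [ChartedSpace (Euc n₁) N₁] [IsManifold (𝓡 n₁) ∞ N₁]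
  [MeasurableSpace N₁]
  {N₂ : Type*} [TopologicalSpace N₂] [ChartedSpace (Euc n₂) N₂] [IsManifold (𝓡 n₂) ∞ N₂]
  [MeasurableSpace N₂] [BorelSpace (RPlus × N₁ × N₂)] {k : ℕ}
  {α₁ α₂ : ℝ} {g₁ : SmoothMetric n₁ N₁} {g₂ : SmoothMetric n₂ N₂}

/-- Below `a` the form coincides with the pullback of the closed form `h`. -/
theorem extD_pullForm_of_lt {h : DForm (𝓡 n₂) N₂ k} (hh : IsSmooth (𝓡 n₂) h)
    (hd : extD (𝓡 n₂) h = 0) {φ : ℝ → ℝ} {a : ℝ} (ha : ∀ s ≤ a, φ s = 1) {p : RPlus × N₁ × N₂}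
    (hp : (p.1 : ℝ) < a) :
    formAt (modelM n₁ n₂) (extD (modelM n₁ n₂) (pullForm N₁ φ h)) p = 0 := by
  rw [← extD_pullForm_one (N₁ := N₁) hh hd p]
  refine formAt_extD_congr _ ?_
  filter_upwards [eventually_radial (gt_mem_nhds hp)] with q hq
  rw [formAt_pullForm, formAt_pullForm, ha _ (le_of_lt hq)]

theorem isTest_pullForm [CompactSpace N₁] [CompactSpace N₂] {h : DForm (𝓡 n₂) N₂ k}
    (hh : IsSmooth (𝓡 n₂) h) {φ : ℝ → ℝ} (hφ : ContDiff ℝ ∞ φ) (hc : HasCompactSupport φ)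
    (hs : tsupport φ ⊆ Set.Ioi 0) : IsTest (modelM n₁ n₂) (pullForm N₁ φ h) := by
  refine ⟨isSmooth_pullForm hφ hh, ((↑) ⁻¹' tsupport φ : Set RPlus) ×ˢ Set.univ, ?_, ?_⟩
  · refine IsCompact.prod ?_ isCompact_univ
    refine Topology.IsInducing.subtypeVal.isCompact_preimage' hc ?_
    rw [Subtype.range_coe]
    exact hs
  · intro p hp
    change formAt (modelM n₁ n₂) (pullForm N₁ φ h) p = 0
    rw [formAt_pullForm, image_eq_zero_of_notMem_tsupport fun h' => hp ⟨h', trivial⟩, zero_smul]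

theorem formInner_congr {u u' v : DForm (modelM n₁ n₂) (RPlus × N₁ × N₂) k} {p : RPlus × N₁ × N₂}
    {g : MetricField (modelM n₁ n₂) (RPlus × N₁ × N₂)}
    (h : formAt (modelM n₁ n₂) u p = formAt (modelM n₁ n₂) u' p ∨
      formAt (modelM n₁ n₂) v p = 0) :
    formInner (modelM n₁ n₂) (basisM n₁ n₂) g p (u p) (v p) =
      formInner (modelM n₁ n₂) (basisM n₁ n₂) g p (u' p) (v p) := by
  rcases h with h | h
  · rw [formInner_eq, formInner_eq, h]
  · rw [formInner_of_formAt_right h, formInner_of_formAt_right h]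

/-- The forms paired against have compact support, so `φ` may be multiplied by a cutoff that is one
near the radial range of both. The result is a test form, for which the identity is the definition
of the formal adjoint. -/
theorem isDMax_pullForm [CompactSpace N₁] [CompactSpace N₂] {h : DForm (𝓡 n₂) N₂ k}
    (hh : IsSmooth (𝓡 n₂) h) {φ : ℝ → ℝ} (hφ : ContDiff ℝ ∞ φ)
    (h1 : MemL2 (modelM n₁ n₂) (basisM n₁ n₂) (warpedMetric α₁ α₂ g₁ g₂) (pullForm N₁ φ h))
    (h2 : MemL2 (modelM n₁ n₂) (basisM n₁ n₂) (warpedMetric α₁ α₂ g₁ g₂)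
      (extD (modelM n₁ n₂) (pullForm N₁ φ h))) :
    IsDMax (modelM n₁ n₂) (basisM n₁ n₂) (warpedMetric α₁ α₂ g₁ g₂) (pullForm N₁ φ h)
      (extD (modelM n₁ n₂) (pullForm N₁ φ h)) := by
  refine ⟨h1, h2, ?_⟩
  rintro η σ ⟨hη, hσ, hadj⟩
  obtain ⟨K₁, hK₁, hK₁', h₁⟩ := hη.2.exists_radial
  obtain ⟨K₂, hK₂, hK₂', h₂⟩ := hσ.2.exists_radial
  obtain ⟨χ, δ, hχ, hχc, hχs, -, hδ, hχ1⟩ := exists_cutoff (hK₁.union hK₂) isOpen_Ioi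
    (Set.union_subset hK₁' hK₂')
  have hloc : ∀ p : RPlus × N₁ × N₂, (p.1 : ℝ) ∈ K₁ ∪ K₂ → ∀ᶠ q in nhds p,
      formAt (modelM n₁ n₂) (pullForm N₁ φ h) q =
        formAt (modelM n₁ n₂) (pullForm N₁ (fun s => χ s * φ s) h) q := by
    intro p hp
    filter_upwards [eventually_radial (Metric.ball_mem_nhds (p.1 : ℝ) hδ)] with q hq
    rw [formAt_pullForm, formAt_pullForm, hχ1 _ hp _ (by rwa [← dist_eq_norm]), one_mul]
  have key := hadj (pullForm N₁ (fun s => χ s * φ s) h)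
    (isTest_pullForm hh (hχ.mul hφ) hχc.mul_right
      ((closure_mono (Function.support_mul_subset_left _ _)).trans hχs))
  calc _ = l2Inner (modelM n₁ n₂) (basisM n₁ n₂) (warpedMetric α₁ α₂ g₁ g₂)
        (extD (modelM n₁ n₂) (pullForm N₁ (fun s => χ s * φ s) h)) η := by
        refine integral_congr_ae (Filter.Eventually.of_forall fun p => formInner_congr ?_)
        by_cases hp : (p.1 : ℝ) ∈ K₁
        · exact Or.inl (formAt_extD_congr _ (hloc p (Or.inl hp)))
        · exact Or.inr (h₁ p hp)
    _ = _ := key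
    _ = _ := by
        refine integral_congr_ae (Filter.Eventually.of_forall fun p => formInner_congr ?_)
        by_cases hp : (p.1 : ℝ) ∈ K₂
        · exact Or.inl (hloc p (Or.inr hp)).self_of_nhds.symm
        · exact Or.inr (h₂ p hp)

/-- The radial profile is cut off near the radial range of the test form, and
`sum_integral_coef_extD` applies to the compactly supported profile. The derivative of the cutoff
plays no part, because the cutoff is one near that range. -/
theorem isDtMax_currentForm {P : ChartPartition (𝓡 n₂) N₂}
    {W : Fin P.m → (Fin k → Fin n₂) → Euc n₂ → ℝ} {x₁ : N₁} {C : Set (Euc n₁)}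
    (hWi : ∀ i J, Integrable (W i J))
    (hWs : ∀ i J, ∀ Y ∉ tsupport (P.φ i), W i J Y = 0)
    (hWe : ∀ u ∈ exactForms (𝓡 n₂) N₂ k, ∑ i, ∑ J, ∫ Y, W i J Y *
      inChart (𝓡 n₂) u (P.c i) Y (fun a => stdBasis n₂ (J a)) = 0)
    (hC : IsCompact C) (hCt : C ⊆ (extChartAt (𝓡 n₁) x₁).target)
    {f : ℝ → ℝ} (hf : ContDiff ℝ ∞ f)
    (h1 : MemL2 (modelM n₁ n₂) (basisM n₁ n₂) (warpedMetric α₁ α₂ g₁ g₂)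
      (currentForm α₁ α₂ g₁ g₂ P W x₁ C (idxR n₁) f))
    (h2 : MemL2 (modelM n₁ n₂) (basisM n₁ n₂) (warpedMetric α₁ α₂ g₁ g₂)
      (currentForm α₁ α₂ g₁ g₂ P W x₁ C (idxN n₁) (fun s => -deriv f s))) :
    IsDtMax (modelM n₁ n₂) (basisM n₁ n₂) (warpedMetric α₁ α₂ g₁ g₂)
      (currentForm α₁ α₂ g₁ g₂ P W x₁ C (idxR n₁) f)
      (currentForm α₁ α₂ g₁ g₂ P W x₁ C (idxN n₁) (fun s => -deriv f s)) := by
  refine ⟨h1, h2, fun θ hθ => ?_⟩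
  obtain ⟨K, hK, hK', h0⟩ := hθ.2.exists_radial
  obtain ⟨χ, δ, hχ, hχc, hχs, -, hδ, hχ1⟩ := exists_cutoff hK isOpen_Ioi hK'
  have hF : ContDiff ℝ ∞ fun s => χ s * f s := hχ.mul hf
  have hFt : tsupport (fun s => χ s * f s) ⊆ tsupport χ :=
    closure_mono (Function.support_mul_subset_left _ _)
  have hFc : HasCompactSupport fun s => χ s * f s := hχc.mul_right
  have hloc : ∀ s ∈ K, f =ᶠ[nhds s] fun s => χ s * f s := fun s hs => by
    filter_upwards [Metric.ball_mem_nhds s hδ] with t ht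
    rw [hχ1 s hs t (by rwa [← dist_eq_norm]), one_mul]
  have hF1 : ∀ s ∉ tsupport χ, -deriv (fun s => χ s * f s) s = 0 := fun s hs => by
    rw [neg_eq_zero]
    by_contra hne
    exact hs (hFt (support_deriv_subset hne))
  rw [l2Inner_currentForm (f₀ := fun s => χ s * f s) hWi hWs hC hCt (hθ.1.extD _) hF.continuous
    hχc hχs (fun s hs => by
      show χ s * f s = 0
      rw [image_eq_zero_of_notMem_tsupport hs, zero_mul]),
    l2Inner_currentForm (f₀ := fun s => -deriv (fun s => χ s * f s) s) hWi hWs hC hCt hθ.1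
      (hF.continuous_deriv (by simp)).neg hχc hχs hF1,
    sum_integral_coef_extD P hWi hWs hWe hC hCt hF hFc (hFt.trans hχs) hθ.1]
  · intro p
    by_cases hp : (p.1 : ℝ) ∈ K
    · exact Or.inl (congrArg Neg.neg (hloc _ hp).deriv_eq)
    · exact Or.inr (h0 p hp)
  · intro p
    by_cases hp : (p.1 : ℝ) ∈ K
    · exact Or.inl (hloc _ hp).self_of_nhds
    · exact Or.inr (formAt_extD_of_radial hK.isClosed h0 hp)

/-- The boundary term at `r = 0`. -/
theorem l2Inner_pullForm_currentForm {P : ChartPartition (𝓡 n₂) N₂}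
    {W : Fin P.m → (Fin k → Fin n₂) → Euc n₂ → ℝ} {x₁ : N₁} {C : Set (Euc n₁)}
    (hWi : ∀ i J, Integrable (W i J))
    (hWs : ∀ i J, ∀ Y ∉ tsupport (P.φ i), W i J Y = 0)
    (hC : IsCompact C) (hCt : C ⊆ (extChartAt (𝓡 n₁) x₁).target)
    {h : DForm (𝓡 n₂) N₂ k} (hh : IsSmooth (𝓡 n₂) h) {φ f : ℝ → ℝ} (hφ : ContDiff ℝ ∞ φ)
    (hf : Continuous f) {K : Set ℝ} (hK : IsCompact K) (hK0 : K ⊆ Set.Ioi 0)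
    (hfK : ∀ s ∉ K, f s = 0) (hφK : ∀ s ∈ K, φ s = 1) :
    l2Inner (modelM n₁ n₂) (basisM n₁ n₂) (warpedMetric α₁ α₂ g₁ g₂) (pullForm N₁ φ h)
      (currentForm α₁ α₂ g₁ g₂ P W x₁ C (idxN n₁) f) =
      (∫ s, f s) * volume.real C * ∑ i, ∑ J, ∫ Y, W i J Y *
        inChart (𝓡 n₂) h (P.c i) Y (fun a => stdBasis n₂ (J a)) := by
  rw [l2Inner_currentForm (f₀ := f) hWi hWs hC hCt (isSmooth_pullForm hφ hh) hf hK hK0 hfK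
    fun p => Or.inl rfl]
  simp only [Finset.mul_sum]
  refine Finset.sum_congr rfl fun i _ => Finset.sum_congr rfl fun J _ => ?_
  have hpt : ∀ z : ℝ × Euc n₁ × Euc n₂, coef f C (W i J) z *
      inChart (modelM n₁ n₂) (pullForm N₁ φ h) (onePos, x₁, P.c i) z
        (fun a => basisM n₁ n₂ (idxN n₁ J a)) =
      f z.1 * (fun w : Euc n₁ × Euc n₂ => C.indicator 1 w.1 *
        (fun Y => W i J Y * inChart (𝓡 n₂) h (P.c i) Y (fun a => stdBasis n₂ (J a))) w.2) z.2 := by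
    rintro ⟨s, X, Y⟩
    simp only [coef]
    by_cases hs : s ∈ K
    · by_cases hX : X ∈ C
      · by_cases hY : Y ∈ tsupport (P.φ i)
        · rw [inChart_pullForm φ h (by
            rw [modelM_target]; exact ⟨hK0 hs, hCt hX, P.subset i hY⟩), hφK s hs, one_smul,
            pullback_basisM_idxN]
          ring
        · simp only [hWs i J Y hY, mul_zero, zero_mul]
      · simp only [Set.indicator_of_notMem hX, mul_zero, zero_mul]
    · simp only [hfK s hs, zero_mul]
  simp only [hpt]
  have e1 := integral_prod_mul (μ := (volume : Measure ℝ))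
    (ν := (volume : Measure (Euc n₁ × Euc n₂))) f
    (fun w : Euc n₁ × Euc n₂ => C.indicator 1 w.1 *
        (fun Y => W i J Y * inChart (𝓡 n₂) h (P.c i) Y (fun a => stdBasis n₂ (J a))) w.2)
  have e2 := integral_prod_mul (μ := (volume : Measure (Euc n₁)))
    (ν := (volume : Measure (Euc n₂))) (C.indicator (1 : Euc n₁ → ℝ))
    (fun Y => W i J Y * inChart (𝓡 n₂) h (P.c i) Y (fun a => stdBasis n₂ (J a)))
  refine e1.trans ?_
  rw [mul_assoc]
  congr 1
  refine e2.trans ?_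
  rw [integral_indicator_one hC.measurableSet]

end MaximalDomains

end L2Forms
end

/-! ### Conclusion. -/

noncomputable section

namespace L2Forms

set_option maxSynthPendingDepth 5

theorem exists_closed_not_exact {n : ℕ} {N : Type*} [TopologicalSpace N] [ChartedSpace (Euc n) N]
    {k : ℕ} (hH : Nontrivial (DeRham (𝓡 n) N k)) :
    ∃ h : DForm (𝓡 n) N k, IsSmooth (𝓡 n) h ∧ extD (𝓡 n) h = 0 ∧ h ∉ exactForms (𝓡 n) N k := by
  obtain ⟨⟨x, hx⟩, hne⟩ := exists_ne (0 : DeRham (𝓡 n) N k)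
  obtain ⟨h, hh, rfl⟩ := hx
  refine ⟨h, hh.1, hh.2, fun hex => hne (Subtype.ext ?_)⟩
  exact (Submodule.Quotient.mk_eq_zero _).2 hex

theorem exists_compact_in_chart (n : ℕ) {N : Type*} [TopologicalSpace N] [ChartedSpace (Euc n) N]
    (x : N) : ∃ C : Set (Euc n), IsCompact C ∧ C ⊆ (extChartAt (𝓡 n) x).target ∧
      volume.real C ≠ 0 := by
  obtain ⟨ρ, hρ, h⟩ := Metric.nhds_basis_closedBall.mem_iff.1 (extChartAt_target_mem_nhds (I := 𝓡 n) x)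
  refine ⟨_, isCompact_closedBall _ _, h, ?_⟩
  rw [Measure.real, ENNReal.toReal_ne_zero]
  exact ⟨(Metric.measure_closedBall_pos _ _ hρ).ne', measure_closedBall_lt_top.ne⟩

/-- With `ω = φ h` and `η` the radial current form, `dω` and `η` live over disjoint ranges of `r`,
whereas `(ω, dᵗη)` equals `vol(C) ⟨W, h⟩`, which is nonzero. -/
theorem not_l2StokesOn {n₁ n₂ : ℕ}
    {N₁ : Type*} [TopologicalSpace N₁] [ChartedSpace (Euc n₁) N₁] [IsManifold (𝓡 n₁) ∞ N₁]
    [CompactSpace N₁] [T2Space N₁] [Nonempty N₁] [MeasurableSpace N₁]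
    {N₂ : Type*} [TopologicalSpace N₂] [ChartedSpace (Euc n₂) N₂] [IsManifold (𝓡 n₂) ∞ N₂]
    [CompactSpace N₂] [T2Space N₂] [MeasurableSpace N₂] [BorelSpace (RPlus × N₁ × N₂)]
    (g₁ : SmoothMetric n₁ N₁) (g₂ : SmoothMetric n₂ N₂) {α₁ α₂ : ℝ} {k : ℕ}
    (hk : 2 * α₂ * k = α₁ * n₁ + α₂ * n₂) (hH : Nontrivial (DeRham (𝓡 n₂) N₂ k))
    {ε : ℝ} (hε : 0 < ε) :
    ¬ L2StokesOn (modelM n₁ n₂) (basisM n₁ n₂) (warpedMetric α₁ α₂ g₁ g₂) k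
      {p : RPlus × N₁ × N₂ | (p.1 : ℝ) < ε} := by
  obtain ⟨P₁⟩ := nonempty_chartPartition (𝓡 n₁) (X := N₁)
  obtain ⟨P₂⟩ := nonempty_chartPartition (𝓡 n₂) (X := N₂)
  obtain ⟨h, hh, hd, hex⟩ := exists_closed_not_exact hH
  obtain ⟨W, hWm, hW, hWs, hWe, hWh⟩ :=
    exists_current (𝓡 n₂) volume P₂ (stdBasis n₂) hh hex
  have hWi : ∀ i J, Integrable (W i J) := fun i J =>
    integrable_of_memLp_two volume (P₂.compact i) (hW i J) (hWs i J)
  obtain ⟨x₁⟩ := ‹Nonempty N₁›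
  obtain ⟨C, hC, hCt, hC0⟩ := exists_compact_in_chart n₁ x₁
  -- The profile `f` falls between `ε / 8` and `ε / 4`, and `φ` only between `ε / 2` and `3ε / 4`.
  -- So `φ = 1` wherever `f'` is nonzero, and `dω` starts where `η` has already vanished.
  obtain ⟨φ, hφ, hφ1, hφ0, hφb⟩ := exists_smooth_step (a := ε / 2) (b := 3 * ε / 4) (by linarith)
  obtain ⟨f, hf, hf1, hf0, hfb⟩ := exists_smooth_step (a := ε / 8) (b := ε / 4) (by linarith)
  have hdf : Continuous fun s => -deriv f s := (hf.continuous_deriv (by simp)).neg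
  have hdf0 : ∀ s ∉ Set.Icc (ε / 8) (ε / 4), -deriv f s = 0 := fun s hs => by
    rw [deriv_step_eq_zero hf1 hf0 hs, neg_zero]
  have hdfc : HasCompactSupport fun s => -deriv f s := HasCompactSupport.intro isCompact_Icc hdf0
  obtain ⟨B, hB⟩ := hdf.bounded_above_of_compact_support hdfc
  have hdfi : Integrable (deriv f) := by
    simpa using (hdf.integrable_of_hasCompactSupport hdfc).neg
  have hφε : ∀ s, 3 * ε / 4 < s → φ s = 0 := fun s hs => hφ0 s hs.le
  have hd0 : ∀ p : RPlus × N₁ × N₂, (p.1 : ℝ) < ε / 2 →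
      formAt (modelM n₁ n₂) (extD (modelM n₁ n₂) (pullForm N₁ φ h)) p = 0 := fun p hp =>
    extD_pullForm_of_lt hh hd hφ1 hp
  have hDMax := isDMax_pullForm (N₁ := N₁) (α₁ := α₁) (α₂ := α₂) (g₁ := g₁) (g₂ := g₂) hh hφ
    (memL2_pullForm P₁ P₂ hk hφ hφb (3 * ε / 4) hφε hh)
    (memL2_of_radial_support P₁ P₂ ((isSmooth_pullForm hφ hh).extD _) (half_pos hε)
      (ε := 3 * ε / 4) fun p hp => by
        rcases lt_or_ge (p.1 : ℝ) (ε / 2) with h1 | h1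
        · exact hd0 p h1
        · refine formAt_extD_of_radial (K := Set.Iic (3 * ε / 4)) isClosed_Iic (fun q hq => ?_)
            fun h2 => hp ⟨h1, h2⟩
          rw [formAt_pullForm, hφε _ (not_le.1 hq), zero_smul])
  have hDtMax := isDtMax_currentForm (α₁ := α₁) (α₂ := α₂) (g₁ := g₁) (g₂ := g₂) hWi hWs hWe hC
    hCt hf
    (memL2_currentForm hk (fun x₂ s hs X hX Y hY J =>
      det_submatrix_idxR α₁ α₂ g₁ g₂ onePos x₁ x₂ hs hX hY J) hWm hW hWs hC hCt hf.continuous hfb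
      (ε := ε / 4) fun s hs => hf0 s hs.le)
    (memL2_currentForm hk (fun x₂ s hs X hX Y hY J =>
      det_submatrix_idxN α₁ α₂ g₁ g₂ onePos x₁ x₂ hs hX hY J) hWm hW hWs hC hCt hdf hB
      (ε := ε / 4) fun s hs => hdf0 s fun h' => hs.not_ge h'.2)
  intro hS
  have key := hS _ _ _ _ hDMax hDtMax
    (fun p hp => by
      change formAt (modelM n₁ n₂) (pullForm N₁ φ h) p = 0
      have hp' : ε ≤ (p.1 : ℝ) := not_lt.1 hp
      rw [formAt_pullForm, hφ0 _ (by linarith), zero_smul])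
    (fun p hp => by
      have hp' : ε ≤ (p.1 : ℝ) := not_lt.1 hp
      exact formAt_currentForm_eq_zero (hf0 _ (by linarith)))
  rw [l2Inner_pullForm_currentForm hWi hWs hC hCt hh hφ hdf isCompact_Icc
    (fun s hs => (show 0 < ε / 8 by linarith).trans_le hs.1) hdf0
    (fun s hs => hφ1 s (hs.2.trans (by linarith))), integral_neg_deriv_of_step hf hf1 hf0 hdfi,
    one_mul] at key
  -- The right side of Stokes' identity has become `vol(C) ⟨W, h⟩`; it remains to see that the left
  -- side is zero, because at every point one of the two forms vanishes.
  refine mul_ne_zero hC0 hWh (key.symm.trans ?_)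
  refine integral_eq_zero_of_ae (Filter.Eventually.of_forall fun p => ?_)
  rcases lt_or_ge (p.1 : ℝ) (ε / 2) with h1 | h1
  · exact formInner_of_formAt_left (hd0 p h1) _
  · exact formInner_of_formAt_right (formAt_currentForm_eq_zero (hf0 _ (by linarith))) _

end L2Forms
end

theorem lemma2p6 (n₁ n₂ : ℕ)
    (N₁ : Type*) [TopologicalSpace N₁] [ChartedSpace (L2Forms.Euc n₁) N₁]
    [IsManifold (𝓡 n₁) ∞ N₁] [CompactSpace N₁] [T2Space N₁] [Nonempty N₁]
    [MeasurableSpace N₁] [BorelSpace N₁]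
    (N₂ : Type*) [TopologicalSpace N₂] [ChartedSpace (L2Forms.Euc n₂) N₂]
    [IsManifold (𝓡 n₂) ∞ N₂] [CompactSpace N₂] [T2Space N₂]
    [MeasurableSpace N₂] [BorelSpace N₂]
    (g₁ : L2Forms.SmoothMetric n₁ N₁) (g₂ : L2Forms.SmoothMetric n₂ N₂)
    (α₁ α₂ : ℝ) (hα₁ : 1 ≤ α₁) (hα₂ : 1 ≤ α₂)
    (k : ℕ) (hk : (k : ℝ) = (α₁ * n₁ + α₂ * n₂) / (2 * α₂))
    (hH : Nontrivial (L2Forms.DeRham (𝓡 n₂) N₂ k))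
    (ε : ℝ) (hε : 0 < ε) :
    ¬ L2Forms.L2StokesOn (L2Forms.modelM n₁ n₂) (L2Forms.basisM n₁ n₂)
      (L2Forms.warpedMetric α₁ α₂ g₁ g₂) k
      {p : L2Forms.RPlus × N₁ × N₂ | (p.1 : ℝ) < ε} := by
  -- Second countability makes the product σ-algebra on `ℝ₊ × N₁ × N₂` the Borel one, as the volume
  -- computations require.
  have := L2Forms.secondCountable_of_compact_charted n₁ N₁
  have := L2Forms.secondCountable_of_compact_charted n₂ N₂
  refine L2Forms.not_l2StokesOn g₁ g₂ ?_ hH hε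
  have h2 : (2 * α₂) ≠ 0 := by linarith
  rw [hk, mul_div_cancel₀ _ h2]
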